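/- **Setting.** Let $d\in\{1,2,3\}$ and let $\Omega\subset\mathbb R^d$ be a nonempty bounded convex open set (in particular, a bounded convex polygonal domain) with Dirichlet or Neumann boundary conditions, or let $\Omega=\prod_n\mathbb R/L_n\mathbb Z$, $L_n>0$, be a torus (periodic conditions). Put $H=L^2(\Omega)=H'$, and $V=W^{1,2}_0(\Omega)$ (Dirichlet) or $V=W^{1,2}(\Omega)$ (Neumann, periodic), with dual $V'$. Let $A:V\to V'$, $\langle Au,z\rangle=(\nabla u,\nabla z)_{L^2}+(u,z)_{L^2}=(u,z)_V$, and $A_0=A-1$, so $\langle A_0u,z\rangle=(\nabla u,\nabla z)_{L^2}$ (thus $A_0=-\Delta$). Let $D(A)=\{u\in V: Au\in H\}$ with $\|u\|_{D(A)}=\|Au\|_H$, and $D(A^{3/2})=\{u\in D(A): Au\in V\}$ with $\|u\|_{D(A^{3/2})}=\|Au\|_V$. Let $\nu_0,\nu_1\in\mathbb R$, $\nu_2>0$ and $f,g:\mathbb R\to\mathbb R$. $W_{\rm loc}:=W_{\rm loc}(\mathbb R_+,D(A^{3/2})\times V,V'\times V')$ is the space of pairs $(w_1,w_2)$ with $w_1\in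 L^2((0,T),D(A^{3/2}))$, $w_2\in L^2((0,T),V)$ and distributional time derivatives $\dot w_1,\dot w_2\in L^2((0,T),V')$ for all $T>0$. Initial values are those of the continuous representative. "Unique" means unique up to equality for almost every $t>0$. **Assumptions.** 1. The external force satisfies $h=(h_1,h_2)\in L^2_{\rm loc}(\mathbb R_+,V'\times V')$. 2. $f=F'$ with $F\ge0$ and $F(z)\in L^1(\Omega)$ for all $z\in D(A^{3/2})$. There are constants $C_f,C_g\ge0$ such that, for all $v\in D(A)$, $f(v)\in H$, $f(v),g(v)\in V'$ and $$\|f(v)\|_{V'}^2\le C_f\|v\|_V^2(1+\|v\|_H^2\|v\|_V^2),\qquad -\langle A_0f(v),v\rangle\le C_f\|v\|_{D(A)}\|v\|_V,$$ $$\|g(v)\|_{V'}^2\le C_g\|v\|_V^2(1+\|v\|_H^2\|v\|_V^2),\qquad -\langle g(v),v\rangle\le C_g\|v\|_{D(A)}\|v\|_V,$$ where $\langle A_0f(v),v\rangle=(f(v),A_0v)_H$. 3. There are constants $\underline C_f,\underline C_g\ge0$ such that, for all $v,w\in D(A^{3/2})$, $f(v)-f(w)\in V$ and $$\|A_0(f(v)-f(w))\|_{V'}\le\underline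 C_f(1+\|(v,w)\|_{V\times V})(1+\|(v,w)\|_{D(A)\times D(A)})\|v-w\|_V,$$ $$\|g(v)-g(w)\|_{V'}\le\underline C_g(1+\|(v,w)\|_{V\times V})(1+\|(v,w)\|_{D(A)\times D(A)})\|v-w\|_V.$$ **Feedback.** Let $\omega=\prod_n(-l_n,l_n)$ and $\varphi(x)=1_\omega(x)\prod_n\sin\bigl(\pi\tfrac{x_n+l_n}{2l_n}\bigr)$. Let $\omega_j=\sigma_j^{-1}(\omega)$, $1\le j\le m$, be finitely many pairwise disjoint rescaled, rotated and translated copies of $\omega$ contained in $\Omega$ (in the fundamental box, for the torus), where the $\sigma_j$ are similarities. Put $\mathcal U=\mathrm{span}\{1_{\omega_j}\}$ and $\widetilde{\mathcal U}=\mathrm{span}\{\varphi^2\circ\sigma_j\}\subset D(A)$. From a second such family (with its own box $\omega$), define $\mathcal V$ as the span of the indicators and $\widetilde{\mathcal V}\subset V$ as the span of the functions $\varphi\circ\sigma_j$. For $\lambda_1,\lambda_2\ge0$ let $$\mathbf F_1=-\lambda_1P_{\mathcal U}^{\widetilde{\mathcal U}^\perp}A^2P_{\widetilde{\mathcal U}}^{\mathcal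 U^\perp},\qquad \mathbf F_2=-\lambda_2P_{\mathcal V}^{\widetilde{\mathcal V}^\perp}AP_{\widetilde{\mathcal V}}^{\mathcal V^\perp},$$ where $P_X^{Y^\perp}$ is the oblique projection onto $X$ along $Y^\perp$, extended by duality: $P_X^{Y^\perp}\ell$ is the $q\in X$ with $(q,v)_H=\ell(v)$ for all $v\in Y$. For $\chi\in\{0,1\}$ and $r=(r_1,r_2)\in L^2_{\rm loc}(\mathbb R_+,H\times H)$ put $\widehat h_j(w_j)=h_j+\chi\mathbf F_j(w_j-r_j)$ and consider $$\dot w_1=-\nu_2A_0^2w_1-\nu_0\nu_1A_0w_1+\nu_1A_0w_2-A_0f(w_1)-g(w_1)+\widehat h_1(w_1),$$ $$\dot w_2=-A_0w_2+\nu_0A_0w_1+\widehat h_2(w_2),\qquad w(0)=w_0=(w_{01},w_{02}),\tag{W}$$ the equations being understood in $V'$ for almost every $t>0$. **Claim.** Under these assumptions the following holds. (i) $H$ has an orthonormal basis $(e_k)$ of eigenfunctions of $A$ with nondecreasing eigenvalues. (ii) For every $w_0\in V\times H$, system (W) has a unique solution $w$ in $W_{\rm loc}$. (iii) Let $w_0\in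 V\times H$, let $(e_k)$ be any basis as in (i), let $\mathcal E_N$ be the span of its first $N$ elements, and let $P_N$ be the orthogonal projection onto $\mathcal E_N$ (extended to $V'$). For every $N$ the Galerkin system $$\dot w_1^N=-\nu_2A_0^2w_1^N-\nu_0\nu_1A_0w_1^N+\nu_1A_0w_2^N+P_N\bigl(-A_0f(w_1^N)-g(w_1^N)+\widehat h_1(w_1^N)\bigr),$$ $$\dot w_2^N=-A_0w_2^N+\nu_0A_0w_1^N+P_N\widehat h_2(w_2^N),\qquad w^N(0)=(P_Nw_{01},P_Nw_{02}),$$ has an $\mathcal E_N\times\mathcal E_N$-valued solution on $[0,\infty)$. For any choice of such solutions $w^N$, and for all $T>0$ and $\varrho>0$, the following quantities are bounded uniformly in $N$: - the norm of $w^N$ in $L^\infty((0,T),H\times H)\cap L^2((0,T),D(A)\times V)$ (energy bound); - the free energy $\nu_2\|w_1^N\|_V^2+2\int_\Omega F(w_1^N)+\varrho\|w_2^N\|_H^2$ on $[0,T]$, the norm of $w_1^N$ in $L^\infty((0,T),V)$, and $\int_0^T\|\nabla\mathfrak p^N\|_{L^2}^2\,dt$, where $\mathfrak p^N=\nu_2A_0w_1^N+\nu_0\nu_1w_1^N+P_Nf(w_1^N)$;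 - the norm of $w^N$ in $W((0,T),D(A^{3/2})\times V,V'\times V')$. A subsequence of $(w^N)$ converges to the solution $w$ of (W), for all $T>0$, weakly in $W((0,T),D(A^{3/2})\times V,V'\times V')$, with $w_1^N\to w_1$ strongly in $L^2((0,T),V)$. (iv) For every $y_{{\rm r}0}\in V\times H$ the free Cahn–Hilliard system $$\partial_ty_1+\nu_2\Delta^2y_1-\Delta(f(y_1)-\nu_1y_2)+g(y_1)=h_1,\qquad \partial_t(y_2+\nu_0y_1)-\Delta y_2=h_2,\qquad y(0)=y_{{\rm r}0},$$ has a unique solution $y_{\rm r}$ in $W_{\rm loc}$. For each such reference solution $y_{\rm r}$ and every $y_{{\rm c}0}\in V\times H$, the controlled system, in which $h_1$ is replaced by $h_1+\mathbf F_1(y_1-y_{{\rm r}1})$ and $h_2$ by $h_2+\mathbf F_2\bigl(y_2+\nu_0y_1-y_{{\rm r}2}-\nu_0y_{{\rm r}1}\bigr)$, and $y(0)=y_{{\rm c}0}$, has a unique solution $y_{\rm c}$ in $W_{\rm loc}$. -/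

import Mathlib

open MeasureTheory Set Filter Topology
open scoped ContDiff InnerProductSpace ENNReal

noncomputable section

namespace CahnHilliard

/-- The ambient Euclidean space `ℝᵈ`. -/
abbrev E (d : ℕ) : Type := EuclideanSpace ℝ (Fin d)

/-- The spatial domain together with the boundary conditions. In the periodic case the domain is the
torus with periods `L`, represented by its fundamental box. -/
inductive Setting (d : ℕ) : Type
  | dirichlet (Ω : Set (E d)) : Setting d
  | neumann (Ω : Set (E d)) : Setting d
  | periodic (L : Fin d → ℝ) : Setting d

namespace Setting

variable {d : ℕ}

def domain : Setting d → Set (E d)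
  | dirichlet Ω => Ω
  | neumann Ω => Ω
  | periodic L => {x | ∀ i, 0 < x i ∧ x i < L i}

/-- Nonempty bounded convex domains for Dirichlet and Neumann conditions; positive periods for the
torus. -/
def IsAdmissible : Setting d → Prop
  | dirichlet Ω => IsOpen Ω ∧ Convex ℝ Ω ∧ Bornology.IsBounded Ω ∧ Ω.Nonempty
  | neumann Ω => IsOpen Ω ∧ Convex ℝ Ω ∧ Bornology.IsBounded Ω ∧ Ω.Nonempty
  | periodic L => ∀ i, 0 < L i

/-- Lebesgue measure on the domain. -/
def vol (S : Setting d) : Measure (E d) := volume.restrict S.domain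

end Setting

section Spaces

variable {d : ℕ} (S : Setting d)

/-- The pivot space `H = L²(Ω)`. -/
abbrev H : Type := Lp ℝ 2 S.vol

/-- Pairs `(u, G)` in `L²(Ω) × L²(Ω)ᵈ`, with `‖(u, G)‖² = ‖u‖² + ∑ᵢ ‖Gᵢ‖²`. -/
abbrev GradPair : Type := WithLp 2 (H S × PiLp 2 (fun _ : Fin d => H S))

/-- The pair `p` is `(ψ, ∇ψ)` for the (smooth) function `ψ`. -/
def IsClassicalPair (ψ : E d → ℝ) (p : GradPair S) : Prop :=
  (⇑p.fst =ᵐ[S.vol] ψ) ∧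
    ∀ i : Fin d, ⇑(p.snd i) =ᵐ[S.vol] fun x => fderiv ℝ ψ x (EuclideanSpace.single i 1)

/-- Test functions of the distributional gradient: `C_c^∞(Ω)` on a domain, and the smooth periodic
functions on the torus. -/
def IsTestFunction (ψ : E d → ℝ) : Prop :=
  ContDiff ℝ ∞ ψ ∧
    match S with
    | .dirichlet Ω => HasCompactSupport ψ ∧ tsupport ψ ⊆ Ω
    | .neumann Ω => HasCompactSupport ψ ∧ tsupport ψ ⊆ Ω
    | .periodic L => ∀ (i : Fin d) (x : E d), ψ (x + EuclideanSpace.single i (L i)) = ψ x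

/-- The graph of the gradient on `W^{1,2}`: all `(u, G)` such that `G` is the distributional gradient
of `u`, that is, `(u, ∂ᵢψ)_H + (Gᵢ, ψ)_H = 0` for all test functions `ψ`. -/
def sobolevW : Submodule ℝ (GradPair S) where
  carrier := {p | ∀ ψ : E d → ℝ, IsTestFunction S ψ → ∀ q : GradPair S, IsClassicalPair S ψ q →
    ∀ i : Fin d, ⟪p.fst, q.snd i⟫_ℝ + ⟪p.snd i, q.fst⟫_ℝ = 0}
  zero_mem' := by
    intro ψ _ q _ i
    simp
  add_mem' := by
    intro a b ha hb ψ hψ q hq i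
    have h1 := ha ψ hψ q hq i
    have h2 := hb ψ hψ q hq i
    simp only [WithLp.add_fst, WithLp.add_snd, PiLp.add_apply, inner_add_left]
    linarith
  smul_mem' := by
    intro c a ha ψ hψ q hq i
    have h1 := ha ψ hψ q hq i
    simp only [WithLp.smul_fst, WithLp.smul_snd, PiLp.smul_apply, real_inner_smul_left]
    rw [← mul_add, h1, mul_zero]

/-- `W₀^{1,2}`, as the closure of the test functions in the norm of `W^{1,2}`. -/
def sobolevW0 : Submodule ℝ (GradPair S) :=
  (Submodule.span ℝ {p : GradPair S |
    ∃ ψ : E d → ℝ, IsTestFunction S ψ ∧ IsClassicalPair S ψ p}).topologicalClosure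

/-- The space `V`: `W₀^{1,2}(Ω)` for Dirichlet conditions and `W^{1,2}(Ω)` for Neumann and periodic
conditions. An element is a pair `(u, ∇u)`. -/
def spaceV : Submodule ℝ (GradPair S) :=
  match S with
  | .dirichlet Ω => sobolevW0 (.dirichlet Ω)
  | .neumann Ω => sobolevW (.neumann Ω)
  | .periodic L => sobolevW (.periodic L)

/-- `V` as a normed space; its scalar product is `(∇u, ∇z) + (u, z) = ⟨A u, z⟩`. -/
def V : Type := spaceV S

instance : NormedAddCommGroup (V S) := inferInstanceAs (NormedAddCommGroup (spaceV S))

instance : InnerProductSpace ℝ (V S) := inferInstanceAs (InnerProductSpace ℝ (spaceV S))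

/-- The dual `V'`. -/
abbrev V' : Type := StrongDual ℝ (V S)

variable {S}

/-- The underlying pair `(u, ∇u)` of an element of `V`. -/
def toPair : V S →ₗᵢ[ℝ] GradPair S := (spaceV S).subtypeₗᵢ

/-- The inclusion `V ⊆ H`. -/
def incl : V S →L[ℝ] H S :=
  (WithLp.fstL 2 ℝ (H S) (PiLp 2 (fun _ : Fin d => H S))) ∘L toPair.toContinuousLinearMap

/-- The gradient `V → L²(Ω)ᵈ`. -/
def grad : V S →L[ℝ] PiLp 2 (fun _ : Fin d => H S) :=
  (WithLp.sndL 2 ℝ (H S) (PiLp 2 (fun _ : Fin d => H S))) ∘L toPair.toContinuousLinearMap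

def InV (u : H S) : Prop := ∃ v : V S, incl v = u

open Classical in
/-- The element of `V` given by a function `u` in `H` (the value is `0` if `u` is not in `V`). -/
def lift (u : H S) : V S := if h : InV u then h.choose else 0

/-- The embedding `H = H' ⊆ V'`, `u ↦ (u, ·)_H`. -/
def pivot (u : H S) : V' S := (innerSL ℝ u) ∘L incl

/-- The nonshifted Laplacian `A₀ : V → V'`, `⟨A₀ u, z⟩ = (∇u, ∇z)`. -/
def lapV (u : V S) : V' S := (innerSL ℝ (grad u)) ∘L grad

/-- `u ∈ D(A)` and `A u = f` in `H`. -/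
def IsA (u f : H S) : Prop :=
  ∃ v : V S, incl v = u ∧ ∀ z : V S, ⟪v, z⟫_ℝ = ⟪f, incl z⟫_ℝ

/-- `D(A) = {u ∈ V : A u ∈ H}`. -/
def InDA (u : H S) : Prop := ∃ f : H S, IsA u f

open Classical in
/-- The shifted Laplacian `A : D(A) → H` (with value `0` outside `D(A)`). -/
def opA (u : H S) : H S := if h : InDA u then h.choose else 0

/-- `D(A^{3/2}) = {u ∈ D(A) : A u ∈ V}`. -/
def InDA32 (u : H S) : Prop := InDA u ∧ InV (opA u)

/-- `A₀ = A - 1` on `D(A)`. -/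
def lap (u : H S) : H S := opA u - u

def normV (u : H S) : ℝ := ‖lift u‖

/-- `‖u‖_{D(A)} = ‖A u‖_H`. -/
def normDA (u : H S) : ℝ := ‖opA u‖

/-- The norm of a pair in a product of two Hilbert spaces. -/
def pairNorm (a b : ℝ) : ℝ := Real.sqrt (a ^ 2 + b ^ 2)

open Classical in
variable (S) in
/-- The class in `H` of a function (with value `0` if the function is not in `L²`). -/
def toH (φ : E d → ℝ) : H S := if h : MemLp φ 2 S.vol then h.toLp φ else 0

/-- The function `φ` belongs to `V'`, being there the functional `ℓ : z ↦ ∫ φ z`. -/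
def RepresentsDual (φ : E d → ℝ) (ℓ : V' S) : Prop :=
  ∀ z : V S, Integrable (fun x => φ x * incl z x) S.vol ∧ ℓ z = ∫ x, φ x * incl z x ∂S.vol

open Classical in
variable (S) in
/-- A function as an element of `V'` (with value `0` if it does not belong to `V'`). -/
def toV' (φ : E d → ℝ) : V' S :=
  if h : ∃ ℓ : V' S, RepresentsDual φ ℓ then h.choose else 0

end Spaces

section Assumptions

variable {d : ℕ}

/-- The growth assumptions on the nonlinearities: `f = F'` with `F ≥ 0` and `F(z) ∈ L¹` for
`z ∈ D(A^{3/2})`, and, for `v ∈ D(A)`, bounds on `f(v)`, `g(v)` in `V'` and one-sided bounds on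
`⟨A₀ f(v), v⟩ = (f(v), A₀ v)_H` and `⟨g(v), v⟩`. -/
def GrowthAssumption (S : Setting d) (F f g : ℝ → ℝ) : Prop :=
  (∀ x, HasDerivAt F (f x) x) ∧ (∀ x, 0 ≤ F x) ∧
  (∀ z : H S, InDA32 z → Integrable (fun x => F (z x)) S.vol) ∧
  (∃ C : ℝ, 0 ≤ C ∧ ∀ v : H S, InDA v →
    MemLp (fun x => f (v x)) 2 S.vol ∧
    (∃ ℓ : V' S, RepresentsDual (fun x => f (v x)) ℓ ∧
      ‖ℓ‖ ^ 2 ≤ C * normV v ^ 2 * (1 + ‖v‖ ^ 2 * normV v ^ 2)) ∧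
    -(∫ x, f (v x) * lap v x ∂S.vol) ≤ C * normDA v * normV v) ∧
  (∃ C : ℝ, 0 ≤ C ∧ ∀ v : H S, InDA v →
    (∃ ℓ : V' S, RepresentsDual (fun x => g (v x)) ℓ ∧
      ‖ℓ‖ ^ 2 ≤ C * normV v ^ 2 * (1 + ‖v‖ ^ 2 * normV v ^ 2)) ∧
    -(∫ x, g (v x) * v x ∂S.vol) ≤ C * normDA v * normV v)

/-- The local Lipschitz assumptions on the nonlinearities, on `D(A^{3/2})`; `f(v) - f(w)` is a
function in `V`, to which `A₀ : V → V'` is applied. -/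
def DifferenceAssumption (S : Setting d) (f g : ℝ → ℝ) : Prop :=
  (∃ C : ℝ, 0 ≤ C ∧ ∀ v w : H S, InDA32 v → InDA32 w →
    ∃ u : V S, (⇑(incl u) =ᵐ[S.vol] fun x => f (v x) - f (w x)) ∧
      ‖lapV u‖ ≤ C * (1 + pairNorm (normV v) (normV w)) *
        (1 + pairNorm (normDA v) (normDA w)) * normV (v - w)) ∧
  (∃ C : ℝ, 0 ≤ C ∧ ∀ v w : H S, InDA32 v → InDA32 w →
    ∃ ℓ : V' S, RepresentsDual (fun x => g (v x) - g (w x)) ℓ ∧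
      ‖ℓ‖ ≤ C * (1 + pairNorm (normV v) (normV w)) *
        (1 + pairNorm (normDA v) (normDA w)) * normV (v - w))

end Assumptions

section Time

/-- `L²_loc` on the time half-line: square integrability on `(0, T)` for all `T > 0`. -/
def LocL2 {X : Type*} [NormedAddCommGroup X] (φ : ℝ → X) : Prop :=
  ∀ T : ℝ, 0 < T → MemLp φ 2 (volume.restrict (Ioo 0 T))

/-- `φ ∈ L²((0,T), X)` with `∫₀ᵀ ‖φ‖² ≤ C²`. -/
def L2Bound {X : Type*} [NormedAddCommGroup X] (T C : ℝ) (φ : ℝ → X) : Prop :=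
  AEStronglyMeasurable φ (volume.restrict (Ioo 0 T)) ∧
    eLpNorm φ 2 (volume.restrict (Ioo 0 T)) ≤ ENNReal.ofReal C

/-- Weak convergence in `L²((0,T), X)` (for a Hilbert space `X`). -/
def WeakL2 {X : Type*} [NormedAddCommGroup X] [NormedSpace ℝ X] (T : ℝ) (u : ℕ → ℝ → X)
    (v : ℝ → X) : Prop :=
  ∀ φ : ℝ → StrongDual ℝ X, MemLp φ 2 (volume.restrict (Ioo 0 T)) →
    Tendsto (fun n => ∫ t in Ioo 0 T, φ t (u n t)) atTop (𝓝 (∫ t in Ioo 0 T, φ t (v t)))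

variable {d : ℕ} {S : Setting d}

/-- `ξ` is the distributional time derivative on `(0, ∞)` of `w`, as a `V'`-valued function. -/
def HasTimeDeriv (w : ℝ → H S) (ξ : ℝ → V' S) : Prop :=
  ∀ ψ : ℝ → ℝ, ContDiff ℝ ∞ ψ → HasCompactSupport ψ → tsupport ψ ⊆ Ioi 0 → ∀ z : V S,
    ∫ t in Ioi (0 : ℝ), deriv ψ t * ⟪w t, incl z⟫_ℝ = -∫ t in Ioi (0 : ℝ), ψ t * ξ t z

/-- `w ∈ L²_loc(ℝ₊, V)`. -/
def LocL2V (w : ℝ → H S) : Prop :=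
  (∀ᵐ t ∂volume.restrict (Ioi (0 : ℝ)), InV (w t)) ∧ LocL2 (fun t => lift (w t))

/-- `w ∈ L²_loc(ℝ₊, D(A^{3/2}))`; note that `‖u‖_{D(A^{3/2})} = ‖A u‖_V`. -/
def LocL2DA32 (w : ℝ → H S) : Prop :=
  (∀ᵐ t ∂volume.restrict (Ioi (0 : ℝ)), InDA32 (w t)) ∧ LocL2 (fun t => lift (opA (w t)))

/-- `w(0) = w₀`, for the continuous representative of `w`. -/
def HasInitialValue (w : ℝ → H S) (w₀ : H S) : Prop :=
  ∃ c : ℝ → H S, ContinuousOn c (Ici 0) ∧ c =ᵐ[volume.restrict (Ioi (0 : ℝ))] w ∧ c 0 = w₀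

/-- `(w₁, w₂)` belongs to `W_loc(ℝ₊, D(A^{3/2}) × V, V' × V')`, with time derivative `(ξ₁, ξ₂)`. -/
def MemWloc (w₁ w₂ : ℝ → H S) (ξ₁ ξ₂ : ℝ → V' S) : Prop :=
  LocL2DA32 w₁ ∧ LocL2V w₂ ∧ LocL2 ξ₁ ∧ LocL2 ξ₂ ∧ HasTimeDeriv w₁ ξ₁ ∧ HasTimeDeriv w₂ ξ₂

end Time

section Systems

/-- The domain with its boundary conditions, the constants and the nonlinearities. -/
structure Model (d : ℕ) where
  S : Setting d
  ν₀ : ℝ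
  ν₁ : ℝ
  ν₂ : ℝ
  f : ℝ → ℝ
  g : ℝ → ℝ

variable {d : ℕ} (P : Model d)

/-- Weak solutions `w = (w₁, w₂)` in `W_loc(ℝ₊, D(A^{3/2}) × V, V' × V')` of
`ẇ₁ = -ν₂A₀²w₁ - ν₀ν₁A₀w₁ + ν₁A₀w₂ - A₀f(w₁) - g(w₁) + η₁(t, w₁)`,
`ẇ₂ = -A₀w₂ + ν₀A₀w₁ + η₂(t, w₂)`, `w(0) = (w₀₁, w₀₂)`. -/
def IsSolutionW (η₁ η₂ : ℝ → H P.S → V' P.S) (w₀₁ w₀₂ : H P.S) (w₁ w₂ : ℝ → H P.S) : Prop :=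
  ∃ ξ₁ ξ₂ : ℝ → V' P.S, MemWloc w₁ w₂ ξ₁ ξ₂ ∧
    HasInitialValue w₁ w₀₁ ∧ HasInitialValue w₂ w₀₂ ∧
    ∀ᵐ t ∂volume.restrict (Ioi (0 : ℝ)),
      ξ₁ t = -P.ν₂ • lapV (lift (lap (w₁ t))) - (P.ν₀ * P.ν₁) • lapV (lift (w₁ t))
          + P.ν₁ • lapV (lift (w₂ t))
          - lapV (lift (toH P.S fun x => P.f (w₁ t x))) - toV' P.S (fun x => P.g (w₁ t x))
          + η₁ t (w₁ t) ∧
      ξ₂ t = -lapV (lift (w₂ t)) + P.ν₀ • lapV (lift (w₁ t)) + η₂ t (w₂ t)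

/-- Weak solutions `y = (y₁, y₂)` in `W_loc(ℝ₊, D(A^{3/2}) × V, V' × V')` of the Cahn–Hilliard system
`∂ₜy₁ + ν₂Δ²y₁ - Δ(f(y₁) - ν₁y₂) + g(y₁) = η₁(t, y₁, y₂)`,
`∂ₜ(y₂ + ν₀y₁) - Δy₂ = η₂(t, y₁, y₂)`, `y(0) = (y₀₁, y₀₂)`. -/
def IsSolutionCH (η₁ η₂ : ℝ → H P.S → H P.S → V' P.S) (y₀₁ y₀₂ : H P.S) (y₁ y₂ : ℝ → H P.S) :
    Prop :=
  ∃ ξ₁ ξ₂ : ℝ → V' P.S, MemWloc y₁ y₂ ξ₁ ξ₂ ∧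
    HasInitialValue y₁ y₀₁ ∧ HasInitialValue y₂ y₀₂ ∧
    ∀ᵐ t ∂volume.restrict (Ioi (0 : ℝ)),
      ξ₁ t + P.ν₂ • lapV (lift (lap (y₁ t)))
          + (lapV (lift (toH P.S fun x => P.f (y₁ t x))) - P.ν₁ • lapV (lift (y₂ t)))
          + toV' P.S (fun x => P.g (y₁ t x)) = η₁ t (y₁ t) (y₂ t) ∧
      (ξ₂ t + P.ν₀ • ξ₁ t) + lapV (lift (y₂ t)) = η₂ t (y₁ t) (y₂ t)

end Systems

section Feedback

variable {d : ℕ}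

/-- Finitely many rescaled, rotated and translated copies `ω_j` of the reference box
`ω = ∏ₙ (-lₙ, lₙ)`. -/
structure Actuators (d : ℕ) where
  m : ℕ
  l : Fin d → ℝ
  center : Fin m → E d
  scale : Fin m → ℝ
  rot : Fin m → (E d ≃ₗᵢ[ℝ] E d)

namespace Actuators

variable (a : Actuators d)

/-- The reference box `ω`. -/
def box : Set (E d) := {z | ∀ n, -a.l n < z n ∧ z n < a.l n}

/-- The similarity that maps `ω_j` onto `ω`. -/
def chart (j : Fin a.m) (x : E d) : E d := a.rot j ((a.scale j)⁻¹ • (x - a.center j))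

/-- The support `ω_j` of the `j`-th actuator. -/
def support (j : Fin a.m) : Set (E d) := a.chart j ⁻¹' a.box

/-- The `j`-th actuator, an indicator function. -/
def indicatorFun (j : Fin a.m) : E d → ℝ := (a.support j).indicator 1

/-- `φ(z) = 1_ω(z) ∏ₙ sin (π (zₙ + lₙ) / (2 lₙ))`. -/
def bump : E d → ℝ :=
  a.box.indicator fun z => ∏ n, Real.sin (Real.pi * ((z n + a.l n) / (2 * a.l n)))

/-- The supports are disjoint and contained in the domain. -/
def IsAdmissible (S : Setting d) : Prop :=
  (∀ n, 0 < a.l n) ∧ (∀ j, 0 < a.scale j) ∧ (∀ j, a.support j ⊆ S.domain) ∧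
    ∀ i j, i ≠ j → Disjoint (a.support i) (a.support j)

variable (S : Setting d)

/-- The span of the actuators. -/
def actSpan : Submodule ℝ (H S) :=
  Submodule.span ℝ (Set.range fun j => toH S (a.indicatorFun j))

/-- The span of the auxiliary functions `φᵏ ∘ (chart j)`. -/
def auxSpan (k : ℕ) : Submodule ℝ (H S) :=
  Submodule.span ℝ (Set.range fun j => toH S fun x => a.bump (a.chart j x) ^ k)

end Actuators

variable {S : Setting d}

open Classical in
/-- The oblique projection onto `X` along `Y^⊥`, extended by duality to functionals on `Y`: the
element `q ∈ X` such that `(q, v)_H = ℓ(v)` for all `v ∈ Y`. For `ℓ = (w, ·)_H` with `w ∈ H` this is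
`q ∈ X` with `w - q ∈ Y^⊥`. -/
def obliqueProj (X Y : Submodule ℝ (H S)) (ℓ : H S → ℝ) : H S :=
  if h : ∃ q ∈ X, ∀ v ∈ Y, ⟪q, v⟫_ℝ = ℓ v then h.choose else 0

/-- `𝐅₁ w = -λ₁ P_U^{Ũ^⊥} A² P_Ũ^{U^⊥} w`, where `⟨A² p, v⟩ = (A p, A v)_H` for `p, v ∈ D(A)`, and
the auxiliary functions are `φ² ∘ (chart j)`. -/
def feedback₁ (a : Actuators d) (lam : ℝ) (w : H S) : H S :=
  -lam • obliqueProj (a.actSpan S) (a.auxSpan S 2) fun v =>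
    ⟪opA (obliqueProj (a.auxSpan S 2) (a.actSpan S) fun u => ⟪w, u⟫_ℝ), opA v⟫_ℝ

/-- `𝐅₂ w = -λ₂ P_U^{Ũ^⊥} A P_Ũ^{U^⊥} w`, where `⟨A p, v⟩ = (p, v)_V` for `p, v ∈ V`, and the
auxiliary functions are `φ ∘ (chart j)`. -/
def feedback₂ (a : Actuators d) (lam : ℝ) (w : H S) : H S :=
  -lam • obliqueProj (a.actSpan S) (a.auxSpan S 1) fun v =>
    ⟪lift (obliqueProj (a.auxSpan S 1) (a.actSpan S) fun u => ⟪w, u⟫_ℝ), lift v⟫_ℝ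

/-- The forcing `ĥ₁(t, w₁) = h₁(t) + χ 𝐅₁(w₁ - r₁(t))`. -/
def forcing₁ (a : Actuators d) (lam χ : ℝ) (h : ℝ → V' S) (r : ℝ → H S) (t : ℝ) (w : H S) : V' S :=
  h t + χ • pivot (feedback₁ a lam (w - r t))

/-- The forcing `ĥ₂(t, w₂) = h₂(t) + χ 𝐅₂(w₂ - r₂(t))`. -/
def forcing₂ (a : Actuators d) (lam χ : ℝ) (h : ℝ → V' S) (r : ℝ → H S) (t : ℝ) (w : H S) : V' S :=
  h t + χ • pivot (feedback₂ a lam (w - r t))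

end Feedback

section Galerkin

variable {d : ℕ}

/-- `e` is an orthonormal basis of `H` of eigenfunctions of `A`, hence of the Laplacian `A₀ = A - 1`,
ordered by nondecreasing eigenvalues. -/
def IsEigenbasis (S : Setting d) (e : ℕ → H S) (μ : ℕ → ℝ) : Prop :=
  Orthonormal ℝ e ∧ (Submodule.span ℝ (Set.range e)).topologicalClosure = ⊤ ∧ Monotone μ ∧
    ∀ k, IsA (e k) (μ k • e k)

/-- The span of the first `N` eigenfunctions. -/
def galSpan {S : Setting d} (e : ℕ → H S) (N : ℕ) : Submodule ℝ (H S) :=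
  Submodule.span ℝ (e '' {k | k < N})

/-- The orthogonal projection onto `galSpan e N`, extended to `V'`. -/
def galProj {S : Setting d} (e : ℕ → H S) (N : ℕ) (ℓ : V' S) : H S :=
  ∑ k ∈ Finset.range N, ℓ (lift (e k)) • e k

variable (P : Model d)

/-- Right-hand side of the first Galerkin equation. -/
def galRHS₁ (e : ℕ → H P.S) (N : ℕ) (η₁ : ℝ → H P.S → V' P.S) (w₁ w₂ : ℝ → H P.S) (t : ℝ) : H P.S :=
  -P.ν₂ • lap (lap (w₁ t)) - (P.ν₀ * P.ν₁) • lap (w₁ t) + P.ν₁ • lap (w₂ t) +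
    galProj e N (-lapV (lift (toH P.S fun x => P.f (w₁ t x))) - toV' P.S (fun x => P.g (w₁ t x))
      + η₁ t (w₁ t))

/-- Right-hand side of the second Galerkin equation. -/
def galRHS₂ (e : ℕ → H P.S) (N : ℕ) (η₂ : ℝ → H P.S → V' P.S) (w₁ w₂ : ℝ → H P.S) (t : ℝ) : H P.S :=
  -lap (w₂ t) + P.ν₀ • lap (w₁ t) + galProj e N (η₂ t (w₂ t))

/-- `(w₁, w₂)` is the `N`-th Galerkin approximation: a solution on `[0, ∞)`, in the sense of
Carathéodory, of the system of ordinary differential equations in `galSpan e N` with right-hand sides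
`galRHS₁`, `galRHS₂` and with the projected initial data. -/
def IsGalerkin (e : ℕ → H P.S) (N : ℕ) (η₁ η₂ : ℝ → H P.S → V' P.S) (w₀₁ w₀₂ : H P.S)
    (w₁ w₂ : ℝ → H P.S) : Prop :=
  (∀ t, 0 ≤ t → w₁ t ∈ galSpan e N ∧ w₂ t ∈ galSpan e N) ∧
  (∀ T, 0 < T → IntegrableOn (galRHS₁ P e N η₁ w₁ w₂) (Ioo 0 T) ∧
    IntegrableOn (galRHS₂ P e N η₂ w₁ w₂) (Ioo 0 T)) ∧
  ∀ t, 0 ≤ t →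
    w₁ t = galProj e N (pivot w₀₁) + ∫ s in (0 : ℝ)..t, galRHS₁ P e N η₁ w₁ w₂ s ∧
    w₂ t = galProj e N (pivot w₀₂) + ∫ s in (0 : ℝ)..t, galRHS₂ P e N η₂ w₁ w₂ s

/-- The free energy `ν₂ ‖u₁‖_V² + 2 ∫ F(u₁) + ρ ‖u₂‖_H²`. -/
def freeEnergy (F : ℝ → ℝ) (ρ : ℝ) (u₁ u₂ : H P.S) : ℝ :=
  P.ν₂ * normV u₁ ^ 2 + 2 * (∫ x, F (u₁ x) ∂P.S.vol) + ρ * ‖u₂‖ ^ 2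

/-- The chemical potential `ν₂ A₀ u + ν₀ ν₁ u + P_N f(u)`. -/
def chemPot (e : ℕ → H P.S) (N : ℕ) (u : H P.S) : H P.S :=
  P.ν₂ • lap u + (P.ν₀ * P.ν₁) • u + galProj e N (pivot (toH P.S fun x => P.f (u x)))

/-- The bounds, uniform in `N`, on the Galerkin approximations on `[0, T]`: the energy bound in
`L^∞(H × H) ∩ L²(D(A) × V)`; the bounds of the free energy, of `w₁` in `L^∞(V)` and of the gradient
of the chemical potential in `L²(H)`; the bound in `W((0,T), D(A^{3/2}) × V, V' × V')`. -/
def HasUniformBounds (F : ℝ → ℝ) (e : ℕ → H P.S) (η₁ η₂ : ℝ → H P.S → V' P.S)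
    (w₁ w₂ : ℕ → ℝ → H P.S) : Prop :=
  ∀ T : ℝ, 0 < T → ∀ ρ : ℝ, 0 < ρ → ∃ C : ℝ, ∀ N : ℕ,
    ((∀ t ∈ Icc 0 T, ‖w₁ N t‖ ≤ C ∧ ‖w₂ N t‖ ≤ C) ∧
      L2Bound T C (fun t => opA (w₁ N t)) ∧ L2Bound T C (fun t => lift (w₂ N t))) ∧
    ((∀ t ∈ Icc 0 T, freeEnergy P F ρ (w₁ N t) (w₂ N t) ≤ C ∧ normV (w₁ N t) ≤ C) ∧
      L2Bound T C (fun t => grad (lift (chemPot P e N (w₁ N t))))) ∧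
    (L2Bound T C (fun t => lift (opA (w₁ N t))) ∧
      L2Bound T C (fun t => pivot (galRHS₁ P e N η₁ (w₁ N) (w₂ N) t)) ∧
      L2Bound T C (fun t => pivot (galRHS₂ P e N η₂ (w₁ N) (w₂ N) t)))

/-- A subsequence of the Galerkin approximations converges to `(w₁, w₂)`: weakly in
`W((0,T), D(A^{3/2}) × V, V' × V')`, and strongly in `L²((0,T), V)` for the first component, for all
`T > 0`. -/
def HasGalerkinLimit (e : ℕ → H P.S) (η₁ η₂ : ℝ → H P.S → V' P.S) (W₁ W₂ : ℕ → ℝ → H P.S)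
    (w₁ w₂ : ℝ → H P.S) : Prop :=
  ∃ ξ₁ ξ₂ : ℝ → V' P.S, MemWloc w₁ w₂ ξ₁ ξ₂ ∧
  ∃ n : ℕ → ℕ, StrictMono n ∧ ∀ T : ℝ, 0 < T →
    WeakL2 T (fun k t => lift (opA (W₁ (n k) t))) (fun t => lift (opA (w₁ t))) ∧
    WeakL2 T (fun k t => lift (W₂ (n k) t)) (fun t => lift (w₂ t)) ∧
    WeakL2 T (fun k t => pivot (galRHS₁ P e (n k) η₁ (W₁ (n k)) (W₂ (n k)) t)) ξ₁ ∧
    WeakL2 T (fun k t => pivot (galRHS₂ P e (n k) η₂ (W₁ (n k)) (W₂ (n k)) t)) ξ₂ ∧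
    Tendsto (fun k => eLpNorm (fun t => lift (W₁ (n k) t) - lift (w₁ t)) 2
      (volume.restrict (Ioo 0 T))) atTop (𝓝 0)

end Galerkin

section WellPosedness

variable {d : ℕ} {S : Setting d}

/-- There is a pair of trajectories with the property `Q`, and it is unique up to equality for almost
all times. -/
def ExistsUniqueAE (Q : (ℝ → H S) → (ℝ → H S) → Prop) : Prop :=
  ∃ w₁ w₂ : ℝ → H S, Q w₁ w₂ ∧ ∀ v₁ v₂ : ℝ → H S, Q v₁ v₂ →
    v₁ =ᵐ[volume.restrict (Ioi (0 : ℝ))] w₁ ∧ v₂ =ᵐ[volume.restrict (Ioi (0 : ℝ))] w₂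

end WellPosedness

end CahnHilliard

end

open MeasureTheory Set Filter Topology
open scoped ContDiff RealInnerProductSpace ENNReal
open intervalIntegral (integral_of_le integral_mono_on integral_mono_interval integral_same integral_congr)
open Real (exp exp_pos norm_eq_abs sqrt_nonneg norm_of_nonneg sqrt_sq sqrt_pos le_sqrt_of_sq_le sqrt_mul exp_le_exp sq_sqrt sqrt_le_sqrt dist_eq)
open Submodule (span subset_span)
open EuclideanSpace (single proj)
open InnerProductSpace (toDual toDual_symm_apply)
open ContinuousLinearMap (adjoint le_opNorm opNorm_le_bound comp_apply coe_fst' coe_snd')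
open Metric (closedBall ball_mem_nhds mem_ball closedBall_mem_nhds_of_mem)

noncomputable section

namespace CahnHilliard

/-- Lebesgue measure on the interval `(0, T)`. -/
local notation "vol(" T ")" => Measure.restrict (volume : Measure ℝ) (Ioo (0 : ℝ) T)

section

section Domain

variable {d : ℕ} {S : Setting d}

theorem Setting.IsAdmissible.isOpen (hS : S.IsAdmissible) : IsOpen S.domain := by
  cases S with
  | dirichlet Ω => exact hS.1
  | neumann Ω => exact hS.1
  | periodic L =>
    have : (Setting.periodic L).domain = ⋂ i, {x : E d | 0 < x i ∧ x i < L i} := by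
      ext x; simp [Setting.domain]
    rw [this]
    refine isOpen_iInter_of_finite fun i => ?_
    have hc : Continuous fun x : E d => x i := by fun_prop
    exact (isOpen_lt continuous_const hc).inter (isOpen_lt hc continuous_const)

theorem Setting.IsAdmissible.convex (hS : S.IsAdmissible) : Convex ℝ S.domain := by
  cases S with
  | dirichlet Ω => exact hS.2.1
  | neumann Ω => exact hS.2.1
  | periodic L =>
    have : (Setting.periodic L).domain =
        ⋂ i, (proj i : E d →L[ℝ] ℝ) ⁻¹' Ioo 0 (L i) := by ext x; simp [Setting.domain]
    rw [this]
    exact convex_iInter fun i => (convex_Ioo _ _).linear_preimage _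

theorem Setting.IsAdmissible.isBounded (hS : S.IsAdmissible) : Bornology.IsBounded S.domain := by
  cases S with
  | dirichlet Ω => exact hS.2.2.1
  | neumann Ω => exact hS.2.2.1
  | periodic L =>
    have h1 : Bornology.IsBounded (Set.pi univ fun i => Icc 0 (L i)) :=
      Bornology.IsBounded.pi fun i => Metric.isBounded_Icc _ _
    refine ((PiLp.antilipschitzWith_ofLp 2 (fun _ : Fin d => ℝ)).isBounded_preimage h1).subset ?_
    intro x hx i _
    exact ⟨(hx i).1.le, (hx i).2.le⟩

theorem Setting.IsAdmissible.nonempty (hS : S.IsAdmissible) : S.domain.Nonempty := by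
  cases S with
  | dirichlet Ω => exact hS.2.2.2
  | neumann Ω => exact hS.2.2.2
  | periodic L =>
    refine ⟨WithLp.toLp 2 fun i => L i / 2, fun i => ?_⟩
    have := hS i
    constructor <;> simp <;> linarith

theorem Setting.IsAdmissible.measurableSet (hS : S.IsAdmissible) : MeasurableSet S.domain :=
  hS.isOpen.measurableSet

theorem Setting.IsAdmissible.volume_lt_top (hS : S.IsAdmissible) : volume S.domain < ⊤ :=
  hS.isBounded.measure_lt_top

variable [hS : Fact S.IsAdmissible]

instance : IsFiniteMeasure S.vol := ⟨by simpa [Setting.vol] using hS.out.volume_lt_top⟩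

theorem memLp_of_continuous {ψ : E d → ℝ} (hψ : Continuous ψ) (p : ℝ≥0∞) : MemLp ψ p S.vol := by
  obtain ⟨C, hC⟩ := (hS.out.isBounded.isCompact_closure).exists_bound_of_continuousOn hψ.continuousOn
  refine MemLp.of_bound hψ.aestronglyMeasurable C ?_
  exact ae_restrict_of_forall_mem hS.out.measurableSet fun x hx => hC x (subset_closure hx)

/-- The smooth functions with compact support in the domain. -/
def IsBump (S : Setting d) (ψ : E d → ℝ) : Prop :=
  ContDiff ℝ ∞ ψ ∧ HasCompactSupport ψ ∧ tsupport ψ ⊆ S.domain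

/-- Partial derivative. -/
def pd (i : Fin d) (ψ : E d → ℝ) (x : E d) : ℝ := fderiv ℝ ψ x (single i 1)

theorem contDiff_pd {ψ : E d → ℝ} (hψ : ContDiff ℝ ∞ ψ) (i : Fin d) : ContDiff ℝ ∞ (pd i ψ) := by
  unfold pd
  exact (hψ.fderiv_right (m := ∞) (by simp)).clm_apply contDiff_const

theorem tsupport_pd_subset (ψ : E d → ℝ) (i : Fin d) : tsupport (pd i ψ) ⊆ tsupport ψ :=
  tsupport_fderiv_apply_subset ℝ _

theorem IsBump.of_pd {ψ : E d → ℝ} (hψ : IsBump S ψ) (i : Fin d) : IsBump S (pd i ψ) :=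
  ⟨contDiff_pd hψ.1 i, hψ.2.1.of_isClosed_subset (isClosed_tsupport _) (tsupport_pd_subset ψ i),
    (tsupport_pd_subset ψ i).trans hψ.2.2⟩

/-- The pair `(ψ, ∇ψ)`. -/
def classicalPair {ψ : E d → ℝ} (hψ : ContDiff ℝ ∞ ψ) : GradPair S :=
  WithLp.toLp 2 ((memLp_of_continuous hψ.continuous 2).toLp ψ,
    WithLp.toLp 2 fun i => (memLp_of_continuous (contDiff_pd hψ i).continuous 2).toLp (pd i ψ))

theorem isClassicalPair_classicalPair {ψ : E d → ℝ} (hψ : ContDiff ℝ ∞ ψ) :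
    IsClassicalPair S ψ (classicalPair hψ) :=
  ⟨MemLp.coeFn_toLp (memLp_of_continuous hψ.continuous 2),
    fun i => MemLp.coeFn_toLp (memLp_of_continuous (contDiff_pd hψ i).continuous 2)⟩

theorem inner_eq_integral {u v : H S} {φ : E d → ℝ} (hv : ⇑v =ᵐ[S.vol] φ) :
    ⟪u, v⟫ = ∫ x, u x * φ x ∂S.vol := by
  rw [L2.inner_def]
  refine integral_congr_ae ?_
  filter_upwards [hv] with x hx
  simp [hx, mul_comm]

theorem setIntegral_domain_eq {ψ : E d → ℝ} (hψ : tsupport ψ ⊆ S.domain) (φ : E d → ℝ)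
    (h : ∀ x, ψ x = 0 → φ x = 0) : ∫ x, φ x ∂S.vol = ∫ x, φ x := by
  refine setIntegral_eq_integral_of_forall_compl_eq_zero fun x hx => h x ?_
  exact image_eq_zero_of_notMem_tsupport fun hx' => hx (hψ hx')

theorem integral_bump_parts {ψ φ : E d → ℝ} (hψ : IsBump S ψ) (hφ : ContDiff ℝ ∞ φ) (i : Fin d) :
    ∫ x, ψ x * pd i φ x ∂S.vol = -∫ x, pd i ψ x * φ x ∂S.vol := by
  rw [setIntegral_domain_eq (S := S) hψ.2.2 _ (fun x hx => by simp [hx]),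
    setIntegral_domain_eq (S := S) (hψ.of_pd i).2.2 _ (fun x hx => by simp [hx])]
  have hc : ∀ {a b : E d → ℝ}, Continuous a → Continuous b → HasCompactSupport a →
      Integrable (fun x => a x * b x) := fun ha hb hs =>
    (ha.mul hb).integrable_of_hasCompactSupport hs.mul_right
  have h := integral_mul_fderiv_eq_neg_fderiv_mul_of_integrable (μ := (volume : Measure (E d)))
    (f := ψ) (g := φ) (v := single i 1)
    (hc (hψ.of_pd i).1.continuous hφ.continuous (hψ.of_pd i).2.1)
    (hc hψ.1.continuous (contDiff_pd hφ i).continuous hψ.2.1)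
    (hc hψ.1.continuous hφ.continuous hψ.2.1)
    (fun x _ => hψ.1.differentiable (by simp) x) (fun x _ => hφ.differentiable (by simp) x)
  exact h

theorem classical_parts {ψ φ : E d → ℝ} {p q : GradPair S} (hψ : IsBump S ψ) (hφ : ContDiff ℝ ∞ φ)
    (hp : IsClassicalPair S ψ p) (hq : IsClassicalPair S φ q) (i : Fin d) :
    ⟪p.fst, q.snd i⟫ + ⟪p.snd i, q.fst⟫ = 0 := by
  rw [inner_eq_integral (hq.2 i), inner_eq_integral hq.1]
  have h1 : ∫ x, p.fst x * fderiv ℝ φ x (single i 1) ∂S.vol =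
      ∫ x, ψ x * pd i φ x ∂S.vol := integral_congr_ae (by
    filter_upwards [hp.1] with x hx; rw [hx]; rfl)
  have h2 : ∫ x, p.snd i x * φ x ∂S.vol = ∫ x, pd i ψ x * φ x ∂S.vol := integral_congr_ae (by
    filter_upwards [hp.2 i] with x hx; rw [hx]; rfl)
  rw [h1, h2, integral_bump_parts hψ hφ i]; ring

theorem isClosed_sobolevW : IsClosed (sobolevW S : Set (GradPair S)) := by
  have : (sobolevW S : Set (GradPair S)) = ⋂ (ψ : E d → ℝ) (_ : IsTestFunction S ψ)
      (q : GradPair S) (_ : IsClassicalPair S ψ q) (i : Fin d),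
      {p : GradPair S | ⟪p.fst, q.snd i⟫ + ⟪p.snd i, q.fst⟫ = 0} := by ext p; simp [sobolevW]
  rw [this]
  refine isClosed_iInter fun ψ => isClosed_iInter fun _ => isClosed_iInter fun q =>
    isClosed_iInter fun _ => isClosed_iInter fun i => isClosed_eq ?_ continuous_const
  have h1 : Continuous fun p : GradPair S => p.fst :=
    (WithLp.fstL 2 ℝ (H S) (PiLp 2 (fun _ : Fin d => H S))).continuous
  have h2 : Continuous fun p : GradPair S => p.snd :=
    (WithLp.sndL 2 ℝ (H S) (PiLp 2 (fun _ : Fin d => H S))).continuous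
  have h3 : Continuous fun p : GradPair S => p.snd i := (PiLp.continuous_apply 2 _ i).comp h2
  exact (h1.inner continuous_const).add (h3.inner continuous_const)

theorem isClosed_spaceV : IsClosed (spaceV S : Set (GradPair S)) := by
  cases S with
  | dirichlet Ω => exact Submodule.isClosed_topologicalClosure _
  | neumann Ω => exact isClosed_sobolevW
  | periodic L => exact isClosed_sobolevW

instance : CompleteSpace (V S) := (isClosed_spaceV (S := S)).completeSpace_coe

theorem sobolevW0_le (Ω : Set (E d)) [Fact (Setting.dirichlet Ω).IsAdmissible] :
    sobolevW0 (.dirichlet Ω) ≤ sobolevW (.dirichlet Ω) := by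
  refine Submodule.topologicalClosure_minimal _ (Submodule.span_le.2 ?_) isClosed_sobolevW
  rintro p ⟨φ, hφ, hp⟩ ψ hψ q hq i
  exact classical_parts (S := .dirichlet Ω) ⟨hφ.1, hφ.2.1, hφ.2.2⟩ hψ.1 hp hq i

theorem IsBump.pair_mem {ψ : E d → ℝ} (hψ : IsBump S ψ) : classicalPair hψ.1 ∈ spaceV S := by
  cases S with
  | dirichlet Ω =>
    exact Submodule.le_topologicalClosure _ (subset_span
      ⟨ψ, ⟨hψ.1, hψ.2.1, hψ.2.2⟩, isClassicalPair_classicalPair _⟩)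
  | neumann Ω =>
    intro φ hφ q hq i
    exact classical_parts hψ hφ.1 (isClassicalPair_classicalPair _) hq i
  | periodic L =>
    intro φ hφ q hq i
    exact classical_parts hψ hφ.1 (isClassicalPair_classicalPair _) hq i

/-- A smooth function with compact support as an element of `V`. -/
def IsBump.toV {ψ : E d → ℝ} (hψ : IsBump S ψ) : V S :=
  (⟨classicalPair hψ.1, hψ.pair_mem⟩ : spaceV S)

theorem IsBump.incl_toV {ψ : E d → ℝ} (hψ : IsBump S ψ) :
    ⇑(incl hψ.toV) =ᵐ[S.vol] ψ := (isClassicalPair_classicalPair hψ.1).1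

theorem IsBump.grad_toV {ψ : E d → ℝ} (hψ : IsBump S ψ) (i : Fin d) :
    ⇑(grad hψ.toV i) =ᵐ[S.vol] pd i ψ := (isClassicalPair_classicalPair hψ.1).2 i

end Domain

section Periodize

variable {d : ℕ}

/-- The periodic extension of a function on the box with sides `L`. -/
def periodize (L : Fin d → ℝ) (ψ : E d → ℝ) (x : E d) : ℝ :=
  ψ (WithLp.toLp 2 fun i => L i * Int.fract (x i / L i))

theorem periodize_add {L : Fin d → ℝ} (hL : ∀ i, 0 < L i) (ψ : E d → ℝ) (i : Fin d) (x : E d) :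
    periodize L ψ (x + single i (L i)) = periodize L ψ x := by
  unfold periodize
  congr 2
  funext j
  by_cases h : j = i
  · subst h
    have h1 : (x j + L j) / L j = x j / L j + 1 := by rw [add_div, div_self (hL j).ne']
    simp [h1]
  · simp [h]

theorem periodize_eq {L : Fin d → ℝ} (ψ : E d → ℝ) {x : E d}
    (hx : ∀ i, 0 < x i ∧ x i < L i) : periodize L ψ x = ψ x := by
  unfold periodize
  congr 1
  ext i
  have h1 : 0 < L i := (hx i).1.trans (hx i).2
  have : Int.fract (x i / L i) = x i / L i :=
    Int.fract_eq_self.2 ⟨(div_pos (hx i).1 h1).le, (div_lt_one h1).2 (hx i).2⟩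
  simp only [this]
  field_simp

theorem contDiff_periodize {L : Fin d → ℝ} (hL : ∀ i, 0 < L i) {ψ : E d → ℝ}
    (hψ : IsBump (.periodic L) ψ) : ContDiff ℝ ∞ (periodize L ψ) := by
  rw [contDiff_iff_contDiffAt]
  intro x
  by_cases hx : ∀ i, Int.fract (x i / L i) ≠ 0
  · have hev : periodize L ψ =ᶠ[𝓝 x] fun y =>
        ψ (y - WithLp.toLp 2 fun i => L i * (⌊x i / L i⌋ : ℝ)) := by
      have : ∀ i, ∀ᶠ y : E d in 𝓝 x, ⌊y i / L i⌋ = ⌊x i / L i⌋ := by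
        intro i
        have hc : ContinuousAt (fun y : E d => y i / L i) x := by fun_prop
        have h1 : (⌊x i / L i⌋ : ℝ) < x i / L i := by
          have := hx i
          have h2 := Int.fract_nonneg (x i / L i)
          have h3 := Int.self_sub_floor (x i / L i)
          have : 0 < Int.fract (x i / L i) := lt_of_le_of_ne h2 (Ne.symm this)
          linarith
        filter_upwards [hc.eventually (lt_mem_nhds h1),
          hc.eventually (gt_mem_nhds (Int.lt_floor_add_one (x i / L i)))]
          with y hy1 hy2
        exact Int.floor_eq_iff.2 ⟨hy1.le, hy2⟩
      filter_upwards [eventually_all.2 this] with y hy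
      unfold periodize
      congr 1
      ext i
      have h1 : L i ≠ 0 := (hL i).ne'
      simp only [PiLp.sub_apply, Int.fract, hy i]
      field_simp
    exact (hψ.1.contDiffAt.comp x (contDiffAt_id.sub contDiffAt_const)).congr_of_eventuallyEq hev
  · push Not at hx
    obtain ⟨i, hi⟩ := hx
    have hK : IsCompact ((fun y : E d => y i) '' tsupport ψ) := hψ.2.1.isCompact.image (by fun_prop)
    have hKs : ∀ t ∈ (fun y : E d => y i) '' tsupport ψ, 0 < t ∧ t < L i := by
      rintro _ ⟨y, hy, rfl⟩; exact hψ.2.2 hy i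
    obtain ⟨ε, hε, hε'⟩ : ∃ ε > 0, ∀ t ∈ (fun y : E d => y i) '' tsupport ψ,
        ε < t ∧ t < L i - ε := by
      rcases ((fun y : E d => y i) '' tsupport ψ).eq_empty_or_nonempty with h | h
      · exact ⟨1, one_pos, by simp [h]⟩
      · obtain ⟨a, ha, ha'⟩ := hK.exists_isMinOn h continuousOn_id
        obtain ⟨b, hb, hb'⟩ := hK.exists_isMaxOn h continuousOn_id
        refine ⟨min a (L i - b) / 2, ?_, fun t ht => ?_⟩
        · have := (hKs a ha).1
          have := (hKs b hb).2
          have : 0 < min a (L i - b) := lt_min (by linarith) (by linarith)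
          linarith
        · have h1 : a ≤ t := ha' ht
          have h2 : t ≤ b := hb' ht
          have := (hKs a ha).1
          have := (hKs b hb).2
          have h3 := min_le_left a (L i - b)
          have h4 := min_le_right a (L i - b)
          constructor <;> linarith
    have hev : periodize L ψ =ᶠ[𝓝 x] fun _ => 0 := by
      have hc : ContinuousAt (fun y : E d => y i) x := by fun_prop
      have h0 := Metric.continuousAt_iff.1 hc ε hε
      obtain ⟨δ, hδ, h0⟩ := h0
      filter_upwards [ball_mem_nhds x hδ] with y hy
      have hy' := h0 (mem_ball.1 hy)
      rw [dist_eq, abs_lt] at hy'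
      unfold periodize
      refine image_eq_zero_of_notMem_tsupport fun hmem => ?_
      have h2 := hε' _ ⟨_, hmem, rfl⟩
      simp only at h2
      have hLi := hL i
      have h4 : x i = L i * (⌊x i / L i⌋ : ℝ) := by
        have := Int.self_sub_floor (x i / L i)
        rw [hi] at this
        have h5 : x i / L i = ⌊x i / L i⌋ := by linarith
        field_simp at h5
        rw [← h5]
      have h6 : y i = L i * (⌊y i / L i⌋ : ℝ) + L i * Int.fract (y i / L i) := by
        rw [← mul_add, Int.floor_add_fract]; field_simp
      have h7 : L i * ((⌊y i / L i⌋ : ℝ) - ⌊x i / L i⌋) < 0 := by nlinarith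
      have h8 : -L i < L i * ((⌊y i / L i⌋ : ℝ) - ⌊x i / L i⌋) := by nlinarith
      have h9 : ((⌊y i / L i⌋ : ℝ) - ⌊x i / L i⌋) < 0 := by
        by_contra hcon; push Not at hcon; nlinarith [mul_nonneg hLi.le hcon]
      have h10 : (-1 : ℝ) < ((⌊y i / L i⌋ : ℝ) - ⌊x i / L i⌋) := by
        by_contra hcon; push Not at hcon; nlinarith
      have h11 : (⌊y i / L i⌋ - ⌊x i / L i⌋ : ℤ) < 0 := by exact_mod_cast h9
      have h12 : (-1 : ℤ) < (⌊y i / L i⌋ - ⌊x i / L i⌋ : ℤ) := by exact_mod_cast h10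
      omega
    exact contDiffAt_const.congr_of_eventuallyEq hev

end Periodize

section Weak

variable {d : ℕ} {S : Setting d} [hS : Fact S.IsAdmissible]

/-- Every element of `V` has the weak gradient with respect to smooth functions with compact
support. -/
theorem weak_gradient (v : V S) {ψ : E d → ℝ} (hψ : IsBump S ψ) (i : Fin d) :
    ∫ x, incl v x * pd i ψ x ∂S.vol = -∫ x, grad v i x * ψ x ∂S.vol := by
  have key : ∀ {φ : E d → ℝ} (hφ : ContDiff ℝ ∞ φ), EqOn φ ψ S.domain →
      ⟪incl v, (classicalPair hφ).snd i⟫ + ⟪grad v i, (classicalPair hφ).fst⟫ = 0 →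
      ∫ x, incl v x * pd i ψ x ∂S.vol = -∫ x, grad v i x * ψ x ∂S.vol := by
    intro φ hφ heq h
    have hcl := isClassicalPair_classicalPair (S := S) hφ
    rw [inner_eq_integral (hcl.2 i), inner_eq_integral hcl.1] at h
    have h1 : ∫ x, incl v x * fderiv ℝ φ x (single i 1) ∂S.vol =
        ∫ x, incl v x * pd i ψ x ∂S.vol := by
      refine setIntegral_congr_fun hS.out.measurableSet fun x hx => ?_
      have : φ =ᶠ[𝓝 x] ψ := heq.eventuallyEq_of_mem (hS.out.isOpen.mem_nhds hx)
      simp only [pd, this.fderiv_eq]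
    have h2 : ∫ x, grad v i x * φ x ∂S.vol = ∫ x, grad v i x * ψ x ∂S.vol := by
      refine setIntegral_congr_fun hS.out.measurableSet fun x hx => ?_
      simp only [heq hx]
    rw [h1, h2] at h
    linarith
  cases S with
  | dirichlet Ω =>
    exact key hψ.1 (fun _ _ => rfl) (sobolevW0_le Ω v.2 ψ ⟨hψ.1, hψ.2.1, hψ.2.2⟩ _
      (isClassicalPair_classicalPair hψ.1) i)
  | neumann Ω =>
    exact key hψ.1 (fun _ _ => rfl) (v.2 ψ ⟨hψ.1, hψ.2.1, hψ.2.2⟩ _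
      (isClassicalPair_classicalPair hψ.1) i)
  | periodic L =>
    have hc := contDiff_periodize hS.out hψ
    exact key hc (fun x hx => periodize_eq ψ hx) (v.2 (periodize L ψ)
      ⟨hc, periodize_add hS.out ψ⟩ _ (isClassicalPair_classicalPair hc) i)

/-- Smooth functions with compact support are total in `H`. -/
theorem eq_zero_of_forall_bump {u : H S}
    (h : ∀ ψ : E d → ℝ, IsBump S ψ → ∫ x, u x * ψ x ∂S.vol = 0) : u = 0 := by
  have hint : Integrable u S.vol := (Lp.memLp u).integrable (by norm_num)
  have hloc : LocallyIntegrableOn u S.domain := (show IntegrableOn u S.domain volume from hint).locallyIntegrableOn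
  have := hS.out.isOpen.ae_eq_zero_of_integral_contDiff_smul_eq_zero hloc (fun ψ h1 h2 h3 => by
    have h4 := h ψ ⟨h1, h2, h3⟩
    rw [setIntegral_domain_eq (S := S) h3 _ (fun x hx => by simp [hx])] at h4
    simpa [mul_comm] using h4)
  refine Lp.ext ?_
  have h5 : ∀ᵐ x ∂S.vol, u x = 0 := (ae_restrict_iff' hS.out.measurableSet).2 this
  filter_upwards [h5, Lp.coeFn_zero ℝ 2 S.vol] with x hx hx0
  rw [hx, hx0]; rfl

theorem inner_toV (u : H S) {ψ : E d → ℝ} (hψ : IsBump S ψ) :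
    ⟪u, incl hψ.toV⟫ = ∫ x, u x * ψ x ∂S.vol := inner_eq_integral (hψ.incl_toV)

theorem eq_zero_of_forall_inner_incl {u : H S} (h : ∀ v : V S, ⟪u, incl v⟫ = 0) : u = 0 :=
  eq_zero_of_forall_bump fun ψ hψ => by rw [← inner_toV u hψ]; exact h _

theorem norm_sq_V (v : V S) : ‖v‖ ^ 2 = ‖incl v‖ ^ 2 + ‖grad v‖ ^ 2 :=
  WithLp.prod_norm_sq_eq_of_L2 (toPair v)

theorem inner_V (u v : V S) : ⟪u, v⟫ = ⟪incl u, incl v⟫ + ⟪grad u, grad v⟫ :=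
  WithLp.prod_inner_apply (toPair u) (toPair v)

theorem incl_injective : Function.Injective (incl : V S → H S) := by
  refine (injective_iff_map_eq_zero _).2 fun v hv => ?_
  have hg : grad v = 0 := by
    ext1 i
    refine eq_zero_of_forall_bump fun ψ hψ => ?_
    have h1 := weak_gradient v hψ i
    have h2 : ∫ x, incl v x * pd i ψ x ∂S.vol = 0 := by
      rw [hv]
      have : (fun x => (0 : H S) x * pd i ψ x) =ᵐ[S.vol] fun _ => 0 := by
        filter_upwards [Lp.coeFn_zero ℝ 2 S.vol] with x hx
        rw [hx]; simp
      rw [integral_congr_ae this]; simp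
    linarith
  have := norm_sq_V v
  rw [hv, hg] at this
  simpa using this

theorem norm_incl_le (v : V S) : ‖incl v‖ ≤ ‖v‖ := by
  have := norm_sq_V v
  exact abs_le_of_sq_le_sq' (by nlinarith [sq_nonneg ‖grad v‖]) (norm_nonneg _) |>.2

theorem norm_grad_le (v : V S) : ‖grad v‖ ≤ ‖v‖ := by
  have := norm_sq_V v
  exact abs_le_of_sq_le_sq' (by nlinarith [sq_nonneg ‖incl v‖]) (norm_nonneg _) |>.2

theorem lift_incl (v : V S) : lift (incl v) = v := by
  have h : InV (incl v) := ⟨v, rfl⟩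
  unfold lift
  rw [dif_pos h]
  exact incl_injective h.choose_spec

theorem InV.incl_lift {u : H S} (h : InV u) : incl (lift u) = u := by
  unfold lift
  rw [dif_pos h]
  exact h.choose_spec

end Weak

section Compactness

variable {d : ℕ} {S : Setting d} [hS : Fact S.IsAdmissible]

theorem norm_toLp_sq {ψ : E d → ℝ} (hψ : MemLp ψ 2 S.vol) :
    ‖hψ.toLp ψ‖ ^ 2 = ∫ x, ψ x ^ 2 ∂S.vol := by
  rw [← real_inner_self_eq_norm_sq, inner_eq_integral hψ.coeFn_toLp]
  refine integral_congr_ae ?_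
  filter_upwards [hψ.coeFn_toLp] with x hx
  rw [hx, sq]

theorem abs_integral_mul_le (g : H S) {ψ : E d → ℝ} (hψ : MemLp ψ 2 S.vol) :
    |∫ x, g x * ψ x ∂S.vol| ≤ ‖g‖ * √(∫ x, ψ x ^ 2 ∂S.vol) := by
  rw [← norm_toLp_sq hψ, sqrt_sq (norm_nonneg _), ← inner_eq_integral hψ.coeFn_toLp]
  exact abs_real_inner_le_norm _ _

theorem norm_le_of_forall_bump {u : H S} {M : ℝ} (hM : 0 ≤ M) (h : ∀ ψ : E d → ℝ, IsBump S ψ →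
      |∫ x, u x * ψ x ∂S.vol| ≤ M * √(∫ x, ψ x ^ 2 ∂S.vol)) : ‖u‖ ≤ M := by
  let B : Submodule ℝ (H S) :=
    { carrier := {w | ∃ ψ, IsBump S ψ ∧ ⇑w =ᵐ[S.vol] ψ}
      add_mem' := by
        rintro a b ⟨ψ, hψ, ha⟩ ⟨φ, hφ, hb⟩
        refine ⟨ψ + φ, ⟨hψ.1.add hφ.1, hψ.2.1.add hφ.2.1, ?_⟩, (Lp.coeFn_add a b).trans (ha.add hb)⟩
        exact (tsupport_add ψ φ).trans (union_subset hψ.2.2 hφ.2.2)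
      zero_mem' := ⟨0, ⟨contDiff_const, HasCompactSupport.zero, by simp [tsupport]⟩,
        Lp.coeFn_zero ℝ 2 S.vol⟩
      smul_mem' := by
        rintro c a ⟨ψ, hψ, ha⟩
        refine ⟨c • ψ, ⟨contDiff_const.smul hψ.1, hψ.2.1.smul_left (f := fun _ => c), ?_⟩,
          (Lp.coeFn_smul c a).trans (ha.const_smul c)⟩
        exact (tsupport_smul_subset_right (fun _ => c) ψ).trans hψ.2.2 }
  have hB : B.topologicalClosure = ⊤ := by
    rw [Submodule.topologicalClosure_eq_top_iff, Submodule.eq_bot_iff]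
    intro w hw
    refine eq_zero_of_forall_bump fun ψ hψ => ?_
    rw [← inner_toV w hψ, real_inner_comm]
    exact hw _ ⟨ψ, hψ, hψ.incl_toV⟩
  have hle : ∀ w ∈ B, ⟪u, w⟫ ≤ M * ‖w‖ := by
    rintro w ⟨ψ, hψ, hw⟩
    have hm := memLp_of_continuous (S := S) hψ.1.continuous 2
    have hwe : w = hm.toLp ψ := Lp.ext (hw.trans hm.coeFn_toLp.symm)
    have h1 := h ψ hψ
    rw [← norm_toLp_sq hm, sqrt_sq (norm_nonneg _), ← inner_eq_integral hw, ← hwe] at h1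
    exact (le_abs_self _).trans h1
  have hall : ∀ w : H S, ⟪u, w⟫ ≤ M * ‖w‖ := by
    intro w
    have hw : w ∈ closure (B : Set (H S)) := by rw [← Submodule.topologicalClosure_coe, hB]; trivial
    have hcl : IsClosed {w : H S | ⟪u, w⟫ ≤ M * ‖w‖} :=
      isClosed_le (continuous_const.inner continuous_id) (continuous_const.mul continuous_norm)
    exact closure_minimal (fun w hw => hle w hw) hcl hw
  have h2 := hall u
  rw [real_inner_self_eq_norm_sq, sq] at h2
  rcases (norm_nonneg u).eq_or_lt with h0 | h0
  · rw [← h0]; exact hM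
  · exact le_of_mul_le_mul_right h2 h0

/-- The function `z ↦ r ^ d φ (y + r (z - y))`. -/
def dilate (r : ℝ) (y : E d) (φ : E d → ℝ) (z : E d) : ℝ := r ^ d * φ (y + r • (z - y))

theorem contDiff_dilate {φ : E d → ℝ} (hφ : ContDiff ℝ ∞ φ) (r : ℝ) (y : E d) :
    ContDiff ℝ ∞ (dilate r y φ) := by
  unfold dilate
  fun_prop

theorem IsBump.mul_left {φ a : E d → ℝ} (hφ : IsBump S φ) (ha : ContDiff ℝ ∞ a) :
    IsBump S (fun z => a z * φ z) :=
  ⟨ha.mul hφ.1, hφ.2.1.mul_left, (tsupport_mul_subset_right (f := a) (g := φ)).trans hφ.2.2⟩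

theorem IsBump.dilate {φ : E d → ℝ} (hφ : IsBump S φ) {r : ℝ} (hr : 1 ≤ r)
    {y : E d} (hy : y ∈ S.domain) : IsBump S (dilate r y φ) := by
  have hr0 : r ≠ 0 := by positivity
  have hsub : Function.support (CahnHilliard.dilate r y φ) ⊆
      (fun w => y + r⁻¹ • (w - y)) '' tsupport φ := by
    intro z hz
    refine ⟨y + r • (z - y), subset_tsupport _ fun h => hz ?_, ?_⟩
    · simp [CahnHilliard.dilate, h]
    · simp [smul_smul, hr0]
  have hK : IsCompact ((fun w => y + r⁻¹ • (w - y)) '' tsupport φ) :=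
    hφ.2.1.isCompact.image (by fun_prop)
  refine ⟨contDiff_dilate hφ.1 r y, HasCompactSupport.of_support_subset_isCompact hK hsub,
    (closure_minimal hsub hK.isClosed).trans ?_⟩
  rintro _ ⟨w, hw, rfl⟩
  have hr1 : r⁻¹ ≤ 1 := inv_le_one_of_one_le₀ hr
  have := hS.out.convex hy (hφ.2.2 hw) (a := 1 - r⁻¹) (b := r⁻¹) (by linarith) (by positivity) (by ring)
  convert this using 1
  simp only [smul_sub, sub_smul, one_smul]; abel

/-- The derivative of `dilate r y φ z` with respect to `r`. -/
def dilateDeriv (r : ℝ) (y : E d) (φ : E d → ℝ) (z : E d) : ℝ :=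
  d * r ^ (d - 1) * φ (y + r • (z - y)) + r ^ d * fderiv ℝ φ (y + r • (z - y)) (z - y)

theorem hasDerivAt_dilate {φ : E d → ℝ} (hφ : ContDiff ℝ ∞ φ) (r : ℝ) (y z : E d) :
    HasDerivAt (fun r => dilate r y φ z) (dilateDeriv r y φ z) r := by
  have h1 : HasDerivAt (fun r : ℝ => y + r • (z - y)) (z - y) r := by
    simpa using ((hasDerivAt_id r).smul_const (z - y)).const_add y
  have h2 := (hφ.differentiable (by simp) (y + r • (z - y))).hasFDerivAt.comp_hasDerivAt r h1
  exact (hasDerivAt_pow d r).mul h2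

theorem mul_dilateDeriv_eq {φ : E d → ℝ} (hφ : ContDiff ℝ ∞ φ) (hd : 1 ≤ d) (r : ℝ) (y z : E d) :
    r * dilateDeriv r y φ z = ∑ i, pd i (fun z => (z i - y i) * dilate r y φ z) z := by
  have h1 : ∀ i, pd i (fun z => (z i - y i) * dilate r y φ z) z =
      dilate r y φ z + (z i - y i) * (r ^ d * (r * fderiv ℝ φ (y + r • (z - y)) (single i 1))) := by
    intro i
    have e1 : HasFDerivAt (fun z : E d => z i - y i) (proj i : E d →L[ℝ] ℝ) z :=
      (proj i : E d →L[ℝ] ℝ).hasFDerivAt.sub_const _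
    have e2 : HasFDerivAt (fun z : E d => y + r • (z - y)) (r • ContinuousLinearMap.id ℝ (E d)) z :=
      (((hasFDerivAt_id z).sub_const y).const_smul r).const_add y
    have e3 := ((hφ.differentiable (by simp) (y + r • (z - y))).hasFDerivAt.comp z e2).const_mul
      (r ^ d)
    have e4 := e1.mul e3
    have e5 := e4.fderiv
    unfold pd
    erw [e5]
    simp [dilate]
    ring
  simp only [h1, Finset.sum_add_distrib, Finset.sum_const, Finset.card_univ, Fintype.card_fin]
  have h2 : fderiv ℝ φ (y + r • (z - y)) (z - y) =
      ∑ i, (z i - y i) * fderiv ℝ φ (y + r • (z - y)) (single i 1) := by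
    have : z - y = ∑ i, (z i - y i) • single i (1 : ℝ) := by
      ext j
      simp [Finset.sum_apply, Pi.single_apply]
    rw [congrArg (fderiv ℝ φ (y + r • (z - y))) this]
    simp only [map_sum, map_smul, smul_eq_mul]
  unfold dilateDeriv dilate
  rw [h2, mul_add, Finset.mul_sum, Finset.mul_sum, nsmul_eq_mul]
  obtain ⟨n, rfl⟩ : ∃ n, d = n + 1 := ⟨d - 1, by omega⟩
  congr 1
  · simp [pow_succ]; ring
  · exact Finset.sum_congr rfl fun i _ => by ring

theorem integral_dilate_sq (φ : E d → ℝ) {r : ℝ} (hr : 0 < r) (y : E d) :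
    ∫ z, dilate r y φ z ^ 2 = r ^ d * ∫ z, φ z ^ 2 := by
  have h1 : ∫ z, dilate r y φ z ^ 2 =
      ∫ z, (fun w => r ^ (2 * d) * φ (y + w) ^ 2) (r • (z - y)) := by
    refine integral_congr_ae (.of_forall fun z => ?_)
    simp only [dilate]; ring
  have h2 : ∫ z, (fun w => r ^ (2 * d) * φ (y + w) ^ 2) (r • (z - y)) =
      ∫ z, (fun w => r ^ (2 * d) * φ (y + w) ^ 2) (r • z) :=
    integral_sub_right_eq_self (fun z => (fun w => r ^ (2 * d) * φ (y + w) ^ 2) (r • z)) y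
  rw [h1, h2, Measure.integral_comp_smul volume (fun w => r ^ (2 * d) * φ (y + w) ^ 2) r]
  simp only [integral_const_mul]
  rw [integral_add_left_eq_self (fun w => φ w ^ 2) y]
  simp only [finrank_euclideanSpace, Fintype.card_fin, smul_eq_mul]
  rw [abs_of_pos (by positivity)]
  field_simp
  ring

theorem setIntegral_sq_le {ψ : E d → ℝ} (hψ : IsBump S ψ) :
    ∫ x, ψ x ^ 2 ∂S.vol = ∫ x, ψ x ^ 2 := setIntegral_domain_eq hψ.2.2 _ fun x hx => by simp [hx]

theorem hasDerivAt_integral_dilate (u : H S) {φ : E d → ℝ}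
    (hφ : ContDiff ℝ ∞ φ) (r : ℝ) (y : E d) : HasDerivAt (fun r => ∫ z, u z * dilate r y φ z ∂S.vol)
      (∫ z, u z * dilateDeriv r y φ z ∂S.vol) r := by
  have hu : Integrable u S.vol := (Lp.memLp u).integrable (by norm_num)
  have hc : Continuous fun p : ℝ × E d => dilateDeriv p.1 y φ p.2 := by
    unfold dilateDeriv
    have h1 : Continuous (fderiv ℝ φ) := hφ.continuous_fderiv (by simp)
    have h2 := hφ.continuous
    fun_prop
  obtain ⟨C, hC⟩ := ((isCompact_Icc (a := r - 1) (b := r + 1)).prod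
    hS.out.isBounded.isCompact_closure).exists_bound_of_continuousOn hc.continuousOn
  have hcz : ∀ r, Continuous fun z => dilate r y φ z := fun r => (contDiff_dilate hφ r y).continuous
  refine (hasDerivAt_integral_of_dominated_loc_of_deriv_le
    (F := fun r z => u z * dilate r y φ z) (F' := fun r z => u z * dilateDeriv r y φ z)
    (bound := fun z => |u z| * C)
    (Icc_mem_nhds (a := r - 1) (b := r + 1) (by linarith) (by linarith))
    (.of_forall fun r => hu.aestronglyMeasurable.mul (hcz r).aestronglyMeasurable) ?_
    (hu.aestronglyMeasurable.mul (hc.comp (by fun_prop : Continuous fun z : E d => (r, z))).aestronglyMeasurable)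
    ?_ (hu.abs.mul_const C) ?_).2
  · exact (Lp.memLp u).integrable_mul (memLp_of_continuous (hcz r) 2)
  · refine ae_restrict_of_forall_mem hS.out.measurableSet fun z hz s hs => ?_
    rw [norm_mul]
    exact mul_le_mul_of_nonneg_left (hC (s, z) ⟨hs, subset_closure hz⟩) (norm_nonneg _)
  · exact Eventually.of_forall fun z s _ => (hasDerivAt_dilate hφ s y z).const_mul _

theorem exists_diam_bound :
    ∃ D : ℝ, 0 ≤ D ∧ ∀ x ∈ S.domain, ∀ y ∈ S.domain, ∀ i, |x i - y i| ≤ D := by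
  obtain ⟨D, hD⟩ := Metric.isBounded_iff.1 hS.out.isBounded
  refine ⟨max D 0, le_max_right _ _, fun x hx y hy i => ?_⟩
  have h1 := hD hx hy
  rw [dist_eq_norm] at h1
  have h2 := PiLp.norm_apply_le (x - y) i
  simp only [PiLp.sub_apply, norm_eq_abs] at h2
  exact (h2.trans h1).trans (le_max_left _ _)

theorem norm_grad_apply_le (v : V S) (i : Fin d) : ‖grad v i‖ ≤ ‖v‖ :=
  (PiLp.norm_apply_le (grad v) i).trans (norm_grad_le v)

/-- Translating an element of `V` along the dilations with centre in the domain. -/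
theorem exists_dilate_bound (hd : 1 ≤ d) :
    ∃ C : ℝ, 0 ≤ C ∧ ∀ (v : V S) (φ : E d → ℝ), IsBump S φ → ∀ y ∈ S.domain, ∀ r ∈ Icc (1 : ℝ) 2,
      |∫ z, incl v z * dilate r y φ z ∂S.vol - ∫ z, incl v z * φ z ∂S.vol| ≤
        C * (r - 1) * ‖v‖ * √(∫ z, φ z ^ 2 ∂S.vol) := by
  obtain ⟨D, hD0, hD⟩ := exists_diam_bound (S := S)
  refine ⟨d * (D * √(2 ^ d)), by positivity, fun v φ hφ y hy r hr => ?_⟩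
  have hder : ∀ s ∈ Icc (1 : ℝ) r, |∫ z, incl v z * dilateDeriv s y φ z ∂S.vol| ≤
      d * (D * √(2 ^ d)) * ‖v‖ * √(∫ z, φ z ^ 2 ∂S.vol) := by
    intro s hs
    have hs0 : 0 < s := by linarith [hs.1]
    have hb : ∀ i : Fin d, IsBump S (fun z : E d => (z i - y i) * dilate s y φ z) := fun i =>
      (hφ.dilate hs.1 hy).mul_left (by fun_prop)
    have h1 : s * ∫ z, incl v z * dilateDeriv s y φ z ∂S.vol =
        -∑ i, ∫ z, grad v i z * ((z i - y i) * dilate s y φ z) ∂S.vol := by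
      rw [← integral_const_mul, ← Finset.sum_neg_distrib]
      have : ∀ z, s * (incl v z * dilateDeriv s y φ z) =
          ∑ i, incl v z * pd i (fun z => (z i - y i) * dilate s y φ z) z := by
        intro z
        rw [← Finset.mul_sum, ← mul_dilateDeriv_eq hφ.1 hd]; ring
      simp only [this]
      rw [integral_finsetSum]
      · exact Finset.sum_congr rfl fun i _ => weak_gradient v (hb i) i
      · intro i _
        exact (Lp.memLp _).integrable_mul
          (memLp_of_continuous (contDiff_pd (hb i).1 i).continuous 2)
    have h2 : ∀ i, |∫ z, grad v i z * ((z i - y i) * dilate s y φ z) ∂S.vol| ≤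
        ‖v‖ * (D * √(2 ^ d) * √(∫ z, φ z ^ 2 ∂S.vol)) := by
      intro i
      refine (abs_integral_mul_le (grad v i) (memLp_of_continuous (hb i).1.continuous 2)).trans ?_
      refine mul_le_mul (norm_grad_apply_le v i) ?_ (sqrt_nonneg _) (norm_nonneg _)
      have e1 : ∫ z, ((z i - y i) * dilate s y φ z) ^ 2 ∂S.vol ≤
          D ^ 2 * (2 ^ d * ∫ z, φ z ^ 2 ∂S.vol) := by
        have e2 : ∫ z, ((z i - y i) * dilate s y φ z) ^ 2 ∂S.vol ≤
            ∫ z, D ^ 2 * dilate s y φ z ^ 2 ∂S.vol := by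
          refine integral_mono_of_nonneg (.of_forall fun z => sq_nonneg _) ?_ ?_
          · exact (memLp_of_continuous (contDiff_dilate hφ.1 s y).continuous 2).integrable_sq.const_mul _
          · refine ae_restrict_of_forall_mem hS.out.measurableSet fun z hz => ?_
            simp only [mul_pow]
            refine mul_le_mul_of_nonneg_right ?_ (sq_nonneg _)
            rw [← sq_abs]
            exact pow_le_pow_left₀ (abs_nonneg _) (hD z hz y hy i) 2
        rw [integral_const_mul] at e2
        refine e2.trans (mul_le_mul_of_nonneg_left ?_ (sq_nonneg _))
        rw [setIntegral_sq_le (hφ.dilate hs.1 hy), integral_dilate_sq φ hs0, setIntegral_sq_le hφ]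
        exact mul_le_mul_of_nonneg_right (pow_le_pow_left₀ hs0.le (hs.2.trans hr.2) d)
          (integral_nonneg fun z => sq_nonneg _)
      refine (sqrt_le_sqrt e1).trans (le_of_eq ?_)
      rw [sqrt_mul (sq_nonneg _), sqrt_sq hD0, sqrt_mul (by positivity), mul_assoc]
    have h3 : |s * ∫ z, incl v z * dilateDeriv s y φ z ∂S.vol| ≤
        d * (‖v‖ * (D * √(2 ^ d) * √(∫ z, φ z ^ 2 ∂S.vol))) := by
      rw [h1, abs_neg]
      refine (Finset.abs_sum_le_sum_abs _ _).trans ?_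
      refine (Finset.sum_le_sum fun i _ => h2 i).trans ?_
      simp
    rw [abs_mul, abs_of_pos hs0] at h3
    have h4 : |∫ z, incl v z * dilateDeriv s y φ z ∂S.vol| ≤
        s * |∫ z, incl v z * dilateDeriv s y φ z ∂S.vol| :=
      le_mul_of_one_le_left (abs_nonneg _) hs.1
    refine (h4.trans h3).trans (le_of_eq (by ring))
  have h5 := Convex.norm_image_sub_le_of_norm_hasDerivWithin_le
    (f := fun s => ∫ z, incl v z * dilate s y φ z ∂S.vol)
    (f' := fun s => ∫ z, incl v z * dilateDeriv s y φ z ∂S.vol)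
    (C := d * (D * √(2 ^ d)) * ‖v‖ * √(∫ z, φ z ^ 2 ∂S.vol)) (s := Icc 1 r) (x := 1) (y := r)
    (fun s _ => (hasDerivAt_integral_dilate (incl v) hφ.1 s y).hasDerivWithinAt)
    (fun s hs => hder s hs) (convex_Icc _ _) ⟨le_rfl, hr.1⟩ ⟨hr.1, le_rfl⟩
  have h6 : ∀ z, dilate 1 y φ z = φ z := fun z => by simp [dilate]
  simp only [h6, norm_eq_abs] at h5
  rw [abs_of_nonneg (by linarith [hr.1] : (0 : ℝ) ≤ r - 1)] at h5
  refine h5.trans (le_of_eq (by ring))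

end Compactness

section Averaging

variable {d : ℕ} {S : Setting d} [hS : Fact S.IsAdmissible]

/-- Kernel of the average of `y ↦ u (y + r⁻¹ (x - y))` over the domain. -/
def avgKer (S : Setting d) (r : ℝ) (x z : E d) : ℝ := (r / (r - 1)) ^ d / volume.real S.domain *
    S.domain.indicator (fun _ => 1) ((r - 1)⁻¹ • (r • z - x))

def avg (r : ℝ) (u : H S) (x : E d) : ℝ := ∫ z, avgKer S r x z * u z ∂S.vol

theorem measurable_avgKer (r : ℝ) : Measurable fun p : E d × E d => avgKer S r p.1 p.2 := by
  unfold avgKer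
  refine Measurable.const_mul ?_ _
  exact (measurable_const.indicator hS.out.measurableSet).comp
    (by fun_prop : Measurable fun p : E d × E d => (r - 1)⁻¹ • (r • p.2 - p.1))

theorem abs_avgKer_le (r : ℝ) (x z : E d) :
    |avgKer S r x z| ≤ |(r / (r - 1)) ^ d / volume.real S.domain| := by
  unfold avgKer
  rw [abs_mul]
  refine mul_le_of_le_one_right (abs_nonneg _) ?_
  unfold indicator
  split_ifs <;> simp

theorem integral_avgKer_mul {φ : E d → ℝ} (hφ : IsBump S φ) {r : ℝ}
    (hr : 1 < r) (z : E d) : ∫ x, avgKer S r x z * φ x ∂S.vol =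
      (volume.real S.domain)⁻¹ * ∫ y, dilate r y φ z ∂S.vol := by
  have hr1 : 0 < r - 1 := by linarith
  rw [setIntegral_domain_eq hφ.2.2 _ (fun x hx => by simp [hx])]
  set G : E d → ℝ := S.domain.indicator fun y => φ (y + r • (z - y)) with hG
  have h1 : ∀ x, avgKer S r x z * φ x =
      (r / (r - 1)) ^ d / volume.real S.domain * G ((r - 1)⁻¹ • (r • z - x)) := by
    intro x
    simp only [avgKer, hG, indicator]
    split_ifs with h
    · have : (r - 1)⁻¹ • (r • z - x) + r • (z - (r - 1)⁻¹ • (r • z - x)) = x := by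
        have e : r • (z - (r - 1)⁻¹ • (r • z - x)) =
            r • z - (r * (r - 1)⁻¹) • (r • z - x) := by rw [smul_sub, smul_smul]
        have e2 : r * (r - 1)⁻¹ = 1 + (r - 1)⁻¹ := by field_simp; ring
        rw [e, e2, add_smul, one_smul]; abel
      rw [this]; ring
    · simp
  have h2 : ∫ x, G ((r - 1)⁻¹ • (r • z - x)) = (r - 1) ^ d * ∫ y, G y := by
    rw [integral_sub_left_eq_self (fun x => G ((r - 1)⁻¹ • x)) volume (r • z),
      Measure.integral_comp_smul]
    simp only [finrank_euclideanSpace, Fintype.card_fin, smul_eq_mul, inv_pow, inv_inv]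
    rw [abs_of_pos (by positivity)]
  simp only [h1]
  rw [integral_const_mul, h2, hG, integral_indicator hS.out.measurableSet]
  unfold dilate
  rw [integral_const_mul, div_pow, Setting.vol]
  field_simp

theorem integral_mul_avg (u : H S) {φ : E d → ℝ} (hφ : IsBump S φ) {r : ℝ}
    (hr : 1 < r) : Integrable (fun y => ∫ z, u z * dilate r y φ z ∂S.vol) S.vol ∧
    ∫ x, avg r u x * φ x ∂S.vol =
      (volume.real S.domain)⁻¹ * ∫ y, (∫ z, u z * dilate r y φ z ∂S.vol) ∂S.vol := by
  have hu : Integrable u S.vol := (Lp.memLp u).integrable (by norm_num)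
  have hφi : Integrable φ S.vol := (memLp_of_continuous hφ.1.continuous 1).integrable le_rfl
  obtain ⟨B, hB⟩ := hφ.1.continuous.bounded_above_of_compact_support hφ.2.1
  have i1 : Integrable (fun p : E d × E d => u p.2 * dilate r p.1 φ p.2) (S.vol.prod S.vol) := by
    have e1 : Integrable (fun p : E d × E d => u p.2) (S.vol.prod S.vol) := hu.comp_snd S.vol
    refine e1.mul_bdd (c := |r ^ d| * B) ?_ (.of_forall fun p => ?_)
    · have : Continuous fun p : E d × E d => dilate r p.1 φ p.2 := by
        unfold dilate
        have := hφ.1.continuous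
        fun_prop
      exact this.aestronglyMeasurable
    · simp only [dilate, norm_mul, norm_eq_abs]
      exact mul_le_mul_of_nonneg_left (hB _) (abs_nonneg _)
  have i2 : Integrable (fun p : E d × E d => avgKer S r p.1 p.2 * (φ p.1 * u p.2))
      (S.vol.prod S.vol) := (hφi.mul_prod hu).bdd_mul (measurable_avgKer r).aestronglyMeasurable
      (.of_forall fun p => abs_avgKer_le r p.1 p.2)
  refine ⟨i1.integral_prod_left, ?_⟩
  rw [integral_integral_swap i1]
  have e1 : ∀ x, avg r u x * φ x = ∫ z, avgKer S r x z * (φ x * u z) ∂S.vol := by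
    intro x
    unfold avg
    rw [← integral_mul_const]
    exact integral_congr_ae (.of_forall fun z => by ring)
  simp only [e1]
  rw [integral_integral_swap i2, ← integral_const_mul]
  refine integral_congr_ae (.of_forall fun z => ?_)
  have e2 : ∫ x, avgKer S r x z * (φ x * u z) ∂S.vol =
      (∫ x, avgKer S r x z * φ x ∂S.vol) * u z := by
    rw [← integral_mul_const]
    exact integral_congr_ae (.of_forall fun z => by ring)
  simp only [e2, integral_avgKer_mul hφ hr, integral_const_mul]
  ring

theorem memLp_avgKer (r : ℝ) (x : E d) : MemLp (avgKer S r x) 2 S.vol := by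
  exact MemLp.of_bound ((measurable_avgKer r).comp measurable_prodMk_left).aestronglyMeasurable _
    (.of_forall fun z => abs_avgKer_le r x z)

theorem abs_avg_le (r : ℝ) : ∃ C, ∀ (u : H S) (x : E d), |avg r u x| ≤ C * ‖u‖ := by
  refine ⟨√(∫ _, |(r / (r - 1)) ^ d / volume.real S.domain| ^ 2 ∂S.vol), fun u x => ?_⟩
  have h := abs_integral_mul_le u (memLp_avgKer r x)
  have e : avg r u x = ∫ z, u z * avgKer S r x z ∂S.vol := by unfold avg; simp only [mul_comm]
  rw [e, mul_comm]
  refine h.trans (mul_le_mul_of_nonneg_left (sqrt_le_sqrt ?_) (norm_nonneg _))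
  refine integral_mono_of_nonneg (.of_forall fun z => sq_nonneg _) (integrable_const _)
    (.of_forall fun z => ?_)
  simp only
  rw [← sq_abs (avgKer S r x z)]
  exact pow_le_pow_left₀ (abs_nonneg _) (abs_avgKer_le r x z) 2

theorem memLp_avg (r : ℝ) (u : H S) : MemLp (avg r u) 2 S.vol := by
  have hu : Integrable u S.vol := (Lp.memLp u).integrable (by norm_num)
  have i2 : Integrable (fun p : E d × E d => avgKer S r p.1 p.2 * u p.2) (S.vol.prod S.vol) :=
    (hu.comp_snd S.vol).bdd_mul (measurable_avgKer r).aestronglyMeasurable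
      (.of_forall fun p => abs_avgKer_le r p.1 p.2)
  obtain ⟨C, hC⟩ := abs_avg_le (S := S) r
  exact MemLp.of_bound i2.integral_prod_left.aestronglyMeasurable (C * ‖u‖)
    (.of_forall fun x => hC u x)

theorem volume_real_pos : 0 < volume.real S.domain :=
  ENNReal.toReal_pos (hS.out.isOpen.measure_pos volume hS.out.nonempty).ne' hS.out.volume_lt_top.ne

theorem exists_norm_incl_le_avg (hd : 1 ≤ d) : ∃ C : ℝ, 0 ≤ C ∧ ∀ (v : V S), ∀ r ∈ Ioc (1 : ℝ) 2,
      ‖incl v‖ ≤ C * (r - 1) * ‖v‖ + √(∫ x, avg r (incl v) x ^ 2 ∂S.vol) := by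
  obtain ⟨C, hC0, hC⟩ := exists_dilate_bound (S := S) hd
  refine ⟨C, hC0, fun v r hr => ?_⟩
  have hr1 : 0 ≤ r - 1 := by linarith [hr.1]
  refine norm_le_of_forall_bump (by positivity) fun φ hφ => ?_
  obtain ⟨h1, h2⟩ := integral_mul_avg (incl v) hφ hr.1
  have hvol := volume_real_pos (S := S)
  have hv : S.vol.real univ = volume.real S.domain := by simp [Setting.vol]
  set N := √(∫ x, φ x ^ 2 ∂S.vol)
  have h3 : ∫ z, incl v z * φ z ∂S.vol = ∫ x, avg r (incl v) x * φ x ∂S.vol -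
      (volume.real S.domain)⁻¹ * ∫ y, (∫ z, incl v z * dilate r y φ z ∂S.vol -
        ∫ z, incl v z * φ z ∂S.vol) ∂S.vol := by
    rw [h2, integral_sub h1 (integrable_const _), integral_const, hv]
    field_simp
    simp only [smul_eq_mul]
    ring
  have h4 : |∫ y, (∫ z, incl v z * dilate r y φ z ∂S.vol -
        ∫ z, incl v z * φ z ∂S.vol) ∂S.vol| ≤ (C * (r - 1) * ‖v‖ * N) * volume.real S.domain := by
    have := norm_integral_le_of_norm_le_const (μ := S.vol)
      (f := fun y => ∫ z, incl v z * dilate r y φ z ∂S.vol - ∫ z, incl v z * φ z ∂S.vol)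
      (C := C * (r - 1) * ‖v‖ * N)
      (ae_restrict_of_forall_mem hS.out.measurableSet fun y hy => hC v φ hφ y hy r ⟨hr.1.le, hr.2⟩)
    rwa [hv] at this
  have h5 : |∫ x, avg r (incl v) x * φ x ∂S.vol| ≤ √(∫ x, avg r (incl v) x ^ 2 ∂S.vol) * N := by
    have ha := memLp_avg r (incl v)
    have h := abs_integral_mul_le (ha.toLp _) (memLp_of_continuous hφ.1.continuous 2)
    have e : ‖ha.toLp _‖ = √(∫ x, avg r (incl v) x ^ 2 ∂S.vol) := by
      rw [← norm_toLp_sq ha, sqrt_sq (norm_nonneg _)]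
    rw [e] at h
    refine le_trans (le_of_eq ?_) h
    congr 1
    refine integral_congr_ae ?_
    filter_upwards [ha.coeFn_toLp] with x hx
    rw [hx]
  rw [h3, add_mul]
  refine (abs_sub _ _).trans ?_
  rw [abs_mul, abs_of_pos (inv_pos.2 hvol), add_comm]
  refine add_le_add ?_ h5
  rw [inv_mul_le_iff₀ hvol]
  linarith

theorem tendsto_norm_incl (hd : 1 ≤ d) {z : ℕ → V S} {R : ℝ}
    (hR : ∀ n, ‖z n‖ ≤ R) (hz : ∀ w, Tendsto (fun n => ⟪z n, w⟫) atTop (𝓝 0)) :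
    Tendsto (fun n => ‖incl (z n)‖) atTop (𝓝 0) := by
  obtain ⟨C, hC0, hC⟩ := exists_norm_incl_le_avg (S := S) hd
  have hR0 : 0 ≤ R := (norm_nonneg _).trans (hR 0)
  have ha : ∀ r : ℝ, Tendsto (fun n => √(∫ x, avg r (incl (z n)) x ^ 2 ∂S.vol)) atTop (𝓝 0) := by
    intro r
    obtain ⟨B, hB⟩ := abs_avg_le (S := S) r
    have : Tendsto (fun n => ∫ x, avg r (incl (z n)) x ^ 2 ∂S.vol) atTop
        (𝓝 (∫ _, (0 : ℝ) ∂S.vol)) := by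
      refine tendsto_integral_of_dominated_convergence (fun _ => (|B| * R) ^ 2)
        (fun n => ((memLp_avg r (incl (z n))).integrable_sq).aestronglyMeasurable)
        (integrable_const _) (fun n => .of_forall fun x => ?_)
        (.of_forall fun x => ?_)
      · rw [norm_pow, norm_eq_abs]
        refine pow_le_pow_left₀ (abs_nonneg _) ((hB _ _).trans ?_) 2
        exact mul_le_mul (le_abs_self _) ((norm_incl_le _).trans (hR n)) (norm_nonneg _)
          (abs_nonneg _)
      · have e : ∀ n, avg r (incl (z n)) x = ⟪z n, (adjoint incl) ((memLp_avgKer r x).toLp _)⟫ := by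
          intro n
          rw [ContinuousLinearMap.adjoint_inner_right,
            inner_eq_integral (memLp_avgKer r x).coeFn_toLp]
          unfold avg
          simp only [mul_comm]
        have := (hz ((adjoint incl) ((memLp_avgKer r x).toLp _))).pow 2
        simpa [e] using this
    have h2 := (Real.continuous_sqrt.tendsto _).comp this
    simpa [Function.comp_def] using h2
  rw [Metric.tendsto_atTop]
  intro ε hε
  set r : ℝ := 1 + min 1 (ε / (2 * (C * R + 1))) with hr
  have hCR : 0 ≤ C * R := mul_nonneg hC0 hR0
  have hr1 : 0 < min 1 (ε / (2 * (C * R + 1))) := lt_min one_pos (by positivity)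
  have hr2 : (r - 1) * (C * R) ≤ ε / 2 := by
    have : r - 1 ≤ ε / (2 * (C * R + 1)) := by rw [hr]; simp
    calc (r - 1) * (C * R) ≤ ε / (2 * (C * R + 1)) * (C * R) := mul_le_mul_of_nonneg_right this hCR
      _ ≤ ε / 2 := by
        rw [div_mul_eq_mul_div, div_le_div_iff₀ (by positivity) (by positivity)]
        nlinarith
  obtain ⟨N, hN⟩ := (Metric.tendsto_atTop.1 (ha r)) (ε / 2) (by positivity)
  refine ⟨N, fun n hn => ?_⟩
  have h1 := hC (z n) r ⟨by rw [hr]; linarith, by rw [hr]; linarith [min_le_left 1 (ε / (2 * (C * R + 1)))]⟩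
  have h2 := hN n hn
  simp only [dist_zero_right, norm_eq_abs, abs_norm] at h2 ⊢
  have h3 := le_abs_self (√(∫ x, avg r (incl (z n)) x ^ 2 ∂S.vol))
  have h4 : C * (r - 1) * ‖z n‖ ≤ (r - 1) * (C * R) := by
    have : 0 ≤ r - 1 := by rw [hr]; linarith
    nlinarith [mul_le_mul_of_nonneg_left (hR n) (mul_nonneg hC0 this)]
  linarith

end Averaging

section WeakLimits

theorem exists_weak_limit {X : Type*} [NormedAddCommGroup X] [InnerProductSpace ℝ X]
    [CompleteSpace X] [TopologicalSpace.SeparableSpace X] {x : ℕ → X} {R : ℝ}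
    (hx : ∀ n, ‖x n‖ ≤ R) : ∃ y : X, ‖y‖ ≤ R ∧ ∃ φ : ℕ → ℕ, StrictMono φ ∧
      ∀ w, Tendsto (fun n => ⟪x (φ n), w⟫) atTop (𝓝 ⟪y, w⟫) := by
  have h := WeakDual.isSeqCompact_closedBall ℝ X 0 R
  obtain ⟨a, ha, φ, hφ, hlim⟩ := h (x := fun n =>
    WeakDual.toStrongDual.symm (toDual ℝ X (x n))) (fun n => by simpa using hx n)
  refine ⟨(toDual ℝ X).symm (WeakDual.toStrongDual a), by simpa using ha, φ, hφ, fun w => ?_⟩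
  have h1 := ((WeakDual.eval_continuous w).tendsto a).comp hlim
  have h2 : ⟪(toDual ℝ X).symm (WeakDual.toStrongDual a), w⟫ = a w := by rw [toDual_symm_apply]; rfl
  rw [h2]
  exact h1

variable {d : ℕ} {S : Setting d} [hS : Fact S.IsAdmissible]

instance : SecondCountableTopology (H S) := by
  haveI : Fact ((2 : ℝ≥0∞) ≠ ⊤) := ⟨by norm_num⟩
  haveI : SFinite S.vol := by unfold Setting.vol; infer_instance
  exact Lp.SecondCountableTopology

instance : SecondCountableTopology (V S) := by
  haveI : SecondCountableTopology (PiLp 2 (fun _ : Fin d => H S)) :=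
    (PiLp.continuousLinearEquiv 2 ℝ (fun _ : Fin d => H S)).toHomeomorph.secondCountableTopology
  haveI : SecondCountableTopology (GradPair S) := (WithLp.prodContinuousLinearEquiv 2 ℝ (H S)
      (PiLp 2 (fun _ : Fin d => H S))).toHomeomorph.secondCountableTopology
  exact inferInstanceAs (SecondCountableTopology (spaceV S))

theorem isCompactOperator_incl (hd : 1 ≤ d) : IsCompactOperator (incl : V S →L[ℝ] H S) := by
  refine (isCompactOperator_iff_isCompact_closure_image_closedBall
    (incl : V S →L[ℝ] H S).toLinearMap one_pos).2 ?_
  have hseq : IsCompact (((incl : V S →L[ℝ] H S).toLinearMap) '' closedBall 0 1) := by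
    refine IsSeqCompact.isCompact fun x hx => ?_
    choose v hv hvx using hx
    have hv1 : ∀ n, ‖v n‖ ≤ 1 := fun n => by simpa using hv n
    obtain ⟨y, hy, φ, hφ, hlim⟩ := exists_weak_limit hv1
    refine ⟨incl y, ⟨y, by simpa using hy, rfl⟩, φ, hφ, ?_⟩
    have := tendsto_norm_incl hd (z := fun n => v (φ n) - y) (R := 2)
      (fun n => (norm_sub_le _ _).trans (by linarith [hv1 (φ n)])) (fun w => by
        have := (hlim w).sub_const ⟪y, w⟫
        simpa [inner_sub_left] using this)
    rw [tendsto_iff_norm_sub_tendsto_zero]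
    refine this.congr fun n => ?_
    simp only [map_sub, Function.comp, ← hvx]; rfl
  exact hseq.closure

end WeakLimits

section Spectral

variable {X : Type*} [NormedAddCommGroup X] [InnerProductSpace ℝ X] [CompleteSpace X]

theorem exists_unit_eigenvector_norm [Nontrivial X] {T : X →L[ℝ] X} (hc : IsCompactOperator T)
    (hs : (T : X →ₗ[ℝ] X).IsSymmetric) (hpos : ∀ x, x ≠ 0 → 0 < ⟪T x, x⟫) :
    ∃ x, ‖x‖ = 1 ∧ T x = ‖T‖ • x ∧ 0 < ‖T‖ := by
  obtain ⟨x0, hx₀⟩ := exists_ne (0 : X)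
  have hT : T ≠ 0 := by
    rintro rfl
    simpa using hpos x0 hx₀
  have hT0 : 0 < ‖T‖ := norm_pos_iff.2 hT
  rcases hc.hasEigenvalue_or_mem_resolventSet hT0.ne' with h | h
  · obtain ⟨x, hx, hx0⟩ := h.exists_hasEigenvector
    have hx' : T x = ‖T‖ • x := by simpa using hx
    refine ⟨‖x‖⁻¹ • x, ?_, ?_, hT0⟩
    · rw [norm_smul, norm_inv, norm_norm, inv_mul_cancel₀ (norm_ne_zero_iff.2 hx0)]
    · rw [map_smul, hx', smul_comm]
  · obtain ⟨ε, hε, hle⟩ := T.rayleighQuotient_le_of_norm_mem_resolventSet (by simpa using h)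
    have h1 := T.norm_eq_iSup_rayleighQuotient hs
    have h2 : ∀ x, |T.rayleighQuotient x| ≤ ‖T‖ - ε := by
      intro x
      have : 0 ≤ T.rayleighQuotient x := by
        unfold ContinuousLinearMap.rayleighQuotient
        refine div_nonneg ?_ (sq_nonneg _)
        by_cases hx : x = 0
        · simp [hx, ContinuousLinearMap.reApplyInnerSelf]
        · exact (hpos x hx).le
      rw [abs_of_nonneg this]
      exact hle x
    have h3 := ciSup_le h2
    rw [← h1] at h3
    linarith

theorem exists_sorted_eigenbasis {T : X →L[ℝ] X} (hc : IsCompactOperator T)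
    (hs : (T : X →ₗ[ℝ] X).IsSymmetric) (hpos : ∀ x, x ≠ 0 → 0 < ⟪T x, x⟫)
    (hinf : ¬ FiniteDimensional ℝ X) : ∃ (e : ℕ → X) (l : ℕ → ℝ), Orthonormal ℝ e ∧
      (span ℝ (Set.range e)).topologicalClosure = ⊤ ∧ Antitone l ∧ (∀ k, 0 < l k) ∧
      ∀ k, T (e k) = l k • e k := by
  let I := {W : Submodule ℝ X // FiniteDimensional ℝ W ∧ ∀ x ∈ W, T x ∈ W}
  have hstep : ∀ W : I, ∃ (x : X) (l : ℝ), x ∈ W.1ᗮ ∧ ‖x‖ = 1 ∧ T x = l • x ∧ 0 < l ∧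
        ∀ y ∈ W.1ᗮ, ⟪T y, y⟫ ≤ l * ‖y‖ ^ 2 := by
    rintro ⟨W, hW, hinv⟩
    have hinv' : ∀ ⦃v⦄, v ∈ Wᗮ → T v ∈ Wᗮ := by
      intro v hv w hw
      rw [← (show ⟪T w, v⟫ = ⟪w, T v⟫ from hs w v)]
      exact hv _ (hinv w hw)
    have hnt : Nontrivial Wᗮ := by
      rw [Submodule.nontrivial_iff_ne_bot]
      intro h
      rw [Submodule.orthogonal_eq_bot_iff] at h
      subst h
      exact hinf (Module.Finite.equiv (Submodule.topEquiv (R := ℝ) (M := X)))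
    obtain ⟨x, hx1, hx2, hx3⟩ := exists_unit_eigenvector_norm (T := T.restrict hinv')
      (hc.restrict' hinv') (hs.restrict_invariant hinv') (fun x hx => by
        have := hpos x (by simpa using hx)
        exact this)
    refine ⟨x, ‖T.restrict hinv'‖, x.2, hx1, ?_, hx3, fun y hy => ?_⟩
    · exact congrArg Subtype.val hx2
    · have h1 : ⟪T.restrict hinv' ⟨y, hy⟩, (⟨y, hy⟩ : Wᗮ)⟫ ≤ _ := real_inner_le_norm _ _
      have h2 := (T.restrict hinv').le_opNorm ⟨y, hy⟩
      have h3 : ‖(⟨y, hy⟩ : Wᗮ)‖ = ‖y‖ := rfl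
      rw [h3] at h1 h2
      have h4 : ⟪T y, y⟫ = ⟪T.restrict hinv' ⟨y, hy⟩, (⟨y, hy⟩ : Wᗮ)⟫ := rfl
      rw [h4]
      refine h1.trans ?_
      rw [sq, ← mul_assoc]
      exact mul_le_mul_of_nonneg_right h2 (norm_nonneg _)
  choose x l hx1 hx2 hx3 hl hx4 using hstep
  let next : I → I := fun W =>
    ⟨W.1 ⊔ span ℝ {x W}, by
      have := W.2.1
      infer_instance, by
      intro y hy
      obtain ⟨a, ha, b, hb, rfl⟩ := Submodule.mem_sup.1 hy
      rw [map_add]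
      refine Submodule.add_mem_sup (W.2.2 a ha) ?_
      obtain ⟨c, rfl⟩ := Submodule.mem_span_singleton.1 hb
      rw [map_smul, hx3]
      exact Submodule.smul_mem _ _ (Submodule.smul_mem _ _ (Submodule.mem_span_singleton_self _))⟩
  let Q : ℕ → I := fun n => Nat.rec ⟨⊥, by infer_instance, by simp⟩ (fun _ W => next W) n
  have hQ : ∀ n, (Q (n + 1)).1 = (Q n).1 ⊔ span ℝ {x (Q n)} := fun n => rfl
  have hmono : Monotone fun n => (Q n).1 :=
    monotone_nat_of_le_succ fun n => by rw [hQ]; exact le_sup_left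
  have hmem : ∀ n m, n < m → x (Q n) ∈ (Q m).1 := fun n m h =>
    hmono (Nat.succ_le_of_lt h) (by
      show x (Q n) ∈ (Q (n + 1)).1
      rw [hQ]
      exact Submodule.mem_sup_right (Submodule.mem_span_singleton_self _))
  have horth : Orthonormal ℝ fun n => x (Q n) := by
    refine ⟨fun n => hx2 _, fun n m hnm => ?_⟩
    rcases lt_or_gt_of_ne hnm with h | h
    · exact hx1 (Q m) _ (hmem n m h)
    · rw [real_inner_comm]; exact hx1 (Q n) _ (hmem m n h)
  have hlan : Antitone fun n => l (Q n) := by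
    refine antitone_nat_of_succ_le fun n => ?_
    have h1 : x (Q (n + 1)) ∈ (Q n).1ᗮ := Submodule.orthogonal_le (hmono n.le_succ) (hx1 _)
    have h2 := hx4 (Q n) _ h1
    rw [hx3, real_inner_smul_left, real_inner_self_eq_norm_sq, hx2] at h2
    simpa using h2
  refine ⟨fun n => x (Q n), fun n => l (Q n), horth, ?_, hlan, fun n => hl _, fun n => hx3 _⟩
  have hl0 : ∀ ε > 0, ∃ n, l (Q n) < ε := by
    intro ε hε
    by_contra hcon
    push Not at hcon
    have hK := (isCompactOperator_iff_isCompact_closure_image_closedBall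
      (T : X →ₗ[ℝ] X) one_pos).1 hc
    obtain ⟨z, -, φ, hφ, hlim⟩ := hK.tendsto_subseq (x := fun n => T (x (Q n))) (fun n =>
      subset_closure ⟨x (Q n), by simp [hx2], rfl⟩)
    have hcau := hlim.cauchySeq
    rw [Metric.cauchySeq_iff] at hcau
    obtain ⟨N, hN⟩ := hcau ε hε
    have h1 := hN N le_rfl (N + 1) (Nat.le_succ N)
    have hne : φ N ≠ φ (N + 1) := (hφ (Nat.lt_succ_self N)).ne
    simp only [Function.comp, dist_eq_norm, hx3] at h1
    have h2 : ‖l (Q (φ N)) • x (Q (φ N)) - l (Q (φ (N + 1))) • x (Q (φ (N + 1)))‖ ^ 2 =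
        l (Q (φ N)) ^ 2 + l (Q (φ (N + 1))) ^ 2 := by
      have h0 : ⟪x (Q (φ N)), x (Q (φ (N + 1)))⟫ = 0 := horth.2 hne
      rw [norm_sub_sq_real, norm_smul, norm_smul, hx2, hx2, real_inner_smul_left,
        real_inner_smul_right, h0]
      simp
    have h3 := hcon (φ N)
    have h4 : ‖l (Q (φ N)) • x (Q (φ N)) - l (Q (φ (N + 1))) • x (Q (φ (N + 1)))‖ ^ 2 < ε ^ 2 :=
      pow_lt_pow_left₀ h1 (norm_nonneg _) two_ne_zero
    nlinarith [sq_nonneg (l (Q (φ (N + 1))))]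
  rw [Submodule.topologicalClosure_eq_top_iff, Submodule.eq_bot_iff]
  intro y hy
  by_contra hy0
  have hyQ : ∀ n, y ∈ (Q n).1ᗮ := by
    have hle : ∀ n, (Q n).1 ≤ span ℝ (Set.range fun n => x (Q n)) := by
      intro n
      induction n with
      | zero => exact bot_le
      | succ n ih =>
        rw [hQ]
        refine sup_le ih (Submodule.span_mono ?_)
        rintro _ rfl
        exact ⟨n, rfl⟩
    exact fun n => Submodule.orthogonal_le (hle n) hy
  have h1 := hpos y hy0
  have hyp : 0 < ‖y‖ ^ 2 := by positivity
  obtain ⟨n, hn⟩ := hl0 (⟪T y, y⟫ / ‖y‖ ^ 2) (div_pos h1 hyp)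
  have h2 := hx4 (Q n) y (hyQ n)
  rw [lt_div_iff₀ hyp] at hn
  linarith

end Spectral

section Eigenbasis

variable {d : ℕ} {S : Setting d} [hS : Fact S.IsAdmissible]

theorem not_finiteDimensional_H (hd : 1 ≤ d) : ¬ FiniteDimensional ℝ (H S) := by
  intro h
  let i : Fin d := ⟨0, hd⟩
  have hc (p : Polynomial ℝ) : Continuous fun x : E d => p.eval (x i) :=
    p.continuous.comp (by fun_prop)
  let L : Polynomial ℝ →ₗ[ℝ] H S :=
    { toFun := fun p => (memLp_of_continuous (hc p) 2).toLp
      map_add' := fun p q => by simp only [Polynomial.eval_add]; rfl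
      map_smul' := fun c p => by simp only [Polynomial.eval_smul]; rfl }
  refine Polynomial.not_finite (R := ℝ) (Module.Finite.of_injective L
    (LinearMap.ker_eq_bot.1 ((Submodule.eq_bot_iff _).2 fun p hp => ?_)))
  obtain ⟨x, hx⟩ := hS.out.nonempty
  have h0 : EqOn (fun x => p.eval (x i)) 0 S.domain := Measure.eqOn_open_of_ae_eq
    ((memLp_of_continuous (hc p) 2).coeFn_toLp.symm.trans ((Lp.ext_iff.1 hp).trans (Lp.coeFn_zero _ _ _))) hS.out.isOpen
    (hc p).continuousOn continuousOn_const
  have hl : Continuous fun t : ℝ => x + t • (single i 1 : E d) := by fun_prop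
  obtain ⟨r, hr, hb⟩ := Metric.isOpen_iff.1 (hS.out.isOpen.preimage hl) 0 (by simpa using hx)
  refine p.eq_zero_of_infinite_isRoot (((Ioo_infinite (half_pos hr)).image
    (add_right_injective (x i)).injOn).mono ?_)
  rintro _ ⟨t, ht, rfl⟩
  have ht' : t ∈ Metric.ball 0 r := by
    rw [mem_ball_zero_iff, norm_eq_abs, abs_of_pos ht.1]
    linarith [ht.2]
  simpa using h0 (hb ht')

theorem exists_eigenbasis (hd : 1 ≤ d) : ∃ (e : ℕ → H S) (μ : ℕ → ℝ), IsEigenbasis S e μ := by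
  let T : H S →L[ℝ] H S := incl ∘L adjoint incl
  have hc : IsCompactOperator T := (isCompactOperator_incl hd).comp_clm (adjoint (incl (S := S)))
  have hin : ∀ x y : H S, ⟪T x, y⟫ = ⟪adjoint incl x, adjoint incl y⟫ := fun x y =>
    (ContinuousLinearMap.adjoint_inner_right (incl (S := S)) _ _).symm
  have hs : (T : H S →ₗ[ℝ] H S).IsSymmetric := fun x y => by
    have h1 := hin x y
    have h2 := hin y x
    rw [real_inner_comm, real_inner_comm (adjoint incl x)] at h2
    exact h1.trans h2.symm
  have hpos : ∀ x, x ≠ 0 → 0 < ⟪T x, x⟫ := fun x hx => by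
    rw [hin, real_inner_self_eq_norm_sq]
    have : adjoint (incl (S := S)) x ≠ 0 := fun h => hx (eq_zero_of_forall_inner_incl fun v => by
        rw [← ContinuousLinearMap.adjoint_inner_left, h, inner_zero_left])
    positivity
  obtain ⟨e, l, he, hdense, hl, hl0, heq⟩ :=
    exists_sorted_eigenbasis hc hs hpos (not_finiteDimensional_H hd)
  refine ⟨e, fun k => (l k)⁻¹, he, hdense, fun k m h => inv_anti₀ (hl0 m) (hl h), fun k => ?_⟩
  refine ⟨adjoint incl ((l k)⁻¹ • e k), ?_, fun z => ?_⟩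
  · have : incl (adjoint incl ((l k)⁻¹ • e k)) = T ((l k)⁻¹ • e k) := rfl
    rw [this, map_smul, heq, smul_smul, inv_mul_cancel₀ (hl0 k).ne', one_smul]
  · rw [ContinuousLinearMap.adjoint_inner_left]

end Eigenbasis

section AbsolutelyContinuous

theorem intervalIntegrable_of_mem {X : Type*} [NormedAddCommGroup X] {φ : ℝ → X} {T t : ℝ}
    (h : IntegrableOn φ (Ioo 0 T)) (ht : t ∈ Icc 0 T) : IntervalIntegrable φ volume 0 t :=
  (intervalIntegrable_iff_integrableOn_Ioo_of_le ht.1).2 (h.mono_set (Ioo_subset_Ioo_right ht.2))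

theorem integral_congr_of_le {X : Type*} [NormedAddCommGroup X] [NormedSpace ℝ X] {f g : ℝ → X}
    {t : ℝ} (ht : 0 ≤ t) (h : ∀ s ∈ Icc 0 t, f s = g s) : ∫ s in 0..t, f s = ∫ s in 0..t, g s :=
  integral_congr fun s hs => h s (uIcc_of_le ht ▸ hs)

theorem integral_le_integral_of_mem {φ G : ℝ → ℝ} {T t : ℝ} (ht : t ∈ Icc 0 T)
    (hφ : IntervalIntegrable φ volume 0 t) (hG : IntegrableOn G (Ioo 0 T)) (hG0 : ∀ s, 0 ≤ G s)
    (h : ∀ᵐ s ∂vol(T), φ s ≤ G s) : ∫ s in 0..t, φ s ≤ ∫ s in 0..T, G s := by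
  have hT := ht.1.trans ht.2
  refine (intervalIntegral.integral_mono_ae_restrict ht.1 hφ (intervalIntegrable_of_mem hG ht)
    ?_).trans (integral_mono_interval le_rfl ht.1 ht.2
    (.of_forall fun s => hG0 s) (intervalIntegrable_of_mem hG ⟨hT, le_rfl⟩))
  rw [← Measure.restrict_congr_set Ioo_ae_eq_Icc]
  exact ae_restrict_of_ae_restrict_of_subset (Ioo_subset_Ioo_right ht.2) h

theorem absolutelyContinuous_of_dist_le {X Y : Type*} [PseudoMetricSpace X]
    [PseudoMetricSpace Y] {f : ℝ → X} {g : ℝ → Y} {a b K : ℝ} (hK : 0 ≤ K)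
    (hg : AbsolutelyContinuousOnInterval g a b)
    (h : ∀ s ∈ uIcc a b, ∀ t ∈ uIcc a b, dist (f s) (f t) ≤ K * dist (g s) (g t)) :
    AbsolutelyContinuousOnInterval f a b := by
  rw [absolutelyContinuousOnInterval_iff] at hg ⊢
  intro ε hε
  obtain ⟨δ, hδ, H⟩ := hg (ε / (K + 1)) (by positivity)
  refine ⟨δ, hδ, fun F hF hlt => ?_⟩
  have h1 := H F hF hlt
  rw [lt_div_iff₀ (by positivity)] at h1
  have h2 : ∑ i ∈ Finset.range F.1, dist (f (F.2 i).1) (f (F.2 i).2) ≤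
      K * ∑ i ∈ Finset.range F.1, dist (g (F.2 i).1) (g (F.2 i).2) := by
    rw [Finset.mul_sum]
    exact Finset.sum_le_sum fun i hi => h _ (hF.1 i hi).1 _ (hF.1 i hi).2
  have h3 : 0 ≤ ∑ i ∈ Finset.range F.1, dist (g (F.2 i).1) (g (F.2 i).2) :=
    Finset.sum_nonneg fun i _ => dist_nonneg
  nlinarith

variable {X : Type*} [NormedAddCommGroup X] [NormedSpace ℝ X] [CompleteSpace X]

theorem continuousOn_of_eq_integral {R w : ℝ → X} {T : ℝ} (hR : IntegrableOn R (Ioo 0 T))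
    (hw : ∀ t ∈ Icc 0 T, w t = w 0 + ∫ s in 0..t, R s) : ContinuousOn w (Icc 0 T) := by
  rcases lt_or_ge T 0 with hT | hT
  · simp [Icc_eq_empty (not_le.2 hT)]
  have h1 : IntervalIntegrable R volume 0 T := intervalIntegrable_of_mem hR ⟨hT, le_rfl⟩
  have h2 : ContinuousOn (fun t => w 0 + ∫ s in 0..t, R s) (Icc 0 T) := by
    refine continuousOn_const.add ?_
    have := intervalIntegral.continuousOn_primitive_interval' h1 (left_mem_uIcc)
    rwa [uIcc_of_le hT] at this
  exact h2.congr hw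

/-- Chain rule for a continuously differentiable function along an absolutely continuous curve. -/
theorem integral_chain_rule {Ψ : X → ℝ} {Ψ' : X → StrongDual ℝ X}
    (hΨ : ∀ x, HasFDerivAt Ψ (Ψ' x) x) (hc : Continuous Ψ') {R w : ℝ → X} {T : ℝ}
    (hR : IntegrableOn R (Ioo 0 T)) (hw : ∀ t ∈ Icc 0 T, w t = w 0 + ∫ s in 0..t, R s)
    {t : ℝ} (ht : t ∈ Icc 0 T) : IntervalIntegrable (fun s => Ψ' (w s) (R s)) volume 0 t ∧
      Ψ (w t) = Ψ (w 0) + ∫ s in 0..t, Ψ' (w s) (R s) := by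
  have hT : 0 ≤ T := ht.1.trans ht.2
  have hRi : IntervalIntegrable R volume 0 T := intervalIntegrable_of_mem hR ⟨hT, le_rfl⟩
  have hwc := continuousOn_of_eq_integral hR hw
  have hcd : ContDiff ℝ 1 Ψ := contDiff_one_iff_hasFDerivAt.2 ⟨Ψ', hc, hΨ⟩
  obtain ⟨K, hK⟩ := LocallyLipschitzOn.exists_lipschitzOnWith_of_compact
    (isCompact_Icc.image_of_continuousOn hwc) (hcd.locallyLipschitz.locallyLipschitzOn)
  have hN := (hRi.norm).absolutelyContinuousOnInterval_intervalIntegral (c := 0) left_mem_uIcc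
  have hsub : ∀ s ∈ uIcc 0 T, ∀ r ∈ uIcc 0 T, IntervalIntegrable R volume s r := fun s hs r hr =>
    hRi.mono_set (uIcc_subset_uIcc hs hr)
  have hac : AbsolutelyContinuousOnInterval (fun s => Ψ (w s)) 0 T := by
    refine absolutelyContinuous_of_dist_le K.2 hN fun s hs r hr => ?_
    have hs' := hs; have hr' := hr
    rw [uIcc_of_le hT] at hs hr
    refine (hK.dist_le_mul _ (mem_image_of_mem _ hs) _ (mem_image_of_mem _ hr)).trans ?_
    refine mul_le_mul_of_nonneg_left ?_ K.2
    rw [hw s hs, hw r hr, dist_add_left, dist_comm, dist_comm (∫ t in 0..s, ‖R t‖),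
      dist_eq_norm, dist_eq,
      intervalIntegral.integral_interval_sub_left (hsub 0 left_mem_uIcc r hr')
        (hsub 0 left_mem_uIcc s hs'),
      intervalIntegral.integral_interval_sub_left (hsub 0 left_mem_uIcc r hr').norm
        (hsub 0 left_mem_uIcc s hs').norm]
    exact intervalIntegral.norm_integral_le_abs_integral_norm
  have hsubt : uIcc 0 t ⊆ uIcc 0 T := uIcc_subset_uIcc left_mem_uIcc
    (by rw [uIcc_of_le hT]; exact ht)
  have hact := hac.mono hsubt
  have hae : ∀ᵐ s, s ∈ uIoc 0 t → deriv (fun s => Ψ (w s)) s = Ψ' (w s) (R s) := by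
    have hne : ∀ᵐ s : ℝ, s ≠ T := by simp [ae_iff]
    filter_upwards [hRi.ae_hasDerivAt_integral, hne] with s hs hsT hst
    rw [uIoc_of_le ht.1] at hst
    have hs1 : s ∈ Ioo 0 T := ⟨hst.1, lt_of_le_of_ne (hst.2.trans ht.2) hsT⟩
    have h1 := (hs (by rw [uIcc_of_le hT]; exact Ioo_subset_Icc_self hs1) 0 left_mem_uIcc).const_add
      (w 0)
    have h2 : w =ᶠ[𝓝 s] fun x => w 0 + ∫ t in 0..x, R t := by
      filter_upwards [isOpen_Ioo.mem_nhds hs1] with r hr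
      exact hw r (Ioo_subset_Icc_self hr)
    exact ((hΨ (w s)).comp_hasDerivAt s (h1.congr_of_eventuallyEq h2)).deriv
  constructor
  · exact hact.intervalIntegrable_deriv.congr_ae ((ae_restrict_iff' measurableSet_uIoc).2 hae)
  · have h1 := hact.integral_deriv_eq_sub
    rw [intervalIntegral.integral_congr_ae hae] at h1
    linarith

end AbsolutelyContinuous

section Gronwall

theorem gronwall_integral {y a : ℝ → ℝ} {C T : ℝ} (ha : IntegrableOn a (Ioo 0 T))
    (ha0 : ∀ t, 0 ≤ a t) (hy : ContinuousOn y (Icc 0 T))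
    (h : ∀ t ∈ Icc 0 T, y t ≤ C + ∫ s in 0..t, a s * y s) :
    ∀ t ∈ Icc 0 T, y t ≤ C * exp (∫ s in 0..t, a s) := by
  intro t ht
  have hT : 0 ≤ T := ht.1.trans ht.2
  have hai : IntervalIntegrable a volume 0 T := intervalIntegrable_of_mem ha ⟨hT, le_rfl⟩
  have hayi : IntervalIntegrable (fun s => a s * y s) volume 0 T :=
    hai.mul_continuousOn (by rwa [uIcc_of_le hT])
  have hay : IntegrableOn (fun s => a s * y s) (Ioo 0 T) :=
    (intervalIntegrable_iff_integrableOn_Ioo_of_le hT).1 hayi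
  let w : ℝ → ℝ × ℝ := fun t => (C + ∫ s in 0..t, a s * y s, ∫ s in 0..t, a s)
  let R : ℝ → ℝ × ℝ := fun s => (a s * y s, a s)
  have hR : IntegrableOn R (Ioo 0 T) := hay.prodMk ha
  have hw : ∀ r ∈ Icc 0 T, w r = w 0 + ∫ s in 0..r, R s := by
    intro r hr
    have hRr := intervalIntegrable_of_mem hR hr
    have e1 := (ContinuousLinearMap.fst ℝ ℝ ℝ).intervalIntegral_comp_comm hRr
    have e2 := (ContinuousLinearMap.snd ℝ ℝ ℝ).intervalIntegral_comp_comm hRr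
    have e1' : (∫ s in 0..r, R s).1 = ∫ s in 0..r, a s * y s := e1.symm
    have e2' : (∫ s in 0..r, R s).2 = ∫ s in 0..r, a s := e2.symm
    ext
    · simp [w, e1']
    · simp [w, e2']
  have hΨ : ∀ x : ℝ × ℝ, HasFDerivAt (fun x : ℝ × ℝ => x.1 * exp (-x.2))
      (x.1 • (exp (-x.2) • (-ContinuousLinearMap.snd ℝ ℝ ℝ)) +
        exp (-x.2) • ContinuousLinearMap.fst ℝ ℝ ℝ) x := fun x =>
    hasFDerivAt_fst.mul (hasFDerivAt_snd.neg.exp)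
  obtain ⟨hi, he⟩ := integral_chain_rule hΨ (by fun_prop) hR hw ht
  have hneg : ∫ s in 0..t, ((w s).1 • (exp (-(w s).2) • (-ContinuousLinearMap.snd ℝ ℝ ℝ)) +
        exp (-(w s).2) • ContinuousLinearMap.fst ℝ ℝ ℝ) (R s) ≤ 0 := by
    have : ∫ s in 0..t, (0 : ℝ) = 0 := by simp
    refine (integral_mono_on ht.1 hi
      (continuous_const.intervalIntegrable _ _) fun s hs => ?_).trans_eq this
    have hs' : s ∈ Icc 0 T := ⟨hs.1, hs.2.trans ht.2⟩
    have h1 := h s hs'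
    simp only [add_apply, smul_apply, neg_apply, coe_snd', coe_fst', smul_eq_mul, w, R]
    have h2 := mul_nonneg (ha0 s) (exp_pos (-∫ s in 0..s, a s)).le
    nlinarith [mul_le_mul_of_nonneg_left h1 h2]
  have h0 : (w 0).1 = C ∧ (w 0).2 = 0 := by simp [w]
  simp only [h0.1, h0.2] at he
  have h1 : (w t).1 * exp (-(w t).2) ≤ C := by
    simp only [neg_zero, Real.exp_zero, mul_one] at he
    linarith
  have h2 : (w t).1 ≤ C * exp (w t).2 := by
    have := mul_le_mul_of_nonneg_right h1 (exp_pos (w t).2).le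
    rwa [mul_assoc, ← Real.exp_add, neg_add_cancel, Real.exp_zero, mul_one] at this
  exact (h t ht).trans h2

end Gronwall

/-- Lipschitz continuity on bounded sets. -/
def LipschitzOnBalls {X Y : Type*} [NormedAddCommGroup X] [NormedAddCommGroup Y] (f : X → Y) : Prop :=
  ∀ M : ℝ, ∃ K : NNReal, LipschitzOnWith K f (closedBall 0 M)

theorem LipschitzOnBalls.continuous {X Y : Type*} [NormedAddCommGroup X] [NormedAddCommGroup Y]
    {f : X → Y} (hf : LipschitzOnBalls f) : Continuous f :=
  continuous_iff_continuousAt.2 fun x => by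
    obtain ⟨K, hK⟩ := hf (‖x‖ + 1)
    exact hK.continuousOn.continuousAt (closedBall_mem_nhds_of_mem (by simp))

section ODE

variable {X : Type*} [NormedAddCommGroup X] [InnerProductSpace ℝ X] [CompleteSpace X]

theorem norm_sq_chain {R w : ℝ → X} {T : ℝ}
    (hR : IntegrableOn R (Ioo 0 T)) (hw : ∀ t ∈ Icc 0 T, w t = w 0 + ∫ s in 0..t, R s)
    {t : ℝ} (ht : t ∈ Icc 0 T) : IntervalIntegrable (fun s => 2 * ⟪w s, R s⟫) volume 0 t ∧
      ‖w t‖ ^ 2 = ‖w 0‖ ^ 2 + ∫ s in 0..t, 2 * ⟪w s, R s⟫ := by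
  have h := integral_chain_rule (Ψ := fun x : X => ‖x‖ ^ 2) (Ψ' := fun x => 2 • innerSL ℝ x)
    (fun x => (hasStrictFDerivAt_norm_sq x).hasFDerivAt)
    (by fun_prop) hR hw ht
  simpa using h

/-- A priori bound for dissipative equations. -/
theorem dissipative_bound {G : X → X} (hG : Continuous G) {C : ℝ} (hC : 0 ≤ C)
    (hdiss : ∀ x, ⟪x, G x⟫ ≤ C * (1 + ‖x‖ ^ 2)) {φ : ℝ → X} {T : ℝ}
    (hφ : IntegrableOn φ (Ioo 0 T)) {w : ℝ → X} (hwc : ContinuousOn w (Icc 0 T))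
    (hw : ∀ t ∈ Icc 0 T, w t = w 0 + ∫ s in 0..t, (G (w s) + φ s)) : ∀ t ∈ Icc 0 T, 1 + ‖w t‖ ^ 2 ≤
      (1 + ‖w 0‖ ^ 2) * exp (∫ s in 0..t, (2 * C + ‖φ s‖)) := by
  rcases lt_or_ge T 0 with hT | hT
  · simp [Icc_eq_empty (not_le.2 hT)]
  have hGc : ContinuousOn (fun s => G (w s)) (Icc 0 T) := hG.comp_continuousOn hwc
  have hR : IntegrableOn (fun s => G (w s) + φ s) (Ioo 0 T) :=
    ((hGc.integrableOn_Icc).mono_set Ioo_subset_Icc_self).add hφ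
  have ha : IntegrableOn (fun s => 2 * C + ‖φ s‖) (Ioo 0 T) :=
    (integrableOn_const (by simp)).add hφ.norm
  have hy : ContinuousOn (fun s => 1 + ‖w s‖ ^ 2) (Icc 0 T) := by fun_prop
  refine gronwall_integral ha (fun t => by positivity) hy fun t ht => ?_
  obtain ⟨hi, he⟩ := norm_sq_chain hR hw ht
  have hai : IntervalIntegrable (fun s => (2 * C + ‖φ s‖) * (1 + ‖w s‖ ^ 2)) volume 0 t := by
    refine (intervalIntegrable_of_mem ha ht).mul_continuousOn (hy.mono ?_)
    rw [uIcc_of_le ht.1]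
    exact Icc_subset_Icc_right ht.2
  rw [he]
  have := integral_mono_on ht.1 hi hai fun s hs => ?_
  · linarith
  · have h1 := hdiss (w s)
    have h2 := real_inner_le_norm (w s) (φ s)
    rw [inner_add_right]
    nlinarith [sq_nonneg (‖w s‖ - 1), norm_nonneg (φ s),
      mul_nonneg (norm_nonneg (φ s)) (sq_nonneg (‖w s‖ - 1))]

/-- Solutions on a compact time interval, for a nonlinearity that is Lipschitz on bounded sets and
bounded. -/
theorem exists_solution_of_bounded {G : X → X} {L : ℝ} (hL : ∀ x, ‖G x‖ ≤ L)
    (hG : LipschitzOnBalls G)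
    {φ : ℝ → X} {T : ℝ} (hT : 0 ≤ T) (hφ : IntegrableOn φ (Ioo 0 T)) (x0 : X) :
    ∃ w : ℝ → X, w 0 = x0 ∧ ContinuousOn w (Icc 0 T) ∧
      ∀ t ∈ Icc 0 T, w t = w 0 + ∫ s in 0..t, (G (w s) + φ s) := by
  have hL0 : 0 ≤ L := (norm_nonneg _).trans (hL 0)
  have hφi : IntervalIntegrable φ volume 0 T := intervalIntegrable_of_mem hφ ⟨hT, le_rfl⟩
  set h : ℝ → X := fun t => ∫ s in 0..t, φ s with hh
  have hhc : ContinuousOn h (Icc 0 T) := by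
    have := intervalIntegral.continuousOn_primitive_interval' hφi (left_mem_uIcc)
    rwa [uIcc_of_le hT] at this
  obtain ⟨B, hB⟩ := isCompact_Icc.exists_bound_of_continuousOn hhc
  have hGc := hG.continuous
  obtain ⟨K, hK⟩ := hG (‖x0‖ + L * T + B)
  have hmem : ∀ t ∈ Icc 0 T, ∀ x ∈ closedBall x0 (L * T),
      x + h t ∈ closedBall (0 : X) (‖x0‖ + L * T + B) := by
    intro t ht x hx
    rw [mem_closedBall_zero_iff]
    rw [mem_closedBall_iff_norm] at hx
    have h1 := norm_add_le (x - x0 + x0) (h t)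
    have h2 := norm_add_le (x - x0) x0
    have h3 := hB t ht
    simp only [sub_add_cancel] at h1 h2
    linarith
  have hpl : IsPicardLindelof (fun t x => G (x + h t)) (tmin := 0) (tmax := T)
      ⟨0, le_rfl, hT⟩ x0 ⟨L * T, by positivity⟩ 0 ⟨L, hL0⟩ K :=
    { lipschitzOnWith := by
        intro t ht
        refine LipschitzOnWith.of_dist_le_mul fun x hx y hy => ?_
        have := hK.dist_le_mul _ (hmem t ht x hx) _ (hmem t ht y hy)
        simpa using this
      continuousOn := fun x _ => hGc.comp_continuousOn (continuousOn_const.add hhc)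
      norm_le := fun t _ x _ => hL _
      mul_max_le := by
        simp [hT]
        exact le_of_eq rfl }
  obtain ⟨u, hu0, hu⟩ := hpl.exists_eq_forall_mem_Icc_hasDerivWithinAt₀
  have huc : ContinuousOn u (Icc 0 T) := fun t ht => (hu t ht).continuousWithinAt
  have hwc : ContinuousOn (fun t => u t + h t) (Icc 0 T) := huc.add hhc
  refine ⟨fun t => u t + h t, by simpa [hh] using hu0, hwc, fun t ht => ?_⟩
  have hGi : IntervalIntegrable (fun s => G (u s + h s)) volume 0 t :=
    ((hGc.comp_continuousOn hwc).mono (Icc_subset_Icc_right ht.2)).intervalIntegrable_of_Icc ht.1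
  have h1 : ∫ s in 0..t, G (u s + h s) = u t - u 0 := by
    refine intervalIntegral.integral_eq_sub_of_hasDeriv_right ?_ ?_ hGi
    · refine huc.mono ?_
      rw [uIcc_of_le ht.1]; exact Icc_subset_Icc_right ht.2
    · intro s hs
      rw [min_eq_left ht.1, max_eq_right ht.1] at hs
      have hs' : s ∈ Icc 0 T := ⟨hs.1.le, hs.2.le.trans ht.2⟩
      refine ((hu s hs').hasDerivAt ?_).hasDerivWithinAt
      exact Icc_mem_nhds hs.1 (hs.2.trans_le ht.2)
  rw [intervalIntegral.integral_add hGi (intervalIntegrable_of_mem hφ ht), h1]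
  simp [hh]
  abel

/-- Global solutions of dissipative equations with an integrable forcing. -/
theorem exists_global_solution {R : X → X} (hR : LipschitzOnBalls R) {C : ℝ} (hC : 0 ≤ C)
    (hdiss : ∀ x, ⟪x, R x⟫ ≤ C * (1 + ‖x‖ ^ 2)) {φ : ℝ → X}
    (hφ : ∀ T : ℝ, 0 < T → IntegrableOn φ (Ioo 0 T)) (x0 : X) :
    ∃ w : ℝ → X, w 0 = x0 ∧ ContinuousOn w (Ici 0) ∧
      ∀ t, 0 ≤ t → w t = w 0 + ∫ s in 0..t, (R (w s) + φ s) := by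
  have hRc := hR.continuous
  have hloc : ∀ T : ℝ, 0 < T → ∃ w : ℝ → X, w 0 = x0 ∧ ContinuousOn w (Icc 0 T) ∧
      ∀ t ∈ Icc 0 T, w t = w 0 + ∫ s in 0..t, (R (w s) + φ s) := by
    intro T hT
    have hφi : IntervalIntegrable (fun s => 2 * C + ‖φ s‖) volume 0 T :=
      intervalIntegrable_of_mem ((integrableOn_const (by simp)).add (hφ T hT).norm) ⟨hT.le, le_rfl⟩
    set B : ℝ := (1 + ‖x0‖ ^ 2) * exp (∫ s in 0..T, (2 * C + ‖φ s‖)) with hB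
    have hB0 : 0 < B := by positivity
    set θ : X → ℝ := fun x => max 0 (min 1 (B + 1 - ‖x‖)) with hθ
    have hθ0 : ∀ x, 0 ≤ θ x := fun x => le_max_left _ _
    have hθ1 : ∀ x, θ x ≤ 1 := fun x => max_le zero_le_one (min_le_left _ _)
    have hθL : LipschitzWith 1 θ := by
      have h1 : LipschitzWith 1 fun x : X => B + 1 - ‖x‖ := by
        refine LipschitzWith.of_dist_le_mul fun x y => ?_
        rw [dist_eq, dist_eq_norm, NNReal.coe_one, one_mul]
        have := abs_norm_sub_norm_le y x
        rw [norm_sub_rev] at this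
        convert this using 2; ring
      exact (h1.const_min 1).const_max 0
    obtain ⟨K, hK⟩ := hR (B + 1)
    have hRb : ∀ x ∈ closedBall (0 : X) (B + 1), ‖R x‖ ≤ ‖R 0‖ + K * (B + 1) := by
      intro x hx
      have := hK.dist_le_mul x hx 0 (by simp; positivity)
      rw [dist_eq_norm, dist_zero_right] at this
      have h2 := norm_sub_norm_le (R x) (R 0)
      have h3 : (K : ℝ) * ‖x‖ ≤ K * (B + 1) := mul_le_mul_of_nonneg_left (by simpa using hx) K.2
      linarith
    have hθout : ∀ x, x ∉ closedBall (0 : X) (B + 1) → θ x = 0 := by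
      intro x hx
      simp only [mem_closedBall_zero_iff, not_le] at hx
      simp only [hθ]
      rw [max_eq_left]
      exact (min_le_right _ _).trans (by linarith)
    have hGL : LipschitzOnBalls fun x => θ x • R x := by
      intro M
      obtain ⟨K', hK'⟩ := hR M
      refine ⟨K' + Real.toNNReal (‖R 0‖ + K' * |M|),
        LipschitzOnWith.of_dist_le_mul fun x hx y hy => ?_⟩
      have hx0 : (0 : X) ∈ closedBall (0 : X) M := by
        simp only [Metric.mem_closedBall, dist_self]
        exact (norm_nonneg x).trans (by simpa using hx)
      have h1 := hK'.dist_le_mul x hx y hy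
      have h2 := hK'.dist_le_mul y hy 0 hx0
      have h3 := hθL.dist_le_mul x y
      rw [dist_eq_norm] at h1 h2 h3 ⊢
      have h4 : ‖R y‖ ≤ ‖R 0‖ + K' * |M| := by
        have h5 := norm_sub_norm_le (R y) (R 0)
        have h6 : ‖y‖ ≤ |M| := (by simpa using hy : ‖y‖ ≤ M).trans (le_abs_self M)
        rw [dist_zero_right] at h2
        have := mul_le_mul_of_nonneg_left h6 K'.2
        have h7 : (K' : ℝ) * ‖y‖ ≤ K' * |M| := this
        linarith
      have e : θ x • R x - θ y • R y = θ x • (R x - R y) + (θ x - θ y) • R y := by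
        simp only [smul_sub, sub_smul]; abel
      rw [e]
      refine (norm_add_le _ _).trans ?_
      rw [norm_smul, norm_smul, norm_of_nonneg (hθ0 x)]
      have h8 : θ x * ‖R x - R y‖ ≤ K' * dist x y :=
        (mul_le_of_le_one_left (norm_nonneg _) (hθ1 x)).trans h1
      have h9 : ‖θ x - θ y‖ * ‖R y‖ ≤ (1 * dist x y) * (‖R 0‖ + K' * |M|) :=
        mul_le_mul (by simpa using h3) h4 (norm_nonneg _) (by positivity)
      have h10 : ((K' + Real.toNNReal (‖R 0‖ + K' * |M|) : NNReal) : ℝ) =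
        K' + (‖R 0‖ + K' * |M|) := by rw [NNReal.coe_add, Real.coe_toNNReal _ (by positivity)]
      rw [h10]
      linarith
    have hGb : ∀ x, ‖θ x • R x‖ ≤ ‖R 0‖ + K * (B + 1) := by
      intro x
      by_cases hx : x ∈ closedBall (0 : X) (B + 1)
      · rw [norm_smul, norm_of_nonneg (hθ0 x)]
        exact (mul_le_of_le_one_left (norm_nonneg _) (hθ1 x)).trans (hRb x hx)
      · rw [hθout x hx, zero_smul, norm_zero]
        have : 0 ≤ (K : ℝ) * (B + 1) := mul_nonneg K.2 (by linarith)
        positivity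
    obtain ⟨w, hw0, hwc, hw⟩ := exists_solution_of_bounded hGb hGL hT.le (hφ T hT) x0
    refine ⟨w, hw0, hwc, fun t ht => ?_⟩
    have hbd := dissipative_bound (G := fun x => θ x • R x) (hθL.continuous.smul hRc) hC
      (fun x => by
        rw [real_inner_smul_right]
        rcases le_or_gt 0 ⟪x, R x⟫ with h | h
        · exact (mul_le_of_le_one_left h (hθ1 x)).trans (hdiss x)
        · exact (mul_nonpos_of_nonneg_of_nonpos (hθ0 x) h.le).trans (by positivity))
      (hφ T hT) hwc hw
    have hle : ∀ s ∈ Icc 0 T, ‖w s‖ ≤ B := by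
      intro s hs
      have h1 := hbd s hs
      have h2 : ∫ r in 0..s, (2 * C + ‖φ r‖) ≤ ∫ r in 0..T, (2 * C + ‖φ r‖) :=
        integral_mono_interval le_rfl hs.1 hs.2 (.of_forall fun r => by positivity) hφi
      have h3 : 1 + ‖w s‖ ^ 2 ≤ B := by
        rw [hw0] at h1
        exact h1.trans (mul_le_mul_of_nonneg_left (exp_le_exp.2 h2) (by positivity))
      nlinarith [sq_nonneg (‖w s‖ - 1), sq_nonneg ‖w s‖]
    have hθw : ∀ s ∈ Icc 0 T, θ (w s) = 1 := by
      intro s hs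
      have := hle s hs
      simp only [hθ]
      rw [min_eq_left (by linarith), max_eq_right zero_le_one]
    rw [hw t ht]
    congr 1
    refine integral_congr_of_le ht.1 fun s hs => ?_
    simp only [hθw s ⟨hs.1, hs.2.trans ht.2⟩, one_smul]
  have hint : ∀ {T s : ℝ} {w : ℝ → X}, 0 < T → s ∈ Icc 0 T → ContinuousOn w (Icc 0 T) →
      IntervalIntegrable (fun s => R (w s) + φ s) volume 0 s := fun hT hs hwc =>
    intervalIntegrable_of_mem (((hRc.comp_continuousOn hwc).integrableOn_Icc.mono_set
      Ioo_subset_Icc_self).add (hφ _ hT)) hs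
  have huniq : ∀ {T : ℝ} {w v : ℝ → X}, 0 < T → w 0 = x0 → ContinuousOn w (Icc 0 T) →
      (∀ t ∈ Icc 0 T, w t = w 0 + ∫ s in 0..t, (R (w s) + φ s)) → v 0 = x0 →
      ContinuousOn v (Icc 0 T) → (∀ t ∈ Icc 0 T, v t = v 0 + ∫ s in 0..t, (R (v s) + φ s)) →
      ∀ t ∈ Icc 0 T, w t = v t := by
    intro T w v hT hw0 hwc hw hv0 hvc hv t ht
    obtain ⟨B1, hB1⟩ := isCompact_Icc.exists_bound_of_continuousOn hwc
    obtain ⟨B2, hB2⟩ := isCompact_Icc.exists_bound_of_continuousOn hvc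
    obtain ⟨K, hK⟩ := hR (max B1 B2)
    have hg := gronwall_integral (y := fun t => ‖w t - v t‖) (a := fun _ => (K : ℝ)) (C := 0) (T := T)
      (integrableOn_const (by simp)) (fun _ => K.2) (hwc.sub hvc).norm (fun s hs => by
        have e : w s - v s = ∫ r in 0..s, (R (w r) - R (v r)) := by
          rw [hw s hs, hv s hs, hw0, hv0, add_sub_add_left_eq_sub, ← intervalIntegral.integral_sub
            (hint hT hs hwc) (hint hT hs hvc)]
          simp
        rw [e, zero_add]
        refine intervalIntegral.norm_integral_le_of_norm_le hs.1 ?_ ?_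
        · refine Eventually.of_forall fun r hr => ?_
          have hr' : r ∈ Icc 0 T := ⟨hr.1.le, hr.2.trans hs.2⟩
          have := hK.dist_le_mul (w r) (by simpa using Or.inl (hB1 r hr')) (v r)
            (by simpa using Or.inr (hB2 r hr'))
          rwa [dist_eq_norm, dist_eq_norm] at this
        · exact (continuousOn_const.mul ((hwc.sub hvc).norm.mono
            (Icc_subset_Icc_right hs.2))).intervalIntegrable_of_Icc hs.1) t ht
    simp only [zero_mul] at hg
    exact sub_eq_zero.1 (norm_le_zero_iff.1 hg)
  choose! W hW0 hWc hW using hloc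
  have hagree : ∀ {T T' : ℝ}, 0 < T → T ≤ T' → ∀ t ∈ Icc 0 T, W T t = W T' t := by
    intro T T' hT hTT'
    have hT' := hT.trans_le hTT'
    exact huniq hT (hW0 T hT) (hWc T hT) (hW T hT) (hW0 T' hT')
      ((hWc T' hT').mono (Icc_subset_Icc_right hTT'))
      (fun t ht => hW T' hT' t ⟨ht.1, ht.2.trans hTT'⟩)
  have hval : ∀ {T t : ℝ}, t ∈ Icc 0 T → 0 < T → W (t + 1) t = W T t := by
    intro T t ht hT
    rcases le_total (t + 1) T with h | h
    · exact hagree (by linarith [ht.1]) h t ⟨ht.1, by linarith⟩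
    · exact (hagree hT h t ht).symm
  refine ⟨fun t => W (t + 1) t, ?_, ?_, fun t ht => ?_⟩
  · simp [hW0]
  · intro t ht
    have ht0 : (0 : ℝ) ≤ t := ht
    have hT : 0 < t + 1 := by linarith
    have h1 : ContinuousWithinAt (W (t + 1)) (Ici 0) t := by
      have := hWc (t + 1) hT t ⟨ht0, by linarith⟩
      refine this.mono_of_mem_nhdsWithin ?_
      rw [← Ici_inter_Iic]
      exact inter_mem_nhdsWithin _ (Iic_mem_nhds (by linarith))
    refine h1.congr_of_eventuallyEq ?_ rfl
    filter_upwards [self_mem_nhdsWithin, mem_nhdsWithin_of_mem_nhds (Iic_mem_nhds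
      (show t < t + 1 by linarith))] with s hs hs'
    exact hval ⟨hs, hs'⟩ hT
  · have hT : 0 < t + 1 := by linarith
    simp only [zero_add]
    rw [hW (t + 1) hT t ⟨ht, by linarith⟩, hW0 _ hT, hW0 _ one_pos]
    congr 1
    refine integral_congr_of_le ht fun s hs => ?_
    simp only [hval (T := t + 1) ⟨hs.1, by linarith [hs.2]⟩ hT]

end ODE

/-- The primitive of a mollifier. -/
def bumpPrimitive (φ : ContDiffBump (0 : ℝ)) (x : ℝ) : ℝ := ∫ y in (-φ.rOut)..x, φ.normed volume y

theorem hasDerivAt_bumpPrimitive (φ : ContDiffBump (0 : ℝ)) (x : ℝ) :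
    HasDerivAt (bumpPrimitive φ) (φ.normed volume x) x :=
  intervalIntegral.integral_hasDerivAt_right (φ.continuous_normed.intervalIntegrable _ _)
    (φ.continuous_normed.stronglyMeasurableAtFilter _ _) φ.continuous_normed.continuousAt

theorem contDiff_bumpPrimitive (φ : ContDiffBump (0 : ℝ)) : ContDiff ℝ ∞ (bumpPrimitive φ) := by
  rw [contDiff_infty_iff_deriv]
  refine ⟨fun x => (hasDerivAt_bumpPrimitive φ x).differentiableAt, ?_⟩
  rw [show deriv (bumpPrimitive φ) = φ.normed volume from
    funext fun x => (hasDerivAt_bumpPrimitive φ x).deriv]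
  exact φ.contDiff_normed

theorem normed_eq_zero (φ : ContDiffBump (0 : ℝ)) {x : ℝ} (hx : φ.rOut ≤ |x|) :
    φ.normed volume x = 0 := by
  by_contra h
  have : x ∈ Function.support (φ.normed volume) := h
  rw [φ.support_normed_eq, mem_ball_zero_iff, norm_eq_abs] at this
  linarith

theorem bumpPrimitive_eq_zero (φ : ContDiffBump (0 : ℝ)) {x : ℝ} (hx : x ≤ -φ.rOut) :
    bumpPrimitive φ x = 0 := by
  unfold bumpPrimitive
  rw [intervalIntegral.integral_symm, intervalIntegral.integral_zero_ae, neg_zero]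
  refine Eventually.of_forall fun y hy => normed_eq_zero φ ?_
  rw [uIoc_of_le hx] at hy
  have := neg_le_abs y
  linarith [hy.2]

theorem bumpPrimitive_eq_one (φ : ContDiffBump (0 : ℝ)) {x : ℝ} (hx : φ.rOut ≤ x) :
    bumpPrimitive φ x = 1 := by
  have h0 := φ.rOut_pos
  unfold bumpPrimitive
  rw [← φ.integral_normed (μ := volume), integral_of_le (by linarith)]
  refine setIntegral_eq_integral_of_forall_compl_eq_zero fun y hy => normed_eq_zero φ ?_
  by_contra hlt
  rw [not_le, abs_lt] at hlt
  exact hy ⟨hlt.1, by linarith [hlt.2]⟩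

theorem bumpPrimitive_mem (φ : ContDiffBump (0 : ℝ)) (x : ℝ) : bumpPrimitive φ x ∈ Icc (0 : ℝ) 1 := by
  have hm : Monotone (bumpPrimitive φ) := by
    refine monotone_of_deriv_nonneg (fun x => (hasDerivAt_bumpPrimitive φ x).differentiableAt)
      fun x => ?_
    rw [(hasDerivAt_bumpPrimitive φ x).deriv]
    exact φ.nonneg_normed x
  constructor
  · rw [← bumpPrimitive_eq_zero φ (min_le_right x (-φ.rOut))]
    exact hm (min_le_left _ _)
  · rw [← bumpPrimitive_eq_one φ (le_max_right x φ.rOut)]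
    exact hm (le_max_left _ _)

/-- A locally integrable function whose distributional derivative is bounded in `L²` is Hölder
continuous outside a null set. -/
theorem exists_ae_holder {v : ℝ → ℝ} (hv : LocallyIntegrable v) {α β M : ℝ} (hM : 0 ≤ M)
    (h : ∀ η : ℝ → ℝ, ContDiff ℝ ∞ η → HasCompactSupport η → tsupport η ⊆ Ioo α β →
      |∫ x, v x * deriv η x| ≤ M * √(∫ x, η x ^ 2)) :
    ∃ G : Set ℝ, (∀ᵐ x, x ∈ G) ∧ ∀ s ∈ G, ∀ t ∈ G, α < s → t < β → s ≤ t →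
      |v s - v t| ≤ M * √(t - s) := by
  let φ : ℕ → ContDiffBump (0 : ℝ) := fun n =>
    ⟨1 / (n + 1) / 2, 1 / (n + 1), by positivity, by
      have : (0 : ℝ) < 1 / (n + 1) := by positivity
      linarith⟩
  have hr : Tendsto (fun n => (φ n).rOut) atTop (𝓝 0) := tendsto_one_div_add_atTop_nhds_zero_nat
  refine ⟨{x | Tendsto (fun n => ∫ y, v y * (φ n).normed volume (y - x)) atTop (𝓝 (v x))}, ?_, ?_⟩
  · have := ContDiffBump.ae_convolution_tendsto_right_of_locallyIntegrable (φ := φ) (K := 2) hr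
      (.of_forall fun n => by simp [φ]; linarith) hv
    filter_upwards [this] with x hx
    refine hx.congr fun n => ?_
    rw [convolution_eq_swap]
    refine integral_congr_ae (.of_forall fun y => ?_)
    simp only [ContinuousLinearMap.lsmul_apply, smul_eq_mul]
    rw [mul_comm, ← (φ n).normed_neg, neg_sub]
  · intro s hs t ht hα hβ hst
    have hint : ∀ n x, Integrable fun y => v y * (φ n).normed volume (y - x) := by
      intro n x
      have hc : HasCompactSupport fun y => (φ n).normed volume (y - x) :=
        (φ n).hasCompactSupport_normed.comp_homeomorph (Homeomorph.subRight x)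
      have := hv.integrable_smul_left_of_hasCompactSupport
        ((φ n).continuous_normed.comp (continuous_id.sub continuous_const)) hc
      refine this.congr (.of_forall fun y => ?_)
      simp [mul_comm]
    have hev : ∀ᶠ n in atTop, |(∫ y, v y * (φ n).normed volume (y - s)) -
        ∫ y, v y * (φ n).normed volume (y - t)| ≤ M * √(t - s + 2 * (φ n).rOut) := by
      have hmin : 0 < min (s - α) (β - t) := lt_min (by linarith) (by linarith)
      filter_upwards [hr.eventually (gt_mem_nhds hmin)] with n hn
      set ρ := (φ n).rOut with hρ
      have hρ0 : 0 < ρ := (φ n).rOut_pos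
      have hn1 := hn.trans_le (min_le_left _ _)
      have hn2 := hn.trans_le (min_le_right _ _)
      set η : ℝ → ℝ := fun y => bumpPrimitive (φ n) (y - s) - bumpPrimitive (φ n) (y - t) with hη
      have hη0 : ∀ y, y ∉ Icc (s - ρ) (t + ρ) → η y = 0 := by
        intro y hy
        simp only [mem_Icc, not_and_or, not_le] at hy
        simp only [hη]
        rcases hy with hy | hy
        · rw [bumpPrimitive_eq_zero _ (by linarith), bumpPrimitive_eq_zero _ (by linarith), sub_zero]
        · rw [bumpPrimitive_eq_one _ (by linarith), bumpPrimitive_eq_one _ (by linarith), sub_self]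
      have hsupp : tsupport η ⊆ Icc (s - ρ) (t + ρ) :=
        closure_minimal (fun y hy => by_contra fun h => hy (hη0 y h)) isClosed_Icc
      have hd : ∀ y, HasDerivAt η ((φ n).normed volume (y - s) - (φ n).normed volume (y - t)) y :=
        fun y => ((hasDerivAt_bumpPrimitive (φ n) (y - s)).comp_sub_const y s).sub
          ((hasDerivAt_bumpPrimitive (φ n) (y - t)).comp_sub_const y t)
      have hη1 : ContDiff ℝ ∞ η :=
        ((contDiff_bumpPrimitive _).comp (contDiff_id.sub contDiff_const)).sub
          ((contDiff_bumpPrimitive _).comp (contDiff_id.sub contDiff_const))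
      have h1 := h η hη1 (isCompact_Icc.of_isClosed_subset (isClosed_tsupport _) hsupp)
        (hsupp.trans fun y hy => ⟨by linarith [hy.1], by linarith [hy.2]⟩)
      have e : ∫ y, v y * deriv η y = (∫ y, v y * (φ n).normed volume (y - s)) -
          ∫ y, v y * (φ n).normed volume (y - t) := by
        rw [← integral_sub (hint n s) (hint n t)]
        refine integral_congr_ae (.of_forall fun y => ?_)
        simp only [(hd y).deriv]
        ring
      rw [← e]
      refine h1.trans (mul_le_mul_of_nonneg_left (sqrt_le_sqrt ?_) hM)
      rw [← setIntegral_eq_integral_of_forall_compl_eq_zero (s := Icc (s - ρ) (t + ρ))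
        (fun y hy => by rw [hη0 y hy]; ring)]
      have h2 : ∫ y in Icc (s - ρ) (t + ρ), η y ^ 2 ≤ ∫ y in Icc (s - ρ) (t + ρ), (1 : ℝ) := by
        refine setIntegral_mono ((hη1.continuous.pow 2).continuousOn.integrableOn_compact
          isCompact_Icc) (integrableOn_const (by simp)) fun y => ?_
        have a1 := bumpPrimitive_mem (φ n) (y - s)
        have a2 := bumpPrimitive_mem (φ n) (y - t)
        simp only [hη]
        rw [sq_le_one_iff_abs_le_one, abs_le]
        constructor <;> linarith [a1.1, a1.2, a2.1, a2.2]
      refine h2.trans ?_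
      simp only [setIntegral_const, smul_eq_mul, mul_one, Measure.real, Real.volume_Icc]
      rw [ENNReal.toReal_ofReal (by linarith)]
      linarith
    have hlim : Tendsto (fun n => M * √(t - s + 2 * (φ n).rOut)) atTop (𝓝 (M * √(t - s))) := by
      have := ((hr.const_mul 2).const_add (t - s)).sqrt.const_mul M
      simpa using this
    exact le_of_tendsto_of_tendsto ((hs.sub ht).abs) hlim hev

/-- The lemma of du Bois-Reymond. -/
theorem exists_ae_eq_const {v : ℝ → ℝ} (hv : LocallyIntegrable v) {α β : ℝ}
    (h : ∀ η : ℝ → ℝ, ContDiff ℝ ∞ η → HasCompactSupport η → tsupport η ⊆ Ioo α β →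
      ∫ x, v x * deriv η x = 0) : ∃ c : ℝ, ∀ᵐ x ∂volume.restrict (Ioo α β), v x = c := by
  obtain ⟨G, hG, hGv⟩ := exists_ae_holder hv le_rfl fun η h1 h2 h3 => by rw [h η h1 h2 h3]; simp
  rcases le_or_gt β α with hle | hlt
  · exact ⟨0, by simp [hle]⟩
  · obtain ⟨x0, hx0, hx1⟩ : ∃ x ∈ Ioo α β, x ∈ G := by
      by_contra hcon
      push Not at hcon
      have : volume (Ioo α β) = 0 := measure_mono_null hcon (ae_iff.1 hG)
      simp [hlt] at this
      linarith
    refine ⟨v x0, ?_⟩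
    filter_upwards [ae_restrict_of_ae hG, ae_restrict_mem measurableSet_Ioo] with x hx hxI
    rcases le_total x x0 with hle | hle
    · have := hGv x hx x0 hx1 hxI.1 hx0.2 hle
      simpa [sub_eq_zero] using this
    · have := hGv x0 hx1 x hx hx0.1 hxI.2 hle
      simpa [sub_eq_zero, eq_comm] using this

/-- A derivative whose distributional derivative is bounded in `L²` is Hölder continuous. -/
theorem holder_of_hasDerivAt {F f : ℝ → ℝ} (hF : ∀ x, HasDerivAt F (f x) x) {α β M : ℝ}
    (hM : 0 ≤ M) (hf : IntegrableOn f (Ioo α β))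
    (h : ∀ η : ℝ → ℝ, ContDiff ℝ ∞ η → HasCompactSupport η → tsupport η ⊆ Ioo α β →
      |∫ x, f x * deriv η x| ≤ M * √(∫ x, η x ^ 2)) {s t : ℝ} (hs : α < s) (ht : t < β)
    (hst : s ≤ t) : |f s - f t| ≤ M * √(t - s) := by
  set v : ℝ → ℝ := (Ioo α β).indicator f with hv
  have hvi : Integrable v := hf.integrable_indicator measurableSet_Ioo
  obtain ⟨G, hG, hGv⟩ := exists_ae_holder hvi.locallyIntegrable hM fun η h1 h2 h3 => by
    rw [show ∫ x, v x * deriv η x = ∫ x, f x * deriv η x from ?_]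
    · exact h η h1 h2 h3
    refine integral_congr_ae (.of_forall fun x => ?_)
    by_cases hx : x ∈ Ioo α β
    · simp [hv, hx]
    · have : deriv η x = 0 := by
        by_contra hne
        exact hx (h3 (tsupport_deriv_subset (subset_tsupport _ hne)))
      simp [this]
  have hG1 : ∀ᵐ x, s + x ∈ G := (measurePreserving_add_left volume s).quasiMeasurePreserving.ae hG
  have hG2 : ∀ᵐ x, t + x ∈ G := (measurePreserving_add_left volume t).quasiMeasurePreserving.ae hG
  have hlim : ∀ x, Tendsto (fun h => h⁻¹ * (F (x + h) - F x)) (𝓝[>] 0) (𝓝 (f x)) := fun x =>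
    (by simpa using (hF x).tendsto_slope_zero_right)
  refine le_of_tendsto ((hlim s).sub (hlim t)).abs ?_
  have hev : ∀ᶠ h : ℝ in 𝓝[>] 0, h < β - t := nhdsWithin_le_nhds (gt_mem_nhds (by linarith))
  filter_upwards [hev, self_mem_nhdsWithin] with h hh hh0
  have hh0' : (0 : ℝ) < h := hh0
  have hFi : ∀ x, α < x → x ≤ t → IntervalIntegrable (fun y => f (x + y)) volume 0 h ∧
      F (x + h) - F x = ∫ y in 0..h, f (x + y) := by
    intro x hx hxt
    have h1 : IntervalIntegrable f volume x (x + h) := by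
      rw [intervalIntegrable_iff_integrableOn_Ioo_of_le (by linarith)]
      exact hf.mono_set (Ioo_subset_Ioo hx.le (by linarith))
    have h2 := h1.comp_add_left x
    simp only [sub_self, add_sub_cancel_left] at h2
    refine ⟨h2, ?_⟩
    rw [intervalIntegral.integral_comp_add_left (fun y => f y), add_zero]
    exact (intervalIntegral.integral_eq_sub_of_hasDerivAt (fun y _ => hF y) h1).symm
  obtain ⟨i1, e1⟩ := hFi s hs hst
  obtain ⟨i2, e2⟩ := hFi t (hs.trans_le hst) le_rfl
  rw [e1, e2, ← mul_sub, ← intervalIntegral.integral_sub i1 i2, abs_mul,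
    abs_of_pos (inv_pos.2 hh0'), inv_mul_le_iff₀ hh0']
  have hb : ∀ᵐ y, y ∈ uIoc (0 : ℝ) h → ‖f (s + y) - f (t + y)‖ ≤ M * √(t - s) := by
    filter_upwards [hG1, hG2] with y y1 y2 hy
    rw [uIoc_of_le hh0'.le] at hy
    have m1 : s + y ∈ Ioo α β := ⟨by linarith [hy.1], by linarith [hy.2]⟩
    have m2 : t + y ∈ Ioo α β := ⟨by linarith [hy.1], by linarith [hy.2]⟩
    have := hGv _ y1 _ y2 m1.1 m2.2 (by linarith)
    simp only [hv, indicator_of_mem m1, indicator_of_mem m2] at this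
    rw [norm_eq_abs]
    convert this using 3
    ring
  have := intervalIntegral.norm_integral_le_of_norm_le_const_ae hb
  rw [norm_eq_abs, sub_zero, abs_of_pos hh0'] at this
  linarith

variable {d : ℕ} {S : Setting d} [hS : Fact S.IsAdmissible]

theorem IsA.unique {u f g : H S} (hf : IsA u f) (hg : IsA u g) : f = g := by
  obtain ⟨v, hv, h1⟩ := hf
  obtain ⟨w, hw, h2⟩ := hg
  obtain rfl : v = w := incl_injective (hv.trans hw.symm)
  rw [← sub_eq_zero]
  refine eq_zero_of_forall_inner_incl fun z => ?_
  rw [inner_sub_left, ← h1, ← h2, sub_self]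

theorem IsA.opA_eq {u f : H S} (h : IsA u f) : opA u = f := by
  have hD : InDA u := ⟨f, h⟩
  rw [opA, dif_pos hD]
  exact hD.choose_spec.unique h

theorem InDA.isA {u : H S} (h : InDA u) : IsA u (opA u) := by
  rw [opA, dif_pos h]
  exact h.choose_spec

theorem isA_zero : IsA (0 : H S) 0 := ⟨0, map_zero _, fun z => by simp⟩

theorem IsA.add {u v f g : H S} (hu : IsA u f) (hv : IsA v g) : IsA (u + v) (f + g) := by
  obtain ⟨a, ha, h1⟩ := hu
  obtain ⟨b, hb, h2⟩ := hv
  exact ⟨a + b, by rw [map_add, ha, hb], fun z => by rw [inner_add_left, inner_add_left, h1, h2]⟩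

theorem IsA.smul {u f : H S} (c : ℝ) (hu : IsA u f) : IsA (c • u) (c • f) := by
  obtain ⟨a, ha, h1⟩ := hu
  exact ⟨c • a, by rw [map_smul, ha], fun z => by
    rw [real_inner_smul_left, real_inner_smul_left, h1]⟩

theorem inDA32_zero : InDA32 (0 : H S) := ⟨⟨0, isA_zero⟩, 0, by rw [isA_zero.opA_eq, map_zero]⟩

theorem IsBump.sub {φ ψ : E d → ℝ} (hφ : IsBump S φ) (hψ : IsBump S ψ) :
    IsBump S (fun x => φ x - ψ x) := ⟨hφ.1.sub hψ.1, hφ.2.1.sub hψ.2.1,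
    (tsupport_sub φ ψ).trans (union_subset hφ.2.2 hψ.2.2)⟩

theorem IsBump.sum {ι : Type*} (s : Finset ι) {φ : ι → E d → ℝ} (h : ∀ i ∈ s, IsBump S (φ i)) :
    IsBump S (fun x => ∑ i ∈ s, φ i x) := by
  classical
  induction s using Finset.induction_on with
  | empty =>
    simp only [Finset.sum_empty]
    exact ⟨contDiff_const, HasCompactSupport.zero, by simp [tsupport]⟩
  | insert a s ha ih =>
    simp only [Finset.sum_insert ha]
    have h1 := h a (Finset.mem_insert_self _ _)
    have h2 := ih fun i hi => h i (Finset.mem_insert_of_mem hi)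
    exact ⟨h1.1.add h2.1, h1.2.1.add h2.2.1, (tsupport_add _ _).trans (union_subset h1.2.2 h2.2.2)⟩

/-- The shifted Laplacian of a smooth function. -/
def classicalA (ψ : E d → ℝ) (x : E d) : ℝ := ψ x - ∑ i, pd i (pd i ψ) x

theorem IsBump.of_classicalA {ψ : E d → ℝ} (hψ : IsBump S ψ) : IsBump S (classicalA ψ) :=
  hψ.sub (IsBump.sum _ fun i _ => (hψ.of_pd i).of_pd i)

theorem integrable_mul_bump (u : H S) {ψ : E d → ℝ} (hψ : IsBump S ψ) :
    Integrable (fun x => u x * ψ x) S.vol :=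
  (Lp.memLp u).integrable_mul (memLp_of_continuous hψ.1.continuous 2)

theorem IsBump.isA {ψ : E d → ℝ} (hψ : IsBump S ψ) :
    IsA (incl hψ.toV) (incl (hψ.of_classicalA.toV)) := by
  refine ⟨hψ.toV, rfl, fun z => ?_⟩
  rw [inner_V, real_inner_comm, real_inner_comm (incl z), inner_toV, inner_toV, PiLp.inner_apply]
  have h : ∀ i, ⟪grad hψ.toV i, grad z i⟫ = -∫ x, incl z x * pd i (pd i ψ) x ∂S.vol := by
    intro i
    rw [real_inner_comm, inner_eq_integral (hψ.grad_toV i), weak_gradient z (hψ.of_pd i) i, neg_neg]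
  simp only [h, classicalA, mul_sub, Finset.mul_sum]
  rw [integral_sub (integrable_mul_bump _ hψ)
    (integrable_finset_sum _ fun i _ => integrable_mul_bump _ ((hψ.of_pd i).of_pd i)),
    integral_finset_sum _ fun i _ => integrable_mul_bump _ ((hψ.of_pd i).of_pd i)]
  rw [Finset.sum_neg_distrib]
  ring

theorem IsBump.inDA32 {ψ : E d → ℝ} (hψ : IsBump S ψ) :
    InDA32 (incl hψ.toV) := ⟨⟨_, hψ.isA⟩, _, ((hψ.isA).opA_eq).symm⟩

theorem exists_box_subset {U : Set (E d)} (hU : U ∈ 𝓝 (0 : E d)) :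
    ∃ ρ > 0, ∀ x : E d, (∀ i, |x i| < ρ) → x ∈ U := by
  have hc : Continuous (fun y : Fin d → ℝ => (WithLp.toLp 2 y : E d)) := PiLp.continuous_toLp 2 _
  have h0 : (fun y : Fin d → ℝ => (WithLp.toLp 2 y : E d)) ⁻¹' U ∈ 𝓝 (0 : Fin d → ℝ) :=
    hc.continuousAt.preimage_mem_nhds (by simpa using hU)
  obtain ⟨ρ, hρ, hsub⟩ := Metric.mem_nhds_iff.1 h0
  refine ⟨ρ, hρ, fun x hx => ?_⟩
  have : (fun i => x i) ∈ Metric.ball (0 : Fin d → ℝ) ρ := by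
    rw [mem_ball_zero_iff, pi_norm_lt_iff hρ]
    exact hx
  exact hsub this

theorem integral_prod_coord (θ : Fin d → ℝ → ℝ) : ∫ x : E d, ∏ i, θ i (x i) = ∏ i, ∫ y, θ i y := by
  rw [← integral_fintype_prod_volume_eq_prod θ]
  have := (PiLp.volume_preserving_toLp (Fin d)).integral_comp
    (MeasurableEquiv.toLp 2 (Fin d → ℝ)).measurableEmbedding (fun x : E d => ∏ i, θ i (x i))
  rw [← this]

/-- A function of one coordinate that is integrable on a box is integrable on an interval. -/
theorem integrableOn_of_box {f : ℝ → ℝ} (hf : Measurable f) (i : Fin d) (c : E d) {ρ : ℝ}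
    (hρ : 0 < ρ)
    (h : IntegrableOn (fun x : E d => f (x i)) {x : E d | ∀ j, |x j - c j| < ρ}) :
    IntegrableOn f (Ioo (c i - ρ) (c i + ρ)) := by
  have h1 : IntegrableOn (fun y : Fin d → ℝ => f (y i))
      (Set.univ.pi fun j => Ioo (c j - ρ) (c j + ρ)) := by
    have := ((PiLp.volume_preserving_toLp (Fin d)).integrableOn_comp_preimage
      (MeasurableEquiv.toLp 2 (Fin d → ℝ)).measurableEmbedding).2 h
    have e : (Set.univ.pi fun j => Ioo (c j - ρ) (c j + ρ)) =
        WithLp.toLp 2 ⁻¹' {x : E d | ∀ j, |x j - c j| < ρ} := by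
      ext y
      simp only [Set.mem_pi, Set.mem_univ, true_imp_iff, Set.mem_Ioo, Set.mem_preimage,
        Set.mem_setOf_eq, abs_lt]
      refine forall_congr' fun j => ⟨fun h => ?_, fun h => ?_⟩ <;>
        constructor <;> linarith [h.1, h.2]
    rw [e]
    exact this
  rw [IntegrableOn, volume_pi, Measure.restrict_pi_pi] at h1
  have h2 := (integrable_map_measure (μ := Measure.pi fun j => volume.restrict
    (Ioo (c j - ρ) (c j + ρ))) (f := Function.eval i) (g := f) hf.aestronglyMeasurable
    (measurable_pi_apply i).aemeasurable).2 h1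
  rw [Measure.pi_map_eval, integrable_smul_measure] at h2
  · exact h2
  · rw [Finset.prod_ne_zero_iff]
    intro j _
    simp [hρ]
  · exact ENNReal.prod_ne_top fun j _ => by simp

theorem hasDerivAt_line {ψ : E d → ℝ} (hψ : Differentiable ℝ ψ) (x : E d) (i : Fin d) :
    HasDerivAt (fun t : ℝ => ψ (x + t • single i 1)) (pd i ψ x) 0 := by
  have h1 : HasDerivAt (fun t : ℝ => x + t • (single i 1 : E d)) (single i 1) 0 := by
    simpa using ((hasDerivAt_id (0 : ℝ)).smul_const (single i (1 : ℝ) : E d)).const_add x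
  have h2 : HasFDerivAt ψ (fderiv ℝ ψ x) (x + (0 : ℝ) • single i 1) := by
    simpa using (hψ x).hasFDerivAt
  exact h2.comp_hasDerivAt 0 h1

open Classical in
/-- The product of `η` in the coordinate `i` and of `β` in the other ones, centred at `c`. -/
def boxFun (i : Fin d) (c : E d) (η β : ℝ → ℝ) (x : E d) : ℝ :=
  ∏ j, (if j = i then η else β) (x j - c j)

theorem boxFun_eq (i : Fin d) (c : E d) (η β : ℝ → ℝ) (x : E d) :
    boxFun i c η β x = η (x i - c i) * ∏ j ∈ Finset.univ.erase i, β (x j - c j) := by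
  classical
  rw [boxFun, ← Finset.mul_prod_erase _ _ (Finset.mem_univ i), if_pos rfl]
  congr 1
  refine Finset.prod_congr rfl fun j hj => ?_
  rw [if_neg (Finset.ne_of_mem_erase hj)]

theorem integral_boxFun (i : Fin d) (c : E d) (η β : ℝ → ℝ) :
    ∫ x, boxFun i c η β x = (∫ y, η y) * (∫ y, β y) ^ (d - 1) := by
  classical
  unfold boxFun
  rw [integral_prod_coord (fun j y => (if j = i then η else β) (y - c j)),
    ← Finset.mul_prod_erase _ _ (Finset.mem_univ i), if_pos rfl, integral_sub_right_eq_self]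
  congr 1
  rw [Finset.prod_congr rfl (g := fun _ => ∫ y, β y) fun j hj => ?_]
  · simp
  · rw [if_neg (Finset.ne_of_mem_erase hj), integral_sub_right_eq_self]

theorem contDiff_boxFun (i : Fin d) (c : E d) {η β : ℝ → ℝ} (hη : ContDiff ℝ ∞ η)
    (hβ : ContDiff ℝ ∞ β) : ContDiff ℝ ∞ (boxFun i c η β) := by
  classical
  unfold boxFun
  refine contDiff_prod fun j _ => ?_
  have h : ContDiff ℝ ∞ (if j = i then η else β) := by split_ifs <;> assumption
  exact h.comp ((proj j : E d →L[ℝ] ℝ).contDiff.sub contDiff_const)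

theorem pd_boxFun (i : Fin d) (c : E d) {η β : ℝ → ℝ} (hη : ContDiff ℝ ∞ η)
    (hβ : ContDiff ℝ ∞ β) : pd i (boxFun i c η β) = boxFun i c (deriv η) β := by
  funext x
  have h1 := hasDerivAt_line ((contDiff_boxFun i c hη hβ).differentiable (by simp)) x i
  refine h1.unique ?_
  have e : (fun t : ℝ => boxFun i c η β (x + t • single i 1)) =
      fun t => η (x i - c i + t) * ∏ j ∈ Finset.univ.erase i, β (x j - c j) := by
    funext t
    rw [boxFun_eq]
    congr 1
    · simp; ring_nf
    · refine Finset.prod_congr rfl fun j hj => ?_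
      simp [Finset.ne_of_mem_erase hj]
  rw [e, boxFun_eq]
  refine HasDerivAt.mul_const ?_ _
  have h2 : HasDerivAt η (deriv η (x i - c i)) (x i - c i + 0) := by
    simpa using ((hη.differentiable (by simp)) (x i - c i)).hasDerivAt
  simpa using h2.comp_const_add (x i - c i) 0

theorem boxFun_eq_zero {i : Fin d} {c : E d} {η β : ℝ → ℝ} {A : Set ℝ} (hη : tsupport η ⊆ A)
    (hβ : tsupport β ⊆ A) {x : E d} {j : Fin d} (hx : x j - c j ∉ A) : boxFun i c η β x = 0 := by
  classical
  refine Finset.prod_eq_zero (Finset.mem_univ j) ?_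
  split_ifs
  · exact image_eq_zero_of_notMem_tsupport fun h => hx (hη h)
  · exact image_eq_zero_of_notMem_tsupport fun h => hx (hβ h)

theorem tsupport_boxFun_subset (i : Fin d) (c : E d) (η β : ℝ → ℝ) :
    tsupport (boxFun i c η β) ⊆ {x | ∀ j, x j - c j ∈ tsupport η ∪ tsupport β} := by
  refine closure_minimal (fun x hx j => ?_) ?_
  · by_contra h
    exact hx (boxFun_eq_zero subset_union_left subset_union_right h)
  · rw [Set.setOf_forall]
    refine isClosed_iInter fun j => ?_
    exact ((isClosed_tsupport η).union (isClosed_tsupport β)).preimage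
      ((proj j : E d →L[ℝ] ℝ).continuous.sub continuous_const)

/-- If `f ∘ v - f 0` belongs to `V` for all `v ∈ D(A^{3/2})`, the derivative `f` is continuous. -/
theorem continuous_of_comp_mem (hd : 1 ≤ d) {F f : ℝ → ℝ} (hF : ∀ x, HasDerivAt F (f x) x)
    (h : ∀ v : H S, InDA32 v → ∃ u : V S, ⇑(incl u) =ᵐ[S.vol] fun x => f (v x) - f 0) :
    Continuous f := by
  rw [continuous_iff_continuousAt]
  intro s0
  obtain ⟨c, hc⟩ := hS.out.nonempty
  let i : Fin d := ⟨0, hd⟩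
  have hfm : Measurable f := by
    rw [show f = deriv F from funext fun x => (hF x).deriv.symm]
    exact measurable_deriv F
  obtain ⟨r, hr, hrs⟩ := Metric.isOpen_iff.1 hS.out.isOpen c hc
  let χ : ContDiffBump c := ⟨r / 4, r / 2, by linarith, by linarith⟩
  obtain ⟨ρ, hρ, hbox⟩ := exists_box_subset (ball_mem_nhds (0 : E d) χ.rIn_pos)
  have hbox' : ∀ x : E d, (∀ j, |x j - c j| < ρ) → x ∈ Metric.ball c χ.rIn := by
    intro x hx
    have := hbox (x - c) (by simpa using hx)
    rw [mem_ball_iff_norm]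
    simpa using this
  set U : Set (E d) := {x : E d | ∀ j, |x j - c j| < ρ} with hU
  have hUdom : U ⊆ S.domain := fun x hx =>
    hrs (Metric.ball_subset_ball (by change r / 4 ≤ r; linarith) (hbox' x hx))
  have hUm : MeasurableSet U := by
    rw [hU, Set.setOf_forall]
    refine MeasurableSet.iInter fun j => ?_
    exact (isOpen_lt (((proj j : E d →L[ℝ] ℝ).continuous.sub continuous_const).abs)
      continuous_const).measurableSet
  have hχ : IsBump S (fun x : E d => (s0 + (x i - c i)) * χ x) := by
    refine IsBump.mul_left ⟨χ.contDiff, χ.hasCompactSupport, ?_⟩ ?_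
    · rw [χ.tsupport_eq]
      exact (Metric.closedBall_subset_ball (by change r / 2 < r; linarith)).trans hrs
    · exact contDiff_const.add ((proj i : E d →L[ℝ] ℝ).contDiff.sub contDiff_const)
  obtain ⟨u, hu⟩ := h _ (hχ.inDA32)
  have hu' : ⇑(incl u) =ᵐ[S.vol] fun x => f ((s0 + (x i - c i)) * χ x) - f 0 := by
    filter_upwards [hu, hχ.incl_toV] with x h1 h2
    rw [h1, h2]
  have hUeq : ∀ x ∈ U, (s0 + (x i - c i)) * χ x = s0 + (x i - c i) := by
    intro x hx
    rw [χ.one_of_mem_closedBall (Metric.ball_subset_closedBall (hbox' x hx)), mul_one]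
  set k : ℝ → ℝ := fun y => f (s0 + y) - f 0 with hk
  have hkm : Measurable k := (hfm.comp (measurable_const_add s0)).sub_const _
  -- integrability
  have hki : IntegrableOn k (Ioo (-ρ) ρ) := by
    have h1 : Integrable (incl u) S.vol := (Lp.memLp (incl u)).integrable one_le_two
    have h2 : IntegrableOn (fun x : E d => k (x i - c i)) U := by
      have h3 := (h1.congr hu').mono_measure (μ := volume.restrict U)
        (Measure.restrict_mono hUdom le_rfl)
      refine IntegrableOn.congr_fun h3 (fun x hx => ?_) hUm
      simp only [hUeq x hx, hk]
    have h4 := integrableOn_of_box (f := fun y => k (y - c i)) (hkm.comp (measurable_sub_const _))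
      i c hρ h2
    have h5 := ((measurePreserving_add_right volume (c i)).integrableOn_comp_preimage
      (measurableEmbedding_addRight (c i))).2 h4
    refine (h5.congr_set_ae ?_).congr (.of_forall fun y => by simp)
    refine Eventually.of_forall fun y => propext ?_
    change y ∈ Ioo _ _ ↔ y + c i ∈ Ioo _ _
    simp only [mem_Ioo]
    constructor <;> intro h <;> constructor <;> linarith [h.1, h.2]
  let β : ContDiffBump (0 : ℝ) := ⟨ρ / 4, ρ / 2, by linarith, by linarith⟩
  have hβs : tsupport β ⊆ Ioo (-ρ) ρ := by
    rw [β.tsupport_eq, Real.closedBall_eq_Icc]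
    refine Icc_subset_Ioo ?_ ?_ <;> simp [β] <;> linarith
  set B1 : ℝ := (∫ y, β y) ^ (d - 1) with hB1
  have hB₁0 : 0 < B1 := pow_pos β.integral_pos _
  set B2 : ℝ := (∫ y, β y ^ 2) ^ (d - 1) with hB2
  have hB₂0 : 0 ≤ B2 := pow_nonneg (integral_nonneg fun y => sq_nonneg _) _
  set M : ℝ := ‖grad u i‖ * √B2 / B1 with hM
  have hM0 : 0 ≤ M := by positivity
  have hweak : ∀ η : ℝ → ℝ, ContDiff ℝ ∞ η → HasCompactSupport η → tsupport η ⊆ Ioo (-ρ) ρ →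
      |∫ y, k y * deriv η y| ≤ M * √(∫ y, η y ^ 2) := by
    intro η hη hηc hηs
    set ψ := boxFun i c η β with hψd
    have hψs : tsupport ψ ⊆ U := (tsupport_boxFun_subset i c η β).trans fun x hx j =>
      abs_lt.2 ((hx j).elim (fun h => hηs h) fun h => hβs h)
    have hψ : IsBump S ψ := by
      refine ⟨contDiff_boxFun i c hη β.contDiff, ?_, hψs.trans hUdom⟩
      refine Metric.isCompact_of_isClosed_isBounded (isClosed_tsupport _) ?_
      exact hS.out.isBounded.subset (hψs.trans hUdom)
    have h1 := weak_gradient u hψ i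
    have hpd : pd i ψ = boxFun i c (deriv η) β := pd_boxFun i c hη β.contDiff
    have h2 : ∫ x, incl u x * pd i ψ x ∂S.vol = (∫ y, k y * deriv η y) * B1 := by
      rw [hB1, ← integral_boxFun i c]
      rw [← setIntegral_domain_eq ((tsupport_pd_subset ψ i).trans hψ.2.2)]
      · refine integral_congr_ae ?_
        filter_upwards [hu'] with x hx
        rw [hx, hpd, boxFun_eq, boxFun_eq, ← mul_assoc]
        by_cases hxU : x ∈ U
        · rw [hUeq x hxU]
        · have : pd i ψ x = 0 := image_eq_zero_of_notMem_tsupport fun h =>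
            hxU (hψs (tsupport_pd_subset ψ i h))
          rw [hpd, boxFun_eq] at this
          rw [mul_assoc, this, mul_assoc, this, mul_zero, mul_zero]
      · intro x hx
        rw [hpd, boxFun_eq] at hx
        rw [boxFun_eq, mul_assoc, hx, mul_zero]
    have h3 : ∫ x, ψ x ^ 2 ∂S.vol = (∫ y, η y ^ 2) * B2 := by
      rw [setIntegral_sq_le hψ, hB2, ← integral_boxFun i c]
      refine integral_congr_ae (.of_forall fun x => ?_)
      simp only [hψd, boxFun_eq]
      rw [mul_pow, Finset.prod_pow]
    have h4 := abs_integral_mul_le (grad u i) (memLp_of_continuous hψ.1.continuous 2)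
    rw [← abs_neg, ← h1, h2, h3, abs_mul, abs_of_pos hB₁0, Real.sqrt_mul' _ hB₂0] at h4
    rw [hM, div_mul_eq_mul_div, le_div_iff₀ hB₁0]
    linarith
  have hFk : ∀ y, HasDerivAt (fun y => F (s0 + y) - f 0 * y) (k y) y := by
    intro y
    have h1 : HasDerivAt (fun y => F (s0 + y)) (f (s0 + y)) y := (hF _).comp_const_add s0 y
    have h2 := h1.sub ((hasDerivAt_id y).const_mul (f 0))
    rw [mul_one] at h2
    exact h2
  have hhol : ∀ y, |y| < ρ → |k y - k 0| ≤ M * √|y| := by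
    intro y hy
    have hy' := abs_lt.1 hy
    rcases le_total 0 y with h0 | h0
    · have := holder_of_hasDerivAt hFk hM0 hki hweak (s := 0) (t := y) (by linarith) hy'.2 h0
      rwa [abs_sub_comm, sub_zero, show √y = √|y| by rw [abs_of_nonneg h0]] at this
    · have := holder_of_hasDerivAt hFk hM0 hki hweak (s := y) (t := 0) hy'.1 (by linarith) h0
      rwa [zero_sub, show √(-y) = √|y| by rw [abs_of_nonpos h0]] at this
  have hlim : Tendsto (fun y => M * √|y - s0|) (𝓝 s0) (𝓝 0) := by
    have : Continuous fun y : ℝ => M * √|y - s0| := by fun_prop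
    simpa using this.tendsto s0
  rw [ContinuousAt, tendsto_iff_norm_sub_tendsto_zero]
  refine squeeze_zero' (.of_forall fun _ => norm_nonneg _) ?_ hlim
  filter_upwards [ball_mem_nhds s0 hρ] with y hy
  rw [mem_ball, dist_eq] at hy
  simpa [hk] using hhol (y - s0) hy

theorem InV.zero : InV (0 : H S) := ⟨0, map_zero _⟩

theorem InV.add {u v : H S} (hu : InV u) (hv : InV v) : InV (u + v) :=
  ⟨lift u + lift v, by rw [map_add, hu.incl_lift, hv.incl_lift]⟩

theorem InV.smul {u : H S} (c : ℝ) (hu : InV u) : InV (c • u) :=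
  ⟨c • lift u, by rw [map_smul, hu.incl_lift]⟩

theorem InV.sub {u v : H S} (hu : InV u) (hv : InV v) : InV (u - v) :=
  ⟨lift u - lift v, by rw [map_sub, hu.incl_lift, hv.incl_lift]⟩

theorem InV.lift_eq {u : H S} {v : V S} (h : incl v = u) : lift u = v := by rw [← h, lift_incl]

theorem lift_zero : lift (0 : H S) = 0 := InV.lift_eq (map_zero _)

theorem InV.lift_add {u v : H S} (hu : InV u) (hv : InV v) :
    lift (u + v) = lift u + lift v := InV.lift_eq (by rw [map_add, hu.incl_lift, hv.incl_lift])

theorem InV.lift_sub {u v : H S} (hu : InV u) (hv : InV v) :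
    lift (u - v) = lift u - lift v := InV.lift_eq (by rw [map_sub, hu.incl_lift, hv.incl_lift])

theorem InV.lift_smul {u : H S} (c : ℝ) (hu : InV u) :
    lift (c • u) = c • lift u := InV.lift_eq (by rw [map_smul, hu.incl_lift])

theorem IsA.inV {u f : H S} (h : IsA u f) : InV u := let ⟨v, hv, _⟩ := h; ⟨v, hv⟩

theorem IsA.inDA {u f : H S} (h : IsA u f) : InDA u := ⟨f, h⟩

theorem InDA.inV {u : H S} (h : InDA u) : InV u := h.isA.inV

theorem InDA32.inV {u : H S} (h : InDA32 u) : InV u := h.1.inV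

theorem IsA.inner_lift {u f : H S} (h : IsA u f) (z : V S) : ⟪lift u, z⟫ = ⟪f, incl z⟫ := by
  obtain ⟨v, hv, h⟩ := h
  rw [InV.lift_eq hv, h]

theorem InDA.inner_lift {u : H S} (h : InDA u) (z : V S) :
    ⟪lift u, z⟫ = ⟪opA u, incl z⟫ := h.isA.inner_lift z

theorem IsA.sub {u v f g : H S} (hu : IsA u f) (hv : IsA v g) : IsA (u - v) (f - g) := by
  have := hu.add (hv.smul (-1))
  rwa [neg_one_smul, neg_one_smul, ← sub_eq_add_neg, ← sub_eq_add_neg] at this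

theorem InDA.sub {u v : H S} (hu : InDA u) (hv : InDA v) : InDA (u - v) := (hu.isA.sub hv.isA).inDA

theorem InDA.opA_sub {u v : H S} (hu : InDA u) (hv : InDA v) :
    opA (u - v) = opA u - opA v := (hu.isA.sub hv.isA).opA_eq

theorem InDA32.sub {u v : H S} (hu : InDA32 u) (hv : InDA32 v) :
    InDA32 (u - v) := ⟨hu.1.sub hv.1, by rw [hu.1.opA_sub hv.1]; exact hu.2.sub hv.2⟩

theorem InDA32.add {u v : H S} (hu : InDA32 u) (hv : InDA32 v) :
    InDA32 (u + v) := ⟨(hu.1.isA.add hv.1.isA).inDA, by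
    rw [(hu.1.isA.add hv.1.isA).opA_eq]; exact hu.2.add hv.2⟩

theorem InDA32.smul {u : H S} (c : ℝ) (hu : InDA32 u) : InDA32 (c • u) :=
  ⟨(hu.1.isA.smul c).inDA, by rw [(hu.1.isA.smul c).opA_eq]; exact hu.2.smul c⟩

theorem InDA32.inV_lap {u : H S} (h : InDA32 u) : InV (lap u) := h.2.sub h.inV

theorem norm_le_normV {u : H S} (h : InV u) : ‖u‖ ≤ normV u := by
  have := norm_incl_le (lift u)
  rwa [h.incl_lift] at this

theorem InDA.normV_sq_le {u : H S} (h : InDA u) : normV u ^ 2 ≤ ‖u‖ * normDA u := by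
  rw [normV, ← real_inner_self_eq_norm_sq, h.inner_lift, h.inV.incl_lift, mul_comm]
  exact real_inner_le_norm _ _

theorem InDA.normV_le {u : H S} (h : InDA u) : normV u ≤ normDA u := by
  have h1 := h.normV_sq_le
  have h2 := norm_le_normV h.inV
  have h3 : 0 ≤ normDA u := norm_nonneg _
  have h4 : 0 ≤ normV u := norm_nonneg _
  rcases h4.eq_or_lt with h0 | h0
  · rw [← h0]; exact h3
  · have := mul_le_mul_of_nonneg_right h2 h3
    nlinarith

theorem InDA32.normDA_sq_le {u : H S} (h : InDA32 u) : normDA u ^ 2 ≤ normV u * ‖lift (opA u)‖ := by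
  have h1 := h.1.inner_lift (lift (opA u))
  rw [h.2.incl_lift, real_inner_self_eq_norm_sq] at h1
  rw [normDA, ← h1]
  exact real_inner_le_norm _ _

theorem InDA32.normDA_le {u : H S} (h : InDA32 u) : normDA u ≤ ‖lift (opA u)‖ := norm_le_normV h.2

theorem lapV_apply (u z : V S) : lapV u z = ⟪grad u, grad z⟫ := rfl

theorem lapV_apply' (u z : V S) : lapV u z = ⟪u, z⟫ - ⟪incl u, incl z⟫ := by
  rw [lapV_apply, inner_V]; ring

theorem lapV_add (u v : V S) : lapV (u + v) = lapV u + lapV v := by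
  ext z; simp [lapV_apply, inner_add_left]

theorem lapV_sub (u v : V S) : lapV (u - v) = lapV u - lapV v := by
  ext z; simp [lapV_apply, inner_sub_left]

theorem lapV_smul (c : ℝ) (u : V S) : lapV (c • u) = c • lapV u := by
  ext z; simp [lapV_apply, real_inner_smul_left]

theorem abs_lapV_le (u z : V S) : |lapV u z| ≤ ‖grad u‖ * ‖grad z‖ := by
  rw [lapV_apply]
  exact abs_real_inner_le_norm _ _

theorem norm_lapV_le_grad (u : V S) : ‖lapV u‖ ≤ ‖grad u‖ := by
  refine opNorm_le_bound _ (norm_nonneg _) fun z => ?_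
  exact (abs_lapV_le u z).trans (mul_le_mul_of_nonneg_left (norm_grad_le z) (norm_nonneg _))

theorem norm_lapV_le (u : V S) : ‖lapV u‖ ≤ ‖u‖ := (norm_lapV_le_grad u).trans (norm_grad_le u)

theorem pivot_apply (u : H S) (z : V S) : pivot u z = ⟪u, incl z⟫ := rfl

theorem norm_pivot_le (u : H S) : ‖pivot u‖ ≤ ‖u‖ := by
  refine opNorm_le_bound _ (norm_nonneg _) fun z => ?_
  exact (abs_real_inner_le_norm _ _).trans
    (mul_le_mul_of_nonneg_left (norm_incl_le z) (norm_nonneg _))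

theorem InDA.lapV_lift {u : H S} (h : InDA u) : lapV (lift u) = pivot (lap u) := by
  ext z
  rw [lapV_apply', h.inner_lift, h.inV.incl_lift, pivot_apply, lap, inner_sub_left]

/-- The norm of `V` is controlled by the gradient and the norm of `V'`. -/
theorem norm_V_le (v : V S) : ‖v‖ ≤ ‖grad v‖ + ‖pivot (incl v)‖ := by
  have h1 := norm_sq_V v
  have h2 : ‖incl v‖ ^ 2 ≤ ‖pivot (incl v)‖ * ‖v‖ := by
    rw [← real_inner_self_eq_norm_sq, ← pivot_apply]
    exact (le_abs_self _).trans ((pivot (incl v)).le_opNorm v)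
  have h3 := norm_nonneg (grad v)
  have h4 := norm_nonneg (pivot (incl v))
  have h5 := norm_nonneg v
  by_contra hlt
  push Not at hlt
  nlinarith

theorem norm_V_le_lapV (v : V S) : ‖v‖ ≤ ‖lapV v‖ + ‖pivot (incl v)‖ := by
  have h : ‖v‖ ^ 2 ≤ (‖lapV v‖ + ‖pivot (incl v)‖) * ‖v‖ := by
    have h1 : ‖v‖ ^ 2 = lapV v v + pivot (incl v) v := by
      rw [lapV_apply', pivot_apply, real_inner_self_eq_norm_sq]; ring
    rw [h1, add_mul]
    exact add_le_add ((le_abs_self _).trans ((lapV v).le_opNorm v))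
      ((le_abs_self _).trans ((pivot (incl v)).le_opNorm v))
  rcases (norm_nonneg v).eq_or_lt with h0 | h0
  · rw [← h0]; positivity
  · nlinarith

section Eigenbasis

variable {e : ℕ → H S} {μ : ℕ → ℝ}

namespace IsEigenbasis

section

variable (hE : IsEigenbasis S e μ)
include hE

theorem inV (k : ℕ) : InV (e k) := (hE.2.2.2 k).inV

theorem incl_lift (k : ℕ) : incl (lift (e k)) = e k := (hE.inV k).incl_lift

theorem inner_lift (k : ℕ) (v : V S) : ⟪lift (e k), v⟫ = μ k * ⟪e k, incl v⟫ := by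
  rw [(hE.2.2.2 k).inner_lift, real_inner_smul_left]

theorem inner_lift' (k : ℕ) (v : V S) : ⟪v, lift (e k)⟫ = μ k * ⟪incl v, e k⟫ := by
  rw [real_inner_comm, hE.inner_lift, real_inner_comm]

theorem norm_lift_sq (k : ℕ) : ‖lift (e k)‖ ^ 2 = μ k := by
  rw [← real_inner_self_eq_norm_sq, hE.inner_lift, hE.incl_lift, real_inner_self_eq_norm_sq,
    hE.1.1 k]
  ring

theorem one_le (k : ℕ) : 1 ≤ μ k := by
  rw [← hE.norm_lift_sq k]
  have := norm_incl_le (lift (e k))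
  rw [hE.incl_lift, hE.1.1 k] at this
  exact one_le_pow₀ this

theorem pos (k : ℕ) : 0 < μ k := one_pos.trans_le (hE.one_le k)

/-- The eigenfunctions as a Hilbert basis of `H`. -/
def basis : HilbertBasis ℕ ℝ (H S) := HilbertBasis.mk hE.1 hE.2.1.ge

theorem basis_apply (k : ℕ) : hE.basis k = e k := by simp [basis]

theorem hasSum_sq (u : H S) : HasSum (fun k => ⟪u, e k⟫ ^ 2) (‖u‖ ^ 2) := by
  have := hE.basis.hasSum_inner_mul_inner u u
  rw [real_inner_self_eq_norm_sq] at this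
  refine this.congr_fun (fun k => ?_) |> fun h => h
  rw [basis_apply, real_inner_comm u, sq]

theorem ext {u v : H S} (h : ∀ k, ⟪u, e k⟫ = ⟪v, e k⟫) : u = v := by
  rw [← sub_eq_zero, ← norm_eq_zero, ← sq_eq_zero_iff]
  refine (hE.hasSum_sq (u - v)).unique ?_
  simp [inner_sub_left, h, hasSum_zero]

theorem orthonormal_V : Orthonormal ℝ fun k => (√(μ k))⁻¹ • lift (e k) := by
  rw [orthonormal_iff_ite]
  intro i j
  rw [real_inner_smul_left, real_inner_smul_right, hE.inner_lift, hE.incl_lift,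
    orthonormal_iff_ite.1 hE.1 i j]
  split_ifs with h
  · subst h
    have h0 := sqrt_pos.2 (hE.pos i)
    have h1 := Real.mul_self_sqrt (hE.pos i).le
    field_simp
    nlinarith
  · simp

theorem ext_V {u v : V S} (h : ∀ k, ⟪u, lift (e k)⟫ = ⟪v, lift (e k)⟫) : u = v := by
  refine incl_injective (hE.ext fun k => ?_)
  have := h k
  rw [hE.inner_lift', hE.inner_lift'] at this
  exact mul_left_cancel₀ (hE.pos k).ne' this

/-- The normalized eigenfunctions as a Hilbert basis of `V`. -/
def basisV : HilbertBasis ℕ ℝ (V S) := HilbertBasis.mkOfOrthogonalEqBot (hE.orthonormal_V) (by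
    rw [Submodule.eq_bot_iff]
    intro v hv
    refine hE.ext_V fun k => ?_
    rw [inner_zero_left, real_inner_comm]
    have h1 := (Submodule.mem_orthogonal _ _).1 hv _ (subset_span (mem_range_self k))
    rw [real_inner_smul_left] at h1
    exact (mul_eq_zero.1 h1).resolve_left (inv_ne_zero (sqrt_pos.2 (hE.pos k)).ne'))

theorem basisV_apply (k : ℕ) : hE.basisV k = (√(μ k))⁻¹ • lift (e k) := by simp [basisV]

theorem hasSum_V (v : V S) : HasSum (fun k => μ k * ⟪incl v, e k⟫ ^ 2) (‖v‖ ^ 2) := by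
  have := (hE.basisV).hasSum_inner_mul_inner v v
  rw [real_inner_self_eq_norm_sq] at this
  refine this.congr_fun fun k => ?_
  rw [basisV_apply, real_inner_smul_left, real_inner_smul_right, hE.inner_lift,
    hE.inner_lift', real_inner_comm (incl v)]
  have h0 := sqrt_pos.2 (hE.pos k)
  have h1 := sq_sqrt (hE.pos k).le
  field_simp
  rw [h1]
  ring

theorem tendsto_atTop (hd : 1 ≤ d) : Tendsto μ atTop atTop := by
  have h := tendsto_norm_incl hd (z := fun k => (√(μ k))⁻¹ • lift (e k)) (R := 1)
    (fun n => ((hE.orthonormal_V).1 n).le) (fun w => by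
      have := ((hE.orthonormal_V).inner_products_summable w).tendsto_atTop_zero
      rw [tendsto_zero_iff_norm_tendsto_zero]
      have h2 := this.sqrt
      simp only [sqrt_sq (norm_nonneg _), Real.sqrt_zero] at h2
      exact h2)
  have h2 : (fun k => ‖incl ((√(μ k))⁻¹ • lift (e k))‖) = fun k => (√(μ k))⁻¹ := by
    funext k
    rw [map_smul, hE.incl_lift, norm_smul, hE.1.1 k, mul_one, norm_of_nonneg (by positivity)]
  rw [h2] at h
  have h3 : Tendsto (fun k => √(μ k)) atTop atTop := by
    have h4 : Tendsto (fun k => (√(μ k))⁻¹) atTop (𝓝[>] 0) :=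
      tendsto_nhdsWithin_iff.2 ⟨h, .of_forall fun k => by
        have := sqrt_pos.2 (hE.pos k)
        simpa using this⟩
    exact h4.inv_tendsto_nhdsGT_zero.congr fun k => by simp
  refine tendsto_atTop_mono (fun k => ?_) h3
  have h1 := hE.one_le k
  rw [Real.sqrt_le_left (by linarith)]
  nlinarith

end

end IsEigenbasis

end Eigenbasis

variable {e : ℕ → H S} {μ : ℕ → ℝ}

/-- The orthogonal projection of `H` onto the span of the first `N` eigenfunctions. -/
def projH (e : ℕ → H S) (N : ℕ) : H S →L[ℝ] H S :=
  ∑ k ∈ Finset.range N, (innerSL ℝ (e k)).smulRight (e k)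

/-- The orthogonal projection of `V` onto the span of the first `N` eigenfunctions. -/
def projV (e : ℕ → H S) (N : ℕ) : V S →L[ℝ] V S :=
  ∑ k ∈ Finset.range N, ((innerSL ℝ (e k)) ∘L incl).smulRight (lift (e k))

theorem projH_apply (N : ℕ) (u : H S) : projH e N u = ∑ k ∈ Finset.range N, ⟪e k, u⟫ • e k := by
  simp [projH, sum_apply]

theorem projV_apply (N : ℕ) (v : V S) :
    projV e N v = ∑ k ∈ Finset.range N, ⟪e k, incl v⟫ • lift (e k) := by simp [projV, sum_apply]

namespace IsEigenbasis

section

variable (hE : IsEigenbasis S e μ)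
include hE

theorem inner_sum (N : ℕ) (c : ℕ → ℝ) (k : ℕ) :
    ⟪∑ j ∈ Finset.range N, c j • e j, e k⟫ = if k < N then c k else 0 := by
  rw [sum_inner]
  simp only [real_inner_smul_left, orthonormal_iff_ite.1 hE.1]
  simp

theorem inner_galProj (N : ℕ) (ℓ : V' S) (k : ℕ) :
    ⟪galProj e N ℓ, e k⟫ = if k < N then ℓ (lift (e k)) else 0 :=
  hE.inner_sum N (fun k => ℓ (lift (e k))) k

theorem inner_projH (N : ℕ) (u : H S) (k : ℕ) :
    ⟪projH e N u, e k⟫ = if k < N then ⟪u, e k⟫ else 0 := by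
  rw [projH_apply, hE.inner_sum N (fun k => ⟪e k, u⟫) k]
  simp [real_inner_comm]

theorem galProj_pivot (N : ℕ) (u : H S) : galProj e N (pivot u) = projH e N u := by
  rw [projH_apply, galProj]
  refine Finset.sum_congr rfl fun k _ => ?_
  rw [pivot_apply, hE.incl_lift, real_inner_comm]

theorem incl_projV (N : ℕ) (v : V S) : incl (projV e N v) = projH e N (incl v) := by
  rw [projV_apply, projH_apply, map_sum]
  refine Finset.sum_congr rfl fun k _ => ?_
  rw [map_smul, hE.incl_lift]

theorem pivot_galProj (N : ℕ) (ℓ : V' S) : pivot (galProj e N ℓ) = ℓ ∘L projV e N := by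
  ext z
  rw [pivot_apply, galProj, sum_inner, comp_apply, projV_apply, map_sum]
  refine Finset.sum_congr rfl fun k _ => ?_
  rw [real_inner_smul_left, map_smul, smul_eq_mul, mul_comm]

theorem norm_projH_le (N : ℕ) (u : H S) : ‖projH e N u‖ ≤ ‖u‖ := by
  rw [← abs_norm, ← abs_norm u, ← sq_le_sq]
  refine hasSum_le (fun k => ?_) (hE.hasSum_sq _) (hE.hasSum_sq u)
  rw [hE.inner_projH]
  split_ifs
  · exact le_rfl
  · simpa using sq_nonneg _

theorem norm_projV_le (N : ℕ) (v : V S) : ‖projV e N v‖ ≤ ‖v‖ := by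
  rw [← abs_norm, ← abs_norm v, ← sq_le_sq]
  refine hasSum_le (fun k => ?_) (hE.hasSum_V _) (hE.hasSum_V v)
  rw [hE.incl_projV, hE.inner_projH]
  have := hE.pos k
  split_ifs
  · exact le_rfl
  · rw [zero_pow two_ne_zero, mul_zero]; positivity

theorem norm_pivot_galProj_le (N : ℕ) (ℓ : V' S) : ‖pivot (galProj e N ℓ)‖ ≤ ‖ℓ‖ := by
  rw [hE.pivot_galProj]
  refine opNorm_le_bound _ (norm_nonneg _) fun z => ?_
  exact (ℓ.le_opNorm _).trans (mul_le_mul_of_nonneg_left (hE.norm_projV_le N z) (norm_nonneg _))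

theorem mem_galSpan_iff (N : ℕ) (u : H S) : u ∈ galSpan e N ↔ projH e N u = u := by
  constructor
  · intro h
    refine Submodule.span_induction (p := fun u _ => projH e N u = u) ?_ (map_zero _) ?_ ?_ h
    · rintro _ ⟨k, hk, rfl⟩
      refine hE.ext fun j => ?_
      rw [hE.inner_projH]
      split_ifs with hj
      · rfl
      · rw [orthonormal_iff_ite.1 hE.1, if_neg]
        rintro rfl
        exact hj hk
    · intro x y _ _ hx hy
      rw [map_add, hx, hy]
    · intro c x _ hx
      rw [map_smul, hx]
  · intro h
    rw [← h, projH_apply]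
    exact Submodule.sum_mem _ fun k hk => Submodule.smul_mem _ _
      (subset_span ⟨k, Finset.mem_range.1 hk, rfl⟩)

end

theorem galProj_mem (N : ℕ) (ℓ : V' S) : galProj e N ℓ ∈ galSpan e N :=
  Submodule.sum_mem _ fun k hk => Submodule.smul_mem _ _
      (subset_span ⟨k, Finset.mem_range.1 hk, rfl⟩)

section

variable (hE : IsEigenbasis S e μ)
include hE

theorem projH_mem (N : ℕ) (u : H S) : projH e N u ∈ galSpan e N := by
  rw [← hE.galProj_pivot]; exact galProj_mem N _

theorem lift_projH {u : H S} (h : InV u) (N : ℕ) :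
    lift (projH e N u) = projV e N (lift u) := InV.lift_eq (by rw [hE.incl_projV, h.incl_lift])

theorem inner_opA {u : H S} (h : InDA u) (k : ℕ) : ⟪opA u, e k⟫ = μ k * ⟪u, e k⟫ := by
  rw [← hE.incl_lift k, ← h.inner_lift, hE.inner_lift', h.inV.incl_lift, hE.incl_lift]

theorem isA_projH (N : ℕ) (u : H S) :
    IsA (projH e N u) (∑ k ∈ Finset.range N, (μ k * ⟪e k, u⟫) • e k) := by
  refine ⟨∑ k ∈ Finset.range N, ⟪e k, u⟫ • lift (e k), ?_, fun z => ?_⟩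
  · rw [map_sum, projH_apply]
    refine Finset.sum_congr rfl fun k _ => ?_
    rw [map_smul, hE.incl_lift]
  · rw [sum_inner, sum_inner]
    refine Finset.sum_congr rfl fun k _ => ?_
    rw [real_inner_smul_left, real_inner_smul_left, hE.inner_lift]
    ring

theorem opA_projH_mem (N : ℕ) (u : H S) : opA (projH e N u) ∈ galSpan e N := by
  rw [(hE.isA_projH N u).opA_eq]
  exact Submodule.sum_mem _ fun k hk => Submodule.smul_mem _ _
      (subset_span ⟨k, Finset.mem_range.1 hk, rfl⟩)

theorem inV_of_mem {N : ℕ} {u : H S} (h : u ∈ galSpan e N) : InV u := by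
  rw [← (hE.mem_galSpan_iff N u).1 h]; exact (hE.isA_projH N u).inV

theorem opA_mem {N : ℕ} {u : H S} (h : u ∈ galSpan e N) : opA u ∈ galSpan e N := by
  have := hE.opA_projH_mem N u
  rwa [(hE.mem_galSpan_iff N u).1 h] at this

theorem inDA32_of_mem {N : ℕ} {u : H S} (h : u ∈ galSpan e N) : InDA32 u :=
  ⟨by rw [← (hE.mem_galSpan_iff N u).1 h]; exact (hE.isA_projH N u).inDA,
    hE.inV_of_mem (hE.opA_mem h)⟩

theorem lap_mem {N : ℕ} {u : H S}
    (h : u ∈ galSpan e N) : lap u ∈ galSpan e N := Submodule.sub_mem _ (hE.opA_mem h) h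

theorem opA_projH {u : H S} (h : InDA u) (N : ℕ) : opA (projH e N u) = projH e N (opA u) := by
  refine hE.ext fun k => ?_
  rw [hE.inner_opA (hE.isA_projH N u).inDA, hE.inner_projH, hE.inner_projH, hE.inner_opA h]
  simp

theorem lap_projH {u : H S} (h : InDA u) (N : ℕ) :
    lap (projH e N u) = projH e N (lap u) := by rw [lap, lap, hE.opA_projH h, map_sub]

theorem inner_galProj_of_mem {N : ℕ} {u : H S}
    (h : u ∈ galSpan e N) (ℓ : V' S) : ⟪u, galProj e N ℓ⟫ = ℓ (lift u) := by
  have h1 := (hE.mem_galSpan_iff N u).1 h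
  have h2 : ⟪galProj e N ℓ, incl (lift u)⟫ = ℓ (projV e N (lift u)) := by
    rw [← pivot_apply, hE.pivot_galProj]; rfl
  rw [← hE.lift_projH (hE.inV_of_mem h), h1, (hE.inV_of_mem h).incl_lift] at h2
  rw [real_inner_comm, h2]

theorem galProj_lapV {N : ℕ} {u : H S}
    (h : u ∈ galSpan e N) : galProj e N (lapV (lift u)) = lap u := by
  rw [(hE.inDA32_of_mem h).1.lapV_lift, hE.galProj_pivot]
  exact (hE.mem_galSpan_iff N _).1 (hE.lap_mem h)

/-- The Laplacian commutes with the projections. -/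
theorem lapV_projV (N : ℕ) (u z : V S) : lapV (projV e N u) z = lapV u (projV e N z) := by
  rw [lapV_apply', lapV_apply', hE.incl_projV, hE.incl_projV, projV_apply, projV_apply,
    projH_apply, projH_apply]
  simp only [sum_inner, _root_.inner_sum, real_inner_smul_left, real_inner_smul_right,
    hE.inner_lift, hE.inner_lift']
  congr 1 <;> refine Finset.sum_congr rfl fun k _ => ?_ <;>
    rw [real_inner_comm (incl u)] <;> ring

theorem hasSum_DA {u : H S} (h : InDA u) :
    HasSum (fun k => μ k ^ 2 * ⟪u, e k⟫ ^ 2) (normDA u ^ 2) := by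
  refine (hE.hasSum_sq (opA u)).congr_fun fun k => ?_
  rw [hE.inner_opA h]
  ring

theorem inner_sub_projH (N : ℕ) (u : H S) (k : ℕ) :
    ⟪u - projH e N u, e k⟫ = if k < N then 0 else ⟪u, e k⟫ := by
  rw [inner_sub_left, hE.inner_projH]
  split_ifs <;> simp

theorem sq_norm_sub_projH_le (N : ℕ) (v : V S) :
    μ N * ‖incl v - projH e N (incl v)‖ ^ 2 ≤ ‖v‖ ^ 2 := by
  refine hasSum_le (fun k => ?_) ((hE.hasSum_sq _).mul_left (μ N)) (hE.hasSum_V v)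
  rw [hE.inner_sub_projH]
  have := hE.pos k
  split_ifs with hk
  · rw [zero_pow two_ne_zero, mul_zero]; positivity
  · exact mul_le_mul_of_nonneg_right (hE.2.2.1 (not_lt.1 hk)) (sq_nonneg _)

theorem sq_normV_sub_projH_le (N : ℕ) {u : H S}
    (h : InDA u) : μ N * normV (u - projH e N u) ^ 2 ≤ normDA u ^ 2 := by
  have hV : InV (u - projH e N u) := h.inV.sub (hE.isA_projH N u).inV
  refine hasSum_le (fun k => ?_) ((hE.hasSum_V (lift (u - projH e N u))).mul_left (μ N))
    (hE.hasSum_DA h)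
  rw [hV.incl_lift, hE.inner_sub_projH]
  have := hE.pos k
  split_ifs with hk
  · rw [zero_pow two_ne_zero, mul_zero, mul_zero]; positivity
  · have := mul_le_mul_of_nonneg_right (hE.2.2.1 (not_lt.1 hk))
      (by positivity : 0 ≤ μ k * ⟪u, e k⟫ ^ 2)
    nlinarith

end

end IsEigenbasis

theorem RepresentsDual.unique {φ : E d → ℝ} {ℓ1 ℓ2 : V' S} (h1 : RepresentsDual φ ℓ1)
    (h2 : RepresentsDual φ ℓ2) : ℓ1 = ℓ2 := by ext z; rw [(h1 z).2, (h2 z).2]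

theorem RepresentsDual.toV'_eq {φ : E d → ℝ} {ℓ : V' S} (h : RepresentsDual φ ℓ) :
    toV' S φ = ℓ := by
  have hex : ∃ ℓ : V' S, RepresentsDual φ ℓ := ⟨ℓ, h⟩
  rw [toV', dif_pos hex]
  exact hex.choose_spec.unique h

theorem RepresentsDual.sub {φ ψ : E d → ℝ} {ℓ m : V' S} (h1 : RepresentsDual φ ℓ)
    (h2 : RepresentsDual ψ m) : RepresentsDual (fun x => φ x - ψ x) (ℓ - m) := by
  intro z
  have e : (fun x => (φ x - ψ x) * incl z x) = fun x => φ x * incl z x - ψ x * incl z x := by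
    funext x; ring
  rw [e]
  refine ⟨(h1 z).1.sub (h2 z).1, ?_⟩
  rw [integral_sub (h1 z).1 (h2 z).1, sub_apply, (h1 z).2, (h2 z).2]

theorem representsDual_pivot {φ : E d → ℝ} {u : H S} (hu : ⇑u =ᵐ[S.vol] φ) :
    RepresentsDual φ (pivot u) := by
  intro z
  constructor
  · refine ((Lp.memLp u).integrable_mul (Lp.memLp (incl z))).congr ?_
    filter_upwards [hu] with x hx
    simp [hx]
  · rw [pivot_apply, real_inner_comm, inner_eq_integral hu]
    simp only [mul_comm]

theorem toH_eq {φ : E d → ℝ} (hφ : MemLp φ 2 S.vol) : ⇑(toH S φ) =ᵐ[S.vol] φ := by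
  rw [toH, dif_pos hφ]
  exact hφ.coeFn_toLp

/-- The function `f(v)` in `H`. -/
def fH (f : ℝ → ℝ) (v : H S) : H S := toH S fun x => f (v x)

/-- The functional `g(v)` in `V'`. -/
def gD (g : ℝ → ℝ) (v : H S) : V' S := toV' S fun x => g (v x)

/-- The factor in the local Lipschitz estimates. -/
def lipFactor (v w : H S) : ℝ := (1 + (normV v + normV w)) * (1 + (normDA v + normDA w))

/-- The properties of the nonlinearities that are used in the analysis of the system. -/
structure NonlinearBounds (S : Setting d) (f g : ℝ → ℝ) (C : ℝ) : Prop where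
  nonneg : 0 ≤ C
  inV : ∀ v : H S, InDA32 v → InV (fH f v)
  coe : ∀ v : H S, InDA32 v → ⇑(fH f v) =ᵐ[S.vol] fun x => f (v x)
  f_le : ∀ v : H S, InDA32 v → ‖pivot (fH f v)‖ ≤ C * normV v * (1 + ‖v‖ * normV v)
  f_lap : ∀ v : H S, InDA32 v → -⟪fH f v, lap v⟫ ≤ C * normDA v * normV v
  g_le : ∀ v : H S, InDA32 v → ‖gD g v‖ ≤ C * normV v * (1 + ‖v‖ * normV v)
  g_self : ∀ v : H S, InDA32 v → -gD g v (lift v) ≤ C * normDA v * normV v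
  f_sub : ∀ v w : H S, InDA32 v → InDA32 w →
    ‖lapV (lift (fH f v)) - lapV (lift (fH f w))‖ ≤ C * lipFactor v w * normV (v - w)
  g_sub : ∀ v w : H S, InDA32 v → InDA32 w → ‖gD g v - gD g w‖ ≤ C * lipFactor v w * normV (v - w)

theorem normV_nonneg (v : H S) : 0 ≤ normV v := norm_nonneg _

theorem normDA_nonneg (v : H S) : 0 ≤ normDA v := norm_nonneg _

theorem pairNorm_le {a b : ℝ} (ha : 0 ≤ a) (hb : 0 ≤ b) : pairNorm a b ≤ a + b := by
  rw [pairNorm, Real.sqrt_le_left (by positivity)]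
  nlinarith [mul_nonneg ha hb]

theorem factor_le (C : ℝ) (hC : 0 ≤ C) (v w : H S) :
    C * (1 + pairNorm (normV v) (normV w)) * (1 + pairNorm (normDA v) (normDA w)) *
      normV (v - w) ≤ C * lipFactor v w * normV (v - w) := by
  have h1 := pairNorm_le (normV_nonneg v) (normV_nonneg w)
  have h2 := pairNorm_le (normDA_nonneg v) (normDA_nonneg w)
  have h3 : 0 ≤ pairNorm (normDA v) (normDA w) := sqrt_nonneg _
  have h5 : 0 ≤ pairNorm (normV v) (normV w) := sqrt_nonneg _
  have h6 := normV_nonneg v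
  have h7 := normV_nonneg w
  have h4 := normV_nonneg (v - w)
  rw [lipFactor, ← mul_assoc]
  gcongr

theorem exists_one_not_zero {c : ℝ} (h : ∀ z : V S, ∫ x, c * incl z x ∂S.vol = 0) : c = 0 := by
  have hm : MemLp (fun _ : E d => c) 2 S.vol := memLp_const c
  have h0 : hm.toLp (fun _ : E d => c) = 0 := by
    refine eq_zero_of_forall_inner_incl fun z => ?_
    rw [real_inner_comm, inner_eq_integral hm.coeFn_toLp, ← h z]
    simp only [mul_comm]
  have h1 := norm_toLp_sq hm
  rw [h0, norm_zero, zero_pow two_ne_zero] at h1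
  simp only [integral_const, smul_eq_mul] at h1
  have h2 : S.vol.real univ = volume.real S.domain := by simp [Setting.vol, Measure.real]
  rw [h2] at h1
  have := volume_real_pos (S := S)
  have h3 := (mul_eq_zero.1 h1.symm).resolve_left this.ne'
  exact pow_eq_zero_iff (two_ne_zero) |>.1 h3

theorem GrowthAssumption.f_zero {F f g : ℝ → ℝ} (h : GrowthAssumption S F f g) : f 0 = 0 := by
  obtain ⟨-, -, -, ⟨C, hC, hf⟩, -⟩ := h
  obtain ⟨-, ⟨ℓ, hℓ, hn⟩, -⟩ := hf 0 ⟨0, isA_zero⟩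
  have h0 : normV (0 : H S) = 0 := by rw [normV, lift_zero, norm_zero]
  rw [h0] at hn
  have hℓ0 : ℓ = 0 := by
    rw [← norm_eq_zero, ← sq_eq_zero_iff]
    exact le_antisymm (by simpa using hn) (sq_nonneg _)
  refine exists_one_not_zero (S := S) fun z => ?_
  have h1 := (hℓ z).2
  rw [hℓ0, zero_apply] at h1
  refine Eq.trans (integral_congr_ae ?_) h1.symm
  filter_upwards [Lp.coeFn_zero ℝ 2 S.vol] with x hx
  rw [hx]; rfl

theorem le_of_sq_growth {C V h n : ℝ} (hC : 0 ≤ C) (hV : 0 ≤ V) (hh : 0 ≤ h)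
    (hn : n ^ 2 ≤ C * V ^ 2 * (1 + h ^ 2 * V ^ 2)) : n ≤ (1 + C) * V * (1 + h * V) := by
  refine abs_le_of_sq_le_sq' (hn.trans ?_) (by positivity) |>.2
  have h1 : (0 : ℝ) ≤ h * V := by positivity
  have h2 : 1 + h ^ 2 * V ^ 2 ≤ (1 + h * V) ^ 2 := by nlinarith
  have h3 : C ≤ (1 + C) ^ 2 := by nlinarith
  calc C * V ^ 2 * (1 + h ^ 2 * V ^ 2) ≤ (1 + C) ^ 2 * V ^ 2 * (1 + h * V) ^ 2 := by gcongr
    _ = _ := by ring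

theorem exists_nonlinearBounds {F f g : ℝ → ℝ}
    (hG : GrowthAssumption S F f g) (hD : DifferenceAssumption S f g) :
    ∃ C, NonlinearBounds S f g C := by
  have hf0 := hG.f_zero
  obtain ⟨-, -, -, ⟨C1, hC1, hf⟩, ⟨C2, hC2, hg⟩⟩ := hG
  obtain ⟨⟨C3, hC3, hfd⟩, ⟨C4, hC4, hgd⟩⟩ := hD
  have hcoe : ∀ v : H S, InDA v → ⇑(fH f v) =ᵐ[S.vol] fun x => f (v x) := fun v hv =>
    toH_eq (hf v hv).1
  have hsub : ∀ v w : H S, InDA32 v → InDA32 w → ∃ u : V S, incl u = fH f v - fH f w ∧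
      ‖lapV u‖ ≤ C3 * (1 + pairNorm (normV v) (normV w)) *
        (1 + pairNorm (normDA v) (normDA w)) * normV (v - w) := by
    intro v w hv hw
    obtain ⟨u, hu, hle⟩ := hfd v w hv hw
    refine ⟨u, Lp.ext ?_, hle⟩
    filter_upwards [hu, Lp.coeFn_sub (fH f v) (fH f w), hcoe v hv.1, hcoe w hw.1] with x h1 h2 h3 h4
    rw [h1, h2, Pi.sub_apply, h3, h4]
  have hzero : fH f (0 : H S) = 0 := by
    refine Lp.ext ?_
    filter_upwards [hcoe 0 ⟨0, isA_zero⟩, Lp.coeFn_zero ℝ 2 S.vol] with x h1 h2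
    rw [h1, h2]; simp [hf0]
  have hinV : ∀ v : H S, InDA32 v → InV (fH f v) := by
    intro v hv
    obtain ⟨u, hu, -⟩ := hsub v 0 hv (inDA32_zero)
    exact ⟨u, by rw [hu, hzero, sub_zero]⟩
  have hp : ∀ v : H S, 0 ≤ normDA v * normV v := fun v =>
    mul_nonneg (normDA_nonneg v) (normV_nonneg v)
  obtain ⟨K, hK, hK1, hK2, hK3, hK4⟩ : ∃ K, 0 ≤ K ∧ 1 + C1 ≤ K ∧ 1 + C2 ≤ K ∧ C3 ≤ K ∧ C4 ≤ K :=
    ⟨(1 + C1) + (1 + C2) + C3 + C4, by positivity, by linarith, by linarith, by linarith,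
      by linarith⟩
  refine ⟨K, hK, hinV, fun v hv => hcoe v hv.1, ?_, ?_, ?_, ?_, ?_, ?_⟩
  · intro v hv
    obtain ⟨-, ⟨ℓ, hℓ, hn⟩, -⟩ := hf v hv.1
    rw [(representsDual_pivot (hcoe v hv.1)).unique hℓ]
    refine (le_of_sq_growth hC1 (normV_nonneg v) (norm_nonneg v) hn).trans ?_
    have := normV_nonneg v
    gcongr
  · intro v hv
    have h1 := (hf v hv.1).2.2
    have h2 : ⟪fH f v, lap v⟫ = ∫ x, f (v x) * lap v x ∂S.vol := by
      rw [real_inner_comm, inner_eq_integral (hcoe v hv.1)]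
      simp only [mul_comm]
    rw [h2]
    refine h1.trans ?_
    have := normV_nonneg v
    have := normDA_nonneg v
    gcongr; linarith
  · intro v hv
    obtain ⟨⟨ℓ, hℓ, hn⟩, -⟩ := hg v hv.1
    rw [gD, hℓ.toV'_eq]
    refine (le_of_sq_growth hC2 (normV_nonneg v) (norm_nonneg v) hn).trans ?_
    have := normV_nonneg v
    gcongr
  · intro v hv
    obtain ⟨⟨ℓ, hℓ, -⟩, hn⟩ := hg v hv.1
    have h2 := (hℓ (lift v)).2
    rw [hv.inV.incl_lift] at h2
    rw [gD, hℓ.toV'_eq, h2]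
    refine hn.trans ?_
    have := normV_nonneg v
    have := normDA_nonneg v
    gcongr; linarith
  · intro v w hv hw
    obtain ⟨u, hu, hle⟩ := hsub v w hv hw
    rw [← lapV_sub, ← InV.lift_sub (hinV v hv) (hinV w hw), ← hu, lift_incl]
    refine (hle.trans (factor_le C3 hC3 v w)).trans ?_
    have h1 := normV_nonneg (v - w)
    have h2 : 0 ≤ lipFactor v w := by
      have := normV_nonneg v; have := normV_nonneg w
      have := normDA_nonneg v; have := normDA_nonneg w
      unfold lipFactor; positivity
    gcongr
  · intro v w hv hw
    obtain ⟨ℓ, hℓ, hle⟩ := hgd v w hv hw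
    obtain ⟨⟨ℓ1, hℓ1, -⟩, -⟩ := hg v hv.1
    obtain ⟨⟨ℓ2, hℓ2, -⟩, -⟩ := hg w hw.1
    rw [gD, gD, hℓ1.toV'_eq, hℓ2.toV'_eq, (hℓ1.sub hℓ2).unique hℓ]
    refine (hle.trans (factor_le C4 hC4 v w)).trans ?_
    have h1 := normV_nonneg (v - w)
    have h2 : 0 ≤ lipFactor v w := by
      have := normV_nonneg v; have := normV_nonneg w
      have := normDA_nonneg v; have := normDA_nonneg w
      unfold lipFactor; positivity
    gcongr

theorem NonlinearBounds.f_zero {f g : ℝ → ℝ} {C : ℝ} (hN : NonlinearBounds S f g C) : lift (fH f (0 : H S)) = 0 := by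
  have h1 := hN.f_le 0 (inDA32_zero)
  rw [normV, lift_zero, norm_zero] at h1
  have h2 : pivot (fH f (0 : H S)) = 0 := norm_le_zero_iff.1 (h1.trans (by simp))
  have h3 : fH f (0 : H S) = 0 := eq_zero_of_forall_inner_incl fun z => by
    rw [← pivot_apply, h2]; rfl
  rw [h3, lift_zero]

theorem NonlinearBounds.lapV_f_le {f g : ℝ → ℝ} {C : ℝ} (hN : NonlinearBounds S f g C) {v : H S} (hv : InDA32 v) :
    ‖lapV (lift (fH f v))‖ ≤ C * ((1 + normV v) * (1 + normDA v)) * normV v := by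
  have h1 := hN.f_sub v 0 hv (inDA32_zero)
  have h0 : lapV (lift (fH f (0 : H S))) = 0 := by rw [hN.f_zero]; ext z; simp [lapV_apply]
  have h2 : normV (0 : H S) = 0 := by rw [normV, lift_zero, norm_zero]
  have h3 : normDA (0 : H S) = 0 := by rw [normDA, isA_zero.opA_eq, norm_zero]
  rwa [h0, sub_zero, sub_zero, lipFactor, h2, h3, add_zero, add_zero] at h1

theorem NonlinearBounds.norm_lift_f_le {f g : ℝ → ℝ} {C : ℝ} (hN : NonlinearBounds S f g C) {v : H S} (hv : InDA32 v) :
    ‖lift (fH f v)‖ ≤ C * ((1 + normV v) * (1 + normDA v)) * normV v +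
      C * normV v * (1 + ‖v‖ * normV v) := by
  refine (norm_V_le_lapV _).trans (add_le_add (hN.lapV_f_le hv) ?_)
  rw [(hN.inV v hv).incl_lift]
  exact hN.f_le v hv

theorem GrowthAssumption.continuous_f (hd : 1 ≤ d) {F f g : ℝ → ℝ}
    (hG : GrowthAssumption S F f g) (hD : DifferenceAssumption S f g) : Continuous f := by
  refine continuous_of_comp_mem (S := S) hd hG.1 fun v hv => ?_
  obtain ⟨⟨C3, hC3, hfd⟩, -⟩ := hD
  obtain ⟨u, hu, -⟩ := hfd v 0 hv (inDA32_zero)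
  refine ⟨u, ?_⟩
  filter_upwards [hu, Lp.coeFn_zero ℝ 2 S.vol] with x h1 h2
  rw [h1, h2]; rfl

/-- Continuity of `f` with values in `H`. -/
theorem NonlinearBounds.tendsto_fH {f g : ℝ → ℝ} {C : ℝ} (hN : NonlinearBounds S f g C) (hd : 1 ≤ d) (hf : Continuous f) {v : ℕ → H S} {w : H S}
    (hv : ∀ n, InDA32 (v n)) (hw : InDA32 w) {R : ℝ} (hR : ∀ n, normDA (v n) ≤ R)
    (hlim : Tendsto v atTop (𝓝 w)) : Tendsto (fun n => fH f (v n)) atTop (𝓝 (fH f w)) := by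
  have hR0 : 0 ≤ R := (normDA_nonneg _).trans (hR 0)
  have hC := hN.nonneg
  have hub : ∀ n, ‖lift (fH f (v n)) - lift (fH f w)‖ ≤
      (C * ((1 + R) * (1 + R)) * R + C * R * (1 + R * R)) + ‖lift (fH f w)‖ := by
    intro n
    refine (norm_sub_le _ _).trans (add_le_add ((hN.norm_lift_f_le (hv n)).trans ?_) le_rfl)
    have h1 := hR n
    have h2 := ((hv n).1.normV_le).trans h1
    have h3 := (norm_le_normV (hv n).inV).trans h2
    have h4 := normV_nonneg (v n)
    have h5 := normDA_nonneg (v n)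
    gcongr
  refine tendsto_of_subseq_tendsto fun ns hns => ?_
  obtain ⟨y, -, φ, hφ, hy⟩ := exists_weak_limit
    (x := fun n => lift (fH f (v (ns n))) - lift (fH f w)) fun n => hub (ns n)
  have hs : Tendsto (fun n => ‖incl ((lift (fH f (v (ns (φ n)))) - lift (fH f w)) - y)‖) atTop
      (𝓝 0) := by
    refine tendsto_norm_incl hd (z := fun n => (lift (fH f (v (ns (φ n)))) - lift (fH f w)) - y)
      (R := ((C * ((1 + R) * (1 + R)) * R + C * R * (1 + R * R)) + ‖lift (fH f w)‖) + ‖y‖)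
      (fun n => (norm_sub_le _ _).trans (add_le_add (hub _) le_rfl)) fun z => ?_
    have := (hy z).sub_const ⟪y, z⟫
    rw [sub_self] at this
    exact this.congr fun n => by rw [inner_sub_left _ y]
  have hs' : Tendsto (fun n => fH f (v (ns (φ n))) - fH f w) atTop (𝓝 (incl y)) := by
    rw [tendsto_iff_norm_sub_tendsto_zero]
    refine hs.congr fun n => ?_
    rw [map_sub, map_sub, (hN.inV _ (hv _)).incl_lift, (hN.inV _ hw).incl_lift]
  obtain ⟨ψ, hψ, hae⟩ := (tendstoInMeasure_of_tendsto_Lp hs').exists_seq_tendsto_ae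
  have hv' : Tendsto (fun n => v (ns (φ (ψ n)))) atTop (𝓝 w) :=
    hlim.comp (hns.comp (hφ.tendsto_atTop.comp hψ.tendsto_atTop))
  obtain ⟨θ, hθ, hae'⟩ := (tendstoInMeasure_of_tendsto_Lp hv').exists_seq_tendsto_ae
  have hy0 : incl y = 0 := by
    refine Lp.ext ?_
    have hc := ae_all_iff.2 fun n => hN.coe (v n) (hv n)
    have hsb := ae_all_iff.2 fun n => Lp.coeFn_sub (fH f (v n)) (fH f w)
    filter_upwards [hae, hae', hc, hsb, hN.coe w hw, Lp.coeFn_zero ℝ 2 S.vol] with x h1 h2 h3 h4 h5 h6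
    have h7 := h1.comp hθ.tendsto_atTop
    have h8 : Tendsto (fun n => f (v (ns (φ (ψ (θ n)))) x) - f (w x)) atTop (𝓝 0) := by
      have := ((hf.tendsto _).comp h2).sub_const (f (w x))
      rwa [sub_self] at this
    rw [h6]
    refine tendsto_nhds_unique h7 (h8.congr fun n => ?_)
    simp only [Function.comp]
    rw [h4, Pi.sub_apply, h3, h5]
  refine ⟨φ, ?_⟩
  rw [hy0] at hs'
  simpa using hs'.add_const (fH f w)

variable {F f g : ℝ → ℝ} {C : ℝ}

/-- `lift` after projection onto the first `N` eigenfunctions. -/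
def liftP (e : ℕ → H S) (N : ℕ) : H S →L[ℝ] V S :=
  ∑ k ∈ Finset.range N, (innerSL ℝ (e k)).smulRight (lift (e k))

theorem liftP_apply (N : ℕ) (u : H S) :
    liftP e N u = ∑ k ∈ Finset.range N, ⟪e k, u⟫ • lift (e k) := by simp [liftP, sum_apply]

namespace IsEigenbasis

section

variable (hE : IsEigenbasis S e μ)
include hE

theorem lift_projH' (N : ℕ) (u : H S) : lift (projH e N u) = liftP e N u := by
  refine InV.lift_eq ?_
  rw [liftP_apply, projH_apply, map_sum]
  refine Finset.sum_congr rfl fun k _ => ?_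
  rw [map_smul, hE.incl_lift]

/-- The operator `A` after projection, as a bounded operator. -/
theorem exists_opAP (N : ℕ) : ∃ A : H S →L[ℝ] H S, ∀ u, opA (projH e N u) = A u := by
  refine ⟨∑ k ∈ Finset.range N, (μ k • innerSL ℝ (e k)).smulRight (e k), fun u => ?_⟩
  rw [(hE.isA_projH N u).opA_eq]
  simp [sum_apply]

theorem inDA32_projH (N : ℕ) (u : H S) : InDA32 (projH e N u) := hE.inDA32_of_mem (hE.projH_mem N u)

theorem continuous_fH_projH (hd : 1 ≤ d)
    (hN : NonlinearBounds S f g C) (hf : Continuous f) (N : ℕ) :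
    Continuous fun u => fH f (projH e N u) := by
  obtain ⟨A, hA⟩ := hE.exists_opAP N
  refine continuous_iff_seqContinuous.2 fun u v hu => ?_
  obtain ⟨R, hR⟩ := (hu.norm.bddAbove_range : BddAbove (range fun n => ‖u n‖))
  refine hN.tendsto_fH hd hf (fun n => hE.inDA32_projH N _) (hE.inDA32_projH N _)
    (R := ‖A‖ * R) (fun n => ?_) (((projH e N).continuous.tendsto _).comp hu)
  rw [normDA, hA]
  exact (A.le_opNorm _).trans (mul_le_mul_of_nonneg_left (hR (mem_range_self n)) (norm_nonneg _))

end

end IsEigenbasis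

/-- The potential energy `∫ F(v)`. -/
def potential (F : ℝ → ℝ) (v : H S) : ℝ := ∫ x, F (v x) ∂S.vol

theorem normV_add_le {u v : H S} (hu : InV u) (hv : InV v) :
    normV (u + v) ≤ normV u + normV v := by rw [normV, hu.lift_add hv]; exact norm_add_le _ _

theorem normDA_add_le {u v : H S} (hu : InDA u) (hv : InDA v) :
    normDA (u + v) ≤ normDA u + normDA v := by
  rw [normDA, (hu.isA.add hv.isA).opA_eq]; exact norm_add_le _ _

theorem normV_smul (c : ℝ) {u : H S} (hu : InV u) :
    normV (c • u) = |c| * normV u := by rw [normV, hu.lift_smul, norm_smul, norm_eq_abs, normV]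

theorem normDA_smul (c : ℝ) {u : H S} (hu : InDA u) : normDA (c • u) = |c| * normDA u := by
  rw [normDA, (hu.isA.smul c).opA_eq, norm_smul, norm_eq_abs, normDA]

theorem NonlinearBounds.norm_fH_le_of_le (hN : NonlinearBounds S f g C)
    {v : H S} (hv : InDA32 v) {R : ℝ} (hR : normDA v ≤ R) :
    ‖fH f v‖ ≤ C * ((1 + R) * (1 + R)) * R + C * R * (1 + R * R) := by
  have h0 := norm_le_normV (hN.inV v hv)
  refine (h0.trans (hN.norm_lift_f_le hv)).trans ?_
  have h2 := (hv.1.normV_le).trans hR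
  have h3 := (norm_le_normV hv.inV).trans h2
  have h4 := normV_nonneg v
  have h5 := normDA_nonneg v
  have := hN.nonneg
  have : 0 ≤ R := h5.trans hR
  gcongr

theorem NonlinearBounds.potential_add_sub (hN : NonlinearBounds S f g C)
    (hF : ∀ x, HasDerivAt F (f x) x) (hf : Continuous f)
    (hFi : ∀ z : H S, InDA32 z → Integrable (fun x => F (z x)) S.vol) {v h : H S} (hv : InDA32 v)
    (hh : InDA32 h) : IntervalIntegrable (fun s => ⟪fH f (v + s • h), h⟫) volume 0 1 ∧
    potential F (v + h) - potential F v = ∫ s in 0..1, ⟪fH f (v + s • h), h⟫ := by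
  have hm : ∀ s : ℝ, InDA32 (v + s • h) := fun s => hv.add (hh.smul s)
  have hval : ∀ s : ℝ, ∀ᵐ x ∂S.vol, (v + s • h) x = v x + s * h x := by
    intro s
    filter_upwards [Lp.coeFn_add v (s • h), Lp.coeFn_smul s h] with x h1 h2
    rw [h1, Pi.add_apply, h2, Pi.smul_apply, smul_eq_mul]
  have hfv : ∀ s : ℝ, ∀ᵐ x ∂S.vol, fH f (v + s • h) x = f (v x + s * h x) := by
    intro s
    filter_upwards [hval s, hN.coe _ (hm s)] with x h1 h2
    rw [h2, h1]
  set R : ℝ := normDA v + normDA h with hR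
  have hRs : ∀ s ∈ Icc (0 : ℝ) 1, normDA (v + s • h) ≤ R := by
    intro s hs
    refine (normDA_add_le hv.1 (hh.smul s).1).trans (add_le_add le_rfl ?_)
    rw [normDA_smul s hh.1, abs_of_nonneg hs.1]
    exact mul_le_of_le_one_left (normDA_nonneg h) hs.2
  set K : ℝ := C * ((1 + R) * (1 + R)) * R + C * R * (1 + R * R) with hK
  have hKs : ∀ s ∈ Icc (0 : ℝ) 1, ‖fH f (v + s • h)‖ ≤ K := fun s hs =>
    hN.norm_fH_le_of_le (hm s) (hRs s hs)
  let G : ℝ × E d → ℝ := fun p => f (v p.2 + p.1 * h p.2) * h p.2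
  have hGm : Measurable G := by
    have m1 : Measurable (v : E d → ℝ) := (Lp.stronglyMeasurable v).measurable
    have m2 : Measurable (h : E d → ℝ) := (Lp.stronglyMeasurable h).measurable
    exact (hf.measurable.comp ((m1.comp measurable_snd).add
      (measurable_fst.mul (m2.comp measurable_snd)))).mul (m2.comp measurable_snd)
  have hinner : ∀ s : ℝ, (fun x => G (s, x)) =ᵐ[S.vol] fun x => fH f (v + s • h) x * h x := by
    intro s
    filter_upwards [hfv s] with x hx
    rw [hx]
  have hprodi : ∀ s : ℝ, Integrable (fun x => fH f (v + s • h) x * h x) S.vol := fun s =>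
    by
    have := (Lp.memLp (fH f (v + s • h))).integrable_mul (Lp.memLp h)
    exact this
  have hGi : Integrable G ((volume.restrict (Ioc (0 : ℝ) 1)).prod S.vol) := by
    rw [integrable_prod_iff hGm.aestronglyMeasurable]
    refine ⟨.of_forall fun s => (hprodi s).congr (hinner s).symm, ?_⟩
    refine Measure.integrableOn_of_bounded (M := K * ‖h‖) (by simp)
      (hGm.aestronglyMeasurable.norm.integral_prod_right') ?_
    filter_upwards [ae_restrict_mem measurableSet_Ioc] with s hs
    rw [norm_of_nonneg (integral_nonneg fun _ => norm_nonneg _)]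
    have e1 : ∫ x, ‖G (s, x)‖ ∂S.vol = ∫ x, |fH f (v + s • h) x| * |h x| ∂S.vol := by
      refine integral_congr_ae ?_
      filter_upwards [hinner s] with x hx
      rw [hx, norm_mul, norm_eq_abs, norm_eq_abs]
    rw [e1]
    have h1 := abs_integral_mul_le (|fH f (v + s • h)|) (Lp.memLp (|h|))
    have h2 : ∫ x, (|fH f (v + s • h)| : H S) x * (|h| : H S) x ∂S.vol =
        ∫ x, |fH f (v + s • h) x| * |h x| ∂S.vol := by
      refine integral_congr_ae ?_
      filter_upwards [Lp.coeFn_abs (fH f (v + s • h)), Lp.coeFn_abs h] with x a1 a2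
      rw [a1, a2]
    have h3 : √(∫ x, (|h| : H S) x ^ 2 ∂S.vol) = ‖h‖ := by
      rw [← norm_toLp_sq (Lp.memLp (|h|)), sqrt_sq (norm_nonneg _), Lp.toLp_coeFn, norm_abs_eq_norm]
    rw [h2, h3, norm_abs_eq_norm] at h1
    exact (le_abs_self _).trans (h1.trans (mul_le_mul_of_nonneg_right
      (hKs s ⟨hs.1.le, hs.2⟩) (norm_nonneg _)))
  have hs_eq : ∀ s : ℝ, ∫ x, G (s, x) ∂S.vol = ⟪fH f (v + s • h), h⟫ := by
    intro s
    rw [inner_eq_integral (Filter.EventuallyEq.refl _ (h : E d → ℝ))]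
    exact integral_congr_ae (hinner s)
  refine ⟨?_, ?_⟩
  · rw [intervalIntegrable_iff_integrableOn_Ioc_of_le zero_le_one]
    exact hGi.integral_prod_left.congr (.of_forall hs_eq)
  · have hswap := integral_integral_swap (μ := volume.restrict (Ioc (0 : ℝ) 1)) (ν := S.vol)
      (f := fun s x => G (s, x)) hGi
    rw [integral_of_le zero_le_one]
    simp only [← hs_eq]
    rw [hswap, potential, potential, ← integral_sub (hFi _ (hv.add hh)) (hFi _ hv)]
    refine integral_congr_ae ?_
    have h1 := hval 1
    simp only [one_smul, one_mul] at h1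
    filter_upwards [h1] with x hx
    simp only [G]
    rw [hx, ← integral_of_le zero_le_one]
    have hd : ∀ s ∈ uIcc (0 : ℝ) 1, HasDerivAt (fun s : ℝ => F (v x + s * h x))
        (f (v x + s * h x) * h x) s := by
      intro s _
      have h2 : HasDerivAt (fun s : ℝ => v x + s * h x) (h x) s := by
        simpa using ((hasDerivAt_id s).mul_const (h x)).const_add (v x)
      exact (hF _).comp s h2
    have hc : Continuous fun s : ℝ => f (v x + s * h x) * h x := by fun_prop
    rw [intervalIntegral.integral_eq_sub_of_hasDerivAt hd (hc.intervalIntegrable _ _)]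
    simp

theorem NonlinearBounds.potential_le (hN : NonlinearBounds S f g C)
    (hF : ∀ x, HasDerivAt F (f x) x) (hf : Continuous f)
    (hFi : ∀ z : H S, InDA32 z → Integrable (fun x => F (z x)) S.vol) {v : H S} (hv : InDA32 v) :
    potential F v ≤ potential F (0 : H S) + C * normV v ^ 2 * (1 + ‖v‖ * normV v) := by
  obtain ⟨hi, he⟩ := hN.potential_add_sub hF hf hFi (inDA32_zero) hv
  rw [zero_add] at he
  have hb : ∫ s in 0..1, ⟪fH f (0 + s • v), v⟫ ≤
      ∫ s in 0..1, C * normV v ^ 2 * (1 + ‖v‖ * normV v) := by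
    refine integral_mono_on zero_le_one hi (continuous_const.intervalIntegrable _ _) fun s hs => ?_
    rw [zero_add]
    have h1 := hN.f_le (s • v) (hv.smul s)
    rw [normV_smul s hv.inV, norm_smul, norm_eq_abs, abs_of_nonneg hs.1] at h1
    have h2 : ⟪fH f (s • v), v⟫ = pivot (fH f (s • v)) (lift v) := by
      rw [pivot_apply, hv.inV.incl_lift]
    rw [h2]
    refine ((le_abs_self _).trans ((pivot (fH f (s • v))).le_opNorm _)).trans ?_
    have h3 : ‖lift v‖ = normV v := rfl
    have h4 := normV_nonneg v
    have h5 := hN.nonneg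
    rw [h3]
    have h6 : s * normV v ≤ normV v := mul_le_of_le_one_left h4 hs.2
    have h7 : s * ‖v‖ ≤ ‖v‖ := mul_le_of_le_one_left (norm_nonneg _) hs.2
    have hs0 := hs.1
    calc ‖pivot (fH f (s • v))‖ * normV v
        ≤ C * (s * normV v) * (1 + s * ‖v‖ * (s * normV v)) * normV v := by gcongr
      _ ≤ C * normV v * (1 + ‖v‖ * normV v) * normV v := by gcongr
      _ = _ := by ring
  simp only [intervalIntegral.integral_const, sub_zero, one_smul] at hb
  linarith

theorem NonlinearBounds.hasFDerivAt_potential (hE : IsEigenbasis S e μ)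
    (hN : NonlinearBounds S f g C) (hd : 1 ≤ d)
    (hF : ∀ x, HasDerivAt F (f x) x) (hf : Continuous f)
    (hFi : ∀ z : H S, InDA32 z → Integrable (fun x => F (z x)) S.vol) (N : ℕ) (u : H S) :
    HasFDerivAt (fun u => potential F (projH e N u))
      ((innerSL ℝ (fH f (projH e N u))) ∘L projH e N) u := by
  rw [hasFDerivAt_iff_isLittleO_nhds_zero, Asymptotics.isLittleO_iff]
  intro ε hε
  obtain ⟨δ, hδ, hδs⟩ := Metric.continuous_iff.1 (hE.continuous_fH_projH hd hN hf N) u ε hε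
  filter_upwards [ball_mem_nhds (0 : H S) hδ] with h hh
  rw [mem_ball_zero_iff] at hh
  obtain ⟨hi, he⟩ := hN.potential_add_sub hF hf hFi (hE.inDA32_projH N u) (hE.inDA32_projH N h)
  rw [map_add, he]
  have e1 : ((innerSL ℝ (fH f (projH e N u))) ∘L projH e N) h =
      ∫ s in 0..1, ⟪fH f (projH e N u), projH e N h⟫ := by simp
  rw [e1, ← intervalIntegral.integral_sub hi (continuous_const.intervalIntegrable _ _)]
  have hb : ∀ s ∈ uIoc (0 : ℝ) 1, ‖⟪fH f (projH e N u + s • projH e N h), projH e N h⟫ -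
      ⟪fH f (projH e N u), projH e N h⟫‖ ≤ ε * ‖h‖ := by
    intro s hs
    rw [uIoc_of_le zero_le_one] at hs
    rw [← inner_sub_left, norm_eq_abs]
    refine (abs_real_inner_le_norm _ _).trans ?_
    have h1 : dist (u + s • h) u < δ := by
      rw [dist_eq_norm, add_sub_cancel_left, norm_smul, norm_eq_abs, abs_of_pos hs.1]
      exact (mul_le_of_le_one_left (norm_nonneg _) hs.2).trans_lt hh
    have h2 := hδs _ h1
    rw [dist_eq_norm, map_add, map_smul] at h2
    exact mul_le_mul h2.le (hE.norm_projH_le N h) (norm_nonneg _) hε.le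
  have := intervalIntegral.norm_integral_le_of_norm_le_const hb
  simpa using this

section Oblique

variable {m : ℕ} {x y : Fin m → H S}

/-- The two families are biorthogonal up to nonzero factors. -/
def Biorthogonal (x y : Fin m → H S) : Prop := (∀ j, ⟪x j, y j⟫ ≠ 0) ∧ ∀ i j, i ≠ j → ⟪x i, y j⟫ = 0

theorem Biorthogonal.symm (h : Biorthogonal x y) : Biorthogonal y x :=
  ⟨fun j => by rw [real_inner_comm]; exact h.1 j,
    fun i j hij => by rw [real_inner_comm]; exact h.2 j i hij.symm⟩

theorem Biorthogonal.inner_sum (h : Biorthogonal x y) (c : Fin m → ℝ) (j : Fin m) :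
    ⟪∑ i, c i • x i, y j⟫ = c j * ⟪x j, y j⟫ := by
  rw [sum_inner, Finset.sum_eq_single j]
  · rw [real_inner_smul_left]
  · intro i _ hij
    rw [real_inner_smul_left, h.2 i j hij, mul_zero]
  · simp

theorem Biorthogonal.eq_sum (h : Biorthogonal x y) {q : H S}
    (hq : q ∈ span ℝ (range x)) : q = ∑ i, (⟪q, y i⟫ / ⟪x i, y i⟫) • x i := by
  obtain ⟨c, rfl⟩ := (Submodule.mem_span_range_iff_exists_fun ℝ).1 hq
  refine Finset.sum_congr rfl fun i _ => ?_
  rw [h.inner_sum, mul_div_cancel_right₀ _ (h.1 i)]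

theorem inner_eq_of_span {q : H S} {ℓ : H S →ₗ[ℝ] ℝ} (h : ∀ j, ⟪q, y j⟫ = ℓ (y j)) :
    ∀ v ∈ span ℝ (range y), ⟪q, v⟫ = ℓ v := by
  intro v hv
  refine Submodule.span_induction (p := fun v _ => ⟪q, v⟫ = ℓ v) ?_ (by simp) ?_ ?_ hv
  · rintro _ ⟨j, rfl⟩
    exact h j
  · intro a b _ _ ha hb
    rw [inner_add_right, map_add, ha, hb]
  · intro c a _ ha
    rw [real_inner_smul_right, map_smul, ha, smul_eq_mul]

theorem Biorthogonal.obliqueProj_of_exists (h : Biorthogonal x y) {ℓ : H S → ℝ}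
    (hex : ∃ q ∈ span ℝ (range x), ∀ v ∈ span ℝ (range y), ⟪q, v⟫ = ℓ v) :
    obliqueProj (span ℝ (range x)) (span ℝ (range y)) ℓ = ∑ i, (ℓ (y i) / ⟪x i, y i⟫) • x i := by
  rw [obliqueProj, dif_pos hex]
  obtain ⟨h1, h2⟩ := hex.choose_spec
  rw [h.eq_sum h1]
  refine Finset.sum_congr rfl fun i _ => ?_
  rw [← h2 (y i) (subset_span (mem_range_self i))]

theorem Biorthogonal.obliqueProj_linear (h : Biorthogonal x y) (ℓ : H S →ₗ[ℝ] ℝ) :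
    obliqueProj (span ℝ (range x)) (span ℝ (range y)) (fun v => ℓ v) =
      ∑ i, (ℓ (y i) / ⟪x i, y i⟫) • x i := by
  refine h.obliqueProj_of_exists ⟨∑ i, (ℓ (y i) / ⟪x i, y i⟫) • x i, ?_, ?_⟩
  · exact Submodule.sum_mem _ fun i _ => Submodule.smul_mem _ _ (subset_span (mem_range_self i))
  · refine inner_eq_of_span fun j => ?_
    rw [h.inner_sum (fun i => ℓ (y i) / ⟪x i, y i⟫), div_mul_cancel₀ _ (h.1 j)]

/-- The feedback operators are bounded linear operators. -/
theorem Biorthogonal.exists_clm (h : Biorthogonal x y) {Z : Type*} [NormedAddCommGroup Z]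
    [InnerProductSpace ℝ Z] (D : Submodule ℝ (H S)) (T : H S → Z)
    (hadd : ∀ u ∈ D, ∀ v ∈ D, T (u + v) = T u + T v) (hsmul : ∀ (c : ℝ), ∀ u ∈ D, T (c • u) = c • T u)
    (hout : ∀ u, u ∉ D → T u = 0) : ∃ B : H S →L[ℝ] H S, ∀ w, obliqueProj (span ℝ (range x))
      (span ℝ (range y)) (fun v => ⟪T (obliqueProj (span ℝ (range y))
        (span ℝ (range x)) fun u => ⟪w, u⟫), T v⟫) = B w := by
  have hp : ∀ w : H S, obliqueProj (span ℝ (range y)) (span ℝ (range x)) (fun u => ⟪w, u⟫) =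
        ∑ i, (⟪w, x i⟫ / ⟪y i, x i⟫) • y i := fun w =>
    h.symm.obliqueProj_linear (innerSL ℝ w).toLinearMap
  have hpmem : ∀ w : H S, ∑ i, (⟪w, x i⟫ / ⟪y i, x i⟫) • y i ∈ span ℝ (range y) :=
    fun w => Submodule.sum_mem _ fun i _ => Submodule.smul_mem _ _ (subset_span (mem_range_self i))
  by_cases hD : span ℝ (range y) ≤ D
  · have hy : ∀ i, y i ∈ D := fun i => hD (subset_span (mem_range_self i))
    let T' : D →ₗ[ℝ] Z := ⟨⟨fun u => T u, fun u v => hadd _ u.2 _ v.2⟩, fun c u => hsmul c _ u.2⟩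
    have hTsum : ∀ c : Fin m → ℝ, T (∑ i, c i • y i) = ∑ i, c i • T (y i) := by
      intro c
      have h1 := map_sum T' (fun i => c i • (⟨y i, hy i⟩ : D)) Finset.univ
      simp only [map_smul] at h1
      have h2 : T' (∑ i, c i • (⟨y i, hy i⟩ : D)) = T (∑ i, c i • y i) := by
        change T _ = T _
        congr 1
        push_cast
        rfl
      rw [← h2, h1]
      rfl
    refine ⟨∑ j, ∑ i, (innerSL ℝ (x i)).smulRight
      (((⟪y i, x i⟫)⁻¹ * ⟪T (y i), T (y j)⟫ / ⟪x j, y j⟫) • x j), fun w => ?_⟩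
    rw [hp w, h.obliqueProj_of_exists]
    · simp only [sum_apply, ContinuousLinearMap.smulRight_apply, innerSL_apply_apply]
      refine Finset.sum_congr rfl fun j _ => ?_
      rw [hTsum, sum_inner, Finset.sum_div, Finset.sum_smul]
      refine Finset.sum_congr rfl fun i _ => ?_
      rw [real_inner_smul_left, smul_smul, real_inner_comm w]
      congr 1
      ring
    · set p := ∑ i, (⟪w, x i⟫ / ⟪y i, x i⟫) • y i
      refine ⟨∑ j, (⟪T p, T (y j)⟫ / ⟪x j, y j⟫) • x j, Submodule.sum_mem _ fun i _ =>
        Submodule.smul_mem _ _ (subset_span (mem_range_self i)), fun v hv => ?_⟩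
      obtain ⟨c, rfl⟩ := (Submodule.mem_span_range_iff_exists_fun ℝ).1 hv
      have hpT : ⟪T p, T (∑ i, c i • y i)⟫ = ∑ i, c i * ⟪T p, T (y i)⟫ := by
        rw [hTsum c, _root_.inner_sum]
        simp only [real_inner_smul_right]
      rw [hpT, _root_.inner_sum]
      refine Finset.sum_congr rfl fun j _ => ?_
      rw [real_inner_smul_right,
        h.inner_sum (fun j => ⟪T p, T (y j)⟫ / ⟪x j, y j⟫), div_mul_cancel₀ _ (h.1 j)]
  · obtain ⟨z, hz, hzD⟩ := SetLike.not_le_iff_exists.1 hD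
    refine ⟨0, fun w => ?_⟩
    rw [zero_apply, obliqueProj]
    split_ifs with hex
    · obtain ⟨hq1, hq2⟩ := hex.choose_spec
      set q := hex.choose
      have key : ∀ v ∈ span ℝ (range y), v ∉ D → ⟪q, v⟫ = 0 := by
        intro v hv hvD
        rw [hq2 v hv, hout v hvD, inner_zero_right]
      have hz0 := key z hz hzD
      have hall : ∀ v ∈ span ℝ (range y), ⟪q, v⟫ = 0 := by
        intro v hv
        by_cases hvD : v ∈ D
        · have h1 : v + z ∉ D := fun h2 => hzD (by simpa using D.sub_mem h2 hvD)
          have h2 := key _ (Submodule.add_mem _ hv hz) h1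
          rwa [inner_add_right, hz0, add_zero] at h2
        · exact key v hv hvD
      rw [h.eq_sum hq1]
      refine Finset.sum_eq_zero fun i _ => ?_
      rw [hall _ (subset_span (mem_range_self i)), zero_div, zero_smul]
    · rfl

end Oblique

namespace Actuators

variable {a : Actuators d}

theorem continuous_chart (j : Fin a.m) : Continuous (a.chart j) := by
  unfold chart
  exact (a.rot j).continuous.comp (by fun_prop)

theorem isOpen_box : IsOpen a.box := by
  have : a.box = ⋂ n, {z : E d | -a.l n < z n ∧ z n < a.l n} := by ext z; simp [box]
  rw [this]
  refine isOpen_iInter_of_finite fun n => ?_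
  have hc : Continuous fun z : E d => z n := (proj n : E d →L[ℝ] ℝ).continuous
  exact (isOpen_lt continuous_const hc).inter (isOpen_lt hc continuous_const)

theorem isOpen_support (j : Fin a.m) : IsOpen (a.support j) :=
  isOpen_box.preimage (continuous_chart j)

theorem measurable_bump : Measurable a.bump := by
  refine Measurable.indicator ?_ isOpen_box.measurableSet
  have hc : ∀ n, Continuous fun z : E d => z n := fun n => (proj n : E d →L[ℝ] ℝ).continuous
  refine (continuous_finset_prod _ fun n _ => Real.continuous_sin.comp ?_).measurable
  exact continuous_const.mul (((hc n).add continuous_const).div_const _)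

theorem bump_pos (hl : ∀ n, 0 < a.l n) {z : E d} (hz : z ∈ a.box) : 0 < a.bump z := by
  rw [bump, indicator_of_mem hz]
  refine Finset.prod_pos fun n _ => Real.sin_pos_of_pos_of_lt_pi ?_ ?_
  · have := hz n
    have := hl n
    have : 0 < z n + a.l n := by linarith [(hz n).1]
    positivity
  · have h1 := hz n
    have h2 := hl n
    have h3 : (z n + a.l n) / (2 * a.l n) < 1 := by rw [div_lt_one (by positivity)]; linarith [h1.2]
    nlinarith [Real.pi_pos]

theorem abs_bump_le (z : E d) : |a.bump z| ≤ 1 := by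
  by_cases hz : z ∈ a.box
  · rw [bump, indicator_of_mem hz, Finset.abs_prod]
    exact Finset.prod_le_one (fun _ _ => abs_nonneg _) fun n _ => Real.abs_sin_le_one _
  · rw [bump, indicator_of_notMem hz]; simp

theorem memLp_indicatorFun (j : Fin a.m) : MemLp (a.indicatorFun j) 2 S.vol := by
  exact (memLp_const (1 : ℝ)).indicator (isOpen_support j).measurableSet

theorem memLp_aux (j : Fin a.m) (k : ℕ) : MemLp (fun x => a.bump (a.chart j x) ^ k) 2 S.vol := by
  refine MemLp.of_bound ((measurable_bump.comp (continuous_chart j).measurable).pow_const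
    k).aestronglyMeasurable 1 (.of_forall fun x => ?_)
  rw [norm_pow, norm_eq_abs]
  exact pow_le_one₀ (abs_nonneg _) (abs_bump_le _)

theorem biorthogonal (ha : a.IsAdmissible S) {k : ℕ} (hk : k ≠ 0) :
    Biorthogonal (fun j => toH S (a.indicatorFun j))
      (fun j => toH S fun x => a.bump (a.chart j x) ^ k) := by
  obtain ⟨hl, hs, hsub, hdis⟩ := ha
  have hin : ∀ i j, ⟪toH S (a.indicatorFun i), toH S fun x => a.bump (a.chart j x) ^ k⟫ =
      ∫ x, a.indicatorFun i x * a.bump (a.chart j x) ^ k ∂S.vol := by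
    intro i j
    rw [inner_eq_integral (toH_eq (memLp_aux j k))]
    refine integral_congr_ae ?_
    filter_upwards [toH_eq (memLp_indicatorFun i)] with x hx
    rw [hx]
  have hout : ∀ j x, x ∉ a.support j → a.bump (a.chart j x) ^ k = 0 := by
    intro j x hx
    rw [bump, indicator_of_notMem (show a.chart j x ∉ a.box from hx), zero_pow hk]
  constructor
  · intro j
    simp only [hin]
    refine ne_of_gt ?_
    rw [integral_pos_iff_support_of_nonneg]
    · have hsupp : a.support j ⊆
          Function.support fun x => a.indicatorFun j x * a.bump (a.chart j x) ^ k := by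
        intro x hx
        have := bump_pos hl hx
        simp only [Function.mem_support, indicatorFun, indicator_of_mem hx, Pi.one_apply, one_mul]
        positivity
      refine lt_of_lt_of_le ?_ (measure_mono hsupp)
      rw [Setting.vol, Measure.restrict_apply (isOpen_support j).measurableSet,
        inter_eq_left.2 (hsub j)]
      refine (isOpen_support j).measure_pos volume ⟨a.center j, ?_⟩
      intro n
      simp only [chart, sub_self, smul_zero, map_zero]
      have := hl n
      constructor <;> simp [this]
    · intro x
      by_cases hx : x ∈ a.support j
      · have := bump_pos hl hx
        simp only [indicatorFun, indicator_of_mem hx, Pi.one_apply, one_mul, Pi.zero_apply]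
        positivity
      · simp [hout j x hx]
    · exact (memLp_indicatorFun j).integrable_mul (memLp_aux j k)
  · intro i j hij
    simp only [hin]
    refine integral_eq_zero_of_ae (.of_forall fun x => ?_)
    by_cases hx : x ∈ a.support j
    · have : x ∉ a.support i := fun h => (hdis i j hij).le_bot ⟨h, hx⟩
      simp [indicatorFun, this]
    · simp [hout j x hx]

end Actuators

theorem lift_eq_zero {u : H S} (h : ¬ InV u) : lift u = 0 := by rw [lift, dif_neg h]

theorem opA_eq_zero {u : H S} (h : ¬ InDA u) : opA u = 0 := by rw [opA, dif_neg h]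

/-- The subspace `D(A)` of `H`. -/
def domA (S : Setting d) [Fact S.IsAdmissible] : Submodule ℝ (H S) where
  carrier := {u | InDA u}
  zero_mem' := ⟨0, isA_zero⟩
  add_mem' := fun hu hv => (hu.isA.add hv.isA).inDA
  smul_mem' := fun c _ hu => (hu.isA.smul c).inDA

/-- The subspace `V` of `H`. -/
def domV (S : Setting d) [Fact S.IsAdmissible] : Submodule ℝ (H S) where
  carrier := {u | InV u}
  zero_mem' := InV.zero
  add_mem' := fun hu hv => hu.add hv
  smul_mem' := fun c _ hu => hu.smul c

theorem exists_feedback₁ {a : Actuators d} (ha : a.IsAdmissible S) (lam : ℝ) :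
    ∃ B : H S →L[ℝ] H S, ∀ w, feedback₁ a lam w = B w := by
  obtain ⟨B, hB⟩ := (Actuators.biorthogonal ha two_ne_zero).exists_clm (domA S) opA
    (fun u hu v hv => (InDA.isA hu |>.add (InDA.isA hv)).opA_eq)
    (fun c u hu => ((InDA.isA hu).smul c).opA_eq) fun u hu => opA_eq_zero hu
  refine ⟨-lam • B, fun w => ?_⟩
  rw [smul_apply, ← hB w]
  rfl

theorem exists_feedback₂ {a : Actuators d} (ha : a.IsAdmissible S) (lam : ℝ) :
    ∃ B : H S →L[ℝ] H S, ∀ w, feedback₂ a lam w = B w := by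
  obtain ⟨B, hB⟩ := (Actuators.biorthogonal ha one_ne_zero).exists_clm (domV S) lift
    (fun u hu v hv => InV.lift_add hu hv)
    (fun c u hu => InV.lift_smul c hu) fun u hu => lift_eq_zero hu
  refine ⟨-lam • B, fun w => ?_⟩
  rw [smul_apply, ← hB w]
  rfl

end

variable {d : ℕ} {S : Setting d} [hS : Fact S.IsAdmissible]

/-- An affine forcing `k(t) + K w`. -/
def affine (k : ℝ → V' S) (K : H S →L[ℝ] H S) (t : ℝ) (w : H S) : V' S := k t + pivot (K w)

/-- The embedding of `H` into `V'` as a continuous linear map. -/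
def pivotL (S : Setting d) [Fact S.IsAdmissible] : H S →L[ℝ] V' S :=
  LinearMap.mkContinuous ⟨⟨pivot, fun u v => by ext z; simp [pivot_apply, inner_add_left]⟩,
    fun c u => by ext z; simp [pivot_apply, real_inner_smul_left]⟩ 1
    fun u => by simpa using norm_pivot_le u

theorem pivotL_apply (u : H S) : pivotL S u = pivot u := rfl

/-- The Laplacian as a continuous linear map. -/
def lapVL (S : Setting d) [Fact S.IsAdmissible] : V S →L[ℝ] V' S :=
  LinearMap.mkContinuous ⟨⟨lapV, lapV_add⟩, lapV_smul⟩ 1 fun u => by simpa using norm_lapV_le u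

/-- The projection of `V'` onto the span of the first `N` eigenfunctions. -/
def galProjL (e : ℕ → H S) (N : ℕ) : V' S →L[ℝ] H S :=
  ∑ k ∈ Finset.range N, (ContinuousLinearMap.apply ℝ ℝ (lift (e k))).smulRight (e k)

theorem galProjL_apply (e : ℕ → H S) (N : ℕ) (ℓ : V' S) : galProjL e N ℓ = galProj e N ℓ := by
  simp [galProjL, galProj, sum_apply]

theorem LocL2.clm {X Y : Type*} [NormedAddCommGroup X] [NormedSpace ℝ X] [NormedAddCommGroup Y]
    [NormedSpace ℝ Y] (L : X →L[ℝ] Y) {φ : ℝ → X} (h : LocL2 φ) : LocL2 fun t => L (φ t) :=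
  fun T hT => L.comp_memLp' (h T hT)

theorem LocL2.add {X : Type*} [NormedAddCommGroup X] {φ ψ : ℝ → X} (hφ : LocL2 φ) (hψ : LocL2 ψ) :
    LocL2 fun t => φ t + ψ t := fun T hT => (hφ T hT).add (hψ T hT)

theorem LocL2.sub {X : Type*} [NormedAddCommGroup X] {φ ψ : ℝ → X} (hφ : LocL2 φ) (hψ : LocL2 ψ) :
    LocL2 fun t => φ t - ψ t := fun T hT => (hφ T hT).sub (hψ T hT)

theorem LocL2.integrableOn {X : Type*} [NormedAddCommGroup X] {φ : ℝ → X} (h : LocL2 φ) {T : ℝ}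
    (hT : 0 < T) : IntegrableOn φ (Ioo 0 T) := (h T hT).integrable one_le_two

theorem exists_affine_of_clm {h : ℝ → V' S} (hh : LocL2 h) {r : ℝ → H S} (hr : LocL2 r)
    (B : H S →L[ℝ] H S) (χ : ℝ) : ∃ (k : ℝ → V' S) (K : H S →L[ℝ] H S), LocL2 k ∧
      ∀ t w, h t + χ • pivot (B (w - r t)) = affine k K t w := by
  refine ⟨fun t => h t - (χ • pivotL S ∘L B) (r t), χ • B, hh.sub (hr.clm _), fun t w => ?_⟩
  simp only [affine, ← pivotL_apply, smul_apply, comp_apply, map_sub, smul_sub, map_smul]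
  abel

theorem forcing₁_eq {a : Actuators d} (ha : a.IsAdmissible S) (lam χ : ℝ)
    {h : ℝ → V' S} (hh : LocL2 h) {r : ℝ → H S} (hr : LocL2 r) :
    ∃ (k : ℝ → V' S) (K : H S →L[ℝ] H S), LocL2 k ∧ forcing₁ a lam χ h r = affine k K := by
  obtain ⟨B, hB⟩ := exists_feedback₁ ha lam
  obtain ⟨k, K, hk, hkK⟩ := exists_affine_of_clm hh hr B χ
  exact ⟨k, K, hk, by funext t w; rw [← hkK, forcing₁, hB]⟩

theorem forcing₂_eq {a : Actuators d} (ha : a.IsAdmissible S) (lam χ : ℝ)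
    {h : ℝ → V' S} (hh : LocL2 h) {r : ℝ → H S} (hr : LocL2 r) :
    ∃ (k : ℝ → V' S) (K : H S →L[ℝ] H S), LocL2 k ∧ forcing₂ a lam χ h r = affine k K := by
  obtain ⟨B, hB⟩ := exists_feedback₂ ha lam
  obtain ⟨k, K, hk, hkK⟩ := exists_affine_of_clm hh hr B χ
  exact ⟨k, K, hk, by funext t w; rw [← hkK, forcing₂, hB]⟩

/-- The right-hand side of the first equation, with the forcing `η`. -/
def full₁ (P : Model d) (η : V' P.S) (w1 w2 : H P.S) : V' P.S :=
  -P.ν₂ • lapV (lift (lap w1)) - (P.ν₀ * P.ν₁) • lapV (lift w1) + P.ν₁ • lapV (lift w2)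
    - lapV (lift (fH P.f w1)) - gD P.g w1 + η

/-- The right-hand side of the second equation, with the forcing `η`. -/
def full₂ (P : Model d) (η : V' P.S) (w1 w2 : H P.S) : V' P.S :=
  -lapV (lift w2) + P.ν₀ • lapV (lift w1) + η

/-- The standing assumptions, in the form in which they are used. -/
structure AnalyticData (P : Model d) (F : ℝ → ℝ) (e : ℕ → H P.S) (μ : ℕ → ℝ) (C : ℝ) : Prop where
  one_le_dim : 1 ≤ d
  ν₂_pos : 0 < P.ν₂
  basis : IsEigenbasis P.S e μ
  bounds : NonlinearBounds P.S P.f P.g C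
  hasDeriv : ∀ x, HasDerivAt F (P.f x) x
  nonneg : ∀ x, 0 ≤ F x
  cont : Continuous P.f
  integrable : ∀ z : H P.S, InDA32 z → Integrable (fun x => F (z x)) P.S.vol

theorem inner_lap_eq {u : H S} (h : InDA u) (z : V S) :
    lapV (lift u) z = ⟪lap u, incl z⟫ := by rw [h.lapV_lift, pivot_apply]

theorem lapV_comm (u z : V S) : lapV u z = lapV z u := by
  rw [lapV_apply, lapV_apply, real_inner_comm]

theorem abs_lapV_le' (u z : V S) : |lapV u z| ≤ ‖u‖ * ‖z‖ :=
  (abs_lapV_le u z).trans (mul_le_mul (norm_grad_le u) (norm_grad_le z) (norm_nonneg _)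
    (norm_nonneg _))

theorem sq_normDA_le (u : H S) : normDA u ^ 2 ≤ 2 * ‖lap u‖ ^ 2 + 2 * ‖u‖ ^ 2 := by
  have h : normDA u ≤ ‖lap u‖ + ‖u‖ := by
    have := norm_add_le (lap u) u
    rwa [lap, sub_add_cancel] at this
  have := normDA_nonneg u
  nlinarith [sq_nonneg (‖lap u‖ - ‖u‖)]

theorem energy_algebra {ν C m : ℝ} (hν : 0 < ν) :
    ∃ c > 0, ∃ M ≥ 0, ∀ D V1 V2 h₁ h₂ : ℝ, 0 ≤ D → 0 ≤ V1 → 0 ≤ V2 → 0 ≤ h₁ → V1 ^ 2 ≤ h₁ * D →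
      -ν * (D ^ 2 / 2 - h₁ ^ 2) + m * V1 ^ 2 + m * (V1 * V2) + 2 * (C * D * V1) - (V2 ^ 2 - h₂ ^ 2) ≤
        -c * (D ^ 2 + V2 ^ 2) + M * (h₁ ^ 2 + h₂ ^ 2) := by
  set A : ℝ := |m| + m ^ 2 / 2 + 8 * C ^ 2 / ν with hA
  have hA0 : 0 ≤ A := by positivity
  refine ⟨min (ν / 4) (1 / 2), by positivity, ν + 2 * A ^ 2 / ν + 1, by positivity, ?_⟩
  intro D V1 V2 h₁ h₂ hD hV1 hV2 hh1 hle
  have e1 : 2 * (C * D * V1) ≤ ν / 8 * D ^ 2 + 8 * C ^ 2 / ν * V1 ^ 2 := by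
    have h : 0 ≤ ν / 8 * (D - 8 * C / ν * V1) ^ 2 := by positivity
    have h2 : ν / 8 * (D - 8 * C / ν * V1) ^ 2 =
      ν / 8 * D ^ 2 + 8 * C ^ 2 / ν * V1 ^ 2 - 2 * (C * D * V1) := by field_simp; ring
    linarith
  have e2 : m * (V1 * V2) ≤ V2 ^ 2 / 2 + m ^ 2 / 2 * V1 ^ 2 := by
    nlinarith [sq_nonneg (V2 - m * V1)]
  have e3 : m * V1 ^ 2 ≤ |m| * V1 ^ 2 := mul_le_mul_of_nonneg_right (le_abs_self m) (sq_nonneg _)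
  have e4 : A * V1 ^ 2 ≤ ν / 8 * D ^ 2 + 2 * A ^ 2 / ν * h₁ ^ 2 := by
    have h : 0 ≤ ν / 8 * (D - 4 * A / ν * h₁) ^ 2 := by positivity
    have h2 : ν / 8 * (D - 4 * A / ν * h₁) ^ 2 =
      ν / 8 * D ^ 2 + 2 * A ^ 2 / ν * h₁ ^ 2 - A * (h₁ * D) := by field_simp; ring
    have h3 := mul_le_mul_of_nonneg_left hle hA0
    linarith
  have e5 : A * V1 ^ 2 = |m| * V1 ^ 2 + m ^ 2 / 2 * V1 ^ 2 + 8 * C ^ 2 / ν * V1 ^ 2 := by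
    rw [hA]; ring
  have e6 : min (ν / 4) (1 / 2) * (D ^ 2 + V2 ^ 2) ≤ ν / 4 * D ^ 2 + 1 / 2 * V2 ^ 2 := by
    have h1 := mul_le_mul_of_nonneg_right (min_le_left (ν / 4) (1 / 2)) (sq_nonneg D)
    have h2 := mul_le_mul_of_nonneg_right (min_le_right (ν / 4) (1 / 2)) (sq_nonneg V2)
    linarith
  have e7 : 0 ≤ 2 * A ^ 2 / ν * h₂ ^ 2 := by positivity
  have e8 : 0 ≤ ν * h₂ ^ 2 := by positivity
  have e9 := sq_nonneg h₁
  linarith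

section

variable {e : ℕ → H S} {μ : ℕ → ℝ} {C : ℝ}

theorem IsEigenbasis.galProj_lapV' (hE : IsEigenbasis S e μ) {u : H S} {N : ℕ} (h : u ∈ galSpan e N) :
    galProjL e N (lapV (lift u)) = lap u := by rw [galProjL_apply, hE.galProj_lapV h]

theorem IsEigenbasis.exists_lapP (hE : IsEigenbasis S e μ) (N : ℕ) : ∃ L : H S →L[ℝ] H S, ∀ u, lap (projH e N u) = L u := by
  obtain ⟨A, hA⟩ := hE.exists_opAP N
  exact ⟨A - projH e N, fun u => by rw [lap, hA]; rfl⟩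

theorem inner_pivot_le (K : H S →L[ℝ] H S) {w : H S} (hw : InV w) :
    pivot (K w) (lift w) ≤ ‖K‖ * ‖w‖ ^ 2 := by
  rw [pivot_apply, hw.incl_lift, sq, ← mul_assoc]
  exact (real_inner_le_norm _ _).trans (mul_le_mul_of_nonneg_right (K.le_opNorm w) (norm_nonneg _))

theorem IsEigenbasis.continuousOn_path (hE : IsEigenbasis S e μ) {N : ℕ} {w : ℝ → H S} {s : Set ℝ} (hw : ContinuousOn w s)
    (hm : ∀ t ∈ s, w t ∈ galSpan e N) :
    ContinuousOn (fun t => opA (w t)) s ∧ ContinuousOn (fun t => lift (w t)) s ∧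
      ContinuousOn (fun t => lift (opA (w t))) s := by
  obtain ⟨A, hA⟩ := hE.exists_opAP N
  have h1 : ∀ t ∈ s, opA (w t) = A (w t) := fun t ht => by
    conv_lhs => rw [← (hE.mem_galSpan_iff N _).1 (hm t ht)]
    exact hA _
  have h2 : ∀ u ∈ galSpan e N, lift u = liftP e N u := fun u hu => by
    conv_lhs => rw [← (hE.mem_galSpan_iff N _).1 hu]
    exact hE.lift_projH' N _
  refine ⟨(A.continuous.comp_continuousOn hw).congr h1,
    ((liftP e N).continuous.comp_continuousOn hw).congr fun t ht => h2 _ (hm t ht),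
    ((liftP e N ∘L A).continuous.comp_continuousOn hw).congr fun t ht => ?_⟩
  rw [h2 _ (hE.opA_mem (hm t ht)), h1 t ht]
  rfl

theorem affine_lift_le (k : ℝ → V' S) (K : H S →L[ℝ] H S) (s : ℝ) {w : H S}
    (hw : InV w) : affine k K s w (lift w) ≤ ‖k s‖ * normV w + ‖K‖ * ‖w‖ ^ 2 := by
  rw [affine, add_apply]
  exact add_le_add ((le_abs_self _).trans ((k s).le_opNorm _)) (inner_pivot_le K hw)

theorem IsEigenbasis.inner_projH_of_mem (hE : IsEigenbasis S e μ) {N : ℕ} {u : H S} (hu : u ∈ galSpan e N) (v : H S) :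
    ⟪u, projH e N v⟫ = ⟪u, v⟫ := by
  rw [← hE.galProj_pivot, hE.inner_galProj_of_mem hu, pivot_apply,
    (hE.inV_of_mem hu).incl_lift, real_inner_comm]

theorem norm_affine_le (k : ℝ → V' S) (K : H S →L[ℝ] H S) (s : ℝ) (w : H S) :
    ‖affine k K s w‖ ≤ ‖k s‖ + ‖K‖ * ‖w‖ :=
  (norm_add_le _ _).trans (add_le_add le_rfl ((norm_pivot_le _).trans (K.le_opNorm w)))

theorem norm_lift_lap_le {u : H S} (h : InDA32 u) : ‖lift (lap u)‖ ≤ 2 * ‖lift (opA u)‖ := by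
  rw [lap, h.2.lift_sub h.inV, two_mul]
  exact (norm_sub_le _ _).trans (add_le_add le_rfl ((h.1.normV_le).trans h.normDA_le))

theorem NonlinearBounds.lapV_f_le_of_le {f g : ℝ → ℝ} (hN : NonlinearBounds S f g C) {u : H S} (h : InDA32 u) {B : ℝ} (hB : normV u ≤ B) :
    ‖lapV (lift (fH f u))‖ ≤ C * (1 + B) * B * (1 + normDA u) := by
  refine (hN.lapV_f_le h).trans ?_
  have h1 := normV_nonneg u
  have h2 := normDA_nonneg u
  have h3 := hN.nonneg
  have h4 := h1.trans hB
  calc C * ((1 + normV u) * (1 + normDA u)) * normV u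
      ≤ C * ((1 + B) * (1 + normDA u)) * B := by gcongr
    _ = _ := by ring

theorem IsEigenbasis.lapV_lift_of_mem (hE : IsEigenbasis S e μ) {N : ℕ} {a : H S} (ha : a ∈ galSpan e N) {u : H S} (hu : InV u) :
    lapV (lift u) (lift a) = lapV (lift (projH e N u)) (lift a) := by
  rw [hE.lift_projH hu, hE.lapV_projV, ← hE.lift_projH (hE.inV_of_mem ha),
    (hE.mem_galSpan_iff N _).1 ha]

/-- The path `u` satisfies `P_N u(t) = P_N u0 + ∫₀ᵗ P_N ξ` on `[0, T]`. -/
def ProjEq (e : ℕ → H S) (N : ℕ) (T : ℝ) (u0 : H S) (u : ℝ → H S) (ξ : ℝ → V' S) :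
    Prop := IntegrableOn (fun s => galProj e N (ξ s)) (Ioo 0 T) ∧
    ∀ t ∈ Icc 0 T, projH e N (u t) = projH e N u0 + ∫ s in 0..t, galProj e N (ξ s)

theorem ProjEq.sub {N : ℕ} {T : ℝ} {u0 v0 : H S} {u v : ℝ → H S}
    {ξ ζ : ℝ → V' S} (h : ProjEq e N T u0 u ξ) (h' : ProjEq e N T v0 v ζ) :
    ProjEq e N T (u0 - v0) (fun t => u t - v t) (fun t => ξ t - ζ t) := by
  have e1 : ∀ s, galProj e N (ξ s - ζ s) = galProj e N (ξ s) - galProj e N (ζ s) := fun s => by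
    simp only [← galProjL_apply, map_sub]
  refine ⟨(h.1.sub h'.1).congr (.of_forall fun s => (e1 s).symm), fun t ht => ?_⟩
  have hi : ∀ {φ : ℝ → H S}, IntegrableOn φ (Ioo 0 T) → IntervalIntegrable φ volume 0 t := fun h =>
    intervalIntegrable_of_mem h ht
  rw [map_sub, h.2 t ht, h'.2 t ht, map_sub]
  simp only [e1]
  rw [intervalIntegral.integral_sub (hi h.1) (hi h'.1)]
  abel

section

variable (hE : IsEigenbasis S e μ)
include hE

theorem IsEigenbasis.projH_galProj {N M : ℕ}
    (h : N ≤ M) (ℓ : V' S) : projH e N (galProj e M ℓ) = galProj e N ℓ := hE.ext fun k => by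
    rw [hE.inner_projH, hE.inner_galProj, hE.inner_galProj]
    split_ifs <;> first | rfl | omega

theorem IsEigenbasis.projH_projH_of_le
    {N M : ℕ} (h : N ≤ M) (u : H S) : projH e N (projH e M u) = projH e N u := hE.ext fun k => by
    simp only [hE.inner_projH]
    split_ifs <;> first | rfl | omega

/-- The chain rule for the norms of `H` and `V` of a projected path. -/
theorem IsEigenbasis.norm_sq_chain {N : ℕ} {T : ℝ} {u0 : H S} {u : ℝ → H S} {ξ : ℝ → V' S}
    (h : ProjEq e N T u0 u ξ) (hT : 0 ≤ T) : ContinuousOn (fun t => projH e N (u t)) (Icc 0 T) ∧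
    ∀ t ∈ Icc 0 T, (IntervalIntegrable (fun s => 2 * ξ s (lift (projH e N (u s)))) volume 0 t ∧
        ‖projH e N (u t)‖ ^ 2 = ‖projH e N u0‖ ^ 2 +
          ∫ s in 0..t, 2 * ξ s (lift (projH e N (u s)))) ∧
      (IntervalIntegrable (fun s => 2 * ξ s (lift (opA (projH e N (u s))))) volume 0 t ∧
        normV (projH e N (u t)) ^ 2 = normV (projH e N u0) ^ 2 +
          ∫ s in 0..t, 2 * ξ s (lift (opA (projH e N (u s))))) := by
  obtain ⟨hi, he⟩ := h
  have h0 : projH e N (u 0) = projH e N u0 := by rw [he 0 ⟨le_rfl, hT⟩]; simp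
  have hp : ∀ t ∈ Icc 0 T, projH e N (u t) = projH e N (u 0) +
      ∫ s in 0..t, galProj e N (ξ s) := fun t ht => by rw [he t ht, h0]
  have hm := fun s => hE.projH_mem N (u s)
  have hlift : ∀ v ∈ galSpan e N, lift v = liftP e N v := fun v hv => by
    conv_lhs => rw [← (hE.mem_galSpan_iff N _).1 hv]
    exact hE.lift_projH' N _
  have hgm := fun s => IsEigenbasis.galProj_mem (e := e) N (ξ s)
  refine ⟨continuousOn_of_eq_integral (w := fun t => projH e N (u t)) hi hp, fun t ht => ⟨?_, ?_⟩⟩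
  · obtain ⟨a, b⟩ := CahnHilliard.norm_sq_chain (w := fun t => projH e N (u t)) hi hp ht
    simp only [hE.inner_galProj_of_mem (hm _)] at a b
    rw [h0] at b
    exact ⟨a, b⟩
  · obtain ⟨a, b⟩ := CahnHilliard.norm_sq_chain (w := fun t => liftP e N (projH e N (u t)))
      (R := fun s => liftP e N (galProj e N (ξ s))) ((liftP e N).integrable_comp hi)
      (fun r hr => by
        rw [hp r hr, map_add, (liftP e N).intervalIntegral_comp_comm
          (intervalIntegrable_of_mem hi hr)]) ht
    have e1 : ∀ s, ⟪liftP e N (projH e N (u s)), liftP e N (galProj e N (ξ s))⟫ =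
        ξ s (lift (opA (projH e N (u s)))) := fun s => by
      rw [← hlift _ (hm s), ← hlift _ (hgm s), (hE.inDA32_of_mem (hm s)).1.inner_lift,
        (hE.inV_of_mem (hgm s)).incl_lift, hE.inner_galProj_of_mem (hE.opA_mem (hm s))]
    simp only [e1] at a b
    rw [← hlift _ (hm t), ← hlift _ (hm 0), h0] at b
    exact ⟨a, b⟩

theorem IsEigenbasis.abs_inner_le (u : H S)
    (k : ℕ) : |⟪u, e k⟫| ≤ ‖u‖ := by simpa [hE.1.1 k] using abs_real_inner_le_norm u (e k)

theorem IsEigenbasis.normDA_sq_le_of_mem {N : ℕ} {u : H S} (h : u ∈ galSpan e N) :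
    normDA u ^ 2 ≤ μ N * normV u ^ 2 := by
  have hV := hE.inV_of_mem h
  refine hasSum_le (fun k => ?_) (hE.hasSum_DA (hE.inDA32_of_mem h).1)
    ((hE.hasSum_V (lift u)).mul_left (μ N))
  rw [hV.incl_lift, ← (hE.mem_galSpan_iff N u).1 h, hE.inner_projH]
  split_ifs with hk
  · rw [pow_two (μ k), mul_assoc]
    have := (hE.pos k).le
    exact mul_le_mul_of_nonneg_right (hE.2.2.1 hk.le) (by positivity)
  · simp

theorem IsEigenbasis.tendsto_rate (hd : 1 ≤ d) (K : ℝ) : Tendsto (fun N => √(μ N)⁻¹ * K) atTop (𝓝 0) := by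
  have := ((tendsto_inv_atTop_zero.comp (hE.tendsto_atTop hd)).sqrt).mul_const K
  simpa using this

theorem IsEigenbasis.rate_le_one (N : ℕ) : √(μ N)⁻¹ ≤ 1 :=
  Real.sqrt_le_one.2 (inv_le_one_of_one_le₀ (hE.one_le N))

end

end

variable {P : Model d} [Fact P.S.IsAdmissible] {F : ℝ → ℝ} {e : ℕ → H P.S} {μ : ℕ → ℝ} {C : ℝ}

/-- The energy inequality. -/
theorem AnalyticData.energy_le (hA : AnalyticData P F e μ C) :
    ∃ c > 0, ∃ M ≥ 0, ∀ (w1 w2 : H P.S) (η1 η2 : V' P.S), InDA32 w1 → InV w2 →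
      full₁ P η1 w1 w2 (lift w1) + full₂ P η2 w1 w2 (lift w2) ≤
        -c * (normDA w1 ^ 2 + normV w2 ^ 2) + M * (‖w1‖ ^ 2 + ‖w2‖ ^ 2) +
          (η1 (lift w1) + η2 (lift w2)) := by
  obtain ⟨c, hc, M, hM, h⟩ := energy_algebra (C := C)
    (m := |P.ν₀ * P.ν₁| + (|P.ν₁| + |P.ν₀|)) hA.ν₂_pos
  refine ⟨c, hc, M, hM, fun w1 w2 η1 η2 hw1 hw2 => ?_⟩
  have key := h (normDA w1) (normV w1) (normV w2) ‖w1‖ ‖w2‖ (normDA_nonneg _) (normV_nonneg _)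
    (normV_nonneg _) (norm_nonneg _) (hw1.1.normV_sq_le)
  have a1 : lapV (lift (lap w1)) (lift w1) = ‖lap w1‖ ^ 2 := by
    rw [lapV_comm, inner_lap_eq hw1.1, hw1.inV_lap.incl_lift, real_inner_self_eq_norm_sq]
  have a2 := abs_lapV_le' (lift w1) (lift w1)
  have a3 := abs_lapV_le' (lift w2) (lift w1)
  have a4 : lapV (lift (fH P.f w1)) (lift w1) = ⟪fH P.f w1, lap w1⟫ := by
    rw [lapV_comm, inner_lap_eq hw1.1, (hA.bounds.inV _ hw1).incl_lift, real_inner_comm]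
  have a5 := hA.bounds.f_lap w1 hw1
  have a6 := hA.bounds.g_self w1 hw1
  have a7 : lapV (lift w2) (lift w2) = normV w2 ^ 2 - ‖w2‖ ^ 2 := by
    rw [lapV_apply', hw2.incl_lift, real_inner_self_eq_norm_sq, real_inner_self_eq_norm_sq, normV]
  have a8 := lapV_comm (lift w1) (lift w2)
  have a9 := sq_normDA_le w1
  have hV1 := normV_nonneg w1
  have hV2 := normV_nonneg w2
  have b2 : -(P.ν₀ * P.ν₁ * lapV (lift w1) (lift w1)) ≤ |P.ν₀ * P.ν₁| * (normV w1 * normV w1) := by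
    refine (neg_le_abs _).trans ?_
    rw [abs_mul]
    exact mul_le_mul_of_nonneg_left a2 (abs_nonneg _)
  have b3 : P.ν₁ * lapV (lift w2) (lift w1) ≤ |P.ν₁| * (normV w2 * normV w1) := by
    refine (le_abs_self _).trans ?_
    rw [abs_mul]
    exact mul_le_mul_of_nonneg_left a3 (abs_nonneg _)
  have b4 : P.ν₀ * lapV (lift w2) (lift w1) ≤ |P.ν₀| * (normV w2 * normV w1) := by
    refine (le_abs_self _).trans ?_
    rw [abs_mul]
    exact mul_le_mul_of_nonneg_left a3 (abs_nonneg _)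
  have b5 : P.ν₂ * (normDA w1 ^ 2 / 2 - ‖w1‖ ^ 2) ≤ P.ν₂ * ‖lap w1‖ ^ 2 :=
    mul_le_mul_of_nonneg_left (by linarith) hA.ν₂_pos.le
  have b6 : 0 ≤ |P.ν₀ * P.ν₁| * (normV w1 * normV w2) := by positivity
  have b7 : 0 ≤ (|P.ν₁| + |P.ν₀|) * normV w1 ^ 2 := by positivity
  simp only [full₁, full₂, add_apply, sub_apply, smul_apply, neg_apply, smul_eq_mul]
  rw [a1, a4, a7, a8]
  nlinarith [key, a5, a6, b2, b3, b4, b5, b6, b7]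

section LocallyLipschitz

variable {X Y Z : Type*} [NormedAddCommGroup X] [NormedSpace ℝ X] [NormedAddCommGroup Y] [NormedSpace ℝ Y] [NormedAddCommGroup Z] [NormedSpace ℝ Z]

theorem LipschitzOnBalls.of_bound {f : X → Y} (h : ∀ M : ℝ, 0 ≤ M → ∃ K : ℝ, 0 ≤ K ∧
    ∀ x y, ‖x‖ ≤ M → ‖y‖ ≤ M → ‖f x - f y‖ ≤ K * ‖x - y‖) : LipschitzOnBalls f := by
  intro M
  obtain ⟨K, hK, hf⟩ := h (max M 0) (le_max_right _ _)
  refine ⟨⟨K, hK⟩, LipschitzOnWith.of_dist_le_mul fun x hx y hy => ?_⟩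
  rw [dist_eq_norm, dist_eq_norm]
  exact hf x y ((mem_closedBall_zero_iff.1 hx).trans (le_max_left _ _))
    ((mem_closedBall_zero_iff.1 hy).trans (le_max_left _ _))

theorem LipschitzOnBalls.clm (L : X →L[ℝ] Y) : LipschitzOnBalls L := fun _ =>
  ⟨_, L.lipschitz.lipschitzOnWith⟩

theorem LipschitzOnBalls.add {f g : X → Y} (hf : LipschitzOnBalls f) (hg : LipschitzOnBalls g) :
    LipschitzOnBalls fun x => f x + g x := by
  intro M
  obtain ⟨K, hK⟩ := hf M
  obtain ⟨L, hL⟩ := hg M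
  exact ⟨K + L, hK.add hL⟩

theorem LipschitzOnBalls.clm_comp (L : Y →L[ℝ] Z) {f : X → Y} (hf : LipschitzOnBalls f) :
    LipschitzOnBalls fun x => L (f x) := by
  intro M
  obtain ⟨K, hK⟩ := hf M
  exact ⟨_, L.lipschitz.comp_lipschitzOnWith hK⟩

theorem LipschitzOnBalls.comp_clm {f : Y → Z} (hf : LipschitzOnBalls f) (L : X →L[ℝ] Y) :
    LipschitzOnBalls fun x => f (L x) := by
  intro M
  obtain ⟨K, hK⟩ := hf (‖L‖ * M)
  refine ⟨_, hK.comp L.lipschitz.lipschitzOnWith fun x hx => ?_⟩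
  rw [mem_closedBall_zero_iff] at hx ⊢
  exact (L.le_opNorm x).trans (mul_le_mul_of_nonneg_left hx (norm_nonneg _))

end LocallyLipschitz

section

variable (hA : AnalyticData P F e μ C)
include hA

theorem AnalyticData.exists_lipFactor_bound (N : ℕ) (M : ℝ)
    (hM : 0 ≤ M) : ∃ K : ℝ, 0 ≤ K ∧ ∀ x y : H P.S, ‖x‖ ≤ M → ‖y‖ ≤ M →
      C * lipFactor (projH e N x) (projH e N y) * normV (projH e N x - projH e N y) ≤
        K * ‖x - y‖ := by
  obtain ⟨A, hAP⟩ := hA.basis.exists_opAP N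
  have hC := hA.bounds.nonneg
  refine ⟨C * ((1 + (‖liftP e N‖ * M + ‖liftP e N‖ * M)) * (1 + (‖A‖ * M + ‖A‖ * M))) *
    ‖liftP e N‖, by positivity, fun x y hx hy => ?_⟩
  have hv : ∀ z : H P.S, normV (projH e N z) ≤ ‖liftP e N‖ * ‖z‖ := fun z => by
    rw [normV, hA.basis.lift_projH']; exact le_opNorm _ _
  have hd : ∀ z : H P.S, normDA (projH e N z) ≤ ‖A‖ * ‖z‖ := fun z => by
    rw [normDA, hAP]; exact le_opNorm _ _
  rw [← map_sub, mul_assoc _ ‖liftP e N‖]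
  refine mul_le_mul ?_ (hv _) (normV_nonneg _) (by positivity)
  refine mul_le_mul_of_nonneg_left ?_ hC
  have b1 := normV_nonneg (projH e N x)
  have b2 := normV_nonneg (projH e N y)
  have b3 := normDA_nonneg (projH e N x)
  have b4 := normDA_nonneg (projH e N y)
  have c1 := (hv x).trans (mul_le_mul_of_nonneg_left hx (norm_nonneg _))
  have c2 := (hv y).trans (mul_le_mul_of_nonneg_left hy (norm_nonneg _))
  have c3 := (hd x).trans (mul_le_mul_of_nonneg_left hx (norm_nonneg _))
  have c4 := (hd y).trans (mul_le_mul_of_nonneg_left hy (norm_nonneg _))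
  unfold lipFactor
  gcongr

theorem AnalyticData.lipschitz_lapV_fH (N : ℕ) :
    LipschitzOnBalls fun x : H P.S => lapV (lift (fH P.f (projH e N x))) := by
  refine LipschitzOnBalls.of_bound fun M hM => ?_
  obtain ⟨K, hK, h⟩ := hA.exists_lipFactor_bound N M hM
  exact ⟨K, hK, fun x y hx hy => (hA.bounds.f_sub _ _ (hA.basis.inDA32_projH N x)
    (hA.basis.inDA32_projH N y)).trans (h x y hx hy)⟩

theorem AnalyticData.lipschitz_gD (N : ℕ) :
    LipschitzOnBalls fun x : H P.S => gD P.g (projH e N x) := by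
  refine LipschitzOnBalls.of_bound fun M hM => ?_
  obtain ⟨K, hK, h⟩ := hA.exists_lipFactor_bound N M hM
  exact ⟨K, hK, fun x y hx hy => (hA.bounds.g_sub _ _ (hA.basis.inDA32_projH N x)
    (hA.basis.inDA32_projH N y)).trans (h x y hx hy)⟩

/-- The right-hand sides of the Galerkin system are the projections of those of the system. -/
theorem AnalyticData.galRHS₁_eq {N : ℕ} {w1 w2 : ℝ → H P.S} {t : ℝ}
    (h1 : w1 t ∈ galSpan e N) (h2 : w2 t ∈ galSpan e N) (η : ℝ → H P.S → V' P.S) :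
    galRHS₁ P e N η w1 w2 t = galProj e N (full₁ P (η t (w1 t)) (w1 t) (w2 t)) := by
  rw [galRHS₁, full₁, ← galProjL_apply, ← galProjL_apply]
  simp only [map_add, map_sub, map_neg, map_smul, hA.basis.galProj_lapV' h1,
    hA.basis.galProj_lapV' h2, hA.basis.galProj_lapV' (hA.basis.lap_mem h1)]
  rw [fH, gD]
  abel

theorem AnalyticData.galRHS₂_eq {N : ℕ} {w1 w2 : ℝ → H P.S} {t : ℝ}
    (h1 : w1 t ∈ galSpan e N) (h2 : w2 t ∈ galSpan e N) (η : ℝ → H P.S → V' P.S) :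
    galRHS₂ P e N η w1 w2 t = galProj e N (full₂ P (η t (w2 t)) (w1 t) (w2 t)) := by
  rw [galRHS₂, full₂, ← galProjL_apply, ← galProjL_apply]
  simp only [map_add, map_neg, map_smul, hA.basis.galProj_lapV' h1, hA.basis.galProj_lapV' h2]

theorem AnalyticData.lipschitz_full₁ (N : ℕ)
    (K : H P.S →L[ℝ] H P.S) : LipschitzOnBalls fun x : WithLp 2 (H P.S × H P.S) =>
      full₁ P (pivot (K (projH e N x.fst))) (projH e N x.fst) (projH e N x.snd) := by
  obtain ⟨L, hL⟩ := hA.basis.exists_lapP N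
  have e1 : ∀ x : H P.S, lapV (lift (projH e N x)) = (lapVL P.S ∘L liftP e N) x := fun x => by
    rw [hA.basis.lift_projH']; rfl
  have e2 : ∀ x : H P.S, lapV (lift (lap (projH e N x))) = (lapVL P.S ∘L liftP e N ∘L L) x := by
    intro x
    rw [← (hA.basis.mem_galSpan_iff N _).1 (hA.basis.lap_mem (hA.basis.projH_mem N x)),
      hA.basis.lift_projH', hL]; rfl
  let f1 := WithLp.fstL 2 ℝ (H P.S) (H P.S)
  let f2 := WithLp.sndL 2 ℝ (H P.S) (H P.S)
  have h1 := ((LipschitzOnBalls.clm ((-P.ν₂ • (lapVL P.S ∘L liftP e N ∘L L) -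
    (P.ν₀ * P.ν₁) • (lapVL P.S ∘L liftP e N) + pivotL P.S ∘L K ∘L projH e N) ∘L f1 +
    (P.ν₁ • (lapVL P.S ∘L liftP e N)) ∘L f2)).add
    (((hA.lipschitz_lapV_fH N).comp_clm f1).clm_comp (-ContinuousLinearMap.id ℝ _))).add
    (((hA.lipschitz_gD N).comp_clm f1).clm_comp (-ContinuousLinearMap.id ℝ _))
  convert h1 using 2 with x
  rw [full₁, e1, e1, e2]
  simp only [f1, f2, add_apply, sub_apply, smul_apply, comp_apply, neg_apply,
    ContinuousLinearMap.id_apply, pivotL_apply, WithLp.fstL_apply, WithLp.sndL_apply]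
  abel

theorem AnalyticData.lipschitz_full₂ (N : ℕ)
    (K : H P.S →L[ℝ] H P.S) : LipschitzOnBalls fun x : WithLp 2 (H P.S × H P.S) =>
      full₂ P (pivot (K (projH e N x.snd))) (projH e N x.fst) (projH e N x.snd) := by
  have e1 : ∀ x : H P.S, lapV (lift (projH e N x)) = (lapVL P.S ∘L liftP e N) x := fun x => by
    rw [hA.basis.lift_projH']; rfl
  let f1 := WithLp.fstL 2 ℝ (H P.S) (H P.S)
  let f2 := WithLp.sndL 2 ℝ (H P.S) (H P.S)
  have h1 := LipschitzOnBalls.clm (((-(lapVL P.S ∘L liftP e N) + pivotL P.S ∘L K ∘L projH e N) ∘L f2 +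
    (P.ν₀ • (lapVL P.S ∘L liftP e N)) ∘L f1))
  convert h1 using 2 with x
  rw [full₂, e1, e1]
  simp only [f1, f2, add_apply, smul_apply, comp_apply, neg_apply,
    pivotL_apply, WithLp.fstL_apply, WithLp.sndL_apply]
  abel

end

theorem full₁_add (η k : V' P.S) (w1 w2 : H P.S) : full₁ P (k + η) w1 w2 = full₁ P η w1 w2 + k := by
  simp only [full₁]; abel

theorem full₂_add (η k : V' P.S) (w1 w2 : H P.S) : full₂ P (k + η) w1 w2 = full₂ P η w1 w2 + k := by
  simp only [full₂]; abel

/-- Existence of the Galerkin approximations. -/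
theorem AnalyticData.exists_isGalerkin (hA : AnalyticData P F e μ C) (N : ℕ) {k1 k2 : ℝ → V' P.S}
    (hk1 : LocL2 k1) (hk2 : LocL2 k2) (K1 K2 : H P.S →L[ℝ] H P.S) (w01 w02 : H P.S) :
    ∃ w1 w2 : ℝ → H P.S, IsGalerkin P e N (affine k1 K1) (affine k2 K2) w01 w02 w1 w2 := by
  have hE := hA.basis
  let G1 : WithLp 2 (H P.S × H P.S) → V' P.S := fun x =>
    full₁ P (pivot (K1 (projH e N x.fst))) (projH e N x.fst) (projH e N x.snd)
  let G2 : WithLp 2 (H P.S × H P.S) → V' P.S := fun x =>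
    full₂ P (pivot (K2 (projH e N x.snd))) (projH e N x.fst) (projH e N x.snd)
  let f1 := WithLp.fstL 2 ℝ (H P.S) (H P.S)
  let f2 := WithLp.sndL 2 ℝ (H P.S) (H P.S)
  let i : (H P.S × H P.S) →L[ℝ] WithLp 2 (H P.S × H P.S) :=
    (WithLp.prodContinuousLinearEquiv 2 ℝ (H P.S) (H P.S)).symm
  let i1 : V' P.S →L[ℝ] WithLp 2 (H P.S × H P.S) :=
    i ∘L (ContinuousLinearMap.inl ℝ (H P.S) (H P.S)) ∘L galProjL e N
  let i2 : V' P.S →L[ℝ] WithLp 2 (H P.S × H P.S) :=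
    i ∘L (ContinuousLinearMap.inr ℝ (H P.S) (H P.S)) ∘L galProjL e N
  let R : WithLp 2 (H P.S × H P.S) → WithLp 2 (H P.S × H P.S) := fun x => i1 (G1 x) + i2 (G2 x)
  let φ : ℝ → WithLp 2 (H P.S × H P.S) := fun t => i1 (k1 t) + i2 (k2 t)
  have hi1 : ∀ a b, (i1 a + i2 b).fst = galProj e N a := by
    intro a b
    rw [← galProjL_apply]
    simp [i1, i2, i]
  have hi2 : ∀ a b, (i1 a + i2 b).snd = galProj e N b := by
    intro a b
    rw [← galProjL_apply]
    simp [i1, i2, i]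
  have hRL : LipschitzOnBalls R :=
    ((hA.lipschitz_full₁ N K1).clm_comp i1).add ((hA.lipschitz_full₂ N K2).clm_comp i2)
  have hRc : Continuous R := hRL.continuous
  obtain ⟨c, hc, M, hM, henergy⟩ := hA.energy_le
  have hdiss : ∀ x, ⟪x, R x⟫ ≤ (M + ‖K1‖ + ‖K2‖) * (1 + ‖x‖ ^ 2) := by
    intro x
    have hp : ∀ (u : H P.S) (ℓ : V' P.S), ⟪u, galProj e N ℓ⟫ = ℓ (lift (projH e N u)) := by
      intro u ℓ
      rw [← hE.inner_galProj_of_mem (hE.projH_mem N u)]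
      refine ((hE.basis.hasSum_inner_mul_inner _ _).unique
        ((hE.basis.hasSum_inner_mul_inner _ _).congr_fun fun j => ?_))
      have h1 := hE.inner_galProj N ℓ j
      rw [real_inner_comm] at h1
      rw [hE.basis_apply, hE.inner_projH, h1]
      split_ifs <;> simp
    have e1 : ⟪x, R x⟫ = G1 x (lift (projH e N x.fst)) + G2 x (lift (projH e N x.snd)) := by
      rw [WithLp.prod_inner_apply, ← hp, ← hp]
      congr 2
      · exact hi1 _ _
      · exact hi2 _ _
    have h1 := henergy (projH e N x.fst) (projH e N x.snd) (pivot (K1 (projH e N x.fst)))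
      (pivot (K2 (projH e N x.snd))) (hE.inDA32_projH N _) (hE.inDA32_projH N _).inV
    have h2 := inner_pivot_le K1 (hE.inDA32_projH N x.fst).inV
    have h3 := inner_pivot_le K2 (hE.inDA32_projH N x.snd).inV
    have h4 := WithLp.prod_norm_sq_eq_of_L2 x
    have h5 : ‖projH e N x.fst‖ ^ 2 ≤ ‖x.fst‖ ^ 2 :=
      pow_le_pow_left₀ (norm_nonneg _) (hE.norm_projH_le N _) 2
    have h6 : ‖projH e N x.snd‖ ^ 2 ≤ ‖x.snd‖ ^ 2 :=
      pow_le_pow_left₀ (norm_nonneg _) (hE.norm_projH_le N _) 2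
    have h7 : 0 ≤ c * (normDA (projH e N x.fst) ^ 2 + normV (projH e N x.snd) ^ 2) := by positivity
    have n1 := norm_nonneg K1
    have n2 := norm_nonneg K2
    have p1 := mul_le_mul_of_nonneg_left h5 (add_nonneg hM n1)
    have p2 := mul_le_mul_of_nonneg_left h6 (add_nonneg hM n2)
    have p3 := mul_nonneg n1 (sq_nonneg ‖x.snd‖)
    have p4 := mul_nonneg n2 (sq_nonneg ‖x.fst‖)
    rw [e1, h4]
    nlinarith
  have hφi : ∀ T : ℝ, 0 < T → IntegrableOn φ (Ioo 0 T) := fun T hT =>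
    (i1.integrable_comp (hk1.integrableOn hT)).add (i2.integrable_comp (hk2.integrableOn hT))
  obtain ⟨w, hw0, hwc, hw⟩ := exists_global_solution hRL (by positivity) hdiss hφi
    (i1 (pivot w01) + i2 (pivot w02))
  have hint : ∀ T, 0 < T → IntegrableOn (fun s => R (w s) + φ s) (Ioo 0 T) := fun T hT =>
    (((hRc.comp_continuousOn (hwc.mono Icc_subset_Ici_self)).integrableOn_Icc).mono_set
      Ioo_subset_Icc_self).add (hφi T hT)
  have hii : ∀ t, 0 ≤ t → IntervalIntegrable (fun s => R (w s) + φ s) volume 0 t := fun t ht =>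
    intervalIntegrable_of_mem (hint (t + 1) (by linarith)) ⟨ht, by linarith⟩
  have hform : ∀ s, R (w s) + φ s = i1 (G1 (w s) + k1 s) + i2 (G2 (w s) + k2 s) := fun s => by
    simp only [R, φ, map_add]; abel
  have hcomp : ∀ (f : WithLp 2 (H P.S × H P.S) →L[ℝ] H P.S) (ξ : ℝ → V' P.S) (ξ0 : V' P.S),
      f (w 0) = galProj e N ξ0 → (∀ s, f (R (w s) + φ s) = galProj e N (ξ s)) →
      (∀ t, 0 ≤ t → f (w t) ∈ galSpan e N ∧
        f (w t) = galProj e N ξ0 + ∫ s in 0..t, galProj e N (ξ s)) ∧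
      ∀ T, 0 < T → IntegrableOn (fun s => galProj e N (ξ s)) (Ioo 0 T) := by
    intro f ξ ξ0 h0 hf
    have hc := fun t ht => f.intervalIntegral_comp_comm (hii t ht)
    simp only [hf] at hc
    refine ⟨fun t ht => ?_, fun T hT => by simp only [← hf]; exact f.integrable_comp (hint T hT)⟩
    have h : f (w t) = galProj e N ξ0 + ∫ s in 0..t, galProj e N (ξ s) := by
      rw [hw t ht, map_add, h0, hc t ht]
    have hξ : IntervalIntegrable (fun s => galProj e N (ξ s)) volume 0 t := by
      simp only [← hf]
      exact intervalIntegrable_of_mem (f.integrable_comp (hint (t + 1) (by linarith)))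
        ⟨ht, by linarith⟩
    refine ⟨?_, h⟩
    rw [h, hE.mem_galSpan_iff, map_add, ← (projH e N).intervalIntegral_comp_comm hξ]
    simp only [(hE.mem_galSpan_iff N _).1 (IsEigenbasis.galProj_mem N _)]
  obtain ⟨h1, hi1'⟩ := hcomp f1 (fun s => G1 (w s) + k1 s) (pivot w01) (by rw [hw0]; exact hi1 _ _)
    fun s => by rw [hform]; exact hi1 _ _
  obtain ⟨h2, hi2'⟩ := hcomp f2 (fun s => G2 (w s) + k2 s) (pivot w02) (by rw [hw0]; exact hi2 _ _)
    fun s => by rw [hform]; exact hi2 _ _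
  have hm1 : ∀ t, 0 ≤ t → (w t).fst ∈ galSpan e N := fun t ht => (h1 t ht).1
  have hm2 : ∀ t, 0 ≤ t → (w t).snd ∈ galSpan e N := fun t ht => (h2 t ht).1
  have hg1 : ∀ t, 0 ≤ t → galRHS₁ P e N (affine k1 K1) (fun t => (w t).fst) (fun t => (w t).snd) t =
      galProj e N (G1 (w t) + k1 t) := by
    intro t ht
    rw [hA.galRHS₁_eq (hm1 t ht) (hm2 t ht), affine, full₁_add]
    simp only [G1, (hE.mem_galSpan_iff N _).1 (hm1 t ht), (hE.mem_galSpan_iff N _).1 (hm2 t ht)]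
  have hg2 : ∀ t, 0 ≤ t → galRHS₂ P e N (affine k2 K2) (fun t => (w t).fst) (fun t => (w t).snd) t =
      galProj e N (G2 (w t) + k2 t) := by
    intro t ht
    rw [hA.galRHS₂_eq (hm1 t ht) (hm2 t ht), affine, full₂_add]
    simp only [G2, (hE.mem_galSpan_iff N _).1 (hm1 t ht), (hE.mem_galSpan_iff N _).1 (hm2 t ht)]
  refine ⟨fun t => (w t).fst, fun t => (w t).snd, fun t ht => ⟨hm1 t ht, hm2 t ht⟩,
    fun T hT => ⟨(hi1' T hT).congr_fun (fun t ht => (hg1 t ht.1.le).symm) measurableSet_Ioo,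
      (hi2' T hT).congr_fun (fun t ht => (hg2 t ht.1.le).symm) measurableSet_Ioo⟩,
    fun t ht => ⟨(h1 t ht).2.trans ?_, (h2 t ht).2.trans ?_⟩⟩
  · exact congrArg _ (integral_congr_of_le ht fun s hs => (hg1 s hs.1).symm)
  · exact congrArg _ (integral_congr_of_le ht fun s hs => (hg2 s hs.1).symm)

/-- Gronwall's inequality for an absolutely continuous quantity with dissipation `G`. -/
theorem gronwall_dissipative {y G I a κ : ℝ → ℝ} {T : ℝ} (hT : 0 ≤ T)
    (ha : IntegrableOn a (Ioo 0 T)) (ha0 : ∀ t, 0 ≤ a t) (hκ : IntegrableOn κ (Ioo 0 T))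
    (hκ0 : ∀ t, 0 ≤ κ t) (hG : IntegrableOn G (Ioo 0 T)) (hG0 : ∀ t, 0 ≤ G t)
    (hy : ContinuousOn y (Icc 0 T)) (hy0 : ∀ t ∈ Icc 0 T, 0 ≤ y t)
    (hI : ∀ t ∈ Icc 0 T, IntervalIntegrable I volume 0 t ∧ y t = y 0 + ∫ s in 0..t, I s)
    (hle : ∀ᵐ s ∂vol(T), I s ≤ -G s + a s * y s + κ s) : ∀ t ∈ Icc 0 T, y t + ∫ s in 0..t, G s ≤
      (y 0 + ∫ s in 0..T, κ s) * exp (2 * ∫ s in 0..T, a s) := by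
  have hayi : ∀ t ∈ Icc 0 T, IntervalIntegrable (fun s => a s * y s) volume 0 t := fun t ht =>
    (intervalIntegrable_of_mem ha ht).mul_continuousOn (hy.mono (by rw [uIcc_of_le ht.1]; exact Icc_subset_Icc_right ht.2))
  have hmonoT : ∀ {φ : ℝ → ℝ}, IntegrableOn φ (Ioo 0 T) → (∀ t, 0 ≤ φ t) → ∀ t ∈ Icc 0 T,
      ∫ s in 0..t, φ s ≤ ∫ s in 0..T, φ s := fun {φ} h h0 t ht =>
    integral_mono_interval le_rfl ht.1 ht.2 (.of_forall h0) (intervalIntegrable_of_mem h ⟨hT, le_rfl⟩)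
  have key : ∀ t ∈ Icc 0 T, y t + ∫ s in 0..t, G s ≤
      (y 0 + ∫ s in 0..T, κ s) + ∫ s in 0..t, a s * y s := by
    intro t ht
    obtain ⟨hi, he⟩ := hI t ht
    have h1 : ∫ s in 0..t, I s ≤ ∫ s in 0..t, (-G s + a s * y s + κ s) := by
      refine intervalIntegral.integral_mono_ae_restrict ht.1 hi
        (((intervalIntegrable_of_mem hG ht).neg.add (hayi t ht)).add (intervalIntegrable_of_mem hκ ht)) ?_
      have h2 : ∀ᵐ s ∂volume.restrict (Ioo 0 t), I s ≤ -G s + a s * y s + κ s :=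
        ae_restrict_of_ae_restrict_of_subset (Ioo_subset_Ioo_right ht.2) hle
      rwa [Measure.restrict_congr_set Ioo_ae_eq_Icc] at h2
    have hGn : IntervalIntegrable (fun s => -G s) volume 0 t := (intervalIntegrable_of_mem hG ht).neg
    rw [intervalIntegral.integral_add (hGn.add (hayi t ht)) (intervalIntegrable_of_mem hκ ht),
      intervalIntegral.integral_add hGn (hayi t ht), intervalIntegral.integral_neg] at h1
    have h3 := hmonoT hκ hκ0 t ht
    linarith
  have hGt : ∀ t ∈ Icc 0 T, 0 ≤ ∫ s in 0..t, G s := fun t ht =>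
    intervalIntegral.integral_nonneg ht.1 fun s _ => hG0 s
  set C := y 0 + ∫ s in 0..T, κ s with hC
  set A := ∫ s in 0..T, a s with hA
  have hC0 : 0 ≤ C := add_nonneg (hy0 0 ⟨le_rfl, hT⟩)
    (intervalIntegral.integral_nonneg hT fun s _ => hκ0 s)
  have hA0 : 0 ≤ A := intervalIntegral.integral_nonneg hT fun s _ => ha0 s
  have hyb : ∀ t ∈ Icc 0 T, y t ≤ C * exp A := by
    intro t ht
    refine (gronwall_integral (C := C) ha ha0 hy (fun t ht => ?_) t ht).trans ?_
    · exact (le_add_of_nonneg_right (hGt t ht)).trans (key t ht)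
    · exact mul_le_mul_of_nonneg_left (exp_le_exp.2 (hmonoT ha ha0 t ht)) hC0
  intro t ht
  refine (key t ht).trans ?_
  have h1 : ∫ s in 0..t, a s * y s ≤ ∫ s in 0..t, a s * (C * exp A) :=
    integral_mono_on ht.1 (hayi t ht) ((intervalIntegrable_of_mem ha ht).mul_const _) fun s hs =>
      mul_le_mul_of_nonneg_left (hyb s ⟨hs.1, hs.2.trans ht.2⟩) (ha0 s)
  rw [intervalIntegral.integral_mul_const] at h1
  have h2 := mul_le_mul_of_nonneg_right (hmonoT ha ha0 t ht) (mul_nonneg hC0 (exp_pos A).le)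
  have h3 : 1 + A ≤ exp A := by linarith [Real.add_one_le_exp A]
  have h4 : 1 ≤ exp A := Real.one_le_exp hA0
  have h5 : exp (2 * A) = exp A * exp A := by rw [two_mul, Real.exp_add]
  rw [h5]
  nlinarith [mul_le_mul_of_nonneg_left h3 (mul_nonneg hC0 (exp_pos A).le), mul_nonneg hC0 (sub_nonneg.2 h4)]

theorem L2Bound.of_sq_le {X : Type*} [NormedAddCommGroup X] {φ : ℝ → X} {G : ℝ → ℝ} {T C : ℝ}
    (hT : 0 ≤ T) (hC : 0 ≤ C) (hφ : AEStronglyMeasurable φ vol(T))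
    (hG : IntegrableOn G (Ioo 0 T)) (hle : ∀ᵐ t ∂vol(T), ‖φ t‖ ^ 2 ≤ G t)
    (h : ∫ s in 0..T, G s ≤ C ^ 2) : L2Bound T C φ := by
  refine ⟨hφ, ?_⟩
  have hi : Integrable (fun t => ‖φ t‖ ^ 2) vol(T) := hG.mono' (hφ.norm.pow 2) (by
      filter_upwards [hle] with t ht
      rwa [norm_of_nonneg (sq_nonneg _)])
  have hm : MemLp φ 2 vol(T) := (memLp_two_iff_integrable_sq_norm hφ).2 hi
  have h2 := integral_mono_ae hi hG hle
  rw [hm.eLpNorm_eq_integral_rpow_norm two_ne_zero ENNReal.ofNat_ne_top]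
  refine ENNReal.ofReal_le_ofReal ?_
  rw [integral_of_le hT, integral_Ioc_eq_integral_Ioo] at h
  simp only [ENNReal.toReal_ofNat, Real.rpow_ofNat]
  rw [← one_div, ← Real.sqrt_eq_rpow]
  exact Real.sqrt_le_iff.2 ⟨hC, h2.trans h⟩

theorem L2Bound.mono {X : Type*} [NormedAddCommGroup X] {φ : ℝ → X} {T C C' : ℝ}
    (h : L2Bound T C φ) (hC : C ≤ C') : L2Bound T C' φ :=
  ⟨h.1, h.2.trans (ENNReal.ofReal_le_ofReal hC)⟩

theorem LocL2.integrableOn_sq {X : Type*} [NormedAddCommGroup X] {φ : ℝ → X} (h : LocL2 φ) {T : ℝ}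
    (hT : 0 < T) : IntegrableOn (fun t => ‖φ t‖ ^ 2) (Ioo 0 T) :=
  (h T hT).integrable_norm_pow two_ne_zero

theorem AnalyticData.galerkin_path (hA : AnalyticData P F e μ C) {N : ℕ} {k1 k2 : ℝ → V' P.S}
    {K1 K2 : H P.S →L[ℝ] H P.S} {w01 w02 : H P.S} {w1 w2 : ℝ → H P.S}
    (hG : IsGalerkin P e N (affine k1 K1) (affine k2 K2) w01 w02 w1 w2) :
    ((∀ T, 0 < T → IntegrableOn (fun s => galProj e N
        (full₁ P (affine k1 K1 s (w1 s)) (w1 s) (w2 s))) (Ioo 0 T)) ∧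
      (∀ t, 0 ≤ t → w1 t = projH e N w01 +
        ∫ s in 0..t, galProj e N (full₁ P (affine k1 K1 s (w1 s)) (w1 s) (w2 s)))) ∧
    ((∀ T, 0 < T → IntegrableOn (fun s => galProj e N
        (full₂ P (affine k2 K2 s (w2 s)) (w1 s) (w2 s))) (Ioo 0 T)) ∧
      (∀ t, 0 ≤ t → w2 t = projH e N w02 +
        ∫ s in 0..t, galProj e N (full₂ P (affine k2 K2 s (w2 s)) (w1 s) (w2 s)))) := by
  obtain ⟨hm, hi, he⟩ := hG
  have h1 : ∀ t, 0 ≤ t → galRHS₁ P e N (affine k1 K1) w1 w2 t =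
      galProj e N (full₁ P (affine k1 K1 t (w1 t)) (w1 t) (w2 t)) := fun t ht =>
    hA.galRHS₁_eq (hm t ht).1 (hm t ht).2 _
  have h2 : ∀ t, 0 ≤ t → galRHS₂ P e N (affine k2 K2) w1 w2 t =
      galProj e N (full₂ P (affine k2 K2 t (w2 t)) (w1 t) (w2 t)) := fun t ht =>
    hA.galRHS₂_eq (hm t ht).1 (hm t ht).2 _
  refine ⟨⟨fun T hT => (hi T hT).1.congr_fun (fun t ht => h1 t ht.1.le) measurableSet_Ioo,
    fun t ht => ?_⟩, ⟨fun T hT => (hi T hT).2.congr_fun (fun t ht => h2 t ht.1.le) measurableSet_Ioo,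
    fun t ht => ?_⟩⟩
  · rw [(he t ht).1, hA.basis.galProj_pivot]
    exact congrArg _ (integral_congr_of_le ht fun s hs => h1 s hs.1)
  · rw [(he t ht).2, hA.basis.galProj_pivot]
    exact congrArg _ (integral_congr_of_le ht fun s hs => h2 s hs.1)

/-- The energy bound, uniform in `N`. -/
theorem AnalyticData.exists_energy_bound (hA : AnalyticData P F e μ C) {k1 k2 : ℝ → V' P.S}
    (hk1 : LocL2 k1) (hk2 : LocL2 k2) (K1 K2 : H P.S →L[ℝ] H P.S) (w01 w02 : H P.S) {T : ℝ}
    (hT : 0 < T) : ∃ B : ℝ, 0 ≤ B ∧ ∀ N w1 w2,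
      IsGalerkin P e N (affine k1 K1) (affine k2 K2) w01 w02 w1 w2 →
        (∀ t ∈ Icc 0 T, ‖w1 t‖ ≤ B ∧ ‖w2 t‖ ≤ B) ∧
        ∫ s in 0..T, (normDA (w1 s) ^ 2 + normV (w2 s) ^ 2) ≤ B := by
  obtain ⟨c, hc, M, hM, henergy⟩ := hA.energy_le
  have hE := hA.basis
  set α : ℝ := 2 * (M + ‖K1‖ + ‖K2‖) with hα
  have hα0 : 0 ≤ α := by positivity
  set κ : ℝ → ℝ := fun s => c⁻¹ * (‖k1 s‖ ^ 2 + ‖k2 s‖ ^ 2) with hκd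
  have hκi : IntegrableOn κ (Ioo 0 T) :=
    ((hk1.integrableOn_sq hT).add (hk2.integrableOn_sq hT)).const_mul c⁻¹
  have hκ0 : ∀ s, 0 ≤ κ s := fun s => by positivity
  set D : ℝ := (‖w01‖ ^ 2 + ‖w02‖ ^ 2 + ∫ s in 0..T, κ s) * exp (2 * ∫ s in 0..T, α) with hD
  have hκT : 0 ≤ ∫ s in 0..T, κ s := intervalIntegral.integral_nonneg hT.le fun s _ => hκ0 s
  have hD0 : 0 ≤ D := by positivity
  refine ⟨√D + c⁻¹ * D, by positivity, fun N w1 w2 hG => ?_⟩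
  obtain ⟨⟨hi1, he1⟩, ⟨hi2, he2⟩⟩ := hA.galerkin_path hG
  have hm := hG.1
  have h01 : w1 0 = projH e N w01 := by rw [he1 0 le_rfl]; simp
  have h02 : w2 0 = projH e N w02 := by rw [he2 0 le_rfl]; simp
  have hp1 := fun t (ht : t ∈ Icc 0 T) => by have := he1 t ht.1; rwa [← h01] at this
  have hp2 := fun t (ht : t ∈ Icc 0 T) => by have := he2 t ht.1; rwa [← h02] at this
  have hc1 : ContinuousOn w1 (Icc 0 T) := continuousOn_of_eq_integral (hi1 T hT) hp1
  have hc2 : ContinuousOn w2 (Icc 0 T) := continuousOn_of_eq_integral (hi2 T hT) hp2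
  have hG1 := (hE.continuousOn_path hc1 fun t ht => (hm t ht.1).1).1
  have hG2 := (hE.continuousOn_path hc2 fun t ht => (hm t ht.1).2).2.1
  have hGc : ContinuousOn (fun s => c * (normDA (w1 s) ^ 2 + normV (w2 s) ^ 2)) (Icc 0 T) :=
    continuousOn_const.mul ((hG1.norm.pow 2).add (hG2.norm.pow 2))
  have key := gronwall_dissipative (y := fun t => ‖w1 t‖ ^ 2 + ‖w2 t‖ ^ 2)
    (G := fun s => c * (normDA (w1 s) ^ 2 + normV (w2 s) ^ 2)) (a := fun _ => α) (κ := κ)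
    (I := fun s => 2 * ⟪w1 s, galProj e N (full₁ P (affine k1 K1 s (w1 s)) (w1 s) (w2 s))⟫ +
      2 * ⟪w2 s, galProj e N (full₂ P (affine k2 K2 s (w2 s)) (w1 s) (w2 s))⟫)
    hT.le (integrableOn_const (by simp)) (fun _ => hα0) hκi hκ0
    (hGc.integrableOn_Icc.mono_set Ioo_subset_Icc_self) (fun s => by positivity)
    ((hc1.norm.pow 2).add (hc2.norm.pow 2)) (fun t _ => by positivity)
    (fun t ht => by
      obtain ⟨a1, b1⟩ := norm_sq_chain (hi1 T hT) hp1 ht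
      obtain ⟨a2, b2⟩ := norm_sq_chain (hi2 T hT) hp2 ht
      refine ⟨a1.add a2, ?_⟩
      rw [intervalIntegral.integral_add a1 a2, b1, b2]
      ring)
    (by
      filter_upwards [ae_restrict_mem measurableSet_Ioo] with s hs
      have m1 := (hm s hs.1.le).1
      have m2 := (hm s hs.1.le).2
      have d1 := hE.inDA32_of_mem m1
      have d2 := hE.inV_of_mem m2
      rw [hE.inner_galProj_of_mem m1, hE.inner_galProj_of_mem m2]
      have b := henergy (w1 s) (w2 s) (affine k1 K1 s (w1 s)) (affine k2 K2 s (w2 s)) d1 d2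
      have b1 := affine_lift_le k1 K1 s d1.inV
      have b2 := affine_lift_le k2 K2 s d2
      have b3 := d1.1.normV_le
      have q : ∀ x y : ℝ, x * y ≤ c / 2 * y ^ 2 + c⁻¹ * x ^ 2 / 2 := fun x y => by
        have h : 0 ≤ c / 2 * (y - c⁻¹ * x) ^ 2 := by positivity
        have h2 : c / 2 * (y - c⁻¹ * x) ^ 2 = c / 2 * y ^ 2 + c⁻¹ * x ^ 2 / 2 - x * y := by
          field_simp; ring
        linarith
      have q1 := q ‖k1 s‖ (normDA (w1 s))
      have q2 := q ‖k2 s‖ (normV (w2 s))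
      have b4 := mul_le_mul_of_nonneg_left b3 (norm_nonneg (k1 s))
      have p1 : 0 ≤ ‖K1‖ * ‖w2 s‖ ^ 2 := by positivity
      have p2 : 0 ≤ ‖K2‖ * ‖w1 s‖ ^ 2 := by positivity
      simp only [κ, hα]
      linarith)
  have hpn : ∀ u : H P.S, ‖projH e N u‖ ^ 2 ≤ ‖u‖ ^ 2 := fun u =>
    pow_le_pow_left₀ (norm_nonneg _) (hE.norm_projH_le N u) 2
  have key2 : ∀ t ∈ Icc 0 T, (‖w1 t‖ ^ 2 + ‖w2 t‖ ^ 2) +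
      ∫ s in 0..t, c * (normDA (w1 s) ^ 2 + normV (w2 s) ^ 2) ≤ D := fun t ht => by
    refine (key t ht).trans (mul_le_mul_of_nonneg_right (add_le_add ?_ le_rfl) (exp_pos _).le)
    simp only [h01, h02]
    exact add_le_add (hpn _) (hpn _)
  have hGn : ∀ t ∈ Icc 0 T, 0 ≤ ∫ s in 0..t, c * (normDA (w1 s) ^ 2 + normV (w2 s) ^ 2) :=
    fun t ht => intervalIntegral.integral_nonneg ht.1 fun s _ => by positivity
  have hcD : 0 ≤ c⁻¹ * D := by positivity
  refine ⟨fun t ht => ?_, ?_⟩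
  · have h1 := key2 t ht
    have h2 := hGn t ht
    have hsq : ∀ x : ℝ, x ^ 2 ≤ D → x ≤ √D + c⁻¹ * D := fun x hx =>
      (le_sqrt_of_sq_le hx).trans (le_add_of_nonneg_right hcD)
    exact ⟨hsq _ (by nlinarith [sq_nonneg ‖w2 t‖]), hsq _ (by nlinarith [sq_nonneg ‖w1 t‖])⟩
  · have h1 := key2 T ⟨hT.le, le_rfl⟩
    rw [intervalIntegral.integral_const_mul] at h1
    refine le_trans ?_ (le_add_of_nonneg_left (sqrt_nonneg D))
    rw [inv_mul_eq_div, le_div_iff₀ hc]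
    nlinarith [sq_nonneg ‖w1 T‖, sq_nonneg ‖w2 T‖]

section

variable (hA : AnalyticData P F e μ C)
include hA

theorem AnalyticData.chemPot_eq (N : ℕ) (u : H P.S) :
    chemPot P e N u = P.ν₂ • lap u + (P.ν₀ * P.ν₁) • u + projH e N (fH P.f u) := by
  rw [chemPot, hA.basis.galProj_pivot]; rfl

theorem AnalyticData.chemPot_mem {N : ℕ} {u : H P.S}
    (hu : u ∈ galSpan e N) : chemPot P e N u ∈ galSpan e N := by
  rw [hA.chemPot_eq]
  exact add_mem (add_mem (Submodule.smul_mem _ _ (hA.basis.lap_mem hu))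
    (Submodule.smul_mem _ _ hu)) (hA.basis.projH_mem N _)

theorem AnalyticData.lift_chemPot {N : ℕ} {u : H P.S}
    (hu : u ∈ galSpan e N) : lift (chemPot P e N u) =
      P.ν₂ • lift (lap u) + (P.ν₀ * P.ν₁) • lift u + projV e N (lift (fH P.f u)) := by
  have h := hA.basis.inDA32_of_mem hu
  have h1 := h.inV_lap
  have h2 := h.inV
  rw [hA.chemPot_eq, InV.lift_add ((h1.smul _).add (h2.smul _))
    (hA.basis.inV_of_mem (hA.basis.projH_mem N _)), InV.lift_add (h1.smul _) (h2.smul _),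
    h1.lift_smul, h2.lift_smul, hA.basis.lift_projH (hA.bounds.inV u h)]

/-- The first equation tested with the chemical potential. -/
theorem AnalyticData.full₁_chemPot {N : ℕ} {w1 : H P.S}
    (h : w1 ∈ galSpan e N) (w2 : H P.S) (η : V' P.S) :
    full₁ P η w1 w2 (lift (chemPot P e N w1)) = -‖grad (lift (chemPot P e N w1))‖ ^ 2 +
      P.ν₁ * lapV (lift w2) (lift (chemPot P e N w1)) - gD P.g w1 (lift (chemPot P e N w1)) +
      η (lift (chemPot P e N w1)) := by
  have hE := hA.basis
  have h1 := hE.inDA32_of_mem h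
  have hp := hA.chemPot_mem h
  have e1 : lapV (lift (fH P.f w1)) (lift (chemPot P e N w1)) =
      lapV (projV e N (lift (fH P.f w1))) (lift (chemPot P e N w1)) := by
    rw [lapV_comm, lapV_comm (projV e N _), inner_lap_eq (hE.inDA32_of_mem hp).1,
      inner_lap_eq (hE.inDA32_of_mem hp).1, hE.incl_projV, hE.inner_projH_of_mem (hE.lap_mem hp)]
  have e2 : ‖grad (lift (chemPot P e N w1))‖ ^ 2 =
      lapV (lift (chemPot P e N w1)) (lift (chemPot P e N w1)) := by
    rw [lapV_apply, real_inner_self_eq_norm_sq]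
  have e3 : lapV (lift (chemPot P e N w1)) = P.ν₂ • lapV (lift (lap w1)) +
      (P.ν₀ * P.ν₁) • lapV (lift w1) + lapV (projV e N (lift (fH P.f w1))) := by
    rw [hA.lift_chemPot h, lapV_add, lapV_add, lapV_smul, lapV_smul]
  have e4 := congrArg (fun ℓ : V' P.S => ℓ (lift (chemPot P e N w1))) e3
  simp only [full₁, add_apply, sub_apply, smul_apply, smul_eq_mul] at e4 ⊢
  rw [e1, e2]
  linarith

theorem AnalyticData.norm_pivot_chemPot_le {N : ℕ} {w : H P.S}
    (h : w ∈ galSpan e N) : ‖pivot (chemPot P e N w)‖ ≤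
      (P.ν₂ + |P.ν₀ * P.ν₁|) * normV w + C * normV w * (1 + ‖w‖ * normV w) := by
  have h1 := hA.basis.inDA32_of_mem h
  have e1 : pivot (chemPot P e N w) = P.ν₂ • lapV (lift w) + (P.ν₀ * P.ν₁) • pivot w +
      pivot (galProj e N (pivot (fH P.f w))) := by
    rw [h1.1.lapV_lift, hA.chemPot_eq, hA.basis.galProj_pivot]
    simp only [← pivotL_apply, map_add, map_smul]
  rw [e1, add_mul]
  refine (norm_add_le _ _).trans (add_le_add ((norm_add_le _ _).trans (add_le_add ?_ ?_)) ?_)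
  · rw [norm_smul, norm_eq_abs, abs_of_pos hA.ν₂_pos]
    exact mul_le_mul_of_nonneg_left (norm_lapV_le _) hA.ν₂_pos.le
  · rw [norm_smul, norm_eq_abs]
    exact mul_le_mul_of_nonneg_left ((norm_pivot_le _).trans (norm_le_normV h1.inV)) (abs_nonneg _)
  · exact (hA.basis.norm_pivot_galProj_le N _).trans (hA.bounds.f_le w h1)

end

theorem free_energy_algebra {ν c1 c2 Q V κ Y : ℝ} (hY : 1 ≤ Y) :
    |ν| * (V * Q) + (c2 * Y + κ) * (Q + c1 * Y) ≤
      Q ^ 2 / 2 + (ν ^ 2 + (3 * c2 ^ 2 + c1 ^ 2 / 2) + 3) * (Y + V ^ 2 + κ ^ 2) * Y := by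
  have b7 : |ν| * (V * Q) ≤ Q ^ 2 / 4 + ν ^ 2 * V ^ 2 := by
    rw [← sq_abs ν]
    linarith [sq_nonneg (Q / 2 - |ν| * V), show (Q / 2 - |ν| * V) ^ 2 =
      Q ^ 2 / 4 + |ν| ^ 2 * V ^ 2 - |ν| * (V * Q) by ring]
  have b8 : (c2 * Y + κ) * (Q + c1 * Y) ≤
      Q ^ 2 / 4 + 3 / 2 * (c2 * Y + κ) ^ 2 + c1 ^ 2 / 2 * Y ^ 2 := by
    have h1 := sq_nonneg (Q / 2 - (c2 * Y + κ))
    have h2 := sq_nonneg ((c2 * Y + κ) - c1 * Y)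
    linarith
  have b9 : (c2 * Y + κ) ^ 2 ≤ 2 * c2 ^ 2 * Y ^ 2 + 2 * κ ^ 2 := by
    linarith [sq_nonneg (c2 * Y - κ)]
  have s2 := sq_nonneg V
  have s3 := sq_nonneg κ
  have mY := le_mul_of_one_le_right (show 0 ≤ Y + V ^ 2 + κ ^ 2 by linarith) hY
  have m1 : V ^ 2 ≤ (Y + V ^ 2 + κ ^ 2) * Y := by linarith
  have m2 : κ ^ 2 ≤ (Y + V ^ 2 + κ ^ 2) * Y := by linarith
  have m3 : Y ^ 2 ≤ (Y + V ^ 2 + κ ^ 2) * Y := by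
    rw [sq Y]
    exact mul_le_mul_of_nonneg_right (by linarith) (by linarith)
  have n1 := mul_le_mul_of_nonneg_left m1 (sq_nonneg ν)
  have n3 := mul_le_mul_of_nonneg_left m3 (show 0 ≤ 3 * c2 ^ 2 + c1 ^ 2 / 2 by positivity)
  linarith

theorem AnalyticData.exists_chemPot_le (hA : AnalyticData P F e μ C) (K : H P.S →L[ℝ] H P.S)
    {B : ℝ} (hB : 0 ≤ B) : ∃ A : ℝ, 0 ≤ A ∧ ∀ (N : ℕ) (k : ℝ → V' P.S) (s : ℝ) (w1 w2 : H P.S),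
      w1 ∈ galSpan e N → ‖w1‖ ≤ B → full₁ P (affine k K s w1) w1 w2 (lift (chemPot P e N w1)) ≤
        -((1 / 2) * ‖grad (lift (chemPot P e N w1))‖ ^ 2) +
        A * (1 + normV w1 ^ 2 + normV w2 ^ 2 + ‖k s‖ ^ 2) * (1 + normV w1 ^ 2) := by
  have hC := hA.bounds.nonneg
  have hν := hA.ν₂_pos
  set c1 : ℝ := P.ν₂ + |P.ν₀ * P.ν₁| + C * (1 + B) with hc1
  set c2 : ℝ := C * (1 + B) + ‖K‖ * B with hc2
  have hc₁0 : 0 ≤ c1 := by positivity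
  have hc₂0 : 0 ≤ c2 := by positivity
  refine ⟨P.ν₁ ^ 2 + (3 * c2 ^ 2 + c1 ^ 2 / 2) + 3, by positivity, ?_⟩
  intro N k s w1 w2 h hw
  rw [hA.full₁_chemPot h]
  set p := chemPot P e N w1 with hp
  have hpV : InV p := hA.basis.inV_of_mem (hA.chemPot_mem h)
  have hV := normV_nonneg w1
  set V1 := normV w1
  set V2 := normV w2
  set Q := ‖grad (lift p)‖ with hQ
  have hQ0 : 0 ≤ Q := norm_nonneg _
  have h1 := hA.basis.inDA32_of_mem h
  have hw0 := norm_nonneg w1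
  have b0 : V1 * (1 + ‖w1‖ * V1) ≤ (1 + B) * (1 + V1 ^ 2) := by
    nlinarith [mul_le_mul_of_nonneg_right hw (sq_nonneg V1), sq_nonneg (V1 - 1)]
  have b1 : ‖gD P.g w1‖ ≤ C * (1 + B) * (1 + V1 ^ 2) := by
    refine (hA.bounds.g_le w1 h1).trans ?_
    rw [mul_assoc, mul_assoc]
    exact mul_le_mul_of_nonneg_left b0 hC
  have b2 : ‖pivot p‖ ≤ c1 * (1 + V1 ^ 2) := by
    refine (hA.norm_pivot_chemPot_le h).trans ?_
    rw [hc1, add_mul _ (C * (1 + B)), mul_assoc C, mul_assoc C]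
    refine add_le_add (mul_le_mul_of_nonneg_left ?_ (by positivity))
      (mul_le_mul_of_nonneg_left b0 hC)
    nlinarith [sq_nonneg (V1 - 1)]
  have b3 : ‖affine k K s w1‖ ≤ ‖k s‖ + ‖K‖ * B := (norm_affine_le _ _ _ _).trans (by gcongr)
  have b4 : ‖lift p‖ ≤ Q + c1 * (1 + V1 ^ 2) := by
    refine (norm_V_le _).trans ?_
    rw [hpV.incl_lift]
    exact add_le_add le_rfl b2
  have b5 : P.ν₁ * lapV (lift w2) (lift p) ≤ |P.ν₁| * (V2 * Q) := by
    refine (le_abs_self _).trans ?_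
    rw [abs_mul]
    exact mul_le_mul_of_nonneg_left ((abs_lapV_le _ _).trans
      (mul_le_mul_of_nonneg_right (norm_grad_le _) hQ0)) (abs_nonneg _)
  have hY : (1 : ℝ) ≤ 1 + V1 ^ 2 := by linarith [sq_nonneg V1]
  have g1 : -gD P.g w1 (lift p) ≤ ‖gD P.g w1‖ * ‖lift p‖ :=
    (neg_le_abs _).trans ((gD P.g w1).le_opNorm _)
  have g2 : affine k K s w1 (lift p) ≤ ‖affine k K s w1‖ * ‖lift p‖ :=
    (le_abs_self _).trans ((affine k K s w1).le_opNorm _)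
  have g3 : ‖gD P.g w1‖ + ‖affine k K s w1‖ ≤ c2 * (1 + V1 ^ 2) + ‖k s‖ := by
    have h3 : 0 ≤ ‖K‖ * B * V1 ^ 2 := by positivity
    have e2 : c2 * (1 + V1 ^ 2) =
      C * (1 + B) * (1 + V1 ^ 2) + (‖K‖ * B + ‖K‖ * B * V1 ^ 2) := by rw [hc2]; ring
    rw [e2]
    linarith only [b1, b3, h3]
  have g4 := mul_le_mul g3 b4 (norm_nonneg _)
    (add_nonneg (mul_nonneg hc₂0 (by linarith only [hY])) (norm_nonneg (k s)))
  have g5 := free_energy_algebra (ν := P.ν₁) (c1 := c1) (c2 := c2) (Q := Q) (V := V2)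
    (κ := ‖k s‖) hY
  rw [add_mul] at g4
  linarith only [b5, g1, g2, g4, g5]

theorem AnalyticData.potential_nonneg (hA : AnalyticData P F e μ C) (u : H P.S) :
    0 ≤ potential F u := integral_nonneg fun _ => hA.nonneg _

/-- The part of the free energy that depends on the first component, up to the constant factor. -/
def energy₁ (P : Model d) (F : ℝ → ℝ) (u : H P.S) : ℝ :=
  P.ν₂ / 2 * ‖grad (lift u)‖ ^ 2 + P.ν₀ * P.ν₁ / 2 * ‖u‖ ^ 2 + potential F u

section

variable (hA : AnalyticData P F e μ C)
include hA

theorem AnalyticData.energy₁_chain {N : ℕ} {w : ℝ → H P.S}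
    {ξ : ℝ → V' P.S} {T : ℝ} (hm : ∀ t ∈ Icc 0 T, w t ∈ galSpan e N)
    (hi : IntegrableOn (fun s => galProj e N (ξ s)) (Ioo 0 T))
    (hw : ∀ t ∈ Icc 0 T, w t = w 0 + ∫ s in 0..t, galProj e N (ξ s)) :
    ContinuousOn (fun t => energy₁ P F (w t)) (Icc 0 T) ∧
    ∀ t ∈ Icc 0 T, IntervalIntegrable (fun s => ξ s (lift (chemPot P e N (w s)))) volume 0 t ∧
      energy₁ P F (w t) = energy₁ P F (w 0) + ∫ s in 0..t, ξ s (lift (chemPot P e N (w s))) := by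
  have hE := hA.basis
  let Ψ : H P.S → ℝ := fun u => P.ν₂ / 2 * ‖(grad ∘L liftP e N) u‖ ^ 2 +
    P.ν₀ * P.ν₁ / 2 * ‖projH e N u‖ ^ 2 + potential F (projH e N u)
  let Ψ' : H P.S → StrongDual ℝ (H P.S) := fun u =>
    (P.ν₂ / 2) • (2 • (innerSL ℝ ((grad ∘L liftP e N) u)) ∘L (grad ∘L liftP e N)) +
    (P.ν₀ * P.ν₁ / 2) • (2 • (innerSL ℝ (projH e N u)) ∘L projH e N) +
    (innerSL ℝ (fH P.f (projH e N u))) ∘L projH e N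
  have hΨ : ∀ u, HasFDerivAt Ψ (Ψ' u) u := fun u =>
    ((((grad ∘L liftP e N).hasFDerivAt (x := u)).norm_sq.const_mul _).add
      (((projH e N).hasFDerivAt (x := u)).norm_sq.const_mul _)).add
      (hA.bounds.hasFDerivAt_potential hE hA.one_le_dim hA.hasDeriv hA.cont hA.integrable N u)
  have hc : Continuous Ψ' := by
    have h1 := hE.continuous_fH_projH hA.one_le_dim hA.bounds hA.cont N
    have h2 : Continuous fun u => (grad ∘L liftP e N) u := (grad ∘L liftP e N).continuous
    have h3 : Continuous fun u => projH e N u := (projH e N).continuous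
    have c1 : ∀ {Y : Type} [NormedAddCommGroup Y] [InnerProductSpace ℝ Y] (L : H P.S →L[ℝ] Y)
        (g : H P.S → Y), Continuous g → Continuous fun u => (innerSL ℝ (g u)) ∘L L :=
      fun L g hg => ((innerSL ℝ).continuous.comp hg).clm_comp continuous_const
    have c2 : ∀ (r : ℝ) (g : H P.S → StrongDual ℝ (H P.S)), Continuous g →
        Continuous fun u => r • (2 • g u) := fun r g hg =>
      Continuous.const_smul (Continuous.const_smul hg (2 : ℕ)) r
    exact ((c2 _ _ (c1 _ _ h2)).add (c2 _ _ (c1 _ _ h3))).add (c1 _ _ h1)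
  have hval : ∀ u ∈ galSpan e N, Ψ u = energy₁ P F u := fun u hu => by
    have h1 := (hE.mem_galSpan_iff N _).1 hu
    have h2 := hE.lift_projH' N u
    rw [h1] at h2
    simp only [Ψ, energy₁, comp_apply, h1, h2]
  have hder : ∀ u ∈ galSpan e N, ∀ ℓ : V' P.S,
      Ψ' u (galProj e N ℓ) = ℓ (lift (chemPot P e N u)) := fun u hu ℓ => by
    have h1 := (hE.mem_galSpan_iff N _).1 hu
    have h2 := hE.lift_projH' N u
    have hr := IsEigenbasis.galProj_mem (e := e) N ℓ
    have h3 := (hE.mem_galSpan_iff N _).1 hr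
    have h4 := hE.lift_projH' N (galProj e N ℓ)
    rw [h1] at h2
    rw [h3] at h4
    have hDA := hE.inDA32_of_mem hu
    rw [← hE.inner_galProj_of_mem (hA.chemPot_mem hu), hA.chemPot_eq, inner_add_left,
      inner_add_left, real_inner_smul_left, real_inner_smul_left,
      ← (hE.inV_of_mem hr).incl_lift, ← inner_lap_eq hDA.1, lapV_apply,
      (hE.inV_of_mem hr).incl_lift, real_inner_comm _ (projH e N _),
      hE.inner_projH_of_mem hr, real_inner_comm (fH P.f u)]
    simp only [Ψ', add_apply, smul_apply,
      comp_apply, innerSL_apply_apply, h1, h3, ← h2, ← h4, smul_eq_mul, nsmul_eq_mul]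
    push_cast
    ring
  have hwc := continuousOn_of_eq_integral hi hw
  have hΨc : Continuous Ψ := continuous_iff_continuousAt.2 fun u => (hΨ u).continuousAt
  refine ⟨(hΨc.comp_continuousOn hwc).congr fun t ht => (hval _ (hm t ht)).symm, fun t ht => ?_⟩
  obtain ⟨a1, a2⟩ := integral_chain_rule hΨ hc hi hw ht
  have hs : ∀ s ∈ Icc 0 t, Ψ' (w s) (galProj e N (ξ s)) = ξ s (lift (chemPot P e N (w s))) :=
    fun s hs => hder _ (hm s ⟨hs.1, hs.2.trans ht.2⟩) _
  rw [hval _ (hm t ht), hval _ (hm 0 ⟨le_rfl, ht.1.trans ht.2⟩)] at a2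
  refine ⟨a1.congr fun s hs' => hs s ?_, a2.trans ?_⟩
  · rw [uIoc_of_le ht.1] at hs'
    exact ⟨hs'.1.le, hs'.2⟩
  · exact congrArg _ (integral_congr_of_le ht.1 hs)

theorem AnalyticData.exists_energy₁_projH_le {u : H P.S}
    (hu : InV u) : ∃ B : ℝ, 0 ≤ B ∧ ∀ N, energy₁ P F (projH e N u) ≤ B := by
  have hE := hA.basis
  have hν := hA.ν₂_pos
  have hC := hA.bounds.nonneg
  have h0 := hA.potential_nonneg 0
  have hV := normV_nonneg u
  refine ⟨P.ν₂ / 2 * normV u ^ 2 + |P.ν₀ * P.ν₁ / 2| * ‖u‖ ^ 2 + (potential F (0 : H P.S) +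
    C * normV u ^ 2 * (1 + ‖u‖ * normV u)), by positivity, fun N => ?_⟩
  have h1 : normV (projH e N u) ≤ normV u := by
    rw [normV, hE.lift_projH hu]
    exact hE.norm_projV_le N _
  have h2 := hE.norm_projH_le N u
  have h3 := normV_nonneg (projH e N u)
  have h4 := hA.bounds.potential_le hA.hasDeriv hA.cont hA.integrable (hE.inDA32_projH N u)
  have h5 : ‖grad (lift (projH e N u))‖ ≤ normV u := (norm_grad_le _).trans h1
  rw [energy₁]
  refine add_le_add (add_le_add (by gcongr) ((mul_le_mul_of_nonneg_right (le_abs_self _)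
    (sq_nonneg _)).trans (by gcongr))) (h4.trans (by gcongr))

theorem AnalyticData.continuousOn_chemPot {N : ℕ} {w : ℝ → H P.S}
    {s : Set ℝ} (hw : ContinuousOn w s) (hm : ∀ t ∈ s, w t ∈ galSpan e N) :
    ContinuousOn (fun t => chemPot P e N (w t)) s := by
  obtain ⟨A, hAP⟩ := hA.basis.exists_opAP N
  have h1 := hA.basis.continuous_fH_projH hA.one_le_dim hA.bounds hA.cont N
  let L : H P.S →L[ℝ] H P.S := P.ν₂ • (A - ContinuousLinearMap.id ℝ (H P.S)) +
    (P.ν₀ * P.ν₁) • ContinuousLinearMap.id ℝ (H P.S)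
  have h2 : Continuous fun u => L u + projH e N (fH P.f (projH e N u)) :=
    L.continuous.add ((projH e N).continuous.comp h1)
  refine (h2.comp_continuousOn hw).congr fun t ht => ?_
  have h3 := (hA.basis.mem_galSpan_iff N _).1 (hm t ht)
  have h4 := hAP (w t)
  rw [h3] at h4
  simp only [L, hA.chemPot_eq, lap, h4, h3, add_apply, Function.comp_apply,
    smul_apply, sub_apply, ContinuousLinearMap.id_apply]

end

set_option maxHeartbeats 400000 in
/-- The free energy bound, uniform in `N`. -/
theorem AnalyticData.exists_free_energy_bound (hA : AnalyticData P F e μ C) {k1 k2 : ℝ → V' P.S}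
    (hk1 : LocL2 k1) (hk2 : LocL2 k2) (K1 K2 : H P.S →L[ℝ] H P.S) {w01 : H P.S} (h0 : InV w01)
    (w02 : H P.S) {T : ℝ} (hT : 0 < T) : ∃ B : ℝ, 0 ≤ B ∧ ∀ N w1 w2,
      IsGalerkin P e N (affine k1 K1) (affine k2 K2) w01 w02 w1 w2 →
        (∀ t ∈ Icc 0 T, normV (w1 t) ≤ B ∧ potential F (w1 t) ≤ B) ∧
        ∫ s in 0..T, ‖grad (lift (chemPot P e N (w1 s)))‖ ^ 2 ≤ B := by
  have hE := hA.basis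
  have hν := hA.ν₂_pos
  obtain ⟨b, hb, hen⟩ := hA.exists_energy_bound hk1 hk2 K1 K2 w01 w02 hT
  obtain ⟨A, hA0, hchem⟩ := hA.exists_chemPot_le K1 hb
  obtain ⟨b0, hb0, hinit⟩ := hA.exists_energy₁_projH_le h0
  set c : ℝ := P.ν₂ / 2 * (1 + b ^ 2) + |P.ν₀ * P.ν₁ / 2| * b ^ 2 with hc
  have hc0 : 0 ≤ c := by positivity
  set A' : ℝ := 2 / P.ν₂ * A with hA'
  have hA'0 : 0 ≤ A' := by positivity
  have hki : IntegrableOn (fun s => ‖k1 s‖ ^ 2) (Ioo 0 T) := hk1.integrableOn_sq hT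
  set L : ℝ := A' * (T + b + ∫ s in 0..T, ‖k1 s‖ ^ 2) with hL
  set D : ℝ := (b0 + c) * exp (2 * L) with hD
  have hD0 : 0 ≤ D := by positivity
  refine ⟨(1 + 2 / P.ν₂ * D) + 2 * D, by positivity, fun N w1 w2 hG => ?_⟩
  obtain ⟨hb12, hbi⟩ := hen N w1 w2 hG
  obtain ⟨⟨hi1, he1⟩, ⟨hi2, he2⟩⟩ := hA.galerkin_path hG
  have hm := hG.1
  have hm1 : ∀ t ∈ Icc 0 T, w1 t ∈ galSpan e N := fun t ht => (hm t ht.1).1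
  have h01 : w1 0 = projH e N w01 := by rw [he1 0 le_rfl]; simp
  have h02 : w2 0 = projH e N w02 := by rw [he2 0 le_rfl]; simp
  have hp1 := fun t (ht : t ∈ Icc 0 T) => by have := he1 t ht.1; rwa [← h01] at this
  have hp2 := fun t (ht : t ∈ Icc 0 T) => by have := he2 t ht.1; rwa [← h02] at this
  have hc1 : ContinuousOn w1 (Icc 0 T) := continuousOn_of_eq_integral (hi1 T hT) hp1
  have hc2 : ContinuousOn w2 (Icc 0 T) := continuousOn_of_eq_integral (hi2 T hT) hp2
  obtain ⟨hcA, hcV, hcT⟩ := hE.continuousOn_path hc1 hm1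
  obtain ⟨-, hcV2, -⟩ := hE.continuousOn_path hc2 fun t ht => (hm t ht.1).2
  obtain ⟨hyc, hchain⟩ := hA.energy₁_chain hm1 (hi1 T hT) hp1
  have hlow : ∀ t ∈ Icc 0 T,
      P.ν₂ / 2 * (1 + normV (w1 t) ^ 2) + potential F (w1 t) ≤ energy₁ P F (w1 t) + c := by
    intro t ht
    have h1 := norm_sq_V (lift (w1 t))
    rw [(hE.inV_of_mem (hm1 t ht)).incl_lift] at h1
    have h2 : ‖w1 t‖ ^ 2 ≤ b ^ 2 := pow_le_pow_left₀ (norm_nonneg _) (hb12 t ht).1 2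
    have h3 : -(P.ν₀ * P.ν₁ / 2 * ‖w1 t‖ ^ 2) ≤ |P.ν₀ * P.ν₁ / 2| * b ^ 2 := by
      rw [← neg_mul]
      exact mul_le_mul (neg_le_abs _) h2 (sq_nonneg _) (abs_nonneg _)
    have h4 := mul_le_mul_of_nonneg_left h2 (half_pos hν).le
    rw [energy₁, hc, normV]
    rw [h1]
    linarith
  have hpc : ContinuousOn (fun s => grad (lift (chemPot P e N (w1 s)))) (Icc 0 T) :=
    grad.continuous.comp_continuousOn (hE.continuousOn_path (hA.continuousOn_chemPot hc1 hm1)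
      fun s hs => hA.chemPot_mem (hm1 s hs)).2.1
  set a : ℝ → ℝ := fun s => A' * (1 + normV (w1 s) ^ 2 + normV (w2 s) ^ 2 + ‖k1 s‖ ^ 2) with ha
  have hai : IntegrableOn a (Ioo 0 T) := by
    have h1 : ContinuousOn (fun s => 1 + normV (w1 s) ^ 2 + normV (w2 s) ^ 2) (Icc 0 T) :=
      (continuousOn_const.add (hcV.norm.pow 2)).add (hcV2.norm.pow 2)
    exact ((h1.integrableOn_Icc.mono_set Ioo_subset_Icc_self).add hki).const_mul A'
  have haL : ∫ s in 0..T, a s ≤ L := by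
    have i1 : IntervalIntegrable (fun s => normDA (w1 s) ^ 2 + normV (w2 s) ^ 2) volume 0 T :=
      ((hcA.norm.pow 2).add (hcV2.norm.pow 2)).intervalIntegrable_of_Icc hT.le
    have i2 : IntervalIntegrable (fun s => ‖k1 s‖ ^ 2) volume 0 T :=
      intervalIntegrable_of_mem hki ⟨hT.le, le_rfl⟩
    have i3 : IntervalIntegrable (fun _ : ℝ => (1 : ℝ)) volume 0 T :=
      continuous_const.intervalIntegrable _ _
    have h1 : ∫ s in 0..T, a s ≤ ∫ s in 0..T,
        A' * ((1 + (normDA (w1 s) ^ 2 + normV (w2 s) ^ 2)) + ‖k1 s‖ ^ 2) := by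
      refine integral_mono_on hT.le (intervalIntegrable_of_mem hai ⟨hT.le, le_rfl⟩)
        (((i3.add i1).add i2).const_mul _) fun s hs => ?_
      have h2 := pow_le_pow_left₀ (normV_nonneg _) ((hE.inDA32_of_mem (hm1 s hs)).1.normV_le) 2
      exact mul_le_mul_of_nonneg_left (by linarith) hA'0
    refine h1.trans ?_
    rw [intervalIntegral.integral_const_mul, intervalIntegral.integral_add (i3.add i1) i2,
      intervalIntegral.integral_add i3 i1]
    refine mul_le_mul_of_nonneg_left ?_ hA'0
    simp only [intervalIntegral.integral_const, sub_zero, smul_eq_mul, mul_one]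
    linarith
  have key := gronwall_dissipative (y := fun t => energy₁ P F (w1 t) + c)
    (G := fun s => 1 / 2 * ‖grad (lift (chemPot P e N (w1 s)))‖ ^ 2) (a := a) (κ := fun _ => 0)
    (I := fun s => full₁ P (affine k1 K1 s (w1 s)) (w1 s) (w2 s) (lift (chemPot P e N (w1 s))))
    hT.le hai (fun s => by positivity) (by simp) (fun _ => le_rfl)
    ((continuousOn_const.mul (hpc.norm.pow 2)).integrableOn_Icc.mono_set Ioo_subset_Icc_self)
    (fun s => by positivity) (hyc.add continuousOn_const)
    (fun t ht => le_trans (add_nonneg (by positivity) (hA.potential_nonneg _)) (hlow t ht))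
    (fun t ht => ⟨(hchain t ht).1, by rw [(hchain t ht).2]; ring⟩)
    (by
      filter_upwards [ae_restrict_mem measurableSet_Ioo] with s hs
      have hs' := Ioo_subset_Icc_self hs
      have h1 := hchem N k1 s (w1 s) (w2 s) (hm1 s hs') (hb12 s hs').1
      have h2 := hlow s hs'
      have h3 := hA.potential_nonneg (w1 s)
      have h4 : A * (1 + normV (w1 s) ^ 2 + normV (w2 s) ^ 2 + ‖k1 s‖ ^ 2) *
          (1 + normV (w1 s) ^ 2) ≤ a s * (energy₁ P F (w1 s) + c) := by
        have h5 : A * (1 + normV (w1 s) ^ 2 + normV (w2 s) ^ 2 + ‖k1 s‖ ^ 2) *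
          (1 + normV (w1 s) ^ 2) = a s * (P.ν₂ / 2 * (1 + normV (w1 s) ^ 2)) := by
          simp only [a, hA']
          field_simp
        rw [h5]
        exact mul_le_mul_of_nonneg_left (by linarith) (by positivity)
      linarith)
  have key2 : ∀ t ∈ Icc 0 T, (energy₁ P F (w1 t) + c) +
      ∫ s in 0..t, 1 / 2 * ‖grad (lift (chemPot P e N (w1 s)))‖ ^ 2 ≤ D := fun t ht => by
    refine (key t ht).trans ?_
    simp only [intervalIntegral.integral_zero, add_zero]
    refine mul_le_mul (add_le_add (by rw [h01]; exact hinit N) le_rfl)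
      (exp_le_exp.2 (by linarith)) (exp_pos _).le (by positivity)
  have hQ : ∀ t ∈ Icc 0 T, 0 ≤
      ∫ s in 0..t, 1 / 2 * ‖grad (lift (chemPot P e N (w1 s)))‖ ^ 2 := fun t ht =>
    intervalIntegral.integral_nonneg ht.1 fun s _ => by positivity
  have hDν : 0 ≤ 2 / P.ν₂ * D := by positivity
  refine ⟨fun t ht => ⟨?_, ?_⟩, ?_⟩
  · have h1 := key2 t ht
    have h2 := hlow t ht
    have h3 := hA.potential_nonneg (w1 t)
    have h4 := hQ t ht
    have h5 : 1 + normV (w1 t) ^ 2 ≤ 2 / P.ν₂ * D := by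
      rw [div_mul_eq_mul_div, le_div_iff₀ hν]
      linarith
    nlinarith [sq_nonneg (normV (w1 t) - 1)]
  · have h1 := key2 t ht
    have h2 := hlow t ht
    have h4 := hQ t ht
    have h5 : 0 ≤ P.ν₂ / 2 * (1 + normV (w1 t) ^ 2) := by positivity
    linarith
  · have h1 := key2 T ⟨hT.le, le_rfl⟩
    have h2 := hlow T ⟨hT.le, le_rfl⟩
    have h3 := hA.potential_nonneg (w1 T)
    have h5 : 0 ≤ P.ν₂ / 2 * (1 + normV (w1 T) ^ 2) := by positivity
    rw [intervalIntegral.integral_const_mul] at h1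
    linarith

theorem NonlinearBounds.growth_le {V B h : ℝ} (hV : 0 ≤ V) (hVB : V ≤ B) (hh : 0 ≤ h)
    (hhV : h ≤ V) (hC : 0 ≤ C) : C * V * (1 + h * V) ≤ C * B * (1 + B * B) := by
  have := hV.trans hVB
  have := hhV.trans hVB
  gcongr

/-- The chemical potential controls the norm of `D(A^{3/2})`. -/
theorem AnalyticData.exists_norm_lift_opA_le (hA : AnalyticData P F e μ C) {B : ℝ} (hB : 0 ≤ B) :
    ∃ c : ℝ, 0 ≤ c ∧ ∀ (N : ℕ) (w : H P.S), w ∈ galSpan e N → normV w ≤ B →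
      ‖lift (opA w)‖ ≤ c * (1 + ‖grad (lift (chemPot P e N w))‖ + normDA w) := by
  have hC := hA.bounds.nonneg
  have hν := hA.ν₂_pos
  set m : ℝ := C * B * (1 + B * B) with hm
  set b : ℝ := (P.ν₂ + |P.ν₀ * P.ν₁|) * B + m + |P.ν₀ * P.ν₁| * B + m + P.ν₂ * B +
    C * (1 + B) * B + 1 with hb
  have hm0 : 0 ≤ m := by positivity
  have hb0 : 0 ≤ b := by positivity
  refine ⟨P.ν₂⁻¹ * b, by positivity, fun N w h hw => ?_⟩
  have h1 := hA.basis.inDA32_of_mem h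
  have hV := normV_nonneg w
  have hD := normDA_nonneg w
  have hg := NonlinearBounds.growth_le hV hw (norm_nonneg w) (norm_le_normV h1.inV) hC
  have hpV : InV (chemPot P e N w) := hA.basis.inV_of_mem (hA.chemPot_mem h)
  have e1 : P.ν₂ • lift (opA w) = lift (chemPot P e N w) - (P.ν₀ * P.ν₁) • lift w -
      projV e N (lift (fH P.f w)) + P.ν₂ • lift w := by
    rw [hA.lift_chemPot h, lap, h1.2.lift_sub h1.inV, smul_sub]
    abel
  have e2 : P.ν₂ * ‖lift (opA w)‖ ≤ ‖lift (chemPot P e N w)‖ + |P.ν₀ * P.ν₁| * normV w +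
      ‖lift (fH P.f w)‖ + P.ν₂ * normV w := by
    have h2 : ‖P.ν₂ • lift (opA w)‖ = P.ν₂ * ‖lift (opA w)‖ := by
      rw [norm_smul, norm_eq_abs, abs_of_pos hν]
    rw [← h2, e1]
    refine (norm_add_le _ _).trans (add_le_add ((norm_sub_le _ _).trans (add_le_add
      ((norm_sub_le _ _).trans (add_le_add le_rfl ?_)) (hA.basis.norm_projV_le N _))) ?_)
    · rw [norm_smul, norm_eq_abs]; rfl
    · rw [norm_smul, norm_eq_abs, abs_of_pos hν]; rfl
  have e3 := norm_V_le (lift (chemPot P e N w))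
  rw [hpV.incl_lift] at e3
  have e4 := hA.norm_pivot_chemPot_le h
  have e5 : ‖lift (fH P.f w)‖ ≤ C * (1 + B) * B * (1 + normDA w) + m := by
    refine (norm_V_le_lapV _).trans (add_le_add (hA.bounds.lapV_f_le_of_le h1 hw) ?_)
    rw [(hA.bounds.inV w h1).incl_lift]
    exact (hA.bounds.f_le w h1).trans hg
  have e6 : (P.ν₂ + |P.ν₀ * P.ν₁|) * normV w ≤ (P.ν₂ + |P.ν₀ * P.ν₁|) * B := by gcongr
  have e7 : |P.ν₀ * P.ν₁| * normV w ≤ |P.ν₀ * P.ν₁| * B := by gcongr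
  have e8 : P.ν₂ * normV w ≤ P.ν₂ * B := by gcongr
  set Q := ‖grad (lift (chemPot P e N w))‖ with hQ
  have hQ0 : 0 ≤ Q := norm_nonneg _
  rw [mul_assoc, ← div_eq_inv_mul, le_div_iff₀' hν]
  set x : ℝ := (P.ν₂ + |P.ν₀ * P.ν₁|) * B + m + |P.ν₀ * P.ν₁| * B + m + P.ν₂ * B with hx
  have hx0 : 0 ≤ x := by positivity
  set y : ℝ := C * (1 + B) * B with hy
  have hy0 : 0 ≤ y := by positivity
  have e9 : P.ν₂ * ‖lift (opA w)‖ ≤ Q + x + y * (1 + normDA w) := by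
    linarith only [e2, e3, e4, e5, e6, e7, e8, hg, hx]
  have e10 : b * (1 + Q + normDA w) = Q + x + y * (1 + normDA w) + (x * (Q + normDA w) + y * Q +
      (1 + normDA w)) := by rw [hb]; ring
  rw [e10]
  refine e9.trans (le_add_of_nonneg_right (by positivity))

theorem AnalyticData.exists_norm_full₁_le (hA : AnalyticData P F e μ C) {B : ℝ} (hB : 0 ≤ B) :
    ∃ c : ℝ, 0 ≤ c ∧ ∀ (η : V' P.S) (w1 w2 : H P.S), InDA32 w1 → normV w1 ≤ B →
      ‖full₁ P η w1 w2‖ ≤ c * (1 + ‖lift (opA w1)‖ + normV w2 + ‖η‖) := by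
  have hC := hA.bounds.nonneg
  have hν := hA.ν₂_pos
  set m : ℝ := C * B * (1 + B * B) with hm
  have hm0 : 0 ≤ m := by positivity
  set y : ℝ := C * (1 + B) * B with hy
  have hy0 : 0 ≤ y := by positivity
  set z : ℝ := |P.ν₀ * P.ν₁| * B with hz
  have hz0 : 0 ≤ z := by positivity
  refine ⟨2 * P.ν₂ + z + |P.ν₁| + y + m + 1, by positivity, ?_⟩
  intro η w1 w2 h1 hw
  have hg := NonlinearBounds.growth_le (normV_nonneg _) hw (norm_nonneg w1)
    (norm_le_normV h1.inV) hC
  have hV2 := normV_nonneg w2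
  have hη := norm_nonneg η
  have hT := norm_nonneg (lift (opA w1))
  have e0 : ‖full₁ P η w1 w2‖ ≤ P.ν₂ * (2 * ‖lift (opA w1)‖) + z + |P.ν₁| * normV w2 +
      y * (1 + ‖lift (opA w1)‖) + m + ‖η‖ := by
    refine (norm_add_le _ _).trans (add_le_add ((norm_sub_le _ _).trans (add_le_add
      ((norm_sub_le _ _).trans (add_le_add ((norm_add_le _ _).trans (add_le_add
      ((norm_sub_le _ _).trans (add_le_add ?_ ?_)) ?_)) ?_)) ?_)) le_rfl)
    · rw [norm_smul, norm_neg, norm_eq_abs, abs_of_pos hν]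
      exact mul_le_mul_of_nonneg_left ((norm_lapV_le _).trans (norm_lift_lap_le h1)) hν.le
    · rw [norm_smul, norm_eq_abs]
      exact mul_le_mul_of_nonneg_left ((norm_lapV_le _).trans hw) (abs_nonneg _)
    · rw [norm_smul, norm_eq_abs]
      exact mul_le_mul_of_nonneg_left (norm_lapV_le _) (abs_nonneg _)
    · refine (hA.bounds.lapV_f_le_of_le h1 hw).trans ?_
      exact mul_le_mul_of_nonneg_left (by linarith [h1.normDA_le]) hy0
    · exact (hA.bounds.g_le w1 h1).trans hg
  set T := ‖lift (opA w1)‖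
  refine e0.trans ?_
  have e1 : (2 * P.ν₂ + z + |P.ν₁| + y + m + 1) * (1 + T + normV w2 + ‖η‖) =
      (P.ν₂ * (2 * T) + z + |P.ν₁| * normV w2 + y * (1 + T) + m + ‖η‖) +
      (2 * P.ν₂ * (1 + normV w2 + ‖η‖) + z * (T + normV w2 + ‖η‖) + |P.ν₁| * (1 + T + ‖η‖) +
        y * (normV w2 + ‖η‖) + m * (T + normV w2 + ‖η‖) + (1 + T + normV w2)) := by ring
  rw [e1]
  exact le_add_of_nonneg_right (by positivity)

theorem norm_full₂_le (η : V' P.S) (w1 w2 : H P.S) :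
    ‖full₂ P η w1 w2‖ ≤ normV w2 + |P.ν₀| * normV w1 + ‖η‖ := by
  refine (norm_add_le _ _).trans (add_le_add ((norm_add_le _ _).trans (add_le_add ?_ ?_)) le_rfl)
  · rw [norm_neg]; exact norm_lapV_le _
  · rw [norm_smul, norm_eq_abs]
    exact mul_le_mul_of_nonneg_left (norm_lapV_le _) (abs_nonneg _)

/-- Trajectories that are continuous and bounded in the spaces of the energy estimates. -/
structure PathBound (P : Model d) (T B : ℝ) (w1 w2 : ℝ → H P.S) : Prop where
  norm_le₁ : ∀ t ∈ Icc 0 T, ‖w1 t‖ ≤ B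
  norm_le₂ : ∀ t ∈ Icc 0 T, ‖w2 t‖ ≤ B
  inV : ∀ t ∈ Icc 0 T, InV (w1 t)
  normV_le : ∀ t ∈ Icc 0 T, normV (w1 t) ≤ B
  inDA32 : ∀ᵐ t ∂vol(T), InDA32 (w1 t)
  inV2 : ∀ᵐ t ∂vol(T), InV (w2 t)
  memLp1 : MemLp (fun t => lift (opA (w1 t))) 2 vol(T)
  memLp2 : MemLp (fun t => lift (w2 t)) 2 vol(T)
  integral_le₁ : ∫ t in 0..T, ‖lift (opA (w1 t))‖ ^ 2 ≤ B
  integral_le₂ : ∫ t in 0..T, normV (w2 t) ^ 2 ≤ B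

theorem memLp_two_of_continuousOn {X : Type*} [NormedAddCommGroup X] {φ : ℝ → X} {T : ℝ}
    (h : ContinuousOn φ (Icc 0 T)) : MemLp φ 2 vol(T) := by
  have h1 : AEStronglyMeasurable φ vol(T) :=
    (h.aestronglyMeasurable_of_isCompact isCompact_Icc measurableSet_Icc).mono_set
      Ioo_subset_Icc_self
  rw [memLp_two_iff_integrable_sq_norm h1]
  exact ((h.norm.pow 2).integrableOn_Icc).mono_set Ioo_subset_Icc_self

/-- All the bounds on the Galerkin approximations, uniform in `N`. -/
theorem AnalyticData.exists_pathBound (hA : AnalyticData P F e μ C) {k1 k2 : ℝ → V' P.S}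
    (hk1 : LocL2 k1) (hk2 : LocL2 k2) (K1 K2 : H P.S →L[ℝ] H P.S) {w01 : H P.S} (h0 : InV w01)
    (w02 : H P.S) {T : ℝ} (hT : 0 < T) : ∃ B : ℝ, 0 ≤ B ∧ ∀ N w1 w2,
      IsGalerkin P e N (affine k1 K1) (affine k2 K2) w01 w02 w1 w2 →
        PathBound P T B w1 w2 ∧ ContinuousOn w1 (Icc 0 T) ∧ ContinuousOn w2 (Icc 0 T) ∧
        (∀ t ∈ Icc 0 T, potential F (w1 t) ≤ B) ∧
        ∫ s in 0..T, ‖grad (lift (chemPot P e N (w1 s)))‖ ^ 2 ≤ B := by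
  have hE := hA.basis
  obtain ⟨b1, hb1, hen⟩ := hA.exists_energy_bound hk1 hk2 K1 K2 w01 w02 hT
  obtain ⟨b2, hb2, hfe⟩ := hA.exists_free_energy_bound hk1 hk2 K1 K2 h0 w02 hT
  obtain ⟨c, hc, hTb⟩ := hA.exists_norm_lift_opA_le hb2
  refine ⟨b1 + b2 + 3 * c ^ 2 * (T + b2 + b1), by positivity, fun N w1 w2 hG => ?_⟩
  obtain ⟨hn, hi⟩ := hen N w1 w2 hG
  obtain ⟨hf, hQ⟩ := hfe N w1 w2 hG
  obtain ⟨⟨hi1, he1⟩, ⟨hi2, he2⟩⟩ := hA.galerkin_path hG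
  have hm1 : ∀ t ∈ Icc 0 T, w1 t ∈ galSpan e N := fun t ht => (hG.1 t ht.1).1
  have hm2 : ∀ t ∈ Icc 0 T, w2 t ∈ galSpan e N := fun t ht => (hG.1 t ht.1).2
  have hc1 : ContinuousOn w1 (Icc 0 T) := continuousOn_of_eq_integral (hi1 T hT) fun t ht => by
    rw [he1 t ht.1, he1 0 le_rfl]; simp
  have hc2 : ContinuousOn w2 (Icc 0 T) := continuousOn_of_eq_integral (hi2 T hT) fun t ht => by
    rw [he2 t ht.1, he2 0 le_rfl]; simp
  obtain ⟨hcA, hcV, hcT⟩ := hE.continuousOn_path hc1 hm1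
  obtain ⟨-, hcV2, -⟩ := hE.continuousOn_path hc2 hm2
  have hpc : ContinuousOn (fun s => grad (lift (chemPot P e N (w1 s)))) (Icc 0 T) :=
    grad.continuous.comp_continuousOn (hE.continuousOn_path (hA.continuousOn_chemPot hc1 hm1)
      fun s hs => hA.chemPot_mem (hm1 s hs)).2.1
  have hii : ∀ {φ : ℝ → ℝ}, ContinuousOn φ (Icc 0 T) → IntervalIntegrable φ volume 0 T :=
    fun h => ContinuousOn.intervalIntegrable (by rwa [uIcc_of_le hT.le])
  have iD : IntervalIntegrable (fun s => normDA (w1 s) ^ 2) volume 0 T := hii (hcA.norm.pow 2)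
  have iV : IntervalIntegrable (fun s => normV (w2 s) ^ 2) volume 0 T := hii (hcV2.norm.pow 2)
  have iQ : IntervalIntegrable (fun s => ‖grad (lift (chemPot P e N (w1 s)))‖ ^ 2) volume 0 T :=
    hii (hpc.norm.pow 2)
  have hsplit : (∫ s in 0..T, normDA (w1 s) ^ 2) + ∫ s in 0..T, normV (w2 s) ^ 2 ≤ b1 := by
    rw [← intervalIntegral.integral_add iD iV]; exact hi
  have nD : 0 ≤ ∫ s in 0..T, normDA (w1 s) ^ 2 :=
    intervalIntegral.integral_nonneg hT.le fun s _ => by positivity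
  have nV : 0 ≤ ∫ s in 0..T, normV (w2 s) ^ 2 :=
    intervalIntegral.integral_nonneg hT.le fun s _ => by positivity
  have hpos : 0 ≤ 3 * c ^ 2 * (T + b2 + b1) := by positivity
  have hT2 : ∫ t in 0..T, ‖lift (opA (w1 t))‖ ^ 2 ≤ 3 * c ^ 2 * (T + b2 + b1) := by
    have i1 : IntervalIntegrable (fun _ : ℝ => (1 : ℝ)) volume 0 T :=
      continuous_const.intervalIntegrable _ _
    have h1 : ∫ t in 0..T, ‖lift (opA (w1 t))‖ ^ 2 ≤ ∫ t in 0..T, 3 * c ^ 2 *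
        ((1 + ‖grad (lift (chemPot P e N (w1 t)))‖ ^ 2) + normDA (w1 t) ^ 2) := by
      refine integral_mono_on hT.le (hii (hcT.norm.pow 2))
        (((i1.add iQ).add iD).const_mul _) fun s hs => ?_
      have h2 := pow_le_pow_left₀ (norm_nonneg _) (hTb N _ (hm1 s hs) (hf s hs).1) 2
      refine h2.trans ?_
      rw [mul_pow, mul_comm 3, mul_assoc]
      refine mul_le_mul_of_nonneg_left ?_ (sq_nonneg c)
      generalize ‖grad (lift (chemPot P e N (w1 s)))‖ = q
      generalize normDA (w1 s) = D
      linarith [sq_nonneg (1 - q), sq_nonneg (1 - D), sq_nonneg (q - D)]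
    refine h1.trans ?_
    rw [intervalIntegral.integral_const_mul, intervalIntegral.integral_add (i1.add iQ) iD,
      intervalIntegral.integral_add i1 iQ]
    refine mul_le_mul_of_nonneg_left ?_ (by positivity)
    simp only [intervalIntegral.integral_const, sub_zero, smul_eq_mul, mul_one]
    linarith
  refine ⟨⟨fun t ht => ?_, fun t ht => ?_, fun t ht => hE.inV_of_mem (hm1 t ht),
    fun t ht => ?_, ?_, ?_, memLp_two_of_continuousOn hcT,
    memLp_two_of_continuousOn hcV2, by linarith, by linarith⟩, hc1, hc2,
    fun t ht => ?_, by linarith⟩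
  · linarith [(hn t ht).1]
  · linarith [(hn t ht).2]
  · linarith [(hf t ht).1]
  · filter_upwards [ae_restrict_mem measurableSet_Ioo] with t ht
    exact hE.inDA32_of_mem (hm1 t (Ioo_subset_Icc_self ht))
  · filter_upwards [ae_restrict_mem measurableSet_Ioo] with t ht
    exact hE.inV_of_mem (hm2 t (Ioo_subset_Icc_self ht))
  · linarith [(hf t ht).2]

/-- Bounds of the right-hand sides along bounded trajectories. -/
theorem AnalyticData.exists_full_sq_le (hA : AnalyticData P F e μ C) {k1 k2 : ℝ → V' P.S}
    (K1 K2 : H P.S →L[ℝ] H P.S) {B : ℝ} (hB : 0 ≤ B) :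
    ∃ c : ℝ, 0 ≤ c ∧ ∀ (s : ℝ) (w1 w2 : H P.S), InDA32 w1 → normV w1 ≤ B → ‖w2‖ ≤ B →
      ‖full₁ P (affine k1 K1 s w1) w1 w2‖ ^ 2 ≤
        c * (1 + ‖lift (opA w1)‖ ^ 2 + normV w2 ^ 2 + ‖k1 s‖ ^ 2) ∧
      ‖full₂ P (affine k2 K2 s w2) w1 w2‖ ^ 2 ≤ c * (1 + normV w2 ^ 2 + ‖k2 s‖ ^ 2) := by
  obtain ⟨c, hc, h⟩ := hA.exists_norm_full₁_le hB
  have hsq : ∀ x y z m : ℝ, (1 + x + y + (z + m)) ^ 2 ≤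
      5 * (1 + m ^ 2) * (1 + x ^ 2 + y ^ 2 + z ^ 2) := fun x y z m => by
    have h1 : (1 + x + y + (z + m)) ^ 2 ≤ 5 * (1 + x ^ 2 + y ^ 2 + z ^ 2 + m ^ 2) := by
      linarith [sq_nonneg (1 - x), sq_nonneg (1 - y), sq_nonneg (1 - z), sq_nonneg (1 - m),
        sq_nonneg (x - y), sq_nonneg (x - z), sq_nonneg (x - m), sq_nonneg (y - z),
        sq_nonneg (y - m), sq_nonneg (z - m)]
    have h2 : 0 ≤ m ^ 2 * (x ^ 2 + y ^ 2 + z ^ 2) := by positivity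
    linarith
  set b : ℝ := c ^ 2 * (5 * (1 + (‖K1‖ * B) ^ 2)) with hb
  set b' : ℝ := 5 * (1 + (|P.ν₀| * B + ‖K2‖ * B) ^ 2) with hb'
  have hb0 : 0 ≤ b := by positivity
  have hb'0 : 0 ≤ b' := by positivity
  refine ⟨b + b', by positivity, fun s w1 w2 h1 hw hw2 => ⟨?_, ?_⟩⟩
  · have h2 := h (affine k1 K1 s w1) w1 w2 h1 hw
    have h3 : ‖affine k1 K1 s w1‖ ≤ ‖k1 s‖ + ‖K1‖ * B := (norm_affine_le _ _ _ _).trans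
      (add_le_add le_rfl (mul_le_mul_of_nonneg_left ((norm_le_normV h1.inV).trans hw)
        (norm_nonneg _)))
    have h4 := h2.trans (mul_le_mul_of_nonneg_left (add_le_add le_rfl h3) hc)
    refine (pow_le_pow_left₀ (norm_nonneg _) h4 2).trans ?_
    rw [mul_pow]
    refine (mul_le_mul_of_nonneg_left (hsq _ _ _ _) (sq_nonneg c)).trans ?_
    rw [← mul_assoc]
    exact mul_le_mul_of_nonneg_right (le_add_of_nonneg_right hb'0) (by positivity)
  · have h2 := norm_full₂_le (P := P) (affine k2 K2 s w2) w1 w2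
    have h3 : ‖affine k2 K2 s w2‖ ≤ ‖k2 s‖ + ‖K2‖ * B := (norm_affine_le _ _ _ _).trans
      (add_le_add le_rfl (mul_le_mul_of_nonneg_left hw2 (norm_nonneg _)))
    have h4 : |P.ν₀| * normV w1 ≤ |P.ν₀| * B := mul_le_mul_of_nonneg_left hw (abs_nonneg _)
    have h5 : ‖full₂ P (affine k2 K2 s w2) w1 w2‖ ≤
        1 + 0 + normV w2 + (‖k2 s‖ + (|P.ν₀| * B + ‖K2‖ * B)) := by linarith
    refine (pow_le_pow_left₀ (norm_nonneg _) h5 2).trans ((hsq _ _ _ _).trans ?_)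
    rw [zero_pow two_ne_zero, add_zero]
    exact mul_le_mul_of_nonneg_right (le_add_of_nonneg_left hb0) (by positivity)

theorem PathBound.integrableOn {T B : ℝ} {w1 w2 : ℝ → H P.S} (h : PathBound P T B w1 w2) :
    IntegrableOn (fun t => ‖lift (opA (w1 t))‖ ^ 2) (Ioo 0 T) ∧
      IntegrableOn (fun t => normV (w2 t) ^ 2) (Ioo 0 T) :=
  ⟨h.memLp1.integrable_norm_pow two_ne_zero, h.memLp2.integrable_norm_pow two_ne_zero⟩

theorem AnalyticData.hasUniformBounds (hA : AnalyticData P F e μ C) {k1 k2 : ℝ → V' P.S}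
    (hk1 : LocL2 k1) (hk2 : LocL2 k2) (K1 K2 : H P.S →L[ℝ] H P.S) {w01 : H P.S} (h0 : InV w01)
    (w02 : H P.S) {W1 W2 : ℕ → ℝ → H P.S} (hG : ∀ N, IsGalerkin P e N (affine k1 K1)
      (affine k2 K2) w01 w02 (W1 N) (W2 N)) :
    HasUniformBounds P F e (affine k1 K1) (affine k2 K2) W1 W2 := by
  intro T hT ρ hρ
  have hE := hA.basis
  obtain ⟨B, hB, hb⟩ := hA.exists_pathBound hk1 hk2 K1 K2 h0 w02 hT
  obtain ⟨c, hc, hfull⟩ := hA.exists_full_sq_le (k1 := k1) (k2 := k2) K1 K2 hB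
  have hν := hA.ν₂_pos
  have n1 := hk1.integrableOn_sq hT
  have n2 := hk2.integrableOn_sq hT
  have hi : ∀ {φ : ℝ → ℝ}, IntegrableOn φ (Ioo 0 T) → IntervalIntegrable φ volume 0 T :=
    fun h => intervalIntegrable_of_mem h ⟨hT.le, le_rfl⟩
  have q1 : 0 ≤ ∫ s in 0..T, ‖k1 s‖ ^ 2 :=
    intervalIntegral.integral_nonneg hT.le fun s _ => by positivity
  have q2 : 0 ≤ ∫ s in 0..T, ‖k2 s‖ ^ 2 :=
    intervalIntegral.integral_nonneg hT.le fun s _ => by positivity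
  set D : ℝ := B + (P.ν₂ * B ^ 2 + 2 * B + ρ * B ^ 2) + c * (T + B + B +
    ((∫ s in 0..T, ‖k1 s‖ ^ 2) + ∫ s in 0..T, ‖k2 s‖ ^ 2)) with hD
  have hD1 : B ≤ D := by rw [hD, add_assoc]; exact le_add_of_nonneg_right (by positivity)
  have hD0 : 0 ≤ D := hB.trans hD1
  have hsq : ∀ x : ℝ, x ≤ D → x ≤ (D + 1) ^ 2 := fun x hx => by
    linarith [sq_nonneg D, show (D + 1) ^ 2 = D ^ 2 + 2 * D + 1 by ring]
  have hD2 : B ≤ D + 1 := by linarith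
  have hone : IntegrableOn (fun _ : ℝ => (1 : ℝ)) (Ioo 0 T) := integrableOn_const (by simp)
  refine ⟨D + 1, fun N => ?_⟩
  obtain ⟨hp, hc1, hc2, hpot, hQ⟩ := hb N _ _ (hG N)
  have hm1 : ∀ t ∈ Icc 0 T, W1 N t ∈ galSpan e N := fun t ht => ((hG N).1 t ht.1).1
  have hm2 : ∀ t ∈ Icc 0 T, W2 N t ∈ galSpan e N := fun t ht => ((hG N).1 t ht.1).2
  obtain ⟨hcA, hcV, hcT⟩ := hE.continuousOn_path hc1 hm1
  obtain ⟨-, hcV2, -⟩ := hE.continuousOn_path hc2 hm2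
  have hpc : ContinuousOn (fun s => grad (lift (chemPot P e N (W1 N s)))) (Icc 0 T) :=
    grad.continuous.comp_continuousOn (hE.continuousOn_path (hA.continuousOn_chemPot hc1 hm1)
      fun s hs => hA.chemPot_mem (hm1 s hs)).2.1
  have mQ := memLp_two_of_continuousOn hpc
  have mA := memLp_two_of_continuousOn hcA
  obtain ⟨i1, i2⟩ := hp.integrableOn
  have hself : ∀ {X : Type} [NormedAddCommGroup X] {φ : ℝ → X},
      MemLp φ 2 vol(T) → ∫ s in 0..T, ‖φ s‖ ^ 2 ≤ B →
      L2Bound T (D + 1) φ := fun hφ h => L2Bound.of_sq_le hT.le (by positivity) hφ.1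
    (hφ.integrable_norm_pow two_ne_zero) (.of_forall fun _ => le_rfl)
    (hsq _ (h.trans hD1))
  have hIoo := fun t (ht : t ∈ Ioo 0 T) => Ioo_subset_Icc_self ht
  refine ⟨⟨fun t ht => ⟨(hp.norm_le₁ t ht).trans hD2, (hp.norm_le₂ t ht).trans hD2⟩, ?_,
    hself hp.memLp2 hp.integral_le₂⟩, ⟨fun t ht => ⟨?_, (hp.normV_le t ht).trans hD2⟩,
    hself mQ hQ⟩, hself hp.memLp1 hp.integral_le₁, ?_, ?_⟩
  · refine L2Bound.of_sq_le hT.le (by positivity) mA.1 i1 ?_ (hsq _ (hp.integral_le₁.trans hD1))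
    filter_upwards [ae_restrict_mem measurableSet_Ioo] with t ht
    exact pow_le_pow_left₀ (norm_nonneg _) (hE.inDA32_of_mem (hm1 t (hIoo t ht))).normDA_le 2
  · have h1 := pow_le_pow_left₀ (normV_nonneg _) (hp.normV_le t ht) 2
    have h2 := pow_le_pow_left₀ (norm_nonneg _) (hp.norm_le₂ t ht) 2
    have h3 : freeEnergy P F ρ (W1 N t) (W2 N t) ≤ P.ν₂ * B ^ 2 + 2 * B + ρ * B ^ 2 :=
      add_le_add (add_le_add (mul_le_mul_of_nonneg_left h1 hν.le)
        (mul_le_mul_of_nonneg_left (hpot t ht) zero_le_two)) (mul_le_mul_of_nonneg_left h2 hρ.le)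
    have h4 : 0 ≤ c * (T + B + B +
      ((∫ s in 0..T, ‖k1 s‖ ^ 2) + ∫ s in 0..T, ‖k2 s‖ ^ 2)) := by positivity
    linarith
  · have i3 : IntegrableOn (fun s => c * (1 + ‖lift (opA (W1 N s))‖ ^ 2 + normV (W2 N s) ^ 2 +
        ‖k1 s‖ ^ 2)) (Ioo 0 T) := (((hone.add i1).add i2).add n1).const_mul c
    refine L2Bound.of_sq_le hT.le (by positivity)
      ((pivotL P.S).continuous.comp_aestronglyMeasurable ((hG N).2.1 T hT).1.1) i3 ?_ (hsq _ ?_)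
    · filter_upwards [ae_restrict_mem measurableSet_Ioo] with t ht
      rw [hA.galRHS₁_eq (hm1 t (hIoo t ht)) (hm2 t (hIoo t ht))]
      exact (pow_le_pow_left₀ (norm_nonneg _) (hE.norm_pivot_galProj_le N _) 2).trans
        (hfull t _ _ (hE.inDA32_of_mem (hm1 t (hIoo t ht))) (hp.normV_le t (hIoo t ht))
          (hp.norm_le₂ t (hIoo t ht))).1
    · rw [intervalIntegral.integral_const_mul, intervalIntegral.integral_add
        (((hi hone).add (hi i1)).add (hi i2)) (hi n1), intervalIntegral.integral_add
        ((hi hone).add (hi i1)) (hi i2), intervalIntegral.integral_add (hi hone) (hi i1)]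
      simp only [intervalIntegral.integral_const, sub_zero, smul_eq_mul, mul_one]
      refine le_trans (mul_le_mul_of_nonneg_left ?_ hc) (le_add_of_nonneg_left (by positivity))
      linarith [hp.integral_le₁, hp.integral_le₂]
  · have i3 : IntegrableOn (fun s => c * (1 + normV (W2 N s) ^ 2 + ‖k2 s‖ ^ 2)) (Ioo 0 T) :=
      ((hone.add i2).add n2).const_mul c
    refine L2Bound.of_sq_le hT.le (by positivity)
      ((pivotL P.S).continuous.comp_aestronglyMeasurable ((hG N).2.1 T hT).2.1) i3 ?_ (hsq _ ?_)
    · filter_upwards [ae_restrict_mem measurableSet_Ioo] with t ht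
      rw [hA.galRHS₂_eq (hm1 t (hIoo t ht)) (hm2 t (hIoo t ht))]
      exact (pow_le_pow_left₀ (norm_nonneg _) (hE.norm_pivot_galProj_le N _) 2).trans
        (hfull t _ _ (hE.inDA32_of_mem (hm1 t (hIoo t ht))) (hp.normV_le t (hIoo t ht))
          (hp.norm_le₂ t (hIoo t ht))).2
    · rw [intervalIntegral.integral_const_mul, intervalIntegral.integral_add
        ((hi hone).add (hi i2)) (hi n2), intervalIntegral.integral_add (hi hone) (hi i2)]
      simp only [intervalIntegral.integral_const, sub_zero, smul_eq_mul, mul_one]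
      refine le_trans (mul_le_mul_of_nonneg_left ?_ hc) (le_add_of_nonneg_left (by positivity))
      linarith [hp.integral_le₂]

theorem stability_algebra {ν m ν₁ ν₀ k : ℝ} (hν : 0 < ν) (hk : 0 ≤ k) :
    ∃ ρ : ℝ, 1 ≤ ρ ∧ ∃ c : ℝ, 0 < c ∧ ∃ A : ℝ, 0 ≤ A ∧ ∀ T Z Z2 h Q q D : ℝ, 1 ≤ D →
      -2 * ν * T ^ 2 + 2 * (m * D * (Z + Q) * T) + 2 * (|ν₁| * (Z2 * T)) +
        ρ * (-2 * Z2 ^ 2 + 2 * h ^ 2 + 2 * (|ν₀| * ((Z + Q) * Z2)) + 2 * (k * (h + q) * h)) ≤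
      -(c * (T ^ 2 + Z2 ^ 2)) + A * D ^ 2 * (Z ^ 2 + ρ * h ^ 2) + A * (D ^ 2 * Q ^ 2 + q ^ 2) := by
  set ρ : ℝ := 2 * ν₁ ^ 2 / ν + 1 with hρ
  have hρ1 : 1 ≤ ρ := by rw [hρ]; exact le_add_of_nonneg_left (by positivity)
  have hρ0 : 0 ≤ ρ := zero_le_one.trans hρ1
  set b : ℝ := 2 * m ^ 2 / ν + ρ * ν₀ ^ 2 with hb
  have hb0 : 0 ≤ b := by positivity
  refine ⟨ρ, hρ1, min ν 1, by positivity, 2 * b + (2 + 3 * k) + ρ * k, by positivity, ?_⟩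
  intro T Z Z2 h Q q D hD
  have hD2 : 1 ≤ D ^ 2 := one_le_pow₀ hD
  have e1 : 2 * (m * D * (Z + Q) * T) ≤ ν / 2 * T ^ 2 + 2 * m ^ 2 / ν * (D ^ 2 * (Z + Q) ^ 2) := by
    have h1 : 0 ≤ ν / 2 * (T - 2 * m / ν * (D * (Z + Q))) ^ 2 := by positivity
    have h2 : ν / 2 * (T - 2 * m / ν * (D * (Z + Q))) ^ 2 = ν / 2 * T ^ 2 +
      2 * m ^ 2 / ν * (D ^ 2 * (Z + Q) ^ 2) - 2 * (m * D * (Z + Q) * T) := by field_simp; ring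
    linarith
  have e2 : 2 * (|ν₁| * (Z2 * T)) ≤ ν / 2 * T ^ 2 + 2 * ν₁ ^ 2 / ν * Z2 ^ 2 := by
    have h1 : 0 ≤ ν / 2 * (T - 2 * |ν₁| / ν * Z2) ^ 2 := by positivity
    have h2 : ν / 2 * (T - 2 * |ν₁| / ν * Z2) ^ 2 = ν / 2 * T ^ 2 +
      2 * |ν₁| ^ 2 / ν * Z2 ^ 2 - 2 * (|ν₁| * (Z2 * T)) := by field_simp; ring
    rw [sq_abs] at h2
    linarith
  have e3 : 2 * (|ν₀| * ((Z + Q) * Z2)) ≤ Z2 ^ 2 + ν₀ ^ 2 * (Z + Q) ^ 2 := by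
    rw [← sq_abs ν₀]
    linarith [sq_nonneg (Z2 - |ν₀| * (Z + Q)), show (Z2 - |ν₀| * (Z + Q)) ^ 2 =
      Z2 ^ 2 + |ν₀| ^ 2 * (Z + Q) ^ 2 - 2 * (|ν₀| * ((Z + Q) * Z2)) by ring]
  have e4 : 2 * (k * (h + q) * h) ≤ 3 * k * h ^ 2 + k * q ^ 2 := by
    have := mul_nonneg hk (sq_nonneg (h - q))
    linarith [show k * (h - q) ^ 2 = 3 * k * h ^ 2 + k * q ^ 2 - 2 * (k * (h + q) * h) by ring]
  have e5 := mul_le_mul_of_nonneg_left (add_le_add e3 e4) hρ0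
  have e6 : (Z + Q) ^ 2 ≤ 2 * Z ^ 2 + 2 * Q ^ 2 := by linarith [sq_nonneg (Z - Q)]
  have e7 : ν₀ ^ 2 * (Z + Q) ^ 2 ≤ ν₀ ^ 2 * (D ^ 2 * (Z + Q) ^ 2) :=
    mul_le_mul_of_nonneg_left (le_mul_of_one_le_left (sq_nonneg _) hD2) (sq_nonneg _)
  have e8 := mul_le_mul_of_nonneg_left e7 hρ0
  have e9 : b * (D ^ 2 * (Z + Q) ^ 2) ≤ b * (D ^ 2 * (2 * Z ^ 2 + 2 * Q ^ 2)) :=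
    mul_le_mul_of_nonneg_left (mul_le_mul_of_nonneg_left e6 (sq_nonneg D)) hb0
  have e10 : b * (D ^ 2 * (Z + Q) ^ 2) = 2 * m ^ 2 / ν * (D ^ 2 * (Z + Q) ^ 2) +
    ρ * (ν₀ ^ 2 * (D ^ 2 * (Z + Q) ^ 2)) := by rw [hb]; ring
  have e11 : ρ * h ^ 2 * (2 + 3 * k) ≤ D ^ 2 * (ρ * h ^ 2) * (2 + 3 * k) :=
    mul_le_mul_of_nonneg_right (le_mul_of_one_le_left (by positivity) hD2) (by positivity)
  have e12 : min ν 1 * (T ^ 2 + Z2 ^ 2) ≤ ν * T ^ 2 + Z2 ^ 2 := by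
    have h1 := mul_le_mul_of_nonneg_right (min_le_left ν 1) (sq_nonneg T)
    have h2 := mul_le_mul_of_nonneg_right (min_le_right ν 1) (sq_nonneg Z2)
    linarith
  have e13 : ρ * Z2 ^ 2 = 2 * ν₁ ^ 2 / ν * Z2 ^ 2 + Z2 ^ 2 := by rw [hρ]; ring
  have p1 : 0 ≤ (2 + 3 * k) * D ^ 2 * Z ^ 2 := by positivity
  have p2 : 0 ≤ ρ * k * (D ^ 2 * (Z ^ 2 + ρ * h ^ 2)) := by positivity
  have p3 : 0 ≤ 2 * b * (D ^ 2 * (ρ * h ^ 2)) := by positivity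
  have p4 : 0 ≤ (2 * b + (2 + 3 * k)) * q ^ 2 := by positivity
  have p5 : 0 ≤ ((2 + 3 * k) + ρ * k) * (D ^ 2 * Q ^ 2) := by positivity
  linarith only [e1, e2, e5, e8, e9, e10, e11, e12, e13, p1, p2, p3, p4, p5]

/-- The differential inequality for the difference of a trajectory and a Galerkin approximation. -/
theorem AnalyticData.exists_stability_le (hA : AnalyticData P F e μ C) (k1 k2 : ℝ → V' P.S)
    (K1 K2 : H P.S →L[ℝ] H P.S) {B : ℝ} (hB : 0 ≤ B) :
    ∃ ρ : ℝ, 1 ≤ ρ ∧ ∃ c : ℝ, 0 < c ∧ ∃ A : ℝ, 0 ≤ A ∧ ∀ (N : ℕ) (s : ℝ) (u1 u2 w1 w2 : H P.S),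
      InDA32 u1 → InV u2 → w1 ∈ galSpan e N → w2 ∈ galSpan e N → normV u1 ≤ B → normV w1 ≤ B →
      2 * (full₁ P (affine k1 K1 s u1) u1 u2 - full₁ P (affine k1 K1 s w1) w1 w2)
          (lift (opA (projH e N u1 - w1))) +
        ρ * (2 * (full₂ P (affine k2 K2 s u2) u1 u2 - full₂ P (affine k2 K2 s w2) w1 w2)
          (lift (projH e N u2 - w2))) ≤
      -(c * (‖lift (opA (projH e N u1 - w1))‖ ^ 2 + normV (projH e N u2 - w2) ^ 2)) +
        A * (1 + ‖lift (opA u1)‖ ^ 2 + ‖lift (opA w1)‖ ^ 2) *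
          (normV (projH e N u1 - w1) ^ 2 + ρ * ‖projH e N u2 - w2‖ ^ 2) +
        (μ N)⁻¹ * A * (‖lift (opA u1)‖ ^ 2 + ‖lift (opA w1)‖ ^ 2 + normV u2 ^ 2) := by
  have hC := hA.bounds.nonneg
  have hν := hA.ν₂_pos
  have hE := hA.basis
  set m : ℝ := 2 * P.ν₂ + |P.ν₀ * P.ν₁| + ‖K1‖ + 2 * C * (1 + (B + B)) with hm
  obtain ⟨ρ, hρ, c, hc, A, hA0, halg⟩ := stability_algebra (m := m) (ν₁ := P.ν₁) (ν₀ := P.ν₀) hν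
    (norm_nonneg K2)
  refine ⟨ρ, hρ, c, hc, 3 * A * (1 + 2 * B ^ 2), by positivity, ?_⟩
  intro N s u1 u2 w1 w2 hu1 hu2 hm1 hm2 hBu hBw
  have hw1 := hE.inDA32_of_mem hm1
  have hw2 := hE.inV_of_mem hm2
  have hzm1 : projH e N u1 - w1 ∈ galSpan e N := sub_mem (hE.projH_mem N _) hm1
  have hzm2 : projH e N u2 - w2 ∈ galSpan e N := sub_mem (hE.projH_mem N _) hm2
  have hz1 := hE.inDA32_of_mem hzm1
  have hz2 := hE.inV_of_mem hzm2
  have ham := hE.opA_mem hzm1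
  have hp1 := hE.inDA32_projH N u1
  have hp2 := (hE.inDA32_projH N u2).inV
  set z1 := projH e N u1 - w1 with hz₁d
  set z2 := projH e N u2 - w2 with hz₂d
  have hμ := hE.pos N
  have hsub1 : u1 - w1 = z1 + (u1 - projH e N u1) := by rw [hz₁d]; abel
  have hsub2 : u2 - w2 = z2 + (u2 - projH e N u2) := by rw [hz₂d]; abel
  have hq1 : InDA32 (u1 - projH e N u1) := hu1.sub hp1
  set Q := normV (u1 - projH e N u1) with hQ
  set q := ‖u2 - projH e N u2‖ with hq
  set a := lift (opA z1) with ha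
  set Tz := ‖a‖ with hTz
  set Z := normV z1 with hZ
  set Z2 := normV z2 with hZ2
  have hZ0 : 0 ≤ Z := normV_nonneg _
  have hZ₂0 : 0 ≤ Z2 := normV_nonneg _
  have hT0 : 0 ≤ Tz := norm_nonneg _
  have hQ0 : 0 ≤ Q := normV_nonneg _
  have hX : normV (u1 - w1) ≤ Z + Q := by rw [hsub1]; exact normV_add_le hz1.inV hq1.inV
  have hX2 : ‖u2 - w2‖ ≤ ‖z2‖ + q := by rw [hsub2]; exact norm_add_le _ _
  set D : ℝ := 1 + (normDA u1 + normDA w1) with hD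
  have hD1 : 1 ≤ D := le_add_of_nonneg_right (add_nonneg (normDA_nonneg _) (normDA_nonneg _))
  have hlip : lipFactor u1 w1 ≤ (1 + (B + B)) * D := by
    have h1 := normV_nonneg u1
    have h2 := normV_nonneg w1
    rw [lipFactor]
    exact mul_le_mul_of_nonneg_right (by linarith) (by linarith)
  -- the first equation
  have t1 : -(lapV (lift (lap u1)) a - lapV (lift (lap w1)) a) ≤ -Tz ^ 2 + 2 * (Z * Tz) := by
    have h1 : lapV (lift (lap u1)) a - lapV (lift (lap w1)) a = lapV a a - lapV (lift z1) a := by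
      rw [hE.lapV_lift_of_mem ham hu1.inV_lap, hE.lapV_lift_of_mem ham hw1.inV_lap,
        hE.lift_projH hu1.inV_lap, hE.lift_projH hw1.inV_lap,
        ← sub_apply, ← sub_apply, ← lapV_sub, ← map_sub,
        ← lapV_sub, ← hu1.inV_lap.lift_sub hw1.inV_lap,
        ← hE.lift_projH (hu1.inV_lap.sub hw1.inV_lap), map_sub,
        ← hE.lap_projH hu1.1, ← hE.lap_projH hw1.1, (hE.mem_galSpan_iff N _).1 hm1, ha,
        ← hz1.2.lift_sub hz1.inV]
      congr 3
      rw [lap, lap, hz₁d, hp1.1.opA_sub hw1.1]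
      abel
    have h2 : lapV a a = Tz ^ 2 - normDA z1 ^ 2 := by
      rw [lapV_apply', ha, hz1.2.incl_lift, real_inner_self_eq_norm_sq, real_inner_self_eq_norm_sq]
      rfl
    have h3 := hz1.normDA_sq_le
    have h4 := (le_abs_self _).trans (abs_lapV_le' (lift z1) a)
    have h5 : ‖lift z1‖ = Z := rfl
    rw [h5] at h4
    rw [h1, h2]
    linarith
  have t2 : |lapV (lift u1) a - lapV (lift w1) a| ≤ (Z + Q) * Tz := by
    rw [← sub_apply, ← lapV_sub, ← hu1.inV.lift_sub hw1.inV]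
    exact (abs_lapV_le' _ _).trans (mul_le_mul_of_nonneg_right hX hT0)
  have t3 : |lapV (lift u2) a - lapV (lift w2) a| ≤ Z2 * Tz := by
    rw [ha, hE.lapV_lift_of_mem ham hu2, ← sub_apply, ← lapV_sub, ← hp2.lift_sub hw2]
    exact abs_lapV_le' _ _
  have t4 : -(lapV (lift (fH P.f u1)) a - lapV (lift (fH P.f w1)) a) ≤
      C * ((1 + (B + B)) * D) * (Z + Q) * Tz := by
    rw [← sub_apply]
    refine ((neg_le_abs _).trans ((norm_eq_abs _).symm.le.trans (le_opNorm _ a))).trans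
      (mul_le_mul_of_nonneg_right ((hA.bounds.f_sub u1 w1 hu1 hw1).trans ?_) hT0)
    exact mul_le_mul (mul_le_mul_of_nonneg_left hlip hC) hX (normV_nonneg _) (by positivity)
  have t5 : -(gD P.g u1 a - gD P.g w1 a) ≤ C * ((1 + (B + B)) * D) * (Z + Q) * Tz := by
    rw [← sub_apply]
    refine ((neg_le_abs _).trans ((norm_eq_abs _).symm.le.trans (le_opNorm _ a))).trans
      (mul_le_mul_of_nonneg_right ((hA.bounds.g_sub u1 w1 hu1 hw1).trans ?_) hT0)
    exact mul_le_mul (mul_le_mul_of_nonneg_left hlip hC) hX (normV_nonneg _) (by positivity)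
  have t6 : affine k1 K1 s u1 a - affine k1 K1 s w1 a ≤ ‖K1‖ * (Z + Q) * Tz := by
    have h1 : affine k1 K1 s u1 a - affine k1 K1 s w1 a = pivot (K1 (u1 - w1)) a := by
      rw [map_sub]
      simp only [affine, add_apply, pivot_apply, inner_sub_left]
      ring
    rw [h1]
    refine ((le_abs_self _).trans ((norm_eq_abs _).symm.le.trans (le_opNorm _ a))).trans
      (mul_le_mul_of_nonneg_right ((norm_pivot_le _).trans ((K1.le_opNorm _).trans ?_)) hT0)
    exact mul_le_mul_of_nonneg_left ((norm_le_normV (hu1.inV.sub hw1.inV)).trans hX) (norm_nonneg _)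
  -- the second equation
  have r1 : -(lapV (lift u2) (lift z2) - lapV (lift w2) (lift z2)) = -Z2 ^ 2 + ‖z2‖ ^ 2 := by
    rw [hE.lapV_lift_of_mem hzm2 hu2, ← sub_apply, ← lapV_sub,
      ← hp2.lift_sub hw2, ← hz₂d, lapV_apply', hz2.incl_lift, real_inner_self_eq_norm_sq,
      real_inner_self_eq_norm_sq, hZ2, normV]
    ring
  have r2 : |lapV (lift u1) (lift z2) - lapV (lift w1) (lift z2)| ≤ (Z + Q) * Z2 := by
    rw [← sub_apply, ← lapV_sub, ← hu1.inV.lift_sub hw1.inV]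
    exact (abs_lapV_le' _ _).trans (mul_le_mul_of_nonneg_right hX hZ₂0)
  have r3 : affine k2 K2 s u2 (lift z2) - affine k2 K2 s w2 (lift z2) ≤
      ‖K2‖ * (‖z2‖ + q) * ‖z2‖ := by
    have h1 : affine k2 K2 s u2 (lift z2) - affine k2 K2 s w2 (lift z2) = ⟪K2 (u2 - w2), z2⟫ := by
      rw [map_sub]
      simp only [affine, add_apply, pivot_apply, inner_sub_left, hz2.incl_lift]
      ring
    rw [h1]
    exact (real_inner_le_norm _ _).trans (mul_le_mul_of_nonneg_right ((K2.le_opNorm _).trans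
      (mul_le_mul_of_nonneg_left hX2 (norm_nonneg _))) (norm_nonneg _))
  have key := halg Tz Z Z2 ‖z2‖ Q q D hD1
  have s2 := mul_le_mul_of_nonneg_left t2 (abs_nonneg (P.ν₀ * P.ν₁))
  have s2' := (neg_le_abs (P.ν₀ * P.ν₁ * (lapV (lift u1) a - lapV (lift w1) a)))
  rw [abs_mul] at s2'
  have s3 := mul_le_mul_of_nonneg_left t3 (abs_nonneg P.ν₁)
  have s3' := (le_abs_self (P.ν₁ * (lapV (lift u2) a - lapV (lift w2) a)))
  rw [abs_mul] at s3'
  have s4 := mul_le_mul_of_nonneg_left r2 (abs_nonneg P.ν₀)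
  have s4' := (le_abs_self (P.ν₀ * (lapV (lift u1) (lift z2) - lapV (lift w1) (lift z2))))
  rw [abs_mul] at s4'
  have s1 := mul_le_mul_of_nonneg_left t1 hν.le
  have first : (full₁ P (affine k1 K1 s u1) u1 u2 - full₁ P (affine k1 K1 s w1) w1 w2) a ≤
      -P.ν₂ * Tz ^ 2 + m * D * (Z + Q) * Tz + |P.ν₁| * (Z2 * Tz) := by
    have hZQ : P.ν₂ * (2 * (Z * Tz)) ≤ 2 * P.ν₂ * ((Z + Q) * Tz) := by
      have : 0 ≤ P.ν₂ * (Q * Tz) := by positivity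
      linarith
    have hmD : (2 * P.ν₂ + |P.ν₀ * P.ν₁| + ‖K1‖) * ((Z + Q) * Tz) ≤
        (2 * P.ν₂ + |P.ν₀ * P.ν₁| + ‖K1‖) * ((Z + Q) * Tz) * D :=
      le_mul_of_one_le_right (by positivity) hD1
    have hmm : m * D * (Z + Q) * Tz = (2 * P.ν₂ + |P.ν₀ * P.ν₁| + ‖K1‖) * ((Z + Q) * Tz) * D +
      2 * (C * ((1 + (B + B)) * D) * (Z + Q) * Tz) := by rw [hm]; ring
    simp only [full₁, add_apply, sub_apply, smul_apply, smul_eq_mul, neg_mul]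
    rw [hmm]
    linarith only [s1, s2, s2', s3, s3', t4, t5, t6, hZQ, hmD]
  have second : (full₂ P (affine k2 K2 s u2) u1 u2 - full₂ P (affine k2 K2 s w2) w1 w2) (lift z2) ≤
      -Z2 ^ 2 + ‖z2‖ ^ 2 + |P.ν₀| * ((Z + Q) * Z2) + ‖K2‖ * (‖z2‖ + q) * ‖z2‖ := by
    simp only [full₂, add_apply, sub_apply, smul_apply, smul_eq_mul, neg_apply]
    linarith only [r1, r3, s4, s4']
  have second' := mul_le_mul_of_nonneg_left second (zero_le_one.trans hρ)
  -- the remainder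
  set Tu := ‖lift (opA u1)‖ with hTu
  set Tw := ‖lift (opA w1)‖ with hTw
  have hTu0 : 0 ≤ Tu := norm_nonneg _
  have hTw0 : 0 ≤ Tw := norm_nonneg _
  have d1 : normDA u1 ^ 2 ≤ B * Tu := (hu1.normDA_sq_le).trans (mul_le_mul_of_nonneg_right hBu hTu0)
  have d2 : normDA w1 ^ 2 ≤ B * Tw := (hw1.normDA_sq_le).trans (mul_le_mul_of_nonneg_right hBw hTw0)
  have d3 : normDA u1 ^ 2 ≤ Tu ^ 2 := pow_le_pow_left₀ (normDA_nonneg _) hu1.normDA_le 2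
  have d4 : normDA w1 ^ 2 ≤ Tw ^ 2 := pow_le_pow_left₀ (normDA_nonneg _) hw1.normDA_le 2
  have d5 : D ^ 2 ≤ 3 * (1 + normDA u1 ^ 2 + normDA w1 ^ 2) := by
    rw [hD]
    linarith [sq_nonneg (1 - normDA u1), sq_nonneg (1 - normDA w1),
      sq_nonneg (normDA u1 - normDA w1)]
  have d6 : Q ^ 2 ≤ (μ N)⁻¹ * normDA u1 ^ 2 := by
    rw [← div_eq_inv_mul, le_div_iff₀' hμ]
    exact hE.sq_normV_sub_projH_le N hu1.1
  have d7 : q ^ 2 ≤ (μ N)⁻¹ * normV u2 ^ 2 := by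
    rw [← div_eq_inv_mul, le_div_iff₀' hμ]
    have := hE.sq_norm_sub_projH_le N (lift u2)
    rwa [hu2.incl_lift] at this
  have hy0 : 0 ≤ Z ^ 2 + ρ * ‖z2‖ ^ 2 := by positivity
  have f1 : A * D ^ 2 * (Z ^ 2 + ρ * ‖z2‖ ^ 2) ≤
      3 * A * (1 + 2 * B ^ 2) * (1 + Tu ^ 2 + Tw ^ 2) * (Z ^ 2 + ρ * ‖z2‖ ^ 2) := by
    refine mul_le_mul_of_nonneg_right ?_ hy0
    have h1 : D ^ 2 ≤ 3 * (1 + Tu ^ 2 + Tw ^ 2) := by linarith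
    have h2 : 3 * (1 + Tu ^ 2 + Tw ^ 2) ≤ 3 * (1 + Tu ^ 2 + Tw ^ 2) * (1 + 2 * B ^ 2) :=
      le_mul_of_one_le_right (by positivity) (le_add_of_nonneg_right (by positivity))
    calc A * D ^ 2 ≤ A * (3 * (1 + Tu ^ 2 + Tw ^ 2) * (1 + 2 * B ^ 2)) :=
          mul_le_mul_of_nonneg_left (h1.trans h2) hA0
      _ = _ := by ring
  have f2 : D ^ 2 * Q ^ 2 + q ^ 2 ≤ (μ N)⁻¹ * (3 * (1 + 2 * B ^ 2) *
      (Tu ^ 2 + Tw ^ 2 + normV u2 ^ 2)) := by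
    have h1 : D ^ 2 * Q ^ 2 ≤ 3 * (1 + normDA u1 ^ 2 + normDA w1 ^ 2) *
        ((μ N)⁻¹ * normDA u1 ^ 2) := mul_le_mul d5 d6 (sq_nonneg _) (by positivity)
    have h2 : (1 + normDA u1 ^ 2 + normDA w1 ^ 2) * normDA u1 ^ 2 ≤
        (1 + 2 * B ^ 2) * (Tu ^ 2 + Tw ^ 2) := by
      have g1 : normDA u1 ^ 2 * normDA u1 ^ 2 ≤ B * Tu * (B * Tu) :=
        mul_le_mul d1 d1 (sq_nonneg _) (by positivity)
      have g2 : normDA w1 ^ 2 * normDA u1 ^ 2 ≤ B * Tw * (B * Tu) :=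
        mul_le_mul d2 d1 (sq_nonneg _) (by positivity)
      have g3 : 0 ≤ B ^ 2 * (Tu - Tw) ^ 2 := by positivity
      have g4 : 0 ≤ B ^ 2 * Tu ^ 2 := by positivity
      have g5 : 0 ≤ B ^ 2 * Tw ^ 2 := by positivity
      have g6 := sq_nonneg Tw
      linarith only [g1, g2, g3, g4, g5, g6, d3]
    have h3 : normV u2 ^ 2 ≤ 3 * (1 + 2 * B ^ 2) * normV u2 ^ 2 := by
      refine le_mul_of_one_le_left (sq_nonneg _) ?_
      linarith only [sq_nonneg B]
    have h4 : D ^ 2 * Q ^ 2 + q ^ 2 ≤ (μ N)⁻¹ * (3 * ((1 + normDA u1 ^ 2 + normDA w1 ^ 2) *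
        normDA u1 ^ 2) + normV u2 ^ 2) := by linarith only [h1, d7]
    refine h4.trans (mul_le_mul_of_nonneg_left ?_ (inv_pos.2 hμ).le)
    linarith only [h2, h3]
  have f3 := mul_le_mul_of_nonneg_left f2 hA0
  linarith only [key, first, second', f1, f3]

theorem AnalyticData.projEq_of_isGalerkin (hA : AnalyticData P F e μ C) {N M : ℕ} (hNM : N ≤ M)
    {k1 k2 : ℝ → V' P.S} {K1 K2 : H P.S →L[ℝ] H P.S} {w01 w02 : H P.S} {w1 w2 : ℝ → H P.S}
    (hG : IsGalerkin P e M (affine k1 K1) (affine k2 K2) w01 w02 w1 w2) {T : ℝ} (hT : 0 < T) :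
    ProjEq e N T w01 w1 (fun s => full₁ P (affine k1 K1 s (w1 s)) (w1 s) (w2 s)) ∧
      ProjEq e N T w02 w2 (fun s => full₂ P (affine k2 K2 s (w2 s)) (w1 s) (w2 s)) := by
  have main : ∀ (w0 : H P.S) (w : ℝ → H P.S) (ξ : ℝ → V' P.S),
      (∀ T, 0 < T → IntegrableOn (fun s => galProj e M (ξ s)) (Ioo 0 T)) →
      (∀ t, 0 ≤ t → w t = projH e M w0 + ∫ s in 0..t, galProj e M (ξ s)) → ProjEq e N T w0 w ξ := by
    intro w0 w ξ hi he
    have e1 : ∀ s, projH e N (galProj e M (ξ s)) = galProj e N (ξ s) := fun s =>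
      hA.basis.projH_galProj hNM _
    refine ⟨((projH e N).integrable_comp (hi T hT)).congr (.of_forall e1), fun t ht => ?_⟩
    rw [he t ht.1, map_add, hA.basis.projH_projH_of_le hNM, ← (projH e N).intervalIntegral_comp_comm (intervalIntegrable_of_mem (hi T hT) ht)]
    simp only [e1]
  obtain ⟨⟨hi1, he1⟩, ⟨hi2, he2⟩⟩ := hA.galerkin_path hG
  exact ⟨main _ _ _ hi1 he1, main _ _ _ hi2 he2⟩

/-- Convergence rate of the Galerkin approximations. -/
theorem AnalyticData.exists_stability (hA : AnalyticData P F e μ C) (k1 k2 : ℝ → V' P.S)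
    (K1 K2 : H P.S →L[ℝ] H P.S) (w01 w02 : H P.S) {B T : ℝ} (hB : 0 ≤ B) (hT : 0 < T) :
    ∃ K : ℝ, 0 ≤ K ∧ ∀ (N : ℕ) (u1 u2 w1 w2 : ℝ → H P.S),
      IsGalerkin P e N (affine k1 K1) (affine k2 K2) w01 w02 w1 w2 →
      PathBound P T B w1 w2 → PathBound P T B u1 u2 →
      ProjEq e N T w01 u1 (fun s => full₁ P (affine k1 K1 s (u1 s)) (u1 s) (u2 s)) →
      ProjEq e N T w02 u2 (fun s => full₂ P (affine k2 K2 s (u2 s)) (u1 s) (u2 s)) →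
      ∀ t ∈ Icc 0 T, normV (projH e N (u1 t) - w1 t) ^ 2 + ‖projH e N (u2 t) - w2 t‖ ^ 2 ≤
        (μ N)⁻¹ * K := by
  have hE := hA.basis
  obtain ⟨ρ, hρ, c, hc, A, hA0, hle⟩ := hA.exists_stability_le k1 k2 K1 K2 hB
  have hρ0 : 0 ≤ ρ := zero_le_one.trans hρ
  set L : ℝ := A * (T + B + B) with hL
  refine ⟨A * (B + B + B) * exp (2 * L), by positivity, ?_⟩
  intro N u1 u2 w1 w2 hG hw hu h₁ h₂
  have hm : ∀ t ∈ Icc 0 T, w1 t ∈ galSpan e N ∧ w2 t ∈ galSpan e N := fun t ht => hG.1 t ht.1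
  obtain ⟨g1, g2⟩ := hA.projEq_of_isGalerkin le_rfl hG hT
  obtain ⟨c1, d1⟩ := hE.norm_sq_chain (h₁.sub g1) hT.le
  obtain ⟨c2, d2⟩ := hE.norm_sq_chain (h₂.sub g2) hT.le
  have hz1 : ∀ t ∈ Icc 0 T, projH e N (u1 t - w1 t) = projH e N (u1 t) - w1 t := fun t ht => by
    rw [map_sub, (hE.mem_galSpan_iff N _).1 (hm t ht).1]
  have hz2 : ∀ t ∈ Icc 0 T, projH e N (u2 t - w2 t) = projH e N (u2 t) - w2 t := fun t ht => by
    rw [map_sub, (hE.mem_galSpan_iff N _).1 (hm t ht).2]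
  have hμ := (inv_pos.2 (hE.pos N)).le
  obtain ⟨iu1, iu2⟩ := hu.integrableOn
  obtain ⟨iw1, -⟩ := hw.integrableOn
  have hone : IntegrableOn (fun _ : ℝ => (1 : ℝ)) (Ioo 0 T) := integrableOn_const (by simp)
  have hi : ∀ {φ : ℝ → ℝ}, IntegrableOn φ (Ioo 0 T) → IntervalIntegrable φ volume 0 T :=
    fun h => intervalIntegrable_of_mem h ⟨hT.le, le_rfl⟩
  set a : ℝ → ℝ := fun s => A * (1 + ‖lift (opA (u1 s))‖ ^ 2 + ‖lift (opA (w1 s))‖ ^ 2) with ha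
  set κ : ℝ → ℝ := fun s => (μ N)⁻¹ * A *
    (‖lift (opA (u1 s))‖ ^ 2 + ‖lift (opA (w1 s))‖ ^ 2 + normV (u2 s) ^ 2) with hκ
  have hai : IntegrableOn a (Ioo 0 T) := ((hone.add iu1).add iw1).const_mul A
  have hκi : IntegrableOn κ (Ioo 0 T) := ((iu1.add iw1).add iu2).const_mul _
  have ha0 : ∀ s, 0 ≤ a s := fun s => by positivity
  have hκ0 : ∀ s, 0 ≤ κ s := fun s => by positivity
  have haT : ∫ s in 0..T, a s ≤ L := by
    rw [intervalIntegral.integral_const_mul, intervalIntegral.integral_add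
      ((hi hone).add (hi iu1)) (hi iw1), intervalIntegral.integral_add (hi hone) (hi iu1)]
    simp only [intervalIntegral.integral_const, sub_zero, smul_eq_mul, mul_one]
    exact mul_le_mul_of_nonneg_left (add_le_add (add_le_add le_rfl hu.integral_le₁)
      hw.integral_le₁) hA0
  have hκT : ∫ s in 0..T, κ s ≤ (μ N)⁻¹ * A * (B + B + B) := by
    rw [intervalIntegral.integral_const_mul, intervalIntegral.integral_add
      ((hi iu1).add (hi iw1)) (hi iu2), intervalIntegral.integral_add (hi iu1) (hi iw1)]
    exact mul_le_mul_of_nonneg_left (add_le_add (add_le_add hu.integral_le₁ hw.integral_le₁)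
      hu.integral_le₂) (mul_nonneg hμ hA0)
  obtain ⟨hAc, hVc, -⟩ := hE.continuousOn_path c1 fun t _ => hE.projH_mem N _
  have key := gronwall_dissipative (G := fun _ => 0) (a := a) (κ := κ)
    (y := fun t => normV (projH e N (u1 t - w1 t)) ^ 2 + ρ * ‖projH e N (u2 t - w2 t)‖ ^ 2)
    hT.le hai ha0 hκi hκ0 (by simp) (fun _ => le_rfl)
    ((hVc.norm.pow 2).add (continuousOn_const.mul (c2.norm.pow 2))) (fun t _ => by positivity)
    (fun t ht => by
      obtain ⟨-, i1, e1⟩ := d1 t ht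
      obtain ⟨⟨i2, e2⟩, -⟩ := d2 t ht
      obtain ⟨-, -, e1'⟩ := d1 0 ⟨le_rfl, hT.le⟩
      obtain ⟨⟨-, e2'⟩, -⟩ := d2 0 ⟨le_rfl, hT.le⟩
      refine ⟨i1.add (i2.const_mul ρ), ?_⟩
      rw [intervalIntegral.integral_add i1 (i2.const_mul ρ), intervalIntegral.integral_const_mul ρ]
      simp only [integral_same, add_zero] at e1' e2'
      rw [e1, e2, e1', e2']
      ring)
    (by
      filter_upwards [ae_restrict_mem measurableSet_Ioo, hu.inDA32, hu.inV2] with s hs hs1 hs2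
      have hs' := Ioo_subset_Icc_self hs
      have h := hle N s (u1 s) (u2 s) (w1 s) (w2 s) hs1 hs2 (hm s hs').1 (hm s hs').2
        (hu.normV_le s hs') (hw.normV_le s hs')
      simp only [hz1 s hs', hz2 s hs', a, κ, neg_zero, zero_add]
      have hG0 : 0 ≤ c * (‖lift (opA (projH e N (u1 s) - w1 s))‖ ^ 2 +
        normV (projH e N (u2 s) - w2 s) ^ 2) := by positivity
      linarith only [h, hG0])
  intro t ht
  have h := key t ht
  have hinit : normV (projH e N (u1 0 - w1 0)) ^ 2 + ρ * ‖projH e N (u2 0 - w2 0)‖ ^ 2 = 0 := by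
    have e1 := (h₁.sub g1).2 0 ⟨le_rfl, hT.le⟩
    have e2 := (h₂.sub g2).2 0 ⟨le_rfl, hT.le⟩
    simp only [sub_self, map_zero, integral_same, add_zero] at e1 e2
    rw [e1, e2, normV, lift_zero]
    simp
  simp only [hinit, intervalIntegral.integral_zero, add_zero, zero_add, hz1 t ht, hz2 t ht] at h
  have h1 : (∫ s in 0..T, κ s) * exp (2 * ∫ s in 0..T, a s) ≤
      (μ N)⁻¹ * A * (B + B + B) * exp (2 * L) :=
    mul_le_mul hκT (exp_le_exp.2 (by linarith)) (exp_pos _).le (by positivity)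
  have h2 : ‖projH e N (u2 t) - w2 t‖ ^ 2 ≤ ρ * ‖projH e N (u2 t) - w2 t‖ ^ 2 :=
    le_mul_of_one_le_left (sq_nonneg _) hρ
  calc _ ≤ _ := add_le_add le_rfl h2
    _ ≤ _ := h.trans h1
    _ = _ := by ring

theorem ae_eq_zero_of_integral_eq_zero {g : ℝ → ℝ} {T : ℝ} (hg : IntegrableOn g (Ioo 0 T))
    (h : ∀ s ∈ Icc 0 T, ∫ t in 0..s, g t = 0) : ∀ᵐ t ∂vol(T), g t = 0 := by
  rcases lt_or_ge T 0 with hT | hT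
  · simp [Ioo_eq_empty (not_lt.2 hT.le)]
  rw [ae_restrict_iff' measurableSet_Ioo]
  filter_upwards [(intervalIntegrable_of_mem hg ⟨hT, le_rfl⟩).ae_hasDerivAt_integral]
    with t ht hIoo
  have h1 := ht (by rw [uIcc_of_le hT]; exact Ioo_subset_Icc_self hIoo) 0 left_mem_uIcc
  have h2 : (fun x => ∫ s in 0..x, g s) =ᶠ[𝓝 t] fun _ => 0 := by
    filter_upwards [Ioo_mem_nhds hIoo.1 hIoo.2] with s hs
    exact h s (Ioo_subset_Icc_self hs)
  exact h1.unique ((hasDerivAt_const t (0 : ℝ)).congr_of_eventuallyEq h2)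

/-- Weak compactness in `L²((0,T), X)`, with the weak limit identified by primitives. -/
theorem exists_weakL2_limit {X : Type*} [NormedAddCommGroup X] [InnerProductSpace ℝ X]
    [CompleteSpace X] [SecondCountableTopology X] {T R : ℝ} (hT : 0 < T) (hR : 0 ≤ R) {x : ℕ → X}
    (hx : ∀ v : X, (∀ k, ⟪v, x k⟫ = 0) → v = 0) {u : ℕ → ℝ → X}
    (hu : ∀ n, MemLp (u n) 2 vol(T))
    (hb : ∀ n, eLpNorm (u n) 2 vol(T) ≤ ENNReal.ofReal R) {A : ℕ → ℝ → ℝ}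
    (hA : ∀ k, ∀ s ∈ Icc 0 T, Tendsto (fun n => ∫ t in 0..s, ⟪u n t, x k⟫) atTop (𝓝 (A k s))) :
    ∃ v : ℝ → X, MemLp v 2 vol(T) ∧ ∫ t in 0..T, ‖v t‖ ^ 2 ≤ R ^ 2 ∧
      (∀ k, ∀ s ∈ Icc 0 T, ∫ t in 0..s, ⟪v t, x k⟫ = A k s) ∧ WeakL2 T u v := by
  set ν := vol(T) with hν
  let U : ℕ → Lp X 2 ν := fun n => (hu n).toLp
  have hU : ∀ n, ‖U n‖ ≤ R := fun n => by
    rw [Lp.norm_toLp]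
    exact ENNReal.toReal_le_of_le_ofReal hR (hb n)
  haveI : Fact ((2 : ℝ≥0∞) ≠ ⊤) := ⟨by simp⟩
  have hind : ∀ (c : X), ∀ s ∈ Icc 0 T, ∃ Z : Lp X 2 ν, ∀ Y : Lp X 2 ν,
      ⟪Y, Z⟫ = ∫ t in 0..s, ⟪Y t, c⟫ := by
    intro c s hs
    refine ⟨indicatorConstLp 2 (measurableSet_Ioo (a := 0) (b := s)) (measure_ne_top _ _) c,
      fun Y => ?_⟩
    have hr : ν.restrict (Ioo 0 s) = volume.restrict (Ioo 0 s) :=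
      Measure.restrict_restrict_of_subset (Ioo_subset_Ioo_right hs.2)
    rw [real_inner_comm, L2.inner_indicatorConstLp_eq_setIntegral_inner, hr,
      integral_of_le hs.1, integral_Ioc_eq_integral_Ioo]
    simp only [real_inner_comm]
  have hcoe : ∀ n, ∀ k, ∀ s ∈ Icc 0 T, ∫ t in 0..s, ⟪U n t, x k⟫ =
      ∫ t in 0..s, ⟪u n t, x k⟫ := fun n k s hs => by
    rw [integral_of_le hs.1, integral_of_le hs.1,
      integral_Ioc_eq_integral_Ioo, integral_Ioc_eq_integral_Ioo]
    refine integral_congr_ae ?_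
    filter_upwards [ae_restrict_of_ae_restrict_of_subset (Ioo_subset_Ioo_right hs.2)
      (hu n).coeFn_toLp] with t ht
    rw [ht]
  have hsub : ∀ ns : ℕ → ℕ, Tendsto ns atTop atTop → ∃ y : Lp X 2 ν, ‖y‖ ≤ R ∧
      (∀ k, ∀ s ∈ Icc 0 T, ∫ t in 0..s, ⟪y t, x k⟫ = A k s) ∧
      ∃ ms : ℕ → ℕ, ∀ w, Tendsto (fun n => ⟪U (ns (ms n)), w⟫) atTop (𝓝 ⟪y, w⟫) := by
    intro ns hns
    obtain ⟨y, hy, φ, hφ, hlim⟩ := exists_weak_limit (x := fun n => U (ns n)) fun n => hU _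
    refine ⟨y, hy, fun k s hs => ?_, φ, hlim⟩
    obtain ⟨Z, hZ⟩ := hind (x k) s hs
    refine tendsto_nhds_unique ?_ ((hA k s hs).comp (hns.comp hφ.tendsto_atTop))
    have h1 := hlim Z
    simp only [hZ, hcoe _ k s hs] at h1
    exact h1
  have huniq : ∀ y y' : Lp X 2 ν, (∀ k, ∀ s ∈ Icc 0 T, ∫ t in 0..s, ⟪y t, x k⟫ = A k s) →
      (∀ k, ∀ s ∈ Icc 0 T, ∫ t in 0..s, ⟪y' t, x k⟫ = A k s) → y = y' := by
    intro y y' h h'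
    have hi : ∀ (z : Lp X 2 ν) k, IntegrableOn (fun t => ⟪z t, x k⟫) (Ioo 0 T) := fun z k =>
      ((Lp.memLp z).integrable one_le_two).inner_const (x k)
    have h1 : ∀ k, ∀ᵐ t ∂ν, ⟪y t, x k⟫ - ⟪y' t, x k⟫ = 0 := fun k =>
      ae_eq_zero_of_integral_eq_zero ((hi y k).sub (hi y' k)) fun s hs => by
        have hii : ∀ z, IntervalIntegrable (fun t => ⟪(z : Lp X 2 ν) t, x k⟫) volume 0 s := fun z => intervalIntegrable_of_mem (hi z k) hs
        rw [intervalIntegral.integral_sub (hii y) (hii y'), h k s hs, h' k s hs, sub_self]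
    refine Lp.ext ?_
    filter_upwards [ae_all_iff.2 h1] with t ht
    rw [← sub_eq_zero]
    exact hx _ fun k => by rw [inner_sub_left, ht k]
  obtain ⟨y, hy, hyA, -⟩ := hsub id tendsto_id
  refine ⟨y, Lp.memLp y, ?_, hyA, fun φ hφ => ?_⟩
  · have h1 : ‖y‖ ^ 2 = ∫ t in 0..T, ‖y t‖ ^ 2 := by
      rw [← real_inner_self_eq_norm_sq, L2.inner_def, integral_of_le hT.le,
        integral_Ioc_eq_integral_Ioo]
      simp only [real_inner_self_eq_norm_sq]
      rfl
    rw [← h1]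
    exact pow_le_pow_left₀ (norm_nonneg _) hy 2
  · have hΦ : MemLp (fun t => (toDual ℝ X).symm (φ t)) 2 ν :=
      (toDual ℝ X).symm.toContinuousLinearEquiv.toContinuousLinearMap.comp_memLp' hφ
    have h1 : ∀ {v : ℝ → X} (Y : Lp X 2 ν), (Y : ℝ → X) =ᵐ[ν] v →
        ∫ t in Ioo 0 T, φ t (v t) = ⟪Y, hΦ.toLp⟫ := fun {v} Y hY => by
      rw [L2.inner_def]
      refine integral_congr_ae ?_
      filter_upwards [hΦ.coeFn_toLp, hY] with t h2 h3
      rw [h2, h3, real_inner_comm, toDual_symm_apply]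
    rw [h1 y (ae_eq_refl _)]
    simp only [fun n => h1 (U n) (hu n).coeFn_toLp]
    refine tendsto_of_subseq_tendsto fun ns hns => ?_
    obtain ⟨y', -, hy', ms, hms⟩ := hsub ns hns
    rw [huniq y y' hyA hy']
    exact ⟨ms, hms _⟩

section

variable {d : ℕ} {S : Setting d} [hS : Fact S.IsAdmissible] {e : ℕ → H S} {μ : ℕ → ℝ}

section

variable (hE : IsEigenbasis S e μ)
include hE

theorem IsEigenbasis.ext_dual {ξ ζ : V' S} (h : ∀ k, ξ (lift (e k)) = ζ (lift (e k))) : ξ = ζ := by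
  refine (toDual ℝ (V S)).symm.injective (hE.ext_V fun k => ?_)
  rw [toDual_symm_apply, toDual_symm_apply, h]

theorem IsEigenbasis.isA_of_inner {u y : H S}
    (hu : InV u) (h : ∀ k, ⟪y, e k⟫ = μ k * ⟪u, e k⟫) : IsA u y := by
  have h1 : innerSL ℝ (lift u) = pivot y := hE.ext_dual fun k => by
    rw [innerSL_apply_apply, pivot_apply, hE.inner_lift', hu.incl_lift, hE.incl_lift, h]
  exact ⟨lift u, hu.incl_lift, fun z => congrArg (fun ℓ : V' S => ℓ z) h1⟩

theorem IsEigenbasis.lapV_lift_inner {u : H S}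
    (hu : InV u) (k : ℕ) : lapV (lift u) (lift (e k)) = (μ k - 1) * ⟪u, e k⟫ := by
  rw [lapV_apply', hE.inner_lift', hu.incl_lift, hE.incl_lift]
  ring

theorem IsEigenbasis.exists_limit_of_cauchy {x : ℕ → H S} {R : ℝ}
    (hx : ∀ n, ‖x n‖ ≤ R) (h : ∀ k, CauchySeq fun n => ⟪x n, e k⟫) :
    ∃ y : H S, ∀ k, Tendsto (fun n => ⟪x n, e k⟫) atTop (𝓝 ⟪y, e k⟫) := by
  obtain ⟨y, -, φ, hφ, hlim⟩ := exists_weak_limit hx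
  exact ⟨y, fun k => tendsto_nhds_of_cauchySeq_of_subseq (h k) hφ.tendsto_atTop (hlim (e k))⟩

theorem IsEigenbasis.norm_le_of_tendsto {x : ℕ → H S} {R : ℝ} (hx : ∀ n, ‖x n‖ ≤ R) {y : H S}
    (h : ∀ k, Tendsto (fun n => ⟪x n, e k⟫) atTop (𝓝 ⟪y, e k⟫)) : ‖y‖ ≤ R := by
  obtain ⟨y', hy, φ, hφ, hlim⟩ := exists_weak_limit hx
  rwa [hE.ext fun k => tendsto_nhds_unique ((h k).comp hφ.tendsto_atTop) (hlim (e k))]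

theorem IsEigenbasis.inV_of_tendsto {x : ℕ → H S}
    {R : ℝ} (hV : ∀ n, InV (x n)) (hx : ∀ n, normV (x n) ≤ R) {y : H S}
    (h : ∀ k, Tendsto (fun n => ⟪x n, e k⟫) atTop (𝓝 ⟪y, e k⟫)) : InV y ∧ normV y ≤ R := by
  obtain ⟨v, hv, φ, hφ, hlim⟩ := exists_weak_limit (x := fun n => lift (x n)) hx
  have hy : incl v = y := hE.ext fun k => by
    have h1 := hlim (lift (e k))
    simp only [hE.inner_lift', (hV _).incl_lift] at h1
    exact mul_left_cancel₀ (hE.pos k).ne'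
      (tendsto_nhds_unique h1 (((h k).comp hφ.tendsto_atTop).const_mul (μ k)))
  exact ⟨⟨v, hy⟩, by rwa [normV, InV.lift_eq hy]⟩

theorem IsEigenbasis.tendsto_projH {x : ℕ → H S}
    {y : H S} (h : ∀ k, Tendsto (fun n => ⟪x n, e k⟫) atTop (𝓝 ⟪y, e k⟫)) (N : ℕ) :
    Tendsto (fun n => projH e N (x n)) atTop (𝓝 (projH e N y)) ∧
      Tendsto (fun n => lift (projH e N (x n))) atTop (𝓝 (lift (projH e N y))) := by
  have hc : ∀ k, Tendsto (fun n => ⟪e k, x n⟫) atTop (𝓝 ⟪e k, y⟫) := fun k => by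
    simpa only [real_inner_comm] using h k
  constructor
  · simp only [projH_apply]
    exact tendsto_finsetSum _ fun k _ => (hc k).smul_const _
  · simp only [hE.lift_projH', liftP_apply]
    exact tendsto_finsetSum _ fun k _ => (hc k).smul_const _

end

end

/-- Weak compactness in `L²((0,T), X)` for a sequence with convergent, dominated coefficients. -/
theorem exists_weakL2_limit_of_tendsto {X : Type*} [NormedAddCommGroup X] [InnerProductSpace ℝ X]
    [CompleteSpace X] [SecondCountableTopology X] {T R : ℝ} (hT : 0 < T) (hR : 0 ≤ R) {x : ℕ → X}
    (hx : ∀ v : X, (∀ k, ⟪v, x k⟫ = 0) → v = 0) {u : ℕ → ℝ → X} (hu : ∀ n, L2Bound T R (u n))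
    {g a : ℕ → ℝ → ℝ} (hg : ∀ k, IntegrableOn (g k) (Ioo 0 T))
    (hle : ∀ k n, ∀ᵐ t ∂vol(T), |⟪u n t, x k⟫| ≤ g k t)
    (ha : ∀ k, ∀ᵐ t ∂vol(T), Tendsto (fun n => ⟪u n t, x k⟫) atTop (𝓝 (a k t))) :
    ∃ v : ℝ → X, MemLp v 2 vol(T) ∧ ∫ t in 0..T, ‖v t‖ ^ 2 ≤ R ^ 2 ∧
      (∀ᵐ t ∂vol(T), ∀ k, ⟪v t, x k⟫ = a k t) ∧
      (∀ k, ∀ s ∈ Icc 0 T, Tendsto (fun n => ∫ t in 0..s, ⟪u n t, x k⟫) atTop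
        (𝓝 (∫ t in 0..s, ⟪v t, x k⟫))) ∧ WeakL2 T u v := by
  have hm : ∀ n, MemLp (u n) 2 vol(T) := fun n =>
    ⟨(hu n).1, (hu n).2.trans_lt ENNReal.ofReal_lt_top⟩
  have hlim : ∀ k, ∀ s ∈ Icc 0 T, Tendsto (fun n => ∫ t in 0..s, ⟪u n t, x k⟫) atTop
      (𝓝 (∫ t in 0..s, a k t)) := fun k s hs => by
    have hsub : Ioo 0 s ⊆ Ioo 0 T := Ioo_subset_Ioo_right hs.2
    simp only [integral_of_le hs.1, integral_Ioc_eq_integral_Ioo]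
    exact tendsto_integral_of_dominated_convergence (g k)
      (fun n => ((hm n).1.mono_set hsub).inner aestronglyMeasurable_const) ((hg k).mono_set hsub)
      (fun n => ae_restrict_of_ae_restrict_of_subset hsub (hle k n))
      (ae_restrict_of_ae_restrict_of_subset hsub (ha k))
  obtain ⟨v, hv, hvR, hvA, hw⟩ := exists_weakL2_limit hT hR hx hm (fun n => (hu n).2) hlim
  refine ⟨v, hv, hvR, ?_, fun k s hs => by rw [hvA k s hs]; exact hlim k s hs, hw⟩
  rw [ae_all_iff]
  intro k
  have hai : IntegrableOn (a k) (Ioo 0 T) := by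
    refine (hg k).mono' (aestronglyMeasurable_of_tendsto_ae atTop
      (fun n => (hm n).1.inner aestronglyMeasurable_const) (ha k)) ?_
    filter_upwards [ha k, ae_all_iff.2 (hle k)] with t h1 h2
    exact le_of_tendsto h1.norm (.of_forall h2)
  have hvi : IntegrableOn (fun t => ⟪v t, x k⟫) (Ioo 0 T) :=
    (hv.integrable one_le_two).inner_const (x k)
  filter_upwards [ae_eq_zero_of_integral_eq_zero (hvi.sub hai) fun s hs => by
    have hi : ∀ {φ : ℝ → ℝ}, IntegrableOn φ (Ioo 0 T) → IntervalIntegrable φ volume 0 s := fun h =>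
      intervalIntegrable_of_mem h hs
    simp only [Pi.sub_apply]
    rw [intervalIntegral.integral_sub (hi hvi) (hi hai), hvA k s hs, sub_self]] with t ht
  exact sub_eq_zero.1 ht

theorem WeakL2.clm {X Y : Type*} [NormedAddCommGroup X] [NormedSpace ℝ X] [NormedAddCommGroup Y]
    [NormedSpace ℝ Y] (L : X →L[ℝ] Y) {T : ℝ} {u : ℕ → ℝ → X} {v : ℝ → X} (h : WeakL2 T u v) :
    WeakL2 T (fun n t => L (u n t)) fun t => L (v t) := fun φ hφ =>
  h (fun t => (φ t) ∘L L) (((ContinuousLinearMap.compL ℝ X Y ℝ).flip L).comp_memLp' hφ)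

theorem WeakL2.congr_right {X : Type*} [NormedAddCommGroup X] [NormedSpace ℝ X] {T : ℝ}
    {u : ℕ → ℝ → X} {v v' : ℝ → X} (h : WeakL2 T u v)
    (hv : ∀ᵐ t ∂vol(T), v t = v' t) : WeakL2 T u v' := fun φ hφ => by
  rw [← integral_congr_ae (f := fun t => φ t (v t)) (by
    filter_upwards [hv] with t ht
    rw [ht])]
  exact h φ hφ

theorem inv_sqrt_rate {a x m K D : ℝ} (hm : 0 < m) (ha : m * a ^ 2 ≤ D ^ 2) (hD : 0 ≤ D)
    (hx : x ^ 2 ≤ m⁻¹ * K) (hK : 0 ≤ K) : x + a ≤ √m⁻¹ * (√K + D) := by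
  have hs := sq_sqrt (inv_pos.2 hm).le
  rw [mul_add]
  refine add_le_add ?_ ?_
  · rw [← sqrt_mul (inv_pos.2 hm).le]
    exact le_sqrt_of_sq_le hx
  · refine abs_le_of_sq_le_sq' ?_ (by positivity) |>.2
    rw [mul_pow, hs]
    rw [← mul_le_mul_iff_right₀ hm, ← mul_assoc, mul_inv_cancel₀ hm.ne', one_mul]
    exact ha

/-- Pointwise rates of convergence, from the rates for the projections. -/
theorem AnalyticData.rate_le (hA : AnalyticData P F e μ C) {N : ℕ} {K : ℝ} (hK : 0 ≤ K)
    {u1 u2 w1 w2 : H P.S} (hu1 : InDA u1) (hu2 : InV u2) (hw1 : w1 ∈ galSpan e N)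
    (h : normV (projH e N u1 - w1) ^ 2 + ‖projH e N u2 - w2‖ ^ 2 ≤ (μ N)⁻¹ * K) :
    normV (w1 - u1) ≤ √(μ N)⁻¹ * (√K + normDA u1) ∧ ‖w2 - u2‖ ≤ √(μ N)⁻¹ * (√K + normV u2) ∧
      normDA w1 ≤ √K + normDA u1 := by
  have hE := hA.basis
  have hμ := hE.pos N
  have hpm := hE.projH_mem N u1
  have hp : InV (projH e N u1) := hE.inV_of_mem hpm
  have hw : InV w1 := hE.inV_of_mem hw1
  have hdm : projH e N u1 - w1 ∈ galSpan e N := Submodule.sub_mem _ hpm hw1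
  have h1 : normV (projH e N u1 - w1) ^ 2 ≤ (μ N)⁻¹ * K := by
    linarith only [h, sq_nonneg ‖projH e N u2 - w2‖]
  have h2 : ‖projH e N u2 - w2‖ ^ 2 ≤ (μ N)⁻¹ * K := by
    linarith only [h, sq_nonneg (normV (projH e N u1 - w1))]
  refine ⟨?_, ?_, ?_⟩
  · refine le_trans ?_ (inv_sqrt_rate hμ (hE.sq_normV_sub_projH_le N hu1) (normDA_nonneg _) h1 hK)
    have e1 : lift (w1 - u1) = -lift (projH e N u1 - w1) - lift (u1 - projH e N u1) := by
      rw [hw.lift_sub hu1.inV, hp.lift_sub hw, hu1.inV.lift_sub hp]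
      abel
    rw [normV, e1]
    exact (norm_sub_le _ _).trans (by rw [norm_neg]; rfl)
  · have h3 := hE.sq_norm_sub_projH_le N (lift u2)
    rw [hu2.incl_lift] at h3
    refine le_trans ?_ (inv_sqrt_rate hμ h3 (normV_nonneg _) h2 hK)
    have e1 : w2 - u2 = -(projH e N u2 - w2) - (u2 - projH e N u2) := by abel
    rw [e1]
    exact (norm_sub_le _ _).trans (by rw [norm_neg])
  · have h3 : normDA (projH e N u1 - w1) ≤ √K := by
      refine le_sqrt_of_sq_le ((hE.normDA_sq_le_of_mem hdm).trans ?_)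
      calc μ N * _ ≤ μ N * ((μ N)⁻¹ * K) := mul_le_mul_of_nonneg_left h1 hμ.le
        _ = K := by rw [← mul_assoc, mul_inv_cancel₀ hμ.ne', one_mul]
    have h4 : normDA (projH e N u1) ≤ normDA u1 := by
      rw [normDA, hE.opA_projH hu1]; exact hE.norm_projH_le N _
    have hpD := (hE.inDA32_of_mem hpm).1
    have e1 : opA w1 = opA (projH e N u1) - opA (projH e N u1 - w1) := by
      rw [hpD.opA_sub (hE.inDA32_of_mem hw1).1]; abel
    rw [normDA, e1, add_comm]
    exact (norm_sub_le _ _).trans (add_le_add h4 h3)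

theorem AnalyticData.exists_full_sub_le (hA : AnalyticData P F e μ C) (k1 k2 : ℝ → V' P.S)
    (K1 K2 : H P.S →L[ℝ] H P.S) {B X : ℝ} (hB : 0 ≤ B) (hX : 1 ≤ X) (k : ℕ) :
    ∃ c : ℝ, 0 ≤ c ∧ ∀ (s δ D V : ℝ) (u1 u2 w1 w2 : H P.S), 0 ≤ δ → 0 ≤ D → 0 ≤ V →
      InDA32 u1 → InDA32 w1 → InV u2 → InV w2 → normV u1 ≤ B → normV w1 ≤ B →
      normV (w1 - u1) ≤ δ * (X * (1 + D)) → ‖w2 - u2‖ ≤ δ * (X * (1 + V)) →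
      normDA u1 ≤ X * (1 + D) → normDA w1 ≤ X * (1 + D) →
      |full₁ P (affine k1 K1 s w1) w1 w2 (lift (e k)) -
        full₁ P (affine k1 K1 s u1) u1 u2 (lift (e k))| ≤ δ * (c * (1 + D ^ 2 + V ^ 2)) ∧
      |full₂ P (affine k2 K2 s w2) w1 w2 (lift (e k)) -
        full₂ P (affine k2 K2 s u2) u1 u2 (lift (e k))| ≤ δ * (c * (1 + D ^ 2 + V ^ 2)) := by
  have hE := hA.basis
  have hC := hA.bounds.nonneg
  set m := μ k - 1 with hm
  set c1 := |P.ν₂| * m ^ 2 + |P.ν₀ * P.ν₁| * |m| + ‖K1‖ + |P.ν₀| * |m| with hc₁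
  set c2 := |P.ν₁| * |m| + |m| + ‖K2‖ with hc₂
  set c3 := 2 * C * (1 + (B + B)) * 3 * X * ‖lift (e k)‖ with hc₃
  have hc1 : 0 ≤ c1 := by positivity
  have hc2 : 0 ≤ c2 := by positivity
  have hc3 : 0 ≤ c3 := by positivity
  refine ⟨2 * X * (c1 + c2 + c3), by positivity, ?_⟩
  intro s δ D V u1 u2 w1 w2 hδ hD hV hu1 hw1 hu2 hw2 hBu hBw ha hb hDu hDw
  have hav : ‖w1 - u1‖ ≤ δ * (X * (1 + D)) := (norm_le_normV (hw1.inV.sub hu1.inV)).trans ha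
  have i1 : |⟪w1 - u1, e k⟫| ≤ δ * (X * (1 + D)) := (hE.abs_inner_le _ _).trans hav
  have i2 : |⟪w2 - u2, e k⟫| ≤ δ * (X * (1 + V)) := (hE.abs_inner_le _ _).trans hb
  have j1 : |⟪K1 (w1 - u1), e k⟫| ≤ ‖K1‖ * (δ * (X * (1 + D))) :=
    (hE.abs_inner_le _ _).trans (K1.le_opNorm_of_le hav)
  have j2 : |⟪K2 (w2 - u2), e k⟫| ≤ ‖K2‖ * (δ * (X * (1 + V))) :=
    (hE.abs_inner_le _ _).trans (K2.le_opNorm_of_le hb)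
  have hlip : C * lipFactor w1 u1 * normV (w1 - u1) ≤
      C * ((1 + (B + B)) * (3 * X * (1 + D))) * (δ * (X * (1 + D))) := by
    have := normV_nonneg w1; have := normV_nonneg u1; have := normV_nonneg (w1 - u1)
    have := normDA_nonneg w1; have := normDA_nonneg u1
    have h1 : 1 + (normDA w1 + normDA u1) ≤ 3 * X * (1 + D) := by
      linarith only [hDu, hDw, one_le_mul_of_one_le_of_one_le hX (by linarith : 1 ≤ 1 + D)]
    rw [lipFactor]
    gcongr
  have l1 : |(lapV (lift (fH P.f w1)) - lapV (lift (fH P.f u1))) (lift (e k))| ≤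
      C * ((1 + (B + B)) * (3 * X * (1 + D))) * (δ * (X * (1 + D))) * ‖lift (e k)‖ :=
    (le_opNorm _ _).trans (mul_le_mul_of_nonneg_right
      ((hA.bounds.f_sub w1 u1 hw1 hu1).trans hlip) (norm_nonneg _))
  have l2 : |(gD P.g w1 - gD P.g u1) (lift (e k))| ≤
      C * ((1 + (B + B)) * (3 * X * (1 + D))) * (δ * (X * (1 + D))) * ‖lift (e k)‖ :=
    (le_opNorm _ _).trans (mul_le_mul_of_nonneg_right
      ((hA.bounds.g_sub w1 u1 hw1 hu1).trans hlip) (norm_nonneg _))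
  have elap : ∀ {u : H P.S}, InDA32 u → lapV (lift (lap u)) (lift (e k)) = m * (m * ⟪u, e k⟫) :=
    fun h => by
      rw [hE.lapV_lift_inner h.inV_lap, lap, inner_sub_left, hE.inner_opA h.1]
      ring
  have eV : ∀ {u : H P.S}, InV u → lapV (lift u) (lift (e k)) = m * ⟪u, e k⟫ :=
    fun h => hE.lapV_lift_inner h k
  have fin : ∀ x : ℝ, |x| ≤ c1 * (δ * (X * (1 + D))) + c2 * (δ * (X * (1 + V))) +
      c3 * (1 + D) * (δ * (X * (1 + D))) →
      |x| ≤ δ * (2 * X * (c1 + c2 + c3) * (1 + D ^ 2 + V ^ 2)) := fun x hx => by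
    have q1 : 1 + D ≤ 2 * (1 + D ^ 2 + V ^ 2) := by
      linarith only [sq_nonneg V, sq_nonneg (D - 1), sq_nonneg D]
    have q2 : 1 + V ≤ 2 * (1 + D ^ 2 + V ^ 2) := by
      linarith only [sq_nonneg V, sq_nonneg (V - 1), sq_nonneg D]
    have q3 : (1 + D) * (1 + D) ≤ 2 * (1 + D ^ 2 + V ^ 2) := by
      linarith only [sq_nonneg V, sq_nonneg (D - 1)]
    calc |x| ≤ _ := hx
      _ = δ * X * (c1 * (1 + D) + c2 * (1 + V) + c3 * ((1 + D) * (1 + D))) := by ring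
      _ ≤ δ * X * (c1 * (2 * (1 + D ^ 2 + V ^ 2)) + c2 * (2 * (1 + D ^ 2 + V ^ 2)) +
          c3 * (2 * (1 + D ^ 2 + V ^ 2))) := by gcongr
      _ = _ := by ring
  have hz : 0 ≤ c3 * (1 + D) * (δ * (X * (1 + D))) := by positivity
  have hz1 : 0 ≤ δ * (X * (1 + D)) := by positivity
  have hz2 : 0 ≤ δ * (X * (1 + V)) := by positivity
  constructor
  · refine fin _ ?_
    have e1 : full₁ P (affine k1 K1 s w1) w1 w2 (lift (e k)) -
        full₁ P (affine k1 K1 s u1) u1 u2 (lift (e k)) =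
        -(P.ν₂ * (m ^ 2 * ⟪w1 - u1, e k⟫)) - P.ν₀ * P.ν₁ * (m * ⟪w1 - u1, e k⟫)
          + P.ν₁ * (m * ⟪w2 - u2, e k⟫)
          - (lapV (lift (fH P.f w1)) - lapV (lift (fH P.f u1))) (lift (e k))
          - (gD P.g w1 - gD P.g u1) (lift (e k)) + ⟪K1 (w1 - u1), e k⟫ := by
      simp only [full₁, affine, add_apply, sub_apply,
        smul_apply, smul_eq_mul, elap hw1, elap hu1, eV hw1.inV,
        eV hu1.inV, eV hw2, eV hu2, pivot_apply, hE.incl_lift, inner_sub_left, map_sub]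
      ring
    rw [e1]
    have b1 : |-(P.ν₂ * (m ^ 2 * ⟪w1 - u1, e k⟫))| ≤ |P.ν₂| * (m ^ 2 * (δ * (X * (1 + D)))) := by
      rw [abs_neg, abs_mul, abs_mul, abs_sq]; gcongr
    have b2 : |P.ν₀ * P.ν₁ * (m * ⟪w1 - u1, e k⟫)| ≤
        |P.ν₀ * P.ν₁| * (|m| * (δ * (X * (1 + D)))) := by
      rw [abs_mul, abs_mul m]; gcongr
    have b3 : |P.ν₁ * (m * ⟪w2 - u2, e k⟫)| ≤ |P.ν₁| * (|m| * (δ * (X * (1 + V)))) := by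
      rw [abs_mul, abs_mul m]; gcongr
    refine (abs_add_le _ _).trans ((add_le_add ((abs_sub _ _).trans (add_le_add ((abs_sub _ _).trans
      (add_le_add ((abs_add_le _ _).trans (add_le_add ((abs_sub _ _).trans (add_le_add b1 b2)) b3))
      l1)) l2)) j1).trans ?_)
    have r1 : 0 ≤ |P.ν₀| * |m| * (δ * (X * (1 + D))) := by positivity
    have r2 : 0 ≤ (|m| + ‖K2‖) * (δ * (X * (1 + V))) := by positivity
    rw [hc₁, hc₂, hc₃]
    linarith only [r1, r2]
  · refine fin _ ?_
    have e1 : full₂ P (affine k2 K2 s w2) w1 w2 (lift (e k)) -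
        full₂ P (affine k2 K2 s u2) u1 u2 (lift (e k)) =
        -(m * ⟪w2 - u2, e k⟫) + P.ν₀ * (m * ⟪w1 - u1, e k⟫) + ⟪K2 (w2 - u2), e k⟫ := by
      simp only [full₂, affine, add_apply, neg_apply, smul_apply, smul_eq_mul, eV hw1.inV,
        eV hu1.inV, eV hw2, eV hu2, pivot_apply, hE.incl_lift, inner_sub_left, map_sub]
      ring
    rw [e1]
    have b1 : |-(m * ⟪w2 - u2, e k⟫)| ≤ |m| * (δ * (X * (1 + V))) := by
      rw [abs_neg, abs_mul]; gcongr
    have b2 : |P.ν₀ * (m * ⟪w1 - u1, e k⟫)| ≤ |P.ν₀| * (|m| * (δ * (X * (1 + D)))) := by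
      rw [abs_mul, abs_mul m]; gcongr
    refine (abs_add_le _ _).trans ((add_le_add ((abs_add_le _ _).trans (add_le_add b1 b2)) j2).trans
      ?_)
    have r1 : 0 ≤ (|P.ν₂| * m ^ 2 + |P.ν₀ * P.ν₁| * |m| + ‖K1‖) * (δ * (X * (1 + D))) := by
      positivity
    have r2 : 0 ≤ |P.ν₁| * |m| * (δ * (X * (1 + V))) := by positivity
    rw [hc₁, hc₂]
    linarith only [r1, r2, hz]

theorem inner_intervalIntegral {X : Type*} [NormedAddCommGroup X] [InnerProductSpace ℝ X]
    [CompleteSpace X] {φ : ℝ → X} {a b : ℝ} (h : IntervalIntegrable φ volume a b) (x : X) :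
    ⟪∫ t in a..b, φ t, x⟫ = ∫ t in a..b, ⟪φ t, x⟫ := by
  rw [real_inner_comm, ← innerSL_apply_apply ℝ, ← (innerSL ℝ x).intervalIntegral_comp_comm h]
  simp only [innerSL_apply_apply, real_inner_comm x]

section

variable {d : ℕ} {S : Setting d} [hS : Fact S.IsAdmissible] {e : ℕ → H S} {μ : ℕ → ℝ}

/-- Passage to the limit in the Galerkin equations. -/
theorem IsEigenbasis.weakL2_of_rate (hE : IsEigenbasis S e μ) (hd : 1 ≤ d)
    {T B : ℝ} (hT : 0 < T) (hB : 0 ≤ B) {R : ℕ → ℝ → H S} (hR : ∀ n, IntegrableOn (R n) (Ioo 0 T))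
    (hRB : ∀ n, L2Bound T B fun t => pivot (R n t)) {ζ : ℕ → ℝ → V' S}
    (hRζ : ∀ n, ∀ t ∈ Icc 0 T, R n t = galProj e n (ζ n t)) {ξ : ℝ → V' S} {g : ℕ → ℝ → ℝ}
    (hg : ∀ k, IntegrableOn (g k) (Ioo 0 T)) (hr : ∀ᵐ t ∂vol(T), ∀ k n,
      |ζ n t (lift (e k)) - ξ t (lift (e k))| ≤ √(μ n)⁻¹ * g k t) {w0 : H S} {w : ℝ → H S}
    {W : ℕ → ℝ → H S} (hw : ∀ s ∈ Icc 0 T, ∀ k,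
      Tendsto (fun n => ⟪W n s, e k⟫) atTop (𝓝 ⟪w s, e k⟫))
    (hW : ∀ n, ∀ s ∈ Icc 0 T, W n s = galProj e n (pivot w0) + ∫ t in 0..s, R n t) :
    MemLp ξ 2 vol(T) ∧ WeakL2 T (fun n t => pivot (R n t)) ξ ∧
      ∀ s ∈ Icc 0 T, ∀ k, ⟪w s, e k⟫ = ⟪w0, e k⟫ + ∫ t in 0..s, ξ t (lift (e k)) := by
  let J := toDual ℝ (V S)
  let u : ℕ → ℝ → V S := fun n t => J.symm (pivot (R n t))
  have hJ : ∀ ℓ : V' S, ∀ z, ⟪J.symm ℓ, z⟫ = ℓ z := fun ℓ z => toDual_symm_apply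
  have huk : ∀ n k t, ⟪u n t, lift (e k)⟫ = ⟪R n t, e k⟫ := fun n k t => by
    rw [hJ, pivot_apply, hE.incl_lift]
  have hui : ∀ n k, ∀ t ∈ Icc 0 T, ⟪u n t, lift (e k)⟫ =
      if k < n then ζ n t (lift (e k)) else 0 := fun n k t ht => by
    rw [huk, hRζ n t ht, hE.inner_galProj]
  have hu : ∀ n, L2Bound T B (u n) := fun n =>
    ⟨J.symm.continuous.comp_aestronglyMeasurable (hRB n).1,
      (eLpNorm_congr_norm_ae (.of_forall fun t => J.symm.norm_map _)).trans_le (hRB n).2⟩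
  have hRk : ∀ n k, IntegrableOn (fun t => ⟪R n t, e k⟫) (Ioo 0 T) := fun n k =>
    (hR n).inner_const (e k)
  obtain ⟨v, hv, -, hvξ, hlim, hweak⟩ := exists_weakL2_limit_of_tendsto hT hB
    (x := fun k => lift (e k)) (fun v h => hE.ext_V fun k => by rw [h k, inner_zero_left])
    (u := u) hu (g := fun k t => |⟪R (k + 1) t, e k⟫| + 2 * |g k t|)
    (a := fun k t => ξ t (lift (e k)))
    (fun k => (hRk (k + 1) k).abs.add ((hg k).abs.const_mul 2))
    (fun k n => by
      filter_upwards [ae_restrict_mem measurableSet_Ioo, hr] with t ht h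
      have ht' := Ioo_subset_Icc_self ht
      rw [hui n k t ht']
      split_ifs with hk
      · have hb : ∀ n, |ζ n t (lift (e k)) - ξ t (lift (e k))| ≤ |g k t| := fun n =>
          (h k n).trans ((mul_le_mul_of_nonneg_left (le_abs_self _) (sqrt_nonneg _)).trans
            (mul_le_of_le_one_left (abs_nonneg _) (hE.rate_le_one n)))
        have h2 : ⟪R (k + 1) t, e k⟫ = ζ (k + 1) t (lift (e k)) := by
          rw [← huk, hui (k + 1) k t ht', if_pos k.lt_succ_self]
        have h3 := hb n
        have h4 := hb (k + 1)
        rw [h2]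
        rw [abs_le] at h3 h4 ⊢
        have h5 := le_abs_self (ζ (k + 1) t (lift (e k)))
        have h6 := neg_abs_le (ζ (k + 1) t (lift (e k)))
        constructor <;> linarith only [h3.1, h3.2, h4.1, h4.2, h5, h6]
      · rw [abs_zero]; positivity)
    (fun k => by
      filter_upwards [ae_restrict_mem measurableSet_Ioo, hr] with t ht h
      refine tendsto_iff_dist_tendsto_zero.2 (squeeze_zero' (.of_forall fun _ =>
        dist_nonneg) ?_ (hE.tendsto_rate hd (g k t)))
      filter_upwards [eventually_gt_atTop k] with n hn
      rw [hui n k t (Ioo_subset_Icc_self ht), if_pos hn, dist_eq]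
      exact h k n)
  have hξv : ∀ᵐ t ∂vol(T), J (v t) = ξ t := by
    filter_upwards [hvξ] with t ht
    exact hE.ext_dual fun k => by rw [← ht k, ← hJ, LinearIsometryEquiv.symm_apply_apply]
  refine ⟨(memLp_congr_ae hξv).1 (J.toContinuousLinearEquiv.toContinuousLinearMap.comp_memLp' hv),
    ?_, fun s hs k => ?_⟩
  · have h1 := (hweak.clm J.toContinuousLinearEquiv.toContinuousLinearMap).congr_right hξv
    have h2 : ∀ n t, J.toContinuousLinearEquiv.toContinuousLinearMap (u n t) = pivot (R n t) :=
      fun n t => J.apply_symm_apply _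
    simpa only [h2] using h1
  · have hcongr : ∫ t in 0..s, ⟪v t, lift (e k)⟫ = ∫ t in 0..s, ξ t (lift (e k)) := by
      rw [integral_of_le hs.1, integral_of_le hs.1,
        integral_Ioc_eq_integral_Ioo, integral_Ioc_eq_integral_Ioo]
      refine integral_congr_ae (ae_restrict_of_ae_restrict_of_subset (Ioo_subset_Ioo_right hs.2) ?_)
      filter_upwards [hvξ] with t ht using ht k
    rw [← hcongr]
    refine tendsto_nhds_unique (hw s hs k) (((hlim k s hs).const_add ⟪w0, e k⟫).congr' ?_)
    filter_upwards [eventually_gt_atTop k] with n hn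
    rw [hW n s hs, inner_add_left, inner_intervalIntegral
      (intervalIntegrable_of_mem (hR n) hs), hE.inner_galProj, if_pos hn, pivot_apply, hE.incl_lift]
    simp only [huk]

theorem IsEigenbasis.projEq_of_inner (hE : IsEigenbasis S e μ) {T : ℝ} {w0 : H S}
    {w : ℝ → H S} {ξ : ℝ → V' S} (hξ : IntegrableOn ξ (Ioo 0 T))
    (h : ∀ s ∈ Icc 0 T, ∀ k, ⟪w s, e k⟫ = ⟪w0, e k⟫ + ∫ t in 0..s, ξ t (lift (e k)))
    (N : ℕ) : ProjEq e N T w0 w ξ := by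
  have hi : IntegrableOn (fun s => galProj e N (ξ s)) (Ioo 0 T) := by
    simp only [← galProjL_apply]
    exact (galProjL e N).integrable_comp hξ
  refine ⟨hi, fun t ht => hE.ext fun k => ?_⟩
  rw [inner_add_left, inner_intervalIntegral (intervalIntegrable_of_mem hi ht), hE.inner_projH, hE.inner_projH]
  simp only [hE.inner_galProj]
  split_ifs with hk
  · exact h t ht k
  · simp

end

theorem PathBound.mono {T B B' : ℝ} {w1 w2 : ℝ → H P.S} (h : PathBound P T B w1 w2) (hB : B ≤ B') :
    PathBound P T B' w1 w2 :=
  ⟨fun t ht => (h.norm_le₁ t ht).trans hB, fun t ht => (h.norm_le₂ t ht).trans hB, h.inV,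
    fun t ht => (h.normV_le t ht).trans hB, h.inDA32, h.inV2, h.memLp1, h.memLp2,
    h.integral_le₁.trans hB, h.integral_le₂.trans hB⟩

/-- Bounded paths that satisfy the projected equations. -/
structure IsPath (P : Model d) (e : ℕ → H P.S) (k1 k2 : ℝ → V' P.S) (K1 K2 : H P.S →L[ℝ] H P.S)
    (w01 w02 : H P.S) (T B : ℝ) (w1 w2 : ℝ → H P.S) : Prop where
  nonneg : 0 ≤ B
  bound : PathBound P T B w1 w2
  proj1 : ∀ N, ProjEq e N T w01 w1 fun s => full₁ P (affine k1 K1 s (w1 s)) (w1 s) (w2 s)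
  proj2 : ∀ N, ProjEq e N T w02 w2 fun s => full₂ P (affine k2 K2 s (w2 s)) (w1 s) (w2 s)

section

variable {k1 k2 : ℝ → V' P.S} {K1 K2 : H P.S →L[ℝ] H P.S} {w01 w02 : H P.S} {W1 W2 : ℕ → ℝ → H P.S}

section

variable (hA : AnalyticData P F e μ C)
include hA

theorem AnalyticData.exists_rate (hk1 : LocL2 k1) (hk2 : LocL2 k2) (h0 : InV w01)
    (hG : ∀ N, IsGalerkin P e N (affine k1 K1) (affine k2 K2) w01 w02 (W1 N) (W2 N)) {T : ℝ}
    (hT : 0 < T) : ∃ B K : ℝ, 0 ≤ B ∧ 0 ≤ K ∧ (∀ N, PathBound P T B (W1 N) (W2 N)) ∧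
      ∀ N M, N ≤ M → ∀ t ∈ Icc 0 T, normV (projH e N (W1 M t) - W1 N t) ^ 2 +
        ‖projH e N (W2 M t) - W2 N t‖ ^ 2 ≤ (μ N)⁻¹ * K := by
  obtain ⟨B, hB, hpath⟩ := hA.exists_pathBound hk1 hk2 K1 K2 h0 w02 hT
  obtain ⟨K, hK, hstab⟩ := hA.exists_stability k1 k2 K1 K2 w01 w02 hB hT
  have hb := fun N => (hpath N _ _ (hG N)).1
  refine ⟨B, K, hB, hK, hb, fun N M h => ?_⟩
  obtain ⟨p1, p2⟩ := hA.projEq_of_isGalerkin h (hG M) hT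
  exact hstab N _ _ _ _ (hG N) (hb N) (hb M) p1 p2

theorem AnalyticData.abs_inner_sub_le {k N : ℕ} (hk : k < N) {K : ℝ}
    {x1 x2 y1 y2 : H P.S} (hy : y1 ∈ galSpan e N)
    (h : normV (projH e N x1 - y1) ^ 2 + ‖projH e N x2 - y2‖ ^ 2 ≤ (μ N)⁻¹ * K) :
    |⟪y1, e k⟫ - ⟪x1, e k⟫| ≤ √(μ N)⁻¹ * √K ∧ |⟪y2, e k⟫ - ⟪x2, e k⟫| ≤ √(μ N)⁻¹ * √K := by
  have hE := hA.basis
  have key : ∀ x y : H P.S, ‖projH e N x - y‖ ^ 2 ≤ (μ N)⁻¹ * K →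
      |⟪y, e k⟫ - ⟪x, e k⟫| ≤ √(μ N)⁻¹ * √K := fun x y h => by
    have h1 : ⟪x, e k⟫ = ⟪projH e N x, e k⟫ := by rw [hE.inner_projH, if_pos hk]
    rw [abs_sub_comm, h1, ← inner_sub_left, ← sqrt_mul (inv_pos.2 (hE.pos N)).le]
    exact (hE.abs_inner_le _ k).trans (le_sqrt_of_sq_le h)
  refine ⟨key _ _ ?_, key _ _ (by linarith only [h, sq_nonneg (normV (projH e N x1 - y1))])⟩
  have h1 := pow_le_pow_left₀ (norm_nonneg _) (norm_le_normV ((hE.inV_of_mem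
    (hE.projH_mem N x1)).sub (hE.inV_of_mem hy))) 2
  linarith only [h, h1, sq_nonneg ‖projH e N x2 - y2‖]

theorem AnalyticData.exists_pointwise_limit (hk1 : LocL2 k1) (hk2 : LocL2 k2) (h0 : InV w01)
    (hG : ∀ N, IsGalerkin P e N (affine k1 K1) (affine k2 K2) w01 w02 (W1 N) (W2 N)) :
    ∃ w1 w2 : ℝ → H P.S, ∀ t, 0 ≤ t → ∀ k, Tendsto (fun n => ⟪W1 n t, e k⟫) atTop (𝓝 ⟪w1 t, e k⟫) ∧
        Tendsto (fun n => ⟪W2 n t, e k⟫) atTop (𝓝 ⟪w2 t, e k⟫) := by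
  have hE := hA.basis
  have key : ∀ t : ℝ, ∃ y1 y2 : H P.S, 0 ≤ t → ∀ k,
      Tendsto (fun n => ⟪W1 n t, e k⟫) atTop (𝓝 ⟪y1, e k⟫) ∧
        Tendsto (fun n => ⟪W2 n t, e k⟫) atTop (𝓝 ⟪y2, e k⟫) := by
    intro t
    by_cases ht : 0 ≤ t
    · obtain ⟨B, K, hB, hK, hb, hle⟩ := hA.exists_rate hk1 hk2 h0 hG (T := t + 1) (by linarith)
      have htm : t ∈ Icc 0 (t + 1) := ⟨ht, by linarith⟩
      have hrate := hE.tendsto_rate hA.one_le_dim (√K)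
      have cauchy : ∀ (x : ℕ → H P.S) k, (∀ N M, k < N → N ≤ M →
          |⟪x N, e k⟫ - ⟪x M, e k⟫| ≤ √(μ N)⁻¹ * √K) → CauchySeq fun n => ⟪x n, e k⟫ := by
        intro x k hx
        rw [Metric.cauchySeq_iff']
        intro ε hε
        obtain ⟨N, hN, hkN⟩ := ((hrate.eventually (gt_mem_nhds hε)).and
          (eventually_gt_atTop k)).exists
        refine ⟨N, fun M hM => ?_⟩
        rw [dist_comm, dist_eq]
        exact (hx N M hkN hM).trans_lt hN
      have hle' := fun k N M (hk : k < N) (h : N ≤ M) =>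
        hA.abs_inner_sub_le hk ((hG N).1 t ht).1 (hle N M h t htm)
      obtain ⟨y1, hy1⟩ := hE.exists_limit_of_cauchy (fun n => (hb n).norm_le₁ t htm) fun k =>
        cauchy (fun n => W1 n t) k fun N M hk h => (hle' k N M hk h).1
      obtain ⟨y2, hy2⟩ := hE.exists_limit_of_cauchy (fun n => (hb n).norm_le₂ t htm) fun k =>
        cauchy (fun n => W2 n t) k fun N M hk h => (hle' k N M hk h).2
      exact ⟨y1, y2, fun _ k => ⟨hy1 k, hy2 k⟩⟩
    · exact ⟨0, 0, fun h => absurd h ht⟩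
  choose w1 w2 h using key
  exact ⟨w1, w2, h⟩

end

end

theorem tendsto_eLpNorm_zero {α X : Type*} [MeasurableSpace α] {ν : Measure α}
    [NormedAddCommGroup X] {u : ℕ → α → X} {δ : ℕ → ℝ} (hδ : Tendsto δ atTop (𝓝 0)) {g : α → ℝ}
    (hg : MemLp g 2 ν) (h : ∀ n, ∀ᵐ t ∂ν, ‖u n t‖ ≤ δ n * ‖g t‖) :
    Tendsto (fun n => eLpNorm (u n) 2 ν) atTop (𝓝 0) := by
  have hz : Tendsto (fun n => ENNReal.ofReal (δ n) * eLpNorm g 2 ν) atTop (𝓝 0) := by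
    simpa using ENNReal.Tendsto.mul_const (ENNReal.tendsto_ofReal hδ) (Or.inr hg.eLpNorm_ne_top)
  exact tendsto_of_tendsto_of_tendsto_of_le_of_le tendsto_const_nhds hz (fun _ => zero_le)
    fun n => eLpNorm_le_mul_eLpNorm_of_ae_le_mul (h n) 2

variable {k1 k2 : ℝ → V' P.S} {K1 K2 : H P.S →L[ℝ] H P.S} {w01 w02 : H P.S} {W1 W2 : ℕ → ℝ → H P.S}

theorem AnalyticData.pathBound_of_limit (hA : AnalyticData P F e μ C) (hk1 : LocL2 k1)
    (hk2 : LocL2 k2) (h0 : InV w01)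
    (hG : ∀ N, IsGalerkin P e N (affine k1 K1) (affine k2 K2) w01 w02 (W1 N) (W2 N))
    {w1 w2 : ℝ → H P.S} (hw : ∀ t, 0 ≤ t → ∀ k,
      Tendsto (fun n => ⟪W1 n t, e k⟫) atTop (𝓝 ⟪w1 t, e k⟫) ∧
        Tendsto (fun n => ⟪W2 n t, e k⟫) atTop (𝓝 ⟪w2 t, e k⟫)) {T : ℝ} (hT : 0 < T) :
    ∃ B K : ℝ, 0 ≤ B ∧ 0 ≤ K ∧ (∀ N, PathBound P T B (W1 N) (W2 N)) ∧ PathBound P T B w1 w2 ∧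
      (∀ N, ∀ t ∈ Icc 0 T, normV (projH e N (w1 t) - W1 N t) ^ 2 +
        ‖projH e N (w2 t) - W2 N t‖ ^ 2 ≤ (μ N)⁻¹ * K) ∧
      WeakL2 T (fun n t => lift (opA (W1 n t))) (fun t => lift (opA (w1 t))) ∧
      WeakL2 T (fun n t => lift (W2 n t)) (fun t => lift (w2 t)) := by
  have hE := hA.basis
  obtain ⟨B, K, hB, hK, hb, hrate⟩ := hA.exists_rate hk1 hk2 h0 hG hT
  obtain ⟨Q, hQ⟩ := hA.hasUniformBounds hk1 hk2 K1 K2 h0 w02 hG T hT 1 one_pos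
  set R := max Q 0 with hR
  have hR0 : 0 ≤ R := le_max_right _ _
  have hQR : Q ≤ R := le_max_left _ _
  have hm : ∀ n, ∀ t ∈ Icc 0 T, W1 n t ∈ galSpan e n ∧ W2 n t ∈ galSpan e n := fun n t ht =>
    (hG n).1 t ht.1
  have hlim : ∀ t ∈ Icc 0 T, ∀ k, _ := fun t ht => hw t ht.1
  have htotal : ∀ v : V P.S, (∀ k, ⟪v, lift (e k)⟫ = 0) → v = 0 := fun v h =>
    hE.ext_V fun k => by rw [h k, inner_zero_left]
  have hcoef1 : ∀ n k, ∀ t ∈ Icc 0 T, ⟪lift (opA (W1 n t)), lift (e k)⟫ =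
      μ k * (μ k * ⟪W1 n t, e k⟫) := fun n k t ht => by
    have h := hE.inDA32_of_mem (hm n t ht).1
    rw [hE.inner_lift', h.2.incl_lift, hE.inner_opA h.1]
  have hcoef2 : ∀ n k, ∀ t ∈ Icc 0 T, ⟪lift (W2 n t), lift (e k)⟫ = μ k * ⟪W2 n t, e k⟫ :=
    fun n k t ht => by rw [hE.inner_lift', (hE.inV_of_mem (hm n t ht).2).incl_lift]
  have habs : ∀ k (y : ℝ), |μ k * y| = μ k * |y| := fun k y => by
    rw [abs_mul, abs_of_pos (hE.pos k)]
  have hmul : ∀ k {x y : ℝ}, x ≤ y → μ k * x ≤ μ k * y := fun k _ _ h =>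
    mul_le_mul_of_nonneg_left h (hE.pos k).le
  obtain ⟨v1, hv1, hv₁R, hv₁c, -, hweak1⟩ := exists_weakL2_limit_of_tendsto hT hR0 htotal
    (u := fun n t => lift (opA (W1 n t))) (fun n => (hQ n).2.2.1.mono hQR)
    (g := fun k _ => μ k * (μ k * B)) (a := fun k t => μ k * (μ k * ⟪w1 t, e k⟫))
    (fun k => integrableOn_const (by simp))
    (fun k n => by
      filter_upwards [ae_restrict_mem measurableSet_Ioo] with t ht
      rw [hcoef1 n k t (Ioo_subset_Icc_self ht), habs, habs]
      exact hmul k (hmul k ((hE.abs_inner_le _ k).trans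
        ((hb n).norm_le₁ t (Ioo_subset_Icc_self ht)))))
    (fun k => by
      filter_upwards [ae_restrict_mem measurableSet_Ioo] with t ht
      have ht' := Ioo_subset_Icc_self ht
      simp only [hcoef1 _ k t ht']
      exact ((hlim t ht' k).1.const_mul _).const_mul _)
  obtain ⟨v2, hv2, hv₂R, hv₂c, -, hweak2⟩ := exists_weakL2_limit_of_tendsto hT hR0 htotal
    (u := fun n t => lift (W2 n t)) (fun n => (hQ n).1.2.2.mono hQR)
    (g := fun k _ => μ k * B) (a := fun k t => μ k * ⟪w2 t, e k⟫)
    (fun k => integrableOn_const (by simp))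
    (fun k n => by
      filter_upwards [ae_restrict_mem measurableSet_Ioo] with t ht
      rw [hcoef2 n k t (Ioo_subset_Icc_self ht), habs]
      exact hmul k ((hE.abs_inner_le _ k).trans ((hb n).norm_le₂ t (Ioo_subset_Icc_self ht))))
    (fun k => by
      filter_upwards [ae_restrict_mem measurableSet_Ioo] with t ht
      have ht' := Ioo_subset_Icc_self ht
      simp only [hcoef2 _ k t ht']
      exact (hlim t ht' k).2.const_mul _)
  have hV : ∀ t ∈ Icc 0 T, InV (w1 t) ∧ normV (w1 t) ≤ B := fun t ht =>
    hE.inV_of_tendsto (fun n => (hb n).inV t ht) (fun n => (hb n).normV_le t ht) fun k =>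
      (hlim t ht k).1
  have hw1 : ∀ᵐ t ∂vol(T), InDA32 (w1 t) ∧ v1 t = lift (opA (w1 t)) := by
    filter_upwards [ae_restrict_mem measurableSet_Ioo, hv₁c] with t ht h
    have h1 : IsA (w1 t) (incl (v1 t)) := hE.isA_of_inner (hV t (Ioo_subset_Icc_self ht)).1
      fun k => by
        have := h k
        rw [hE.inner_lift'] at this
        exact mul_left_cancel₀ (hE.pos k).ne' this
    have h2 := h1.opA_eq
    exact ⟨⟨h1.inDA, v1 t, h2.symm⟩, (InV.lift_eq h2.symm).symm⟩
  have hw2 : ∀ᵐ t ∂vol(T), InV (w2 t) ∧ v2 t = lift (w2 t) := by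
    filter_upwards [hv₂c] with t h
    have h1 : incl (v2 t) = w2 t := hE.ext fun k => by
      have := h k
      rw [hE.inner_lift'] at this
      exact mul_left_cancel₀ (hE.pos k).ne' this
    exact ⟨⟨v2 t, h1⟩, (InV.lift_eq h1).symm⟩
  have hv₁w : v1 =ᵐ[vol(T)] fun t => lift (opA (w1 t)) := hw1.mono fun t h => h.2
  have hv₂w : v2 =ᵐ[vol(T)] fun t => lift (w2 t) := hw2.mono fun t h => h.2
  have hint : ∀ {v v' : ℝ → V P.S}, v =ᵐ[vol(T)] v' →
      ∫ t in 0..T, ‖v t‖ ^ 2 = ∫ t in 0..T, ‖v' t‖ ^ 2 := fun h => by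
    rw [integral_of_le hT.le, integral_of_le hT.le,
      integral_Ioc_eq_integral_Ioo, integral_Ioc_eq_integral_Ioo]
    exact integral_congr_ae (h.mono fun t ht => by simp only [ht])
  have hbw : PathBound P T (B + R ^ 2) w1 w2 := by
    have hBR : B ≤ B + R ^ 2 := le_add_of_nonneg_right (sq_nonneg R)
    have hRB : R ^ 2 ≤ B + R ^ 2 := le_add_of_nonneg_left hB
    refine ⟨fun t ht => (hE.norm_le_of_tendsto (fun n => (hb n).norm_le₁ t ht) fun k =>
      (hlim t ht k).1).trans hBR, fun t ht => (hE.norm_le_of_tendsto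
      (fun n => (hb n).norm_le₂ t ht) fun k => (hlim t ht k).2).trans hBR, fun t ht => (hV t ht).1,
      fun t ht => (hV t ht).2.trans hBR, hw1.mono fun t h => h.1, hw2.mono fun t h => h.1,
      (memLp_congr_ae hv₁w).1 hv1, (memLp_congr_ae hv₂w).1 hv2, ?_, ?_⟩
    · rw [← hint hv₁w]; exact hv₁R.trans hRB
    · simp only [normV]
      rw [← hint hv₂w]; exact hv₂R.trans hRB
  refine ⟨B + R ^ 2, K, by positivity, hK, fun N => (hb N).mono (le_add_of_nonneg_right
    (sq_nonneg R)), hbw, ?_, hweak1.congr_right hv₁w, hweak2.congr_right hv₂w⟩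
  intro N t ht
  have hl : ∀ y, normV (projH e N y - W1 N t) = ‖lift (projH e N y) - lift (W1 N t)‖ := fun y => by
    rw [normV, (hE.inV_of_mem (hE.projH_mem N y)).lift_sub ((hb N).inV t ht)]
  have t1 := (hE.tendsto_projH (fun k => (hlim t ht k).1) N).2
  have t2 := (hE.tendsto_projH (fun k => (hlim t ht k).2) N).1
  rw [hl]
  refine le_of_tendsto (((t1.sub_const _).norm.pow 2).add ((t2.sub_const _).norm.pow 2)) ?_
  filter_upwards [eventually_ge_atTop N] with M hM
  rw [← hl]
  exact hrate N M hM t ht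

theorem AnalyticData.isPath_of_limit (hA : AnalyticData P F e μ C) (hk1 : LocL2 k1)
    (hk2 : LocL2 k2) (h0 : InV w01)
    (hG : ∀ N, IsGalerkin P e N (affine k1 K1) (affine k2 K2) w01 w02 (W1 N) (W2 N))
    {w1 w2 : ℝ → H P.S} (hw : ∀ t, 0 ≤ t → ∀ k,
      Tendsto (fun n => ⟪W1 n t, e k⟫) atTop (𝓝 ⟪w1 t, e k⟫) ∧
        Tendsto (fun n => ⟪W2 n t, e k⟫) atTop (𝓝 ⟪w2 t, e k⟫)) {T : ℝ} (hT : 0 < T) :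
    (∃ B, IsPath P e k1 k2 K1 K2 w01 w02 T B w1 w2) ∧
    MemLp (fun s => full₁ P (affine k1 K1 s (w1 s)) (w1 s) (w2 s)) 2 vol(T) ∧
    MemLp (fun s => full₂ P (affine k2 K2 s (w2 s)) (w1 s) (w2 s)) 2 vol(T) ∧
    WeakL2 T (fun n t => lift (opA (W1 n t))) (fun t => lift (opA (w1 t))) ∧
    WeakL2 T (fun n t => lift (W2 n t)) (fun t => lift (w2 t)) ∧
    WeakL2 T (fun n t => pivot (galRHS₁ P e n (affine k1 K1) (W1 n) (W2 n) t))
      (fun s => full₁ P (affine k1 K1 s (w1 s)) (w1 s) (w2 s)) ∧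
    WeakL2 T (fun n t => pivot (galRHS₂ P e n (affine k2 K2) (W1 n) (W2 n) t))
      (fun s => full₂ P (affine k2 K2 s (w2 s)) (w1 s) (w2 s)) ∧
    Tendsto (fun n => eLpNorm (fun t => lift (W1 n t) - lift (w1 t)) 2
      vol(T)) atTop (𝓝 0) := by
  have hE := hA.basis
  obtain ⟨B, K, hB, hK, hb, hbw, hrate', hweak1, hweak2⟩ :=
    hA.pathBound_of_limit hk1 hk2 h0 hG hw hT
  obtain ⟨Q, hQ⟩ := hA.hasUniformBounds hk1 hk2 K1 K2 h0 w02 hG T hT 1 one_pos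
  have hR0 : 0 ≤ max Q 0 := le_max_right _ _
  have hQR : Q ≤ max Q 0 := le_max_left _ _
  have hm : ∀ n, ∀ t ∈ Icc 0 T, W1 n t ∈ galSpan e n ∧ W2 n t ∈ galSpan e n := fun n t ht =>
    (hG n).1 t ht.1
  have hae : ∀ᵐ t ∂vol(T), t ∈ Icc 0 T ∧ InDA32 (w1 t) ∧ InV (w2 t) ∧
      ∀ N, normV (W1 N t - w1 t) ≤ √(μ N)⁻¹ * (√K + normDA (w1 t)) ∧
        ‖W2 N t - w2 t‖ ≤ √(μ N)⁻¹ * (√K + normV (w2 t)) ∧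
        normDA (W1 N t) ≤ √K + normDA (w1 t) := by
    filter_upwards [ae_restrict_mem measurableSet_Ioo, hbw.inDA32, hbw.inV2] with t ht h1 h2
    have ht' := Ioo_subset_Icc_self ht
    exact ⟨ht', h1, h2, fun N => hA.rate_le hK h1.1 h2 (hm N t ht').1 (hrate' N t ht')⟩
  have hX : 1 ≤ 1 + √K := le_add_of_nonneg_right (sqrt_nonneg K)
  choose c hc hcle using fun k => hA.exists_full_sub_le k1 k2 K1 K2 hB hX k
  obtain ⟨i1, i2⟩ := hbw.integrableOn
  have hg : ∀ k, IntegrableOn (fun t => c k * (1 + ‖lift (opA (w1 t))‖ ^ 2 + normV (w2 t) ^ 2))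
      (Ioo 0 T) := fun k => (((integrableOn_const (by simp)).add i1).add i2).const_mul _
  have hfull : ∀ᵐ t ∂vol(T), ∀ k n,
      |full₁ P (affine k1 K1 t (W1 n t)) (W1 n t) (W2 n t) (lift (e k)) -
        full₁ P (affine k1 K1 t (w1 t)) (w1 t) (w2 t) (lift (e k))| ≤
        √(μ n)⁻¹ * (c k * (1 + ‖lift (opA (w1 t))‖ ^ 2 + normV (w2 t) ^ 2)) ∧
      |full₂ P (affine k2 K2 t (W2 n t)) (W1 n t) (W2 n t) (lift (e k)) -
        full₂ P (affine k2 K2 t (w2 t)) (w1 t) (w2 t) (lift (e k))| ≤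
        √(μ n)⁻¹ * (c k * (1 + ‖lift (opA (w1 t))‖ ^ 2 + normV (w2 t) ^ 2)) := by
    filter_upwards [hae] with t ⟨ht, h1, h2, h⟩ k n
    have hx : ∀ {x : ℝ}, 0 ≤ x → √K + x ≤ (1 + √K) * (1 + x) := fun {x} hx => by
      linarith only [hx, mul_nonneg (sqrt_nonneg K) hx]
    have hD := h1.normDA_le
    have hδ := sqrt_nonneg (μ n)⁻¹
    have hxD : √K + normDA (w1 t) ≤ (1 + √K) * (1 + ‖lift (opA (w1 t))‖) :=
      (add_le_add le_rfl hD).trans (hx (norm_nonneg _))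
    obtain ⟨a, b, c⟩ := h n
    exact hcle k t (√(μ n)⁻¹) ‖lift (opA (w1 t))‖ (normV (w2 t)) (w1 t) (w2 t) (W1 n t) (W2 n t)
      hδ (norm_nonneg _) (normV_nonneg _) h1 (hE.inDA32_of_mem (hm n t ht).1) h2
      (hE.inV_of_mem (hm n t ht).2) (hbw.normV_le t ht) ((hb n).normV_le t ht)
      (a.trans (mul_le_mul_of_nonneg_left hxD hδ))
      (b.trans (mul_le_mul_of_nonneg_left (hx (normV_nonneg _)) hδ))
      ((le_add_of_nonneg_left (sqrt_nonneg K)).trans hxD) (c.trans hxD)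
  obtain ⟨m1, wk1, e1⟩ := hE.weakL2_of_rate hA.one_le_dim hT hR0
    (R := fun n => galRHS₁ P e n (affine k1 K1) (W1 n) (W2 n))
    (fun n => ((hG n).2.1 T hT).1) (fun n => (hQ n).2.2.2.1.mono hQR)
    (fun n t ht => hA.galRHS₁_eq (hm n t ht).1 (hm n t ht).2 _) hg
    (hfull.mono fun t h k n => (h k n).1) (fun s hs k => (hw s hs.1 k).1)
    (fun n s hs => ((hG n).2.2 s hs.1).1)
  obtain ⟨m2, wk2, e2⟩ := hE.weakL2_of_rate hA.one_le_dim hT hR0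
    (R := fun n => galRHS₂ P e n (affine k2 K2) (W1 n) (W2 n))
    (fun n => ((hG n).2.1 T hT).2) (fun n => (hQ n).2.2.2.2.mono hQR)
    (fun n t ht => hA.galRHS₂_eq (hm n t ht).1 (hm n t ht).2 _) hg
    (hfull.mono fun t h k n => (h k n).2) (fun s hs k => (hw s hs.1 k).2)
    (fun n s hs => ((hG n).2.2 s hs.1).2)
  refine ⟨⟨B, hB, hbw, hE.projEq_of_inner (m1.integrable one_le_two) e1,
    hE.projEq_of_inner (m2.integrable one_le_two) e2⟩, m1, m2, hweak1, hweak2, wk1, wk2, ?_⟩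
  have hmem : MemLp (fun t => √K + ‖lift (opA (w1 t))‖) 2 vol(T) :=
    MemLp.add (f := fun _ => √K) (g := fun t => ‖lift (opA (w1 t))‖) (memLp_const √K)
      hbw.memLp1.norm
  refine tendsto_eLpNorm_zero (δ := fun n => √(μ n)⁻¹)
    (by simpa using hE.tendsto_rate hA.one_le_dim 1) hmem fun n => ?_
  filter_upwards [hae] with t h
  obtain ⟨ht, h1, -, h⟩ := h
  rw [← ((hb n).inV t ht).lift_sub (hbw.inV t ht), norm_of_nonneg (by positivity)]
  exact (h n).1.trans (mul_le_mul_of_nonneg_left (add_le_add le_rfl h1.normDA_le) (sqrt_nonneg _))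

theorem integral_deriv_mul_primitive {g r ψ : ℝ → ℝ} {T : ℝ} (hT : 0 ≤ T)
    (hr : IntegrableOn r (Ioo 0 T)) (hg : ∀ t ∈ Icc 0 T, g t = g 0 + ∫ s in 0..t, r s)
    (hψ : ContDiff ℝ ∞ ψ) (hs : tsupport ψ ⊆ Ioo 0 T) :
    ∫ t in 0..T, deriv ψ t * g t = -∫ t in 0..T, ψ t * r t := by
  have hψ' : Continuous (deriv ψ) := hψ.continuous_deriv (by simp)
  have hz : ∀ t ∉ Ioo 0 T, ψ t = 0 := fun t ht => image_eq_zero_of_notMem_tsupport fun h => ht (hs h)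
  have hT' : T ∈ Icc 0 T := ⟨hT, le_rfl⟩
  have hid : ∀ a b, ∫ s in a..b, deriv ψ s = ψ b - ψ a := fun a b =>
    intervalIntegral.integral_deriv_eq_sub (fun x _ => hψ.differentiable (by simp) x)
      (hψ'.intervalIntegrable _ _)
  have hp : IntegrableOn (fun t => (deriv ψ t, r t)) (Ioo 0 T) :=
    Integrable.prodMk (hψ'.integrableOn_Icc.mono_set Ioo_subset_Icc_self) hr
  obtain ⟨-, h⟩ := integral_chain_rule (Ψ := fun x : ℝ × ℝ => x.1 * x.2) (T := T)
    (fun x => hasFDerivAt_fst.mul hasFDerivAt_snd) (by fun_prop) (R := fun t => (deriv ψ t, r t))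
    (w := fun t => (ψ t, g t)) hp (fun t ht => by
      have i := intervalIntegrable_of_mem hp ht
      ext
      · have := (ContinuousLinearMap.fst ℝ ℝ ℝ).intervalIntegral_comp_comm i
        simp only [coe_fst'] at this
        simp [← this, hid]
      · have := (ContinuousLinearMap.snd ℝ ℝ ℝ).intervalIntegral_comp_comm i
        simp only [coe_snd'] at this
        simp [← this, hg t ht]) hT'
  have hgc : ContinuousOn g (Icc 0 T) := continuousOn_of_eq_integral hr hg
  have i1 : IntervalIntegrable (fun t => deriv ψ t * g t) volume 0 T :=
    (hψ'.continuousOn.mul (by rwa [uIcc_of_le hT])).intervalIntegrable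
  have i2 : IntervalIntegrable (fun t => ψ t * r t) volume 0 T :=
    (intervalIntegrable_of_mem hr hT').continuousOn_mul hψ.continuous.continuousOn
  simp only [hz T (by simp), hz 0 (by simp), zero_mul, zero_add, add_apply,
    smul_apply, coe_fst', coe_snd', smul_eq_mul] at h
  rw [intervalIntegral.integral_add i2 (by simpa only [mul_comm] using i1)] at h
  simp only [mul_comm (g _)] at h
  linarith only [h]

theorem setIntegral_Ioi_eq {φ ψ : ℝ → ℝ} {T : ℝ} (hT : 0 ≤ T) (hs : tsupport ψ ⊆ Ioo 0 T)
    (h : ∀ x ∉ tsupport ψ, φ x = 0) : ∫ t in Ioi (0 : ℝ), φ t = ∫ t in 0..T, φ t := by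
  rw [integral_of_le hT, integral_Ioc_eq_integral_Ioo]
  exact setIntegral_eq_of_subset_of_forall_diff_eq_zero measurableSet_Ioi Ioo_subset_Ioi_self
    fun x hx => h x fun h => hx.2 (hs h)

section

variable {d : ℕ} {S : Setting d} [hS : Fact S.IsAdmissible] {e : ℕ → H S} {μ : ℕ → ℝ}

section

variable (hE : IsEigenbasis S e μ)
include hE

theorem IsEigenbasis.inner_incl_eq {T : ℝ}
    {w0 : H S} {w : ℝ → H S} {ξ : ℝ → V' S} (hξ : IntegrableOn ξ (Ioo 0 T))
    (h : ∀ N, ProjEq e N T w0 w ξ) {t : ℝ} (ht : t ∈ Icc 0 T) (z : V S) :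
    ⟪w t, incl z⟫ = ⟪w0, incl z⟫ + ∫ s in 0..t, ξ s z := by
  have hi := intervalIntegrable_of_mem hξ ht
  have h1 : pivot (w t) = pivot w0 + ∫ s in 0..t, ξ s := hE.ext_dual fun k => by
    have h2 := congrArg (fun u => ⟪u, e k⟫) ((h (k + 1)).2 t ht)
    simp only [inner_add_left, inner_intervalIntegral (intervalIntegrable_of_mem (h (k + 1)).1 ht),
      hE.inner_projH, hE.inner_galProj, if_pos k.lt_succ_self] at h2
    rw [add_apply, pivot_apply, pivot_apply, hE.incl_lift, h2,
      ContinuousLinearMap.intervalIntegral_apply hi]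
  rw [← pivot_apply, h1, add_apply, pivot_apply, ContinuousLinearMap.intervalIntegral_apply hi]

theorem IsEigenbasis.hasTimeDeriv {w0 : H S}
    {w : ℝ → H S} {ξ : ℝ → V' S} (hξ : LocL2 ξ) (h : ∀ T, 0 < T → ∀ N, ProjEq e N T w0 w ξ) :
    HasTimeDeriv w ξ := by
  intro ψ hψ hc hs z
  obtain ⟨T, hT0, hT⟩ : ∃ T : ℝ, 0 < T ∧ tsupport ψ ⊆ Ioo 0 T := by
    obtain ⟨T, hT⟩ := hc.isCompact.bddAbove
    exact ⟨max T 0 + 1, by positivity, fun x hx => ⟨hs hx, by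
      linarith only [hT hx, le_max_left T 0]⟩⟩
  have hT0' := hT0.le
  have hd : ∀ x ∉ tsupport ψ, deriv ψ x = 0 := fun x hx =>
    image_eq_zero_of_notMem_tsupport fun h => hx (tsupport_deriv_subset h)
  have hξT := hξ.integrableOn hT0
  have h0 := hE.inner_incl_eq hξT (h T hT0) (left_mem_Icc.2 hT0') z
  rw [integral_same, add_zero] at h0
  rw [setIntegral_Ioi_eq hT0' hT fun x hx => by rw [hd x hx, zero_mul],
    setIntegral_Ioi_eq hT0' hT fun x hx => by rw [image_eq_zero_of_notMem_tsupport hx, zero_mul]]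
  exact integral_deriv_mul_primitive (g := fun t => ⟪w t, incl z⟫) hT0'
    ((ContinuousLinearMap.apply ℝ ℝ z).integrable_comp hξT)
    (fun t ht => by rw [h0]; exact hE.inner_incl_eq hξT (h T hT0) ht z) hψ hT

/-- The continuous representative of a path with a time derivative in `V'`. -/
theorem IsEigenbasis.projEq_of_hasTimeDeriv {w c : ℝ → H S}
    {ξ : ℝ → V' S} (hξ : LocL2 ξ) (hw : HasTimeDeriv w ξ) (hc : ContinuousOn c (Ici 0))
    (hcw : c =ᵐ[volume.restrict (Ioi (0 : ℝ))] w) {T : ℝ} (hT : 0 < T) (N : ℕ) :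
    ProjEq e N T (c 0) c ξ := by
  refine hE.projEq_of_inner (hξ.integrableOn hT) (fun t ht k => ?_) N
  set z := lift (e k) with hz
  have hr : IntegrableOn (fun s => ξ s z) (Ioo 0 T) :=
    (ContinuousLinearMap.apply ℝ ℝ z).integrable_comp (hξ.integrableOn hT)
  have hT' := hT.le
  set I : ℝ → ℝ := fun t => ∫ s in 0..t, ξ s z with hI
  have hI0 : I 0 = 0 := integral_same
  have hIe : ∀ t ∈ Icc 0 T, I t = I 0 + ∫ s in 0..t, ξ s z := fun t _ => by rw [hI0, zero_add]
  have hIc : ContinuousOn I (Icc 0 T) := continuousOn_of_eq_integral hr hIe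
  have hgc : ContinuousOn (fun t => ⟪c t, e k⟫) (Icc 0 T) :=
    (hc.mono fun t ht => ht.1).inner continuousOn_const
  have hvc : ContinuousOn (fun t => ⟪c t, e k⟫ - I t) (Icc 0 T) := hgc.sub hIc
  obtain ⟨b, hb⟩ := exists_ae_eq_const (α := 0) (β := T)
    (v := (Ioo 0 T).indicator fun t => ⟪c t, e k⟫ - I t)
    ((integrable_indicator_iff measurableSet_Ioo).2
      (hvc.integrableOn_Icc.mono_set Ioo_subset_Icc_self)).locallyIntegrable fun η h1 h2 h3 => by
    have hη : ∀ x ∉ tsupport η, deriv η x = 0 := fun x hx =>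
      image_eq_zero_of_notMem_tsupport fun h => hx (tsupport_deriv_subset h)
    have hcont : Continuous (deriv η) := h1.continuous_deriv (by simp)
    have e1 := hw η h1 h2 (h3.trans Ioo_subset_Ioi_self) z
    have e0 : ∫ t in Ioi (0 : ℝ), deriv η t * ⟪c t, e k⟫ =
        ∫ t in Ioi (0 : ℝ), deriv η t * ⟪w t, incl z⟫ := integral_congr_ae (by
      filter_upwards [hcw] with t ht
      rw [ht, hz, hE.incl_lift])
    rw [← e0, setIntegral_Ioi_eq hT' h3 fun x hx => by rw [hη x hx, zero_mul],
      setIntegral_Ioi_eq hT' h3 fun x hx => by rw [image_eq_zero_of_notMem_tsupport hx, zero_mul]]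
      at e1
    have e2 := integral_deriv_mul_primitive hT' hr hIe h1 h3
    have e3 : ∀ x, (Ioo 0 T).indicator (fun t => ⟪c t, e k⟫ - I t) x * deriv η x =
        (Ioo 0 T).indicator (fun t => deriv η t * ⟪c t, e k⟫ - deriv η t * I t) x := fun x => by
      by_cases hx : x ∈ Ioo 0 T
      · rw [indicator_of_mem hx, indicator_of_mem hx]; ring
      · rw [indicator_of_notMem hx, indicator_of_notMem hx, zero_mul]
    have hi : ∀ {φ : ℝ → ℝ}, ContinuousOn φ (Icc 0 T) →
        IntervalIntegrable (fun t => deriv η t * φ t) volume 0 T := fun h =>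
      (hcont.continuousOn.mul (by rwa [uIcc_of_le hT'])).intervalIntegrable
    simp only [e3]
    rw [integral_indicator measurableSet_Ioo, ← integral_Ioc_eq_integral_Ioo,
      ← integral_of_le hT', intervalIntegral.integral_sub (hi hgc) (hi hIc), e1, e2, sub_self]
  have hae : (fun t => ⟪c t, e k⟫ - I t) =ᵐ[volume.restrict (Icc 0 T)] fun _ => b := by
    rw [← Measure.restrict_congr_set Ioo_ae_eq_Icc]
    filter_upwards [hb, ae_restrict_mem measurableSet_Ioo] with t h1 h2
    rwa [indicator_of_mem h2] at h1
  have heq := Measure.eqOn_Icc_of_ae_eq volume hT.ne hae hvc continuousOn_const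
  have h1 := heq ht
  have h2 := heq (left_mem_Icc.2 hT')
  simp only [hI0, sub_zero] at h1 h2
  linarith only [h1, h2]

end

end

section

variable {d : ℕ} {S : Setting d} [hS : Fact S.IsAdmissible] {e : ℕ → H S} {μ : ℕ → ℝ}

section

variable (hE : IsEigenbasis S e μ)
include hE

theorem IsEigenbasis.tendsto_projH_self (u : H S) : Tendsto (fun N => projH e N u) atTop (𝓝 u) := by
  refine (hE.basis.hasSum_repr u).tendsto_sum_nat.congr fun N => ?_
  rw [projH_apply]
  simp only [hE.basis.repr_apply_apply, hE.basis_apply]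

theorem IsEigenbasis.tendsto_projV (v : V S) : Tendsto (fun N => projV e N v) atTop (𝓝 v) := by
  refine ((hE.basisV).hasSum_repr v).tendsto_sum_nat.congr fun N => ?_
  rw [projV_apply]
  refine Finset.sum_congr rfl fun k _ => ?_
  rw [(hE.basisV).repr_apply_apply, hE.basisV_apply, real_inner_smul_left, hE.inner_lift, smul_smul]
  congr 1
  have h1 := hE.pos k
  have h2 := sqrt_pos.2 h1
  field_simp
  rw [sq_sqrt h1.le]

theorem IsEigenbasis.norm_sq_projH_sub {N M : ℕ} (h : N ≤ M) (u : H S) :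
    ‖projH e M u - projH e N u‖ ^ 2 = ‖projH e M u‖ ^ 2 - ‖projH e N u‖ ^ 2 := by
  refine (hE.hasSum_sq _).unique (((hE.hasSum_sq _).sub (hE.hasSum_sq _)).congr_fun fun k => ?_)
  rw [inner_sub_left, hE.inner_projH, hE.inner_projH]
  split_ifs <;> first | omega | ring

/-- A path with a derivative in `L²(V')` is uniformly approximated by its projections in `H`. -/
theorem IsEigenbasis.exists_tail {T : ℝ}
    (hT : 0 < T) {w0 : H S} {w : ℝ → H S} {ξ : ℝ → V' S} (h : ∀ N, ProjEq e N T w0 w ξ)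
    (hξ : MemLp ξ 2 vol(T))
    (hV : ∀ᵐ t ∂vol(T), InV (w t))
    (hw : MemLp (fun t => lift (w t)) 2 vol(T)) :
    ∃ ε : ℕ → ℝ, Tendsto ε atTop (𝓝 0) ∧ ∀ N, ∀ t ∈ Icc 0 T, ‖w t - projH e N (w t)‖ ^ 2 ≤ ε N := by
  set G : ℕ → ℝ → ℝ := fun N s => 2 * (‖ξ s‖ * ‖lift (w s) - projV e N (lift (w s))‖) with hG
  have hmeas : ∀ N, MemLp (fun s => lift (w s) - projV e N (lift (w s))) 2
      vol(T) := fun N => hw.sub ((projV e N).comp_memLp' hw)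
  have hGi : ∀ N, IntegrableOn (G N) (Ioo 0 T) := fun N =>
    (MemLp.integrable_mul hξ.norm (hmeas N).norm).const_mul 2
  have hlim : Tendsto (fun N => ∫ s in Ioo 0 T, G N s) atTop (𝓝 0) := by
    have h0 := tendsto_integral_of_dominated_convergence (f := fun _ => (0 : ℝ))
      (fun s => 2 * (‖ξ s‖ * (2 * ‖lift (w s)‖))) (fun N => (hGi N).1)
      ((MemLp.integrable_mul hξ.norm (hw.norm.const_mul 2)).const_mul 2)
      (fun N => .of_forall fun s => by
        rw [norm_of_nonneg (by positivity)]
        refine mul_le_mul_of_nonneg_left (mul_le_mul_of_nonneg_left ?_ (norm_nonneg _)) zero_le_two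
        rw [two_mul]
        exact (norm_sub_le _ _).trans (add_le_add le_rfl (hE.norm_projV_le N _)))
      (.of_forall fun s => by
        have := ((tendsto_const_nhds (x := lift (w s))).sub (hE.tendsto_projV (lift (w s)))).norm
        simpa using (this.const_mul ‖ξ s‖).const_mul 2)
    simpa using h0
  have hlim0 : Tendsto (fun N => ‖w0 - projH e N w0‖ ^ 2) atTop (𝓝 0) := by
    simpa using (((tendsto_const_nhds (x := w0)).sub (hE.tendsto_projH_self w0)).norm.pow 2)
  refine ⟨fun N => ‖w0 - projH e N w0‖ ^ 2 + ∫ s in Ioo 0 T, G N s, by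
    simpa using hlim0.add hlim, fun N t ht => ?_⟩
  refine le_of_tendsto_of_tendsto
    (((hE.tendsto_projH_self (w t)).sub_const (projH e N (w t))).norm.pow 2)
    ((((hE.tendsto_projH_self w0).sub_const (projH e N w0)).norm.pow 2).add_const _) ?_
  filter_upwards [eventually_ge_atTop N] with M hM
  obtain ⟨iM, eM⟩ := ((hE.norm_sq_chain (h M) hT.le).2 t ht).1
  obtain ⟨iN, eN⟩ := ((hE.norm_sq_chain (h N) hT.le).2 t ht).1
  rw [hE.norm_sq_projH_sub hM, hE.norm_sq_projH_sub hM, eM, eN, add_sub_add_comm,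
    ← intervalIntegral.integral_sub iM iN]
  refine add_le_add le_rfl ?_
  rw [← integral_Ioc_eq_integral_Ioo, ← integral_of_le hT.le]
  refine integral_le_integral_of_mem ht (iM.sub iN) (hGi N) (fun s => by positivity) ?_
  filter_upwards [hV] with s hs
  rw [hE.lift_projH hs, hE.lift_projH hs, ← mul_sub, ← map_sub]
  have e1 : projV e M (lift (w s)) - projV e N (lift (w s)) =
      projV e M (lift (w s) - projV e N (lift (w s))) := by
    rw [map_sub]
    refine congrArg _ (incl_injective (hE.ext fun k => ?_))
    simp only [hE.incl_projV, hE.inner_projH]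
    split_ifs <;> first | rfl | omega
  rw [e1]
  exact mul_le_mul_of_nonneg_left ((le_abs_self _).trans (((ξ s).le_opNorm _).trans
    (mul_le_mul_of_nonneg_left (hE.norm_projV_le M _) (norm_nonneg _)))) zero_le_two

theorem IsEigenbasis.continuousOn_of_tail {T : ℝ}
    (hT : 0 < T) {w0 : H S} {w : ℝ → H S} {ξ : ℝ → V' S} (h : ∀ N, ProjEq e N T w0 w ξ) {ε : ℕ → ℝ}
    (hε : Tendsto ε atTop (𝓝 0))
    (hle : ∀ N, ∀ t ∈ Icc 0 T, ‖w t - projH e N (w t)‖ ^ 2 ≤ ε N) : ContinuousOn w (Icc 0 T) := by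
  refine TendstoUniformlyOn.continuousOn (F := fun N t => projH e N (w t)) (p := atTop) ?_
    (Frequently.of_forall fun N => (hE.norm_sq_chain (h N) hT.le).1)
  rw [Metric.tendstoUniformlyOn_iff]
  intro δ hδ
  filter_upwards [hε.eventually (gt_mem_nhds (pow_pos hδ 2))] with N hN t ht
  rw [dist_eq_norm]
  exact lt_of_pow_lt_pow_left₀ 2 hδ.le ((hle N t ht).trans_lt hN)

end

theorem ProjEq.congr {N : ℕ} {T : ℝ} {w0 : H S} {w : ℝ → H S} {ξ ζ : ℝ → V' S}
    (h : ProjEq e N T w0 w ξ) (hξ : ∀ᵐ t ∂vol(T), ξ t = ζ t) : ProjEq e N T w0 w ζ := by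
  have h1 : ∀ᵐ t ∂vol(T), galProj e N (ξ t) = galProj e N (ζ t) := hξ.mono fun t h => by rw [h]
  refine ⟨h.1.congr h1, fun t ht => ?_⟩
  rw [h.2 t ht, integral_of_le ht.1, integral_of_le ht.1,
    integral_Ioc_eq_integral_Ioo, integral_Ioc_eq_integral_Ioo, integral_congr_ae
    (ae_restrict_of_ae_restrict_of_subset (Ioo_subset_Ioo_right ht.2) h1)]

/-- The bound in `V` of a path with a derivative in `L²(V')`. -/
theorem IsEigenbasis.exists_normV_le (hE : IsEigenbasis S e μ) {T : ℝ}
    (hT : 0 < T) {w0 : H S} {w : ℝ → H S} {ξ : ℝ → V' S} (h0 : InV w0)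
    (h : ∀ N, ProjEq e N T w0 w ξ) (hξ : MemLp ξ 2 vol(T))
    (hD : ∀ᵐ t ∂vol(T), InDA32 (w t))
    (hw : MemLp (fun t => lift (opA (w t))) 2 vol(T)) :
    ∃ B : ℝ, 0 ≤ B ∧ ∀ t ∈ Icc 0 T, InV (w t) ∧ normV (w t) ≤ B := by
  set G : ℝ → ℝ := fun s => 2 * (‖ξ s‖ * ‖lift (opA (w s))‖) with hG
  have hGi : IntegrableOn G (Ioo 0 T) := (MemLp.integrable_mul hξ.norm hw.norm).const_mul 2
  refine ⟨√(normV w0 ^ 2 + ∫ s in 0..T, G s), sqrt_nonneg _, fun t ht =>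
    hE.inV_of_tendsto (x := fun N => projH e N (w t)) (fun N => hE.inV_of_mem
      (hE.projH_mem N _)) (fun N => le_sqrt_of_sq_le ?_)
      fun k => (hE.tendsto_projH_self (w t)).inner tendsto_const_nhds⟩
  obtain ⟨iN, eN⟩ := ((hE.norm_sq_chain (h N) hT.le).2 t ht).2
  rw [eN]
  refine add_le_add (pow_le_pow_left₀ (normV_nonneg _) ?_ 2) ?_
  · rw [normV, hE.lift_projH h0]; exact hE.norm_projV_le N _
  · refine integral_le_integral_of_mem ht iN hGi (fun s => by positivity) ?_
    filter_upwards [hD] with s hs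
    rw [hE.opA_projH hs.1, hE.lift_projH hs.2]
    exact mul_le_mul_of_nonneg_left ((le_abs_self _).trans (((ξ s).le_opNorm _).trans
      (mul_le_mul_of_nonneg_left (hE.norm_projV_le N _) (norm_nonneg _)))) zero_le_two

end

theorem ae_Ioi_of_ae_Ioo {p : ℝ → Prop} (h : ∀ T, 0 < T → ∀ᵐ t ∂vol(T), p t) :
    ∀ᵐ t ∂volume.restrict (Ioi (0 : ℝ)), p t := by
  rw [ae_restrict_iff' measurableSet_Ioi]
  filter_upwards [ae_all_iff.2 fun n : ℕ => (ae_restrict_iff' measurableSet_Ioo).1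
    (h (n + 1) n.cast_add_one_pos)] with t ht h0
  obtain ⟨n, hn⟩ := exists_nat_gt t
  exact ht n ⟨h0, hn.trans (lt_add_one _)⟩

theorem ae_Ioo_of_ae_Ioi {p : ℝ → Prop} (h : ∀ᵐ t ∂volume.restrict (Ioi (0 : ℝ)), p t) {T : ℝ} :
    ∀ᵐ t ∂vol(T), p t := ae_restrict_of_ae_restrict_of_subset Ioo_subset_Ioi_self h

theorem continuousOn_Ici_of_Icc {X : Type*} [TopologicalSpace X] {w : ℝ → X}
    (h : ∀ T, 0 < T → ContinuousOn w (Icc 0 T)) : ContinuousOn w (Ici 0) := fun t ht =>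
  (h (t + 1) (add_pos_of_nonneg_of_pos ht one_pos) t ⟨ht, (lt_add_one t).le⟩).mono_of_mem_nhdsWithin
    (mem_nhdsWithin.2 ⟨Iio (t + 1), isOpen_Iio, lt_add_one t, fun _ hx => ⟨hx.2, hx.1.le⟩⟩)

section

variable (hA : AnalyticData P F e μ C)
include hA

theorem AnalyticData.exists_isPath_of_isSolutionW (h0 : InV w01)
    {w1 w2 : ℝ → H P.S} (h : IsSolutionW P (affine k1 K1) (affine k2 K2) w01 w02 w1 w2) :
    ∃ c1 c2 : ℝ → H P.S, c1 =ᵐ[volume.restrict (Ioi (0 : ℝ))] w1 ∧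
      c2 =ᵐ[volume.restrict (Ioi (0 : ℝ))] w2 ∧
      ∀ T, 0 < T → ∃ B, IsPath P e k1 k2 K1 K2 w01 w02 T B c1 c2 := by
  have hE := hA.basis
  obtain ⟨ξ1, ξ2, ⟨⟨d1, l1⟩, ⟨d2, l2⟩, hξ1, hξ2, t1, t2⟩, ⟨c1, cc1, ce1, c0₁⟩, ⟨c2, cc2, ce2, c0₂⟩,
    heq⟩ := h
  refine ⟨c1, c2, ce1, ce2, fun T hT => ?_⟩
  have a1 := ae_Ioo_of_ae_Ioi ce1 (T := T)
  have a2 := ae_Ioo_of_ae_Ioi ce2 (T := T)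
  have p1 := hE.projEq_of_hasTimeDeriv hξ1 t1 cc1 ce1 hT
  have p2 := hE.projEq_of_hasTimeDeriv hξ2 t2 cc2 ce2 hT
  rw [c0₁] at p1
  rw [c0₂] at p2
  have m1 : MemLp (fun t => lift (opA (c1 t))) 2 vol(T) :=
    (memLp_congr_ae (a1.mono fun t h => by simp only [h])).2 (l1 T hT)
  have m2 : MemLp (fun t => lift (c2 t)) 2 vol(T) :=
    (memLp_congr_ae (a2.mono fun t h => by simp only [h])).2 (l2 T hT)
  have hD : ∀ᵐ t ∂vol(T), InDA32 (c1 t) := by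
    filter_upwards [a1, ae_Ioo_of_ae_Ioi d1] with t h1 h2 using h1 ▸ h2
  have hV : ∀ᵐ t ∂vol(T), InV (c2 t) := by
    filter_upwards [a2, ae_Ioo_of_ae_Ioi d2] with t h1 h2 using h1 ▸ h2
  obtain ⟨B, hB, hBV⟩ := hE.exists_normV_le hT h0 p1 (hξ1 T hT) hD m1
  obtain ⟨B2, hB2⟩ := isCompact_Icc.exists_bound_of_continuousOn (cc2.mono fun t ht => ht.1)
    (s := Icc 0 T)
  have hB₂0 := (norm_nonneg _).trans (hB2 0 ⟨le_rfl, hT.le⟩)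
  set J1 := ∫ t in 0..T, ‖lift (opA (c1 t))‖ ^ 2 with hJ1
  set J2 := ∫ t in 0..T, normV (c2 t) ^ 2 with hJ2
  have hJ₁0 : 0 ≤ J1 := intervalIntegral.integral_nonneg hT.le fun _ _ => sq_nonneg _
  have hJ₂0 : 0 ≤ J2 := intervalIntegral.integral_nonneg hT.le fun _ _ => sq_nonneg _
  refine ⟨B + B2 + J1 + J2, by positivity, ⟨fun t ht => ?_, fun t ht => ?_, fun t ht => (hBV t ht).1,
    fun t ht => ?_, hD, hV, m1, m2, ?_, ?_⟩, fun N => (p1 N).congr ?_, fun N => (p2 N).congr ?_⟩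
  · linarith only [norm_le_normV (hBV t ht).1, (hBV t ht).2, hB₂0, hJ₁0, hJ₂0]
  · linarith only [hB2 t ht, hB, hJ₁0, hJ₂0]
  · linarith only [(hBV t ht).2, hB₂0, hJ₁0, hJ₂0]
  · linarith only [hB, hB₂0, hJ₂0]
  · linarith only [hB, hB₂0, hJ₁0]
  · filter_upwards [ae_Ioo_of_ae_Ioi heq, a1, a2] with t h h1 h2
    rw [h1, h2]
    exact h.1
  · filter_upwards [ae_Ioo_of_ae_Ioi heq, a1, a2] with t h h1 h2
    rw [h1, h2]
    exact h.2

/-- The Galerkin approximations converge to every bounded solution of the projected equations. -/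
theorem AnalyticData.tendsto_inner (hk1 : LocL2 k1) (hk2 : LocL2 k2) (h0 : InV w01)
    (hG : ∀ N, IsGalerkin P e N (affine k1 K1) (affine k2 K2) w01 w02 (W1 N) (W2 N)) {T B : ℝ}
    (hT : 0 < T) {u1 u2 : ℝ → H P.S} (hu : IsPath P e k1 k2 K1 K2 w01 w02 T B u1 u2) {t : ℝ}
    (ht : t ∈ Icc 0 T) (k : ℕ) : Tendsto (fun n => ⟪W1 n t, e k⟫) atTop (𝓝 ⟪u1 t, e k⟫) ∧
      Tendsto (fun n => ⟪W2 n t, e k⟫) atTop (𝓝 ⟪u2 t, e k⟫) := by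
  obtain ⟨B', hB', hpath⟩ := hA.exists_pathBound hk1 hk2 K1 K2 h0 w02 hT
  obtain ⟨K, hK, hstab⟩ := hA.exists_stability k1 k2 K1 K2 w01 w02 (B := B + B')
    (add_nonneg hu.nonneg hB') hT
  have key : ∀ᶠ N in atTop, |⟪W1 N t, e k⟫ - ⟪u1 t, e k⟫| ≤ √(μ N)⁻¹ * √K ∧
      |⟪W2 N t, e k⟫ - ⟪u2 t, e k⟫| ≤ √(μ N)⁻¹ * √K := by
    filter_upwards [eventually_gt_atTop k] with N hN
    exact hA.abs_inner_sub_le hN ((hG N).1 t ht.1).1 (hstab N _ _ _ _ (hG N)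
      ((hpath N _ _ (hG N)).1.mono (le_add_of_nonneg_left hu.nonneg))
      (hu.bound.mono (le_add_of_nonneg_right hB')) (hu.proj1 N) (hu.proj2 N) t ht)
  have hz := hA.basis.tendsto_rate hA.one_le_dim (√K)
  exact ⟨tendsto_iff_dist_tendsto_zero.2 (squeeze_zero' (.of_forall fun _ => dist_nonneg)
    (key.mono fun N h => h.1) hz), tendsto_iff_dist_tendsto_zero.2 (squeeze_zero'
    (.of_forall fun _ => dist_nonneg) (key.mono fun N h => h.2) hz)⟩

theorem AnalyticData.exists_galerkin_limit (hk1 : LocL2 k1) (hk2 : LocL2 k2) (h₀ : InV w01)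
    (hG : ∀ N, IsGalerkin P e N (affine k1 K1) (affine k2 K2) w01 w02 (W1 N) (W2 N)) :
    ∃ w1 w2 : ℝ → H P.S, IsSolutionW P (affine k1 K1) (affine k2 K2) w01 w02 w1 w2 ∧
      HasGalerkinLimit P e (affine k1 K1) (affine k2 K2) W1 W2 w1 w2 := by
  have hE := hA.basis
  obtain ⟨w1, w2, hw⟩ := hA.exists_pointwise_limit hk1 hk2 h₀ hG
  have hlim := fun T (hT : 0 < T) => hA.isPath_of_limit hk1 hk2 h₀ hG hw hT
  choose B hB using fun T hT => (hlim T hT).1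
  have m1 : LocL2 _ := fun T hT => (hlim T hT).2.1
  have m2 : LocL2 _ := fun T hT => (hlim T hT).2.2.1
  have hW : MemWloc w1 w2 _ _ := ⟨⟨ae_Ioi_of_ae_Ioo fun T hT => (hB T hT).bound.inDA32,
    fun T hT => (hB T hT).bound.memLp1⟩, ⟨ae_Ioi_of_ae_Ioo fun T hT => (hB T hT).bound.inV2,
    fun T hT => (hB T hT).bound.memLp2⟩, m1, m2, hE.hasTimeDeriv m1 fun T hT => (hB T hT).proj1,
    hE.hasTimeDeriv m2 fun T hT => (hB T hT).proj2⟩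
  have h0 : ∀ {u0 : H P.S} {u : ℝ → H P.S} {ξ : ℝ → V' P.S}, (∀ N, ProjEq e N 1 u0 u ξ) →
      u 0 = u0 := fun {u0 u ξ} h => hE.ext fun k => by
    have h1 := congrArg (fun y => ⟪y, e k⟫) ((h (k + 1)).2 0 ⟨le_rfl, zero_le_one⟩)
    simpa [hE.inner_projH] using h1
  refine ⟨w1, w2, ⟨_, _, hW, ⟨w1, continuousOn_Ici_of_Icc fun T hT => ?_, ae_eq_refl _,
    h0 (hB 1 one_pos).proj1⟩, ⟨w2, continuousOn_Ici_of_Icc fun T hT => ?_, ae_eq_refl _,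
    h0 (hB 1 one_pos).proj2⟩, .of_forall fun t => ⟨rfl, rfl⟩⟩, _, _, hW, id, strictMono_id,
    fun T hT => (hlim T hT).2.2.2⟩
  · refine hE.continuousOn_of_tail hT (hB T hT).proj1 (ε := fun N => (μ N)⁻¹ * B T hT ^ 2)
      ?_ fun N t ht => ?_
    · have := tendsto_inv_atTop_zero.comp (hE.tendsto_atTop hA.one_le_dim)
      simpa using this.mul_const (B T hT ^ 2)
    have h1 := hE.sq_norm_sub_projH_le N (lift (w1 t))
    rw [((hB T hT).bound.inV t ht).incl_lift] at h1
    have h2 := pow_le_pow_left₀ (norm_nonneg _) ((hB T hT).bound.normV_le t ht) 2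
    rw [← div_eq_inv_mul, le_div_iff₀' (hE.pos N)]
    exact h1.trans h2
  · obtain ⟨ε, hε, hle⟩ := hE.exists_tail hT (hB T hT).proj2 (m2 T hT) (hB T hT).bound.inV2
      (hB T hT).bound.memLp2
    exact hE.continuousOn_of_tail hT (hB T hT).proj2 hε hle

theorem AnalyticData.existsUniqueAE (hk1 : LocL2 k1)
    (hk2 : LocL2 k2) (K1 K2 : H P.S →L[ℝ] H P.S) (h0 : InV w01) (w02 : H P.S) :
    ExistsUniqueAE (IsSolutionW P (affine k1 K1) (affine k2 K2) w01 w02) := by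
  choose W1 W2 hG using fun N => hA.exists_isGalerkin N hk1 hk2 K1 K2 w01 w02
  obtain ⟨w1, w2, hw, -⟩ := hA.exists_galerkin_limit hk1 hk2 h0 hG
  refine ⟨w1, w2, hw, fun v1 v2 hv => ?_⟩
  obtain ⟨c1, c2, e1, e2, hc⟩ := hA.exists_isPath_of_isSolutionW h0 hw
  obtain ⟨b1, b2, f1, f2, hb⟩ := hA.exists_isPath_of_isSolutionW h0 hv
  have key : ∀ t : ℝ, 0 < t → b1 t = c1 t ∧ b2 t = c2 t := fun t ht => by
    have hm : t ∈ Icc 0 t := ⟨ht.le, le_rfl⟩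
    obtain ⟨B, hB⟩ := hc t ht
    obtain ⟨B', hB'⟩ := hb t ht
    have h1 := hA.tendsto_inner hk1 hk2 h0 hG ht hB hm
    have h2 := hA.tendsto_inner hk1 hk2 h0 hG ht hB' hm
    exact ⟨hA.basis.ext fun k => tendsto_nhds_unique (h2 k).1 (h1 k).1,
      hA.basis.ext fun k => tendsto_nhds_unique (h2 k).2 (h1 k).2⟩
  constructor
  · filter_upwards [e1, f1, ae_restrict_mem measurableSet_Ioi] with t h1 h2 ht
    rw [← h1, ← h2, (key t ht).1]
  · filter_upwards [e2, f2, ae_restrict_mem measurableSet_Ioi] with t h1 h2 ht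
    rw [← h1, ← h2, (key t ht).2]

end

section

variable {d : ℕ} {S : Setting d} [hS : Fact S.IsAdmissible]

theorem LocL2.congr {X : Type*} [NormedAddCommGroup X] {φ ψ : ℝ → X} (h : LocL2 φ)
    (he : φ =ᵐ[volume.restrict (Ioi (0 : ℝ))] ψ) : LocL2 ψ := fun T hT =>
  (memLp_congr_ae (ae_Ioo_of_ae_Ioi he)).1 (h T hT)

theorem LocL2V.locL2 {w : ℝ → H S} (h : LocL2V w) : LocL2 w :=
  (h.2.clm incl).congr (h.1.mono fun _ ht => ht.incl_lift)

theorem LocL2DA32.locL2V {w : ℝ → H S} (h : LocL2DA32 w) : LocL2V w := by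
  refine ⟨h.1.mono fun _ ht => ht.inV, ((h.2.clm incl).clm
    ((toDual ℝ (V S)).symm.toContinuousLinearEquiv.toContinuousLinearMap ∘L
      pivotL S)).congr (h.1.mono fun t ht => ext_inner_right ℝ fun z => ?_)⟩
  rw [ht.1.inner_lift]
  refine toDual_symm_apply.trans ?_
  exact (pivot_apply _ _).trans (by rw [ht.2.incl_lift])

theorem HasTimeDeriv.shear {w1 w2 : ℝ → H S} {ξ1 ξ2 : ℝ → V' S} (h₁ : HasTimeDeriv w1 ξ1)
    (h2 : HasTimeDeriv w2 ξ2) (l1 : LocL2 w1) (l2 : LocL2 w2) (m1 : LocL2 ξ1) (m2 : LocL2 ξ2)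
    (c : ℝ) : HasTimeDeriv (fun t => w2 t + c • w1 t) fun t => ξ2 t + c • ξ1 t := by
  intro ψ hψ hc hs z
  have hi : ∀ {θ g : ℝ → ℝ}, Continuous θ → tsupport θ ⊆ tsupport ψ → LocL2 g →
      IntegrableOn (fun t => θ t * g t) (Ioi 0) := fun {θ g} hθ hsub hg => by
    obtain ⟨T, hT⟩ := hc.isCompact.bddAbove
    have hT0 : 0 < max T 0 + 1 := by positivity
    have hz : ∀ t ∉ Ioo 0 (max T 0 + 1), θ t = 0 := fun t ht =>
      image_eq_zero_of_notMem_tsupport fun h => ht ⟨hs (hsub h), by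
        linarith only [hT (hsub h), le_max_left T 0]⟩
    have h1 := ((intervalIntegrable_of_mem (hg.integrableOn hT0) ⟨hT0.le, le_rfl⟩).continuousOn_mul
      hθ.continuousOn)
    rw [intervalIntegrable_iff_integrableOn_Ioo_of_le hT0.le] at h1
    exact h1.of_forall_diff_eq_zero measurableSet_Ioi fun t ht => by rw [hz t ht.2, zero_mul]
  have hψ' : Continuous (deriv ψ) := hψ.continuous_deriv (by simp)
  have lw : ∀ {w : ℝ → H S}, LocL2 w → LocL2 fun t => ⟪w t, incl z⟫ := fun h => by
    simpa only [innerSL_apply_apply, real_inner_comm] using h.clm (innerSL ℝ (incl z))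
  have lξ : ∀ {ξ : ℝ → V' S}, LocL2 ξ → LocL2 fun t => ξ t z := fun h =>
    h.clm (ContinuousLinearMap.apply ℝ ℝ z)
  have e1 : ∀ t, deriv ψ t * ⟪w2 t + c • w1 t, incl z⟫ =
      deriv ψ t * ⟪w2 t, incl z⟫ + c * (deriv ψ t * ⟪w1 t, incl z⟫) := fun t => by
    rw [inner_add_left, real_inner_smul_left]; ring
  have e2 : ∀ t, ψ t * (ξ2 t + c • ξ1 t) z = ψ t * ξ2 t z + c * (ψ t * ξ1 t z) := fun t => by
    rw [add_apply, smul_apply, smul_eq_mul]; ring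
  simp only [e1, e2]
  rw [integral_add (hi hψ' tsupport_deriv_subset (lw l2))
    ((hi hψ' tsupport_deriv_subset (lw l1)).const_mul c),
    integral_add (hi hψ.continuous subset_rfl (lξ m2))
    ((hi hψ.continuous subset_rfl (lξ m1)).const_mul c), integral_const_mul, integral_const_mul,
    h₁ ψ hψ hc hs z, h2 ψ hψ hc hs z]
  ring

theorem MemWloc.shear {w1 w2 : ℝ → H S} {ξ1 ξ2 : ℝ → V' S} (h : MemWloc w1 w2 ξ1 ξ2) (c : ℝ) :
    MemWloc w1 (fun t => w2 t + c • w1 t) ξ1 fun t => ξ2 t + c • ξ1 t := by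
  obtain ⟨a, b, m1, m2, t1, t2⟩ := h
  have a' := a.locL2V
  refine ⟨a, ⟨?_, (b.2.add (a'.2.clm (c • ContinuousLinearMap.id ℝ (V S)))).congr ?_⟩, m1,
    m2.add (m1.clm (c • ContinuousLinearMap.id ℝ (V' S))), t1, t1.shear t2 a'.locL2 b.locL2 m1 m2 c⟩
  · filter_upwards [a'.1, b.1] with t h1 h2 using h2.add (h1.smul c)
  · filter_upwards [a'.1, b.1] with t h1 h2
    rw [h2.lift_add (h1.smul c), h1.lift_smul]
    rfl

theorem HasInitialValue.shear {w1 w2 : ℝ → H S} {w01 w02 : H S} (h₁ : HasInitialValue w1 w01)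
    (h₂ : HasInitialValue w2 w02) (c : ℝ) :
    HasInitialValue (fun t => w2 t + c • w1 t) (w02 + c • w01) := by
  obtain ⟨c1, cc1, ce1, c0₁⟩ := h₁
  obtain ⟨c2, cc2, ce2, c0₂⟩ := h₂
  refine ⟨fun t => c2 t + c • c1 t, cc2.add (cc1.const_smul c), ?_, by simp only [c0₁, c0₂]⟩
  filter_upwards [ce1, ce2] with t h1 h2
  rw [h1, h2]

end

/-- The Cahn–Hilliard system in the variables `w1 = y1`, `w2 = y2 + ν₀ y1`. -/
theorem isSolutionCH_iff {η1 η2 : ℝ → H P.S → V' P.S} {y01 y02 : H P.S} {y1 y2 : ℝ → H P.S} :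
    IsSolutionCH P (fun t y _ => η1 t y) (fun t y z => η2 t (z + P.ν₀ • y)) y01 y02 y1 y2 ↔
      IsSolutionW P η1 η2 y01 (y02 + P.ν₀ • y01) y1 fun t => y2 t + P.ν₀ • y1 t := by
  have key : ∀ {t : ℝ}, InV (y1 t) → InV (y2 t) → lapV (lift (y2 t + P.ν₀ • y1 t)) =
      lapV (lift (y2 t)) + P.ν₀ • lapV (lift (y1 t)) := fun h1 h2 => by
    rw [h2.lift_add (h1.smul _), h1.lift_smul, lapV_add, lapV_smul]
  constructor
  · rintro ⟨ξ1, ξ2, hm, i1, i2, heq⟩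
    refine ⟨ξ1, _, hm.shear P.ν₀, i1, i1.shear i2 P.ν₀, ?_⟩
    filter_upwards [heq, (hm.1.locL2V).1, hm.2.1.1] with t ⟨a, b⟩ h1 h2
    rw [key h1 h2, ← b, ← a]
    constructor <;> module
  · rintro ⟨ξ1, ξ2, hm, i1, i2, heq⟩
    have hy : (fun t => y2 t + P.ν₀ • y1 t + (-P.ν₀) • y1 t) = y2 := by funext t; module
    have hy0 : y02 + P.ν₀ • y01 + (-P.ν₀) • y01 = y02 := by module
    have hm' := hm.shear (-P.ν₀)
    have i2' := i1.shear i2 (-P.ν₀)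
    rw [hy] at hm' i2'
    rw [hy0] at i2'
    refine ⟨ξ1, _, hm', i1, i2', ?_⟩
    filter_upwards [heq, (hm.1.locL2V).1, hm'.2.1.1] with t ⟨a, b⟩ h1 h2
    rw [key h1 h2] at a b
    rw [a, b]
    constructor <;> module

theorem existsUniqueAE_isSolutionCH {η1 η2 : ℝ → H P.S → V' P.S}
    {y01 y02 : H P.S} (h : ExistsUniqueAE (IsSolutionW P η1 η2 y01 (y02 + P.ν₀ • y01))) :
    ExistsUniqueAE (IsSolutionCH P (fun t y _ => η1 t y) (fun t y z => η2 t (z + P.ν₀ • y))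
      y01 y02) := by
  obtain ⟨w1, w2, hw, huniq⟩ := h
  refine ⟨w1, fun t => w2 t - P.ν₀ • w1 t, (isSolutionCH_iff).2 ?_, fun v1 v2 hv => ?_⟩
  · simpa only [sub_add_cancel] using hw
  · obtain ⟨h1, h2⟩ := huniq _ _ ((isSolutionCH_iff).1 hv)
    refine ⟨h1, ?_⟩
    filter_upwards [h1, h2] with t h1 h2
    rw [← h2, ← h1, add_sub_cancel_right]

end CahnHilliard

end

open CahnHilliard in
theorem mainTheorem3 {d : ℕ} (hd : 1 ≤ d) (hd' : d ≤ 3) (P : Model d) (hS : P.S.IsAdmissible)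
    (hν : 0 < P.ν₂) (F : ℝ → ℝ) (hfg : GrowthAssumption P.S F P.f P.g)
    (hdif : DifferenceAssumption P.S P.f P.g)
    (h₁ h₂ : ℝ → V' P.S) (hh₁ : LocL2 h₁) (hh₂ : LocL2 h₂)
    (a b : Actuators d) (ha : a.IsAdmissible P.S) (hb : b.IsAdmissible P.S)
    (lam₁ lam₂ : ℝ) (hlam₁ : 0 ≤ lam₁) (hlam₂ : 0 ≤ lam₂) :
    (∃ (e : ℕ → H P.S) (μ : ℕ → ℝ), IsEigenbasis P.S e μ) ∧
    (∀ χ : ℝ, χ = 0 ∨ χ = 1 → ∀ r₁ r₂ : ℝ → H P.S, LocL2 r₁ → LocL2 r₂ →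
      ∀ w₀₁ w₀₂ : H P.S, InV w₀₁ →
        ExistsUniqueAE (IsSolutionW P (forcing₁ a lam₁ χ h₁ r₁) (forcing₂ b lam₂ χ h₂ r₂)
          w₀₁ w₀₂) ∧
        ∀ (e : ℕ → H P.S) (μ : ℕ → ℝ), IsEigenbasis P.S e μ →
          (∀ N : ℕ, ∃ w₁ w₂ : ℝ → H P.S, IsGalerkin P e N (forcing₁ a lam₁ χ h₁ r₁)
            (forcing₂ b lam₂ χ h₂ r₂) w₀₁ w₀₂ w₁ w₂) ∧
          ∀ W₁ W₂ : ℕ → ℝ → H P.S,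
            (∀ N : ℕ, IsGalerkin P e N (forcing₁ a lam₁ χ h₁ r₁) (forcing₂ b lam₂ χ h₂ r₂)
              w₀₁ w₀₂ (W₁ N) (W₂ N)) →
            HasUniformBounds P F e (forcing₁ a lam₁ χ h₁ r₁) (forcing₂ b lam₂ χ h₂ r₂) W₁ W₂ ∧
            ∃ w₁ w₂ : ℝ → H P.S,
              IsSolutionW P (forcing₁ a lam₁ χ h₁ r₁) (forcing₂ b lam₂ χ h₂ r₂) w₀₁ w₀₂ w₁ w₂ ∧
              HasGalerkinLimit P e (forcing₁ a lam₁ χ h₁ r₁) (forcing₂ b lam₂ χ h₂ r₂) W₁ W₂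
                w₁ w₂) ∧
    (∀ y₀₁ y₀₂ : H P.S, InV y₀₁ →
      ExistsUniqueAE (IsSolutionCH P (fun t _ _ => h₁ t) (fun t _ _ => h₂ t) y₀₁ y₀₂)) ∧
    (∀ r₀₁ r₀₂ : H P.S, InV r₀₁ → ∀ r₁ r₂ : ℝ → H P.S,
      IsSolutionCH P (fun t _ _ => h₁ t) (fun t _ _ => h₂ t) r₀₁ r₀₂ r₁ r₂ →
      ∀ y₀₁ y₀₂ : H P.S, InV y₀₁ →
        ExistsUniqueAE (IsSolutionCH P
          (fun t y₁ _ => h₁ t + pivot (feedback₁ a lam₁ (y₁ - r₁ t)))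
          (fun t y₁ y₂ => h₂ t + pivot
            (feedback₂ b lam₂ ((y₂ + P.ν₀ • y₁) - (r₂ t + P.ν₀ • r₁ t))))
          y₀₁ y₀₂)) := by
  have := Fact.mk hS
  obtain ⟨C, hC⟩ := exists_nonlinearBounds hfg hdif
  obtain ⟨e₀, μ₀, he₀⟩ := exists_eigenbasis (S := P.S) hd
  have data : ∀ (e : ℕ → H P.S) (μ : ℕ → ℝ), IsEigenbasis P.S e μ → AnalyticData P F e μ C :=
    fun e μ he => ⟨hd, hν, he, hC, hfg.1, hfg.2.1, hfg.continuous_f hd hdif, hfg.2.2.1⟩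
  have hW : ∀ χ : ℝ, ∀ r₁ r₂ : ℝ → H P.S, LocL2 r₁ → LocL2 r₂ → ∀ w₀₁ w₀₂ : H P.S, InV w₀₁ →
      ExistsUniqueAE (IsSolutionW P (forcing₁ a lam₁ χ h₁ r₁) (forcing₂ b lam₂ χ h₂ r₂)
        w₀₁ w₀₂) := fun χ r₁ r₂ hr₁ hr₂ w₀₁ w₀₂ h₀ => by
    obtain ⟨k₁, K₁, hk₁, e₁⟩ := forcing₁_eq ha lam₁ χ hh₁ hr₁
    obtain ⟨k₂, K₂, hk₂, e₂⟩ := forcing₂_eq hb lam₂ χ hh₂ hr₂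
    rw [e₁, e₂]
    exact (data e₀ μ₀ he₀).existsUniqueAE hk₁ hk₂ K₁ K₂ h₀ w₀₂
  refine ⟨⟨e₀, μ₀, he₀⟩, fun χ _ r₁ r₂ hr₁ hr₂ w₀₁ w₀₂ h₀ => ⟨hW χ r₁ r₂ hr₁ hr₂ w₀₁ w₀₂ h₀,
    fun e μ he => ?_⟩, fun y₀₁ y₀₂ h₀ => ?_, fun r₀₁ r₀₂ _ r₁ r₂ hr y₀₁ y₀₂ h₀ => ?_⟩
  · obtain ⟨k₁, K₁, hk₁, e₁⟩ := forcing₁_eq ha lam₁ χ hh₁ hr₁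
    obtain ⟨k₂, K₂, hk₂, e₂⟩ := forcing₂_eq hb lam₂ χ hh₂ hr₂
    rw [e₁, e₂]
    exact ⟨fun N => (data e μ he).exists_isGalerkin N hk₁ hk₂ K₁ K₂ w₀₁ w₀₂, fun W₁ W₂ hG =>
      ⟨(data e μ he).hasUniformBounds hk₁ hk₂ K₁ K₂ h₀ w₀₂ hG,
        (data e μ he).exists_galerkin_limit hk₁ hk₂ h₀ hG⟩⟩
  · have h0 : LocL2 fun _ : ℝ => (0 : H P.S) := fun _ _ => MemLp.zero
    have h := existsUniqueAE_isSolutionCH (hW 0 _ _ h0 h0 y₀₁ (y₀₂ + P.ν₀ • y₀₁) h₀)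
    simpa only [forcing₁, forcing₂, zero_smul, add_zero] using h
  · obtain ⟨ξ₁, ξ₂, hm, -⟩ := hr
    have h := existsUniqueAE_isSolutionCH (hW 1 _ _ (hm.1.locL2V).locL2
      (hm.shear P.ν₀).2.1.locL2 y₀₁ (y₀₂ + P.ν₀ • y₀₁) h₀)
    simpa only [forcing₁, forcing₂, one_smul] using h
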